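/- Let $S$ be a scheme, $x:X\to S$ a smooth $S$-scheme, and $i:Y\hookrightarrow X$ an immersion of smooth $S$-schemes with structure morphism $y=x\circ i:Y\to S$. Let $\mathcal A$ be a twisted sheaf of differential operators (tdo) on $X$ over $S$: a sheaf of $x^{-1}\mathcal O_S$-algebras with a homomorphism $\mathcal O_X\to\mathcal A$ and an exhaustive increasing multiplicative filtration $F_\bullet\mathcal A$ with $F_{-1}\mathcal A=0$ and $\mathcal O_X\cong F_0\mathcal A$, such that $\operatorname{gr}_F\mathcal A$ is commutative, $P\mapsto[P,-]$ induces an isomorphism $\operatorname{gr}^1_F\mathcal A\cong\Theta_{X/S}$, and the induced homomorphism $\operatorname{Sym}_{\mathcal O_X}\Theta_{X/S}\to\operatorname{gr}_F\mathcal A$ is an isomorphism. Let $i^\cdot\mathcal A$ be the pullback tdo on $Y$, that is, the enveloping algebra of the Picard algebroid $\Theta_{Y/S}\times_{i^*\Theta_{X/S}}i^*F_1\mathcal A$. Let $\mathcal A_{Y\to X}=i^*\mathcal A=\mathcal O_Y\otimes_{i^{-1}\mathcal O_X}i^{-1}\mathcal A$ be the transfer $(i^\cdot\mathcal A,i^{-1}\mathcal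 A)$-bimodule, on which a section $(D,t)$ of the algebroid acts from the left by $(D,t)\cdot(c\otimes q)=D(c)\otimes q+c\,t\,q$. For $p\in\mathbb Z$ let $G_p\mathcal A_{Y\to X}\subset\mathcal A_{Y\to X}$ be the left $i^\cdot\mathcal A$-submodule generated by $i^*F_p\mathcal A$; it is a right $i^{-1}\mathcal O_X$-submodule. Let $\mathcal N_{X/Y}=i^*\Theta_{X/S}/\Theta_{Y/S}$. Let $\mathcal V$ be any right $i^\cdot\mathcal A$-module, and put $$G_p(\mathcal V\otimes_{i^\cdot\mathcal A}\mathcal A_{Y\to X})=\mathcal V\otimes_{i^\cdot\mathcal A}G_p\mathcal A_{Y\to X},\qquad i_+\mathcal V=i_*(\mathcal V\otimes_{i^\cdot\mathcal A}\mathcal A_{Y\to X}),$$ $$G_p\,i_+\mathcal V=i_*(\mathcal V\otimes_{i^\cdot\mathcal A}G_p\mathcal A_{Y\to X}),\qquad G_p\,x_*i_+\mathcal V=x_*G_p\,i_+\mathcal V .$$ Filtrations are increasing and positive: the canonical maps from the $p$th terms are monomorphisms compatible with the maps from the $(p-1)$st terms to the $p$th terms, and the $(-1)$st term is $0$. Then: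 (1) The $i^{-1}\mathcal O_X$-modules $G_\bullet(\mathcal V\otimes_{i^\cdot\mathcal A}\mathcal A_{Y\to X})$ form an exhaustive filtration of $\mathcal V\otimes_{i^\cdot\mathcal A}\mathcal A_{Y\to X}$, and there is a graded isomorphism of $i^{-1}\mathcal O_X$-modules $\operatorname{gr}_G(\mathcal V\otimes_{i^\cdot\mathcal A}\mathcal A_{Y\to X})\cong\mathcal V\otimes_{\mathcal O_Y}\operatorname{Sym}_{\mathcal O_Y}\mathcal N_{X/Y}$, that is, an isomorphism $\operatorname{gr}^p_G\cong\mathcal V\otimes_{\mathcal O_Y}\operatorname{Sym}^p_{\mathcal O_Y}\mathcal N_{X/Y}$ for every $p\ge 0$ (and $\operatorname{gr}^p_G=0$ for $p<0$). (2) The $\mathcal O_X$-modules $G_\bullet\,i_+\mathcal V$ form a filtration of $i_+\mathcal V$. It is exhaustive if $i$ is quasi-compact. (3) The $\mathcal O_S$-modules $G_\bullet\,x_*i_+\mathcal V$ form a filtration of $x_*i_+\mathcal V$. It is exhaustive if $y$ is quasi-compact. -/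

import Mathlib

open CategoryTheory TopologicalSpace Opposite AlgebraicGeometry TensorProduct

universe u

noncomputable section

namespace TwistedD

/-! ### Sheaves of rings and modules presented by their stalks

A sheaf on `Y` is the sheaf of those families of germs that locally come from the sections of a
generating presheaf. The sheaves below are given by their stalks together with local generators. -/

section Germs

variable {Y : TopCat.{u}}

/-- Restriction of a family of germs to a smaller open set. -/
abbrev res {E : Y → Type u} {U V : Opens Y} (h : V ≤ U) (s : ∀ y : U, E y.1) :
    ∀ y : V, E y.1 := fun y => s ⟨y.1, h y.2⟩

/-- The families on `V` that are restrictions of generators on larger open sets. -/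
def resGens {E : Y → Type u} (gens : ∀ U : Opens Y, Set (∀ y : U, E y.1)) (V : Opens Y) :
    Set (∀ y : V, E y.1) :=
  {s | ∃ (U : Opens Y) (h : V ≤ U), ∃ t ∈ gens U, s = res h t}

lemma res_mem_resGens {E : Y → Type u} (gens : ∀ U : Opens Y, Set (∀ y : U, E y.1))
    {U V : Opens Y} (h : V ≤ U) {s : ∀ y : U, E y.1} (hs : s ∈ resGens gens U) :
    res h s ∈ resGens gens V := by
  obtain ⟨W, hW, t, ht, rfl⟩ := hs
  exact ⟨W, h.trans hW, t, ht, rfl⟩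

/-- A sheaf of rings given by its stalks and by local ring generators. -/
structure GermRing (Y : TopCat.{u}) where
  stalk : Y → Type u
  [ring : ∀ y, Ring (stalk y)]
  gens : ∀ U : Opens Y, Set (∀ y : U, stalk y.1)

attribute [instance] GermRing.ring

namespace GermRing

variable (R : GermRing Y)

/-- The families of germs over `V` obtained from generators over `V` by ring operations. -/
def pre (V : Opens Y) : Subring (∀ y : V, R.stalk y.1) :=
  Subring.closure (resGens R.gens V)

/-- Restriction as a ring homomorphism. -/
def resHom {U V : Opens Y} (h : V ≤ U) :
    (∀ y : U, R.stalk y.1) →+* (∀ y : V, R.stalk y.1) where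
  toFun := res h
  map_one' := rfl
  map_mul' _ _ := rfl
  map_zero' := rfl
  map_add' _ _ := rfl

lemma res_mem_pre {U V : Opens Y} (h : V ≤ U) {s : ∀ y : U, R.stalk y.1} (hs : s ∈ R.pre U) :
    res h s ∈ R.pre V := by
  have : R.pre U ≤ (R.pre V).comap (R.resHom h) := by
    rw [pre, Subring.closure_le]
    intro t ht
    exact Subring.subset_closure (res_mem_resGens _ h ht)
  exact this hs

/-- Being locally a family obtained from generators. -/
def localPred : TopCat.LocalPredicate R.stalk :=
  TopCat.PrelocalPredicate.sheafify
    { pred := fun {V} s => s ∈ R.pre V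
      res := fun f _ hs => R.res_mem_pre f.le hs }

/-- The sections over `U`: families of germs locally obtained from generators. -/
def sections (U : Opens Y) : Subring (∀ y : U, R.stalk y.1) where
  carrier := {s | R.localPred.pred s}
  zero_mem' y := ⟨U, y.2, 𝟙 _, (R.pre U).zero_mem⟩
  one_mem' y := ⟨U, y.2, 𝟙 _, (R.pre U).one_mem⟩
  neg_mem' hs y := by
    obtain ⟨V, hV, f, h⟩ := hs y
    exact ⟨V, hV, f, (R.pre V).neg_mem h⟩
  add_mem' hs ht y := by
    obtain ⟨V, hV, f, h⟩ := hs y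
    obtain ⟨W, hW, g, k⟩ := ht y
    exact ⟨V ⊓ W, ⟨hV, hW⟩, Opens.infLELeft _ _ ≫ f, (R.pre (V ⊓ W)).add_mem
      (R.res_mem_pre inf_le_left h) (R.res_mem_pre inf_le_right k)⟩
  mul_mem' hs ht y := by
    obtain ⟨V, hV, f, h⟩ := hs y
    obtain ⟨W, hW, g, k⟩ := ht y
    exact ⟨V ⊓ W, ⟨hV, hW⟩, Opens.infLELeft _ _ ≫ f, (R.pre (V ⊓ W)).mul_mem
      (R.res_mem_pre inf_le_left h) (R.res_mem_pre inf_le_right k)⟩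

variable {R} in
lemma res_mem_sections {U V : Opens Y} (h : V ≤ U) {s : ∀ y : U, R.stalk y.1}
    (hs : s ∈ R.sections U) : res h s ∈ R.sections V :=
  R.localPred.res (homOfLE h) s hs

lemma gens_subset_sections {U : Opens Y} {s : ∀ y : U, R.stalk y.1} (hs : s ∈ R.gens U) :
    s ∈ R.sections U := fun y =>
  ⟨U, y.2, 𝟙 _, Subring.subset_closure ⟨U, le_rfl, s, hs, rfl⟩⟩

/-- Restriction of sections. -/
def sectionsRes {U V : Opens Y} (h : V ≤ U) : R.sections U →+* R.sections V where
  toFun s := ⟨res h s.1, res_mem_sections h s.2⟩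
  map_one' := rfl
  map_mul' _ _ := rfl
  map_zero' := rfl
  map_add' _ _ := rfl

/-- The underlying presheaf of rings. -/
def presheaf : TopCat.Presheaf RingCat.{u} Y where
  obj U := RingCat.of (R.sections U.unop)
  map f := RingCat.ofHom (R.sectionsRes f.unop.le)

/-- The sheaf of rings. -/
def sheaf : CategoryTheory.Sheaf (Opens.grothendieckTopology Y) RingCat.{u} :=
  ⟨R.presheaf, (TopCat.Presheaf.isSheaf_iff_isSheaf_comp (forget RingCat) _).mpr
    (TopCat.Presheaf.isSheaf_of_iso
      (NatIso.ofComponents (fun _ => Iso.refl _) (fun _ => rfl) :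
        (TopCat.subsheafToTypes R.localPred).1 ≅ R.presheaf ⋙ forget RingCat)
      (TopCat.subsheafToTypes R.localPred).2)⟩

/-- The sheaf of opposite rings. Left modules over it are right modules over `R`. -/
def op (R : GermRing Y) : GermRing Y where
  stalk y := (R.stalk y)ᵐᵒᵖ
  gens U := {s | (fun y => (s y).unop) ∈ R.gens U}

lemma op_mem_sections {U : Opens Y} {s : ∀ y : U, R.stalk y.1} (hs : s ∈ R.sections U) :
    (fun y => MulOpposite.op (s y)) ∈ R.op.sections U := by
  intro y
  obtain ⟨V, hV, f, h⟩ := hs y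
  refine ⟨V, hV, f, ?_⟩
  have key : ∀ t ∈ R.pre V, (fun y : V => (MulOpposite.op (t y) : R.op.stalk y.1)) ∈ R.op.pre V := by
    intro t ht
    induction ht using Subring.closure_induction with
    | mem t ht =>
      obtain ⟨W, hW, t, ht, rfl⟩ := ht
      exact Subring.subset_closure ⟨W, hW, fun y => MulOpposite.op (t y), ht, rfl⟩
    | zero => exact (R.op.pre V).zero_mem
    | one => exact (R.op.pre V).one_mem
    | add _ _ _ _ h k => exact (R.op.pre V).add_mem h k
    | neg _ _ h => exact (R.op.pre V).neg_mem h
    | mul _ _ _ _ h k => exact (R.op.pre V).mul_mem k h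
  exact key _ h

/-- A section of `R` as a section of the sheaf of opposite rings. -/
def opSection {U : Opens Y} (s : R.sections U) : R.op.sections U :=
  ⟨_, R.op_mem_sections s.2⟩

end GermRing

/-- A sheaf of modules over `R` given by its stalks and by local module generators. -/
structure GermModule (R : GermRing Y) where
  stalk : Y → Type u
  [addCommGroup : ∀ y, AddCommGroup (stalk y)]
  [module : ∀ y, Module (R.stalk y) (stalk y)]
  gens : ∀ U : Opens Y, Set (∀ y : U, stalk y.1)

attribute [instance] GermModule.addCommGroup GermModule.module

namespace GermModule

variable {R : GermRing Y} (M N : GermModule R)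

/-- The families of germs over `V` that are linear combinations of generators over `V` with
coefficients sections of `R` over `V`. -/
def pre (V : Opens Y) : Submodule (R.sections V) (∀ y : V, M.stalk y.1) :=
  Submodule.span (R.sections V) (resGens M.gens V)

variable {M} in
lemma res_mem_pre {U V : Opens Y} (h : V ≤ U) {s : ∀ y : U, M.stalk y.1} (hs : s ∈ M.pre U) :
    res h s ∈ M.pre V := by
  induction hs using Submodule.span_induction with
  | mem s hs => exact Submodule.subset_span (res_mem_resGens _ h hs)
  | zero => exact (M.pre V).zero_mem
  | add _ _ _ _ h k => exact (M.pre V).add_mem h k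
  | smul r s _ hs => exact (M.pre V).smul_mem (R.sectionsRes h r) hs

/-- Being locally a linear combination of generators. -/
def localPred : TopCat.LocalPredicate M.stalk :=
  TopCat.PrelocalPredicate.sheafify
    { pred := fun {V} s => s ∈ M.pre V
      res := fun f _ hs => res_mem_pre f.le hs }

/-- The sections over `U`: families of germs that locally are combinations of generators. -/
def sections (U : Opens Y) : Submodule (R.sections U) (∀ y : U, M.stalk y.1) where
  carrier := {s | M.localPred.pred s}
  zero_mem' y := ⟨U, y.2, 𝟙 _, (M.pre U).zero_mem⟩
  add_mem' hs ht y := by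
    obtain ⟨V, hV, f, h⟩ := hs y
    obtain ⟨W, hW, g, k⟩ := ht y
    exact ⟨V ⊓ W, ⟨hV, hW⟩, Opens.infLELeft _ _ ≫ f, (M.pre (V ⊓ W)).add_mem
      (res_mem_pre inf_le_left h) (res_mem_pre inf_le_right k)⟩
  smul_mem' r s hs y := by
    obtain ⟨V, hV, f, h⟩ := hs y
    exact ⟨V, hV, f, (M.pre V).smul_mem (R.sectionsRes f.le r) h⟩

lemma mem_sections {U : Opens Y} {s : ∀ y : U, M.stalk y.1} :
    s ∈ M.sections U ↔ M.localPred.pred s := Iff.rfl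

variable {M} in
lemma res_mem_sections {U V : Opens Y} (h : V ≤ U) {s : ∀ y : U, M.stalk y.1}
    (hs : s ∈ M.sections U) : res h s ∈ M.sections V :=
  M.localPred.res (homOfLE h) s hs

variable {M} in
lemma gens_subset_sections {U : Opens Y} {s : ∀ y : U, M.stalk y.1} (hs : s ∈ M.gens U) :
    s ∈ M.sections U := fun y =>
  ⟨U, y.2, 𝟙 _, Submodule.subset_span ⟨U, le_rfl, s, hs, rfl⟩⟩

/-- The underlying presheaf of abelian groups. -/
def abPresheaf : TopCat.Presheaf AddCommGrpCat.{u} Y where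
  obj U := AddCommGrpCat.of (M.sections U.unop)
  map f := AddCommGrpCat.ofHom
    { toFun := fun s => ⟨res f.unop.le s.1, res_mem_sections f.unop.le s.2⟩
      map_zero' := rfl
      map_add' := fun _ _ => rfl }

instance (U : (Opens Y)ᵒᵖ) : Module (R.sheaf.obj.obj U) (M.abPresheaf.obj U) :=
  inferInstanceAs (Module (R.sections U.unop) (M.sections U.unop))

lemma abPresheaf_isSheaf : M.abPresheaf.IsSheaf :=
  (TopCat.Presheaf.isSheaf_iff_isSheaf_comp (forget AddCommGrpCat) _).mpr
    (TopCat.Presheaf.isSheaf_of_iso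
      (NatIso.ofComponents (fun _ => Iso.refl _) (fun _ => rfl) :
        (TopCat.subsheafToTypes M.localPred).1 ≅ M.abPresheaf ⋙ forget AddCommGrpCat)
      (TopCat.subsheafToTypes M.localPred).2)

/-- The sheaf of modules. -/
def sheaf : SheafOfModules.{u} R.sheaf where
  val := PresheafOfModules.ofPresheaf (R := R.sheaf.obj) M.abPresheaf (fun _ _ _ _ _ => rfl)
  isSheaf := M.abPresheaf_isSheaf

variable {M N}

lemma map_mem_sections (φ : ∀ y, M.stalk y →ₗ[R.stalk y] N.stalk y)
    (hφ : ∀ U, ∀ s ∈ M.gens U, (fun y : U => φ y.1 (s y)) ∈ N.sections U)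
    {U : Opens Y} {s : ∀ y : U, M.stalk y.1} (hs : s ∈ M.sections U) :
    (fun y : U => φ y.1 (s y)) ∈ N.sections U := by
  refine N.mem_sections.mpr (N.localPred.locality _ ?_)
  intro y
  obtain ⟨V, hV, f, h⟩ := hs y
  refine ⟨V, hV, f, ?_⟩
  have key : ∀ t ∈ M.pre V, (fun y : V => φ y.1 (t y)) ∈ N.sections V := by
    intro t ht
    induction ht using Submodule.span_induction with
    | mem t ht =>
      obtain ⟨W, hW, t, ht, rfl⟩ := ht
      exact res_mem_sections hW (hφ W t ht)
    | zero =>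
      convert (N.sections V).zero_mem using 1
      funext y
      exact (φ y.1).map_zero
    | add s t _ _ h k =>
      have := (N.sections V).add_mem h k
      convert this using 1
      funext y
      simp
    | smul r s _ hs =>
      have := (N.sections V).smul_mem r hs
      convert this using 1
      funext y
      exact (φ y.1).map_smul (r.1 y) (s y)
  exact key _ h

/-- The morphism of sheaves of modules with the given stalks. -/
def homMk (φ : ∀ y, M.stalk y →ₗ[R.stalk y] N.stalk y)
    (hφ : ∀ U, ∀ s ∈ M.gens U, (fun y : U => φ y.1 (s y)) ∈ N.sections U) :
    M.sheaf ⟶ N.sheaf where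
  val := PresheafOfModules.homMk (M₁ := M.sheaf.val) (M₂ := N.sheaf.val)
    { app := fun U => AddCommGrpCat.ofHom
        { toFun := fun (s : M.sections U.unop) =>
            (⟨fun y => φ y.1 (s.1 y), map_mem_sections φ hφ s.2⟩ : N.sections U.unop)
          map_zero' := Subtype.ext (funext fun y => (φ y.1).map_zero)
          map_add' := fun s t => Subtype.ext (funext fun y => (φ y.1).map_add (s.1 y) (t.1 y)) }
      naturality := fun _ _ _ => rfl }
    (fun U (r : R.sections U.unop) (m : M.sections U.unop) => by
      refine Subtype.ext (funext fun y => ?_)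
      exact (φ y.1).map_smul (r.1 y) (m.1 y))

end GermModule

end Germs

/-! ### Twisted sheaves of differential operators -/

section TDO

/-- For a morphism `f : Y ⟶ X` the local ring at `y` is an algebra over the local ring at `f y`. -/
instance stalkAlgebra {X Y : Scheme.{u}} (f : Y ⟶ X) (y : Y) :
    Algebra (X.presheaf.stalk (f y)) (Y.presheaf.stalk y) :=
  (f.stalkMap y).hom.toAlgebra

/-- The stalk at `z` of the sheaf of vector fields of `X` over `S` (for `X` locally of finite
presentation over `S`): the derivations of the local ring over the local ring of the base. -/
abbrev TangentStalk {X S : Scheme.{u}} (x : X ⟶ S) (z : X) : Type u :=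
  Derivation (S.presheaf.stalk (x z)) (X.presheaf.stalk z) (X.presheaf.stalk z)

/-- A family of derivations of the local rings over `U` is a vector field on `U`, that is, a
derivation of the sheaf of rings on `U`, if it maps sections to sections. -/
def IsVectorField {X S : Scheme.{u}} (x : X ⟶ S) (U : X.Opens)
    (θ : ∀ z : U, TangentStalk x z.1) : Prop :=
  ∀ (V : X.Opens) (hV : V ≤ U) (f : Γ(X, V)), ∃ g : Γ(X, V), ∀ (z : X) (hz : z ∈ V),
    θ ⟨z, hV hz⟩ (X.presheaf.germ V z hz f) = X.presheaf.germ V z hz g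

/-- A sheaf of rings `A` on `X` with a homomorphism `𝒪_X → A` and an exhaustive positive filtration
by subsheaves of abelian groups, compatible with the multiplication. -/
structure FilteredRing (X : Scheme.{u}) where
  A : TopCat.Sheaf RingCat.{u} X
  ι : X.ringCatSheaf.obj ⟶ A.presheaf
  F : ℤ → ∀ U : X.Opens, AddSubgroup (A.presheaf.obj (op U))
  F_res : ∀ (p : ℤ) {U V : X.Opens} (h : V ≤ U), ∀ a ∈ F p U,
    A.presheaf.map (homOfLE h).op a ∈ F p V
  F_glue : ∀ (p : ℤ) (U : X.Opens) (a : A.presheaf.obj (op U)),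
    (∀ z ∈ U, ∃ (V : X.Opens) (h : V ≤ U), z ∈ V ∧
      A.presheaf.map (homOfLE h).op a ∈ F p V) → a ∈ F p U
  F_mono : ∀ {p q : ℤ} (_ : p ≤ q) (U : X.Opens), F p U ≤ F q U
  F_neg : ∀ U : X.Opens, F (-1) U = ⊥
  F_mul : ∀ (p q : ℤ) (U : X.Opens), ∀ a ∈ F p U, ∀ b ∈ F q U, a * b ∈ F (p + q) U
  F_exhaustive : ∀ (U : X.Opens) (a : A.presheaf.obj (op U)), ∀ z ∈ U,
    ∃ (V : X.Opens) (h : V ≤ U) (p : ℤ), z ∈ V ∧ A.presheaf.map (homOfLE h).op a ∈ F p V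

namespace FilteredRing

variable {X : Scheme.{u}} (𝒜 : FilteredRing X)

/-- The stalk of `A` at `z`. -/
def Stalk (z : X) : Type u := 𝒜.A.presheaf.stalk z

instance (z : X) : Ring (𝒜.Stalk z) := inferInstanceAs (Ring (𝒜.A.presheaf.stalk z))

/-- The germ at `z` of a section of `A`. -/
def germ {U : X.Opens} {z : X} (hz : z ∈ U) : 𝒜.A.presheaf.obj (op U) →+* 𝒜.Stalk z :=
  (𝒜.A.presheaf.germ U z hz).hom

/-- The homomorphism `𝒪_{X,z} → A_z` induced by `𝒪_X → A`. -/
def ιStalk (z : X) : X.presheaf.stalk z →+* 𝒜.Stalk z :=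
  ((Limits.isColimitOfPreserves (forget₂ CommRingCat RingCat)
      (Limits.colimit.isColimit ((OpenNhds.inclusion z).op ⋙ X.presheaf))).desc
    ((Limits.Cocone.precompose (Functor.whiskerLeft (OpenNhds.inclusion z).op 𝒜.ι)).obj
      (Limits.colimit.cocone ((OpenNhds.inclusion z).op ⋙ 𝒜.A.presheaf)))).hom

lemma ιStalk_germ {U : X.Opens} {z : X} (hz : z ∈ U) (f : Γ(X, U)) :
    𝒜.ιStalk z (X.presheaf.germ U z hz f) = 𝒜.germ hz (𝒜.ι.app (op U) f) := by
  have h := (Limits.isColimitOfPreserves (forget₂ CommRingCat RingCat)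
    (Limits.colimit.isColimit ((OpenNhds.inclusion z).op ⋙ X.presheaf))).fac
    ((Limits.Cocone.precompose (Functor.whiskerLeft (OpenNhds.inclusion z).op 𝒜.ι)).obj
      (Limits.colimit.cocone ((OpenNhds.inclusion z).op ⋙ 𝒜.A.presheaf))) (op ⟨U, hz⟩)
  exact ConcreteCategory.congr_hom h f

/-- `A_z` as a left `𝒪_{X,z}`-module. -/
instance (z : X) : Module (X.presheaf.stalk z) (𝒜.Stalk z) := Module.compHom _ (𝒜.ιStalk z)

lemma smul_def (z : X) (f : X.presheaf.stalk z) (a : 𝒜.Stalk z) : f • a = 𝒜.ιStalk z f * a := rfl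

/-- The stalk of `F_p A` at `z`. -/
def FStalk (p : ℤ) (z : X) : Submodule (X.presheaf.stalk z) (𝒜.Stalk z) :=
  Submodule.span _ {a | ∃ (U : X.Opens) (hz : z ∈ U), ∃ b ∈ 𝒜.F p U, 𝒜.germ hz b = a}

/-- The germ `a` has symbol the derivation `θ`, that is, `[a, f] = θ f` for all functions `f`. -/
def HasSymbol {S : Scheme.{u}} (x : X ⟶ S) {z : X} (a : 𝒜.Stalk z) (θ : TangentStalk x z) : Prop :=
  ∀ f : X.presheaf.stalk z, a * 𝒜.ιStalk z f - 𝒜.ιStalk z f * a = 𝒜.ιStalk z (θ f)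

end FilteredRing

/-- A twisted sheaf of differential operators on `X` over `S`: a filtered sheaf of
`x⁻¹𝒪_S`-algebras `A` with `𝒪_X ≅ F_0 A` whose associated graded ring is commutative, such that
the commutator with functions identifies `gr¹ A` with the sheaf of vector fields and the induced
map `Sym Θ → gr A` is an isomorphism. The last conditions are expressed on stalks. -/
structure TDO {X S : Scheme.{u}} (x : X ⟶ S) extends FilteredRing X where
  ι_injective : ∀ U : X.Opens, Function.Injective (ι.app (op U))
  F_zero : ∀ (U : X.Opens) (a : A.presheaf.obj (op U)), a ∈ F 0 U ↔ ∃ f : Γ(X, U), ι.app (op U) f = a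
  central : ∀ (z : X) (s : S.presheaf.stalk (x z)) (a : toFilteredRing.Stalk z),
    toFilteredRing.ιStalk z (algebraMap _ _ s) * a = a * toFilteredRing.ιStalk z (algebraMap _ _ s)
  commutator : ∀ (p q : ℤ) (U : X.Opens), ∀ a ∈ F p U, ∀ b ∈ F q U, a * b - b * a ∈ F (p + q - 1) U
  symbol_surjective : ∀ (z : X) (θ : TangentStalk x z),
    ∃ a ∈ toFilteredRing.FStalk 1 z, toFilteredRing.HasSymbol x a θ
  symbol_injective : ∀ z : X, ∀ a ∈ toFilteredRing.FStalk 1 z,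
    toFilteredRing.HasSymbol x a (0 : TangentStalk x z) → a ∈ toFilteredRing.FStalk 0 z
  /-- The principal symbol `F_p A → Sym^p Θ` on stalks: it is onto with kernel `F_{p-1} A`, and it
  maps a product of `p` operators of order at most one to the product of their symbols. -/
  exists_principalSymbol : ∀ (z : X) (p : ℕ),
    ∃ σ : toFilteredRing.FStalk p z →ₗ[X.presheaf.stalk z]
        SymmetricAlgebra (X.presheaf.stalk z) (TangentStalk x z),
      LinearMap.range σ =
        (LinearMap.range (SymmetricAlgebra.ι (X.presheaf.stalk z) (TangentStalk x z))) ^ p ∧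
      LinearMap.ker σ =
        (toFilteredRing.FStalk (p - 1) z).comap (toFilteredRing.FStalk p z).subtype ∧
      ∀ (a : Fin p → toFilteredRing.Stalk z) (θ : Fin p → TangentStalk x z)
        (h : (List.ofFn a).prod ∈ toFilteredRing.FStalk p z),
        (∀ k, a k ∈ toFilteredRing.FStalk 1 z) →
        (∀ k, toFilteredRing.HasSymbol x (a k) (θ k)) →
        σ ⟨(List.ofFn a).prod, h⟩ = ∏ k, SymmetricAlgebra.ι (X.presheaf.stalk z) _ (θ k)

end TDO

/-! ### The transfer bimodule and the pullback of a tdo -/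

section Transfer

variable {X Y S : Scheme.{u}} {x : X ⟶ S} (𝒜 : TDO x) (i : Y ⟶ X)

/-- Right multiplication on `A_z` as a left `𝒪_{X,z}`-linear map. -/
def rightMul (z : X) : (𝒜.Stalk z)ᵐᵒᵖ →+* Module.End (X.presheaf.stalk z) (𝒜.Stalk z) where
  toFun q :=
    { toFun := fun a => a * q.unop
      map_add' := fun _ _ => add_mul _ _ _
      map_smul' := fun _ _ => mul_assoc _ _ _ }
  map_one' := LinearMap.ext fun _ => mul_one _
  map_mul' _ _ := LinearMap.ext fun _ => (mul_assoc _ _ _).symm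
  map_zero' := LinearMap.ext fun _ => mul_zero _
  map_add' _ _ := LinearMap.ext fun _ => mul_add _ _ _

/-- The stalk at `y` of the transfer bimodule `A_{Y→X} = i^*A = 𝒪_Y ⊗ i⁻¹A`, the tensor product
over `i⁻¹𝒪_X`. -/
def TransferStalk (y : Y) : Type u :=
  Y.presheaf.stalk y ⊗[X.presheaf.stalk (i y)] 𝒜.Stalk (i y)

namespace TransferStalk

instance (y : Y) : AddCommGroup (TransferStalk 𝒜 i y) :=
  inferInstanceAs (AddCommGroup (Y.presheaf.stalk y ⊗[X.presheaf.stalk (i y)] 𝒜.Stalk (i y)))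

/-- The left `𝒪_{Y,y}`-module structure. -/
instance (y : Y) : Module (Y.presheaf.stalk y) (TransferStalk 𝒜 i y) :=
  inferInstanceAs (Module (Y.presheaf.stalk y)
    (Y.presheaf.stalk y ⊗[X.presheaf.stalk (i y)] 𝒜.Stalk (i y)))

/-- The element `c ⊗ a`. -/
def mk {y : Y} (c : Y.presheaf.stalk y) (a : 𝒜.Stalk (i y)) : TransferStalk 𝒜 i y := c ⊗ₜ a

/-- The right multiplication by `A`. -/
def rightAct (y : Y) : (𝒜.Stalk (i y))ᵐᵒᵖ →+* AddMonoid.End (TransferStalk 𝒜 i y) where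
  toFun q := (LinearMap.lTensor (Y.presheaf.stalk y) (rightMul 𝒜 (i y) q)).toAddMonoidHom
  map_one' := by
    rw [map_one]
    exact AddMonoidHom.ext fun m => LinearMap.congr_fun (LinearMap.lTensor_id _ _) m
  map_mul' p q := by
    rw [map_mul]
    exact AddMonoidHom.ext fun m => LinearMap.congr_fun (LinearMap.lTensor_mul _ _ _) m
  map_zero' := by
    rw [map_zero]
    exact AddMonoidHom.ext fun m => LinearMap.congr_fun (LinearMap.lTensor_zero _) m
  map_add' p q := by
    rw [map_add]
    exact AddMonoidHom.ext fun m => LinearMap.congr_fun (LinearMap.lTensor_add _ _ _) m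

/-- The right `i⁻¹A`-module structure. -/
instance (y : Y) : Module (𝒜.Stalk (i y))ᵐᵒᵖ (TransferStalk 𝒜 i y) :=
  Module.compHom _ (rightAct 𝒜 i y)

lemma op_smul_mk {y : Y} (q : 𝒜.Stalk (i y)) (c : Y.presheaf.stalk y) (a : 𝒜.Stalk (i y)) :
    MulOpposite.op q • mk 𝒜 i c a = mk 𝒜 i c (a * q) := rfl

lemma smul_mk {y : Y} (c d : Y.presheaf.stalk y) (a : 𝒜.Stalk (i y)) :
    c • mk 𝒜 i d a = mk 𝒜 i (c * d) a := rfl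

lemma mk_zero_left {y : Y} (a : 𝒜.Stalk (i y)) : mk 𝒜 i (0 : Y.presheaf.stalk y) a = 0 :=
  TensorProduct.zero_tmul _ _

lemma op_smul_smul {y : Y} (q : (𝒜.Stalk (i y))ᵐᵒᵖ) (c : Y.presheaf.stalk y)
    (m : TransferStalk 𝒜 i y) : q • c • m = c • q • m := by
  have h0 : q • c • (0 : TransferStalk 𝒜 i y) = c • q • (0 : TransferStalk 𝒜 i y) := by simp
  have hadd : ∀ a b : TransferStalk 𝒜 i y, q • c • a = c • q • a → q • c • b = c • q • b →
      q • c • (a + b) = c • q • (a + b) := by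
    intro a b ha hb
    rw [smul_add, smul_add, ha, hb, smul_add, smul_add]
  exact TensorProduct.induction_on (motive := fun m : TransferStalk 𝒜 i y =>
    q • c • m = c • q • m) m h0 (fun _ _ => rfl) hadd

/-- The right `i⁻¹𝒪_X`-module structure, given by right multiplication through `𝒪_X → A`. -/
instance (y : Y) : Module (X.presheaf.stalk (i y)) (TransferStalk 𝒜 i y) :=
  Module.compHom _ ((RingHom.op (𝒜.ιStalk (i y))).comp
    (RingEquiv.toOpposite (X.presheaf.stalk (i y))).toRingHom)

lemma smul_def {y : Y} (f : X.presheaf.stalk (i y)) (m : TransferStalk 𝒜 i y) :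
    f • m = MulOpposite.op (𝒜.ιStalk (i y) f) • m := rfl

end TransferStalk

/-- The stalk at `y` of `F_p A_{Y→X} = i^* F_p A`, as a submodule of `A_{Y→X}`. -/
def FTransferStalk (p : ℤ) (y : Y) : Submodule (Y.presheaf.stalk y) (TransferStalk 𝒜 i y) :=
  Submodule.span _ {m | ∃ a ∈ 𝒜.FStalk p (i y), TransferStalk.mk 𝒜 i 1 a = m}

/-- The family `t` of germs over `W` is a finite sum of elements `c ⊗ a` with `c ∈ 𝒪_Y(W)` and `a`
a section of `F_p A` over an open set containing `i(W)`. -/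
def IsTransferSection (p : ℤ) (W : Y.Opens) (t : ∀ y : W, TransferStalk 𝒜 i y.1) : Prop :=
  ∃ (U : X.Opens) (h : W ≤ i ⁻¹ᵁ U) (n : ℕ) (c : Fin n → Γ(Y, W)) (a : Fin n → 𝒜.F p U),
    ∀ y : W, t y = ∑ k, TransferStalk.mk 𝒜 i (Y.presheaf.germ W y.1 y.2 (c k))
      (𝒜.germ (h y.2) (a k).1)

/-- The endomorphisms of the stalk of `A_{Y→X}` commuting with the right `i⁻¹A`-action. -/
abbrev EndStalk (y : Y) : Type u :=
  Module.End (𝒜.Stalk (i y))ᵐᵒᵖ (TransferStalk 𝒜 i y)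

/-- The sections over `W` of the pullback `Θ_Y ×_{i^*Θ_X} i^*F_1 A` of the Picard algebroid `F_1 A`,
encoded by their action on `A_{Y→X}`: a pair `(D, t)` acts by `c ⊗ q ↦ D c ⊗ q + c t q`. This is
well defined on the tensor product over `i⁻¹𝒪_X` exactly if `D` and `t` have the same image in
`i^*Θ_X`, and the action determines `(D, t)`. The Lie bracket is the commutator. -/
def IsPicardSection (W : Y.Opens) (φ : ∀ y : W, EndStalk 𝒜 i y.1) : Prop :=
  ∃ (D : ∀ y : W, TangentStalk (i ≫ x) y.1) (t : ∀ y : W, TransferStalk 𝒜 i y.1),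
    IsVectorField (i ≫ x) W D ∧ IsTransferSection 𝒜 i 1 W t ∧
    ∀ (y : W) (c : Y.presheaf.stalk y.1) (q : 𝒜.Stalk (i y.1)),
      φ y (TransferStalk.mk 𝒜 i c q) =
        TransferStalk.mk 𝒜 i (D y c) q + c • (MulOpposite.op q • t y)

/-- The stalk at `y` of the pullback of the Picard algebroid `F_1 A`. -/
def PicardStalk (y : Y) : Type u :=
  {φ : EndStalk 𝒜 i y // ∃ (W : Y.Opens) (hy : y ∈ W) (Φ : ∀ y : W, EndStalk 𝒜 i y.1),
    IsPicardSection 𝒜 i W Φ ∧ Φ ⟨y, hy⟩ = φ}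

/-- The relations of the enveloping algebra of the Picard algebroid: the embedding of the algebroid
is additive and compatible with multiplication by functions (`γ` being multiplication by `c`), it
takes the bracket to the commutator, and the unit section to `1`. -/
inductive EnvRel (y : Y) : FreeAlgebra ℤ (PicardStalk 𝒜 i y) → FreeAlgebra ℤ (PicardStalk 𝒜 i y) → Prop
  | add (φ ψ χ : PicardStalk 𝒜 i y) (h : χ.1 = φ.1 + ψ.1) :
      EnvRel y (FreeAlgebra.ι ℤ χ) (FreeAlgebra.ι ℤ φ + FreeAlgebra.ι ℤ ψ)
  | smul (c : Y.presheaf.stalk y) (γ φ χ : PicardStalk 𝒜 i y) (hγ : ∀ m, γ.1 m = c • m)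
      (h : ∀ m, χ.1 m = c • φ.1 m) :
      EnvRel y (FreeAlgebra.ι ℤ χ) (FreeAlgebra.ι ℤ γ * FreeAlgebra.ι ℤ φ)
  | bracket (φ ψ χ : PicardStalk 𝒜 i y) (h : χ.1 = φ.1 * ψ.1 - ψ.1 * φ.1) :
      EnvRel y (FreeAlgebra.ι ℤ χ)
        (FreeAlgebra.ι ℤ φ * FreeAlgebra.ι ℤ ψ - FreeAlgebra.ι ℤ ψ * FreeAlgebra.ι ℤ φ)
  | one (φ : PicardStalk 𝒜 i y) (h : φ.1 = 1) : EnvRel y (FreeAlgebra.ι ℤ φ) 1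

/-- The stalk at `y` of the pullback tdo `i^·A`. -/
def PullbackStalk (y : Y) : Type u := RingQuot (EnvRel 𝒜 i y)

instance (y : Y) : Ring (PullbackStalk 𝒜 i y) := inferInstanceAs (Ring (RingQuot _))

/-- The embedding of the Picard algebroid into `i^·A`. -/
def picardι {y : Y} (φ : PicardStalk 𝒜 i y) : PullbackStalk 𝒜 i y :=
  RingQuot.mkRingHom _ (FreeAlgebra.ι ℤ φ)

/-- The pullback `i^·A`: the enveloping algebra of the pullback of the Picard algebroid `F_1 A`. -/
def pullback : GermRing Y.carrier where
  stalk := PullbackStalk 𝒜 i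
  gens W := {s | ∃ (Φ : ∀ y : W, EndStalk 𝒜 i y.1) (hΦ : IsPicardSection 𝒜 i W Φ),
    ∀ y : W, s y = picardι 𝒜 i ⟨Φ y, W, y.2, Φ, hΦ, rfl⟩}

/-- The action of the free algebra on the Picard algebroid on `A_{Y→X}`. -/
def freeAct (y : Y) : FreeAlgebra ℤ (PicardStalk 𝒜 i y) →+* EndStalk 𝒜 i y :=
  (FreeAlgebra.lift ℤ (Subtype.val : PicardStalk 𝒜 i y → EndStalk 𝒜 i y)).toRingHom

lemma freeAct_ι {y : Y} (φ : PicardStalk 𝒜 i y) : freeAct 𝒜 i y (FreeAlgebra.ι ℤ φ) = φ.1 :=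
  FreeAlgebra.lift_ι_apply _ _

/-- The action of `i^·A` on `A_{Y→X}`. -/
def pullbackAct (y : Y) : PullbackStalk 𝒜 i y →+* EndStalk 𝒜 i y :=
  RingQuot.lift ⟨freeAct 𝒜 i y, by
    intro a b h
    induction h with
    | add φ ψ χ h => simpa [freeAct_ι] using h
    | smul c γ φ χ hγ h =>
      refine LinearMap.ext fun m => ?_
      simp [freeAct_ι, hγ, h]
    | bracket φ ψ χ h => simpa [freeAct_ι] using h
    | one φ h => simpa [freeAct_ι] using h⟩

lemma pullbackAct_picardι {y : Y} (φ : PicardStalk 𝒜 i y) :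
    pullbackAct 𝒜 i y (picardι 𝒜 i φ) = φ.1 :=
  (RingQuot.lift_mkRingHom_apply _ _ _).trans (freeAct_ι 𝒜 i φ)

/-- The left `i^·A`-module structure of `A_{Y→X}`. -/
instance (y : Y) : Module (PullbackStalk 𝒜 i y) (TransferStalk 𝒜 i y) :=
  Module.compHom _ (pullbackAct 𝒜 i y)

lemma pullback_smul_def {y : Y} (b : PullbackStalk 𝒜 i y) (m : TransferStalk 𝒜 i y) :
    b • m = pullbackAct 𝒜 i y b m := rfl

/-- The stalk at `y` of `G_p A_{Y→X}`: the left `i^·A`-submodule generated by `F_p A_{Y→X}`. -/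
def GTransferStalk (p : ℤ) (y : Y) : Submodule (PullbackStalk 𝒜 i y) (TransferStalk 𝒜 i y) :=
  Submodule.span _ (FTransferStalk 𝒜 i p y)

lemma GTransferStalk_mono {p q : ℤ} (h : p ≤ q) (y : Y) :
    GTransferStalk 𝒜 i p y ≤ GTransferStalk 𝒜 i q y := by
  refine Submodule.span_mono ?_
  refine SetLike.coe_subset_coe.mpr (Submodule.span_mono ?_)
  rintro _ ⟨a, ha, rfl⟩
  refine ⟨a, ?_, rfl⟩
  refine Submodule.span_mono ?_ ha
  rintro _ ⟨U, hz, b, hb, rfl⟩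
  exact ⟨U, hz, b, 𝒜.F_mono h U hb, rfl⟩

lemma smul_mem_FTransferStalk (p : ℤ) {y : Y} (f : X.presheaf.stalk (i y))
    {m : TransferStalk 𝒜 i y} (hm : m ∈ FTransferStalk 𝒜 i p y) :
    f • m ∈ FTransferStalk 𝒜 i p y := by
  have hF : ∀ a ∈ 𝒜.FStalk p (i y), a * 𝒜.ιStalk (i y) f ∈ 𝒜.FStalk p (i y) := by
    intro a ha
    induction ha using Submodule.span_induction with
    | mem a ha =>
      obtain ⟨U, hz, b, hb, rfl⟩ := ha
      obtain ⟨V, hV, g, rfl⟩ := X.presheaf.exists_germ_eq f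
      have hW : i y ∈ U ⊓ V := ⟨hz, hV⟩
      refine Submodule.subset_span ⟨U ⊓ V, hW,
        𝒜.A.presheaf.map (homOfLE (inf_le_left : U ⊓ V ≤ U)).op b *
          𝒜.ι.app (op (U ⊓ V)) (X.presheaf.map (homOfLE (inf_le_right : U ⊓ V ≤ V)).op g), ?_, ?_⟩
      · have := 𝒜.F_mul p 0 (U ⊓ V) _ (𝒜.F_res p (inf_le_left : U ⊓ V ≤ U) b hb) _
          ((𝒜.F_zero (U ⊓ V) _).mpr ⟨X.presheaf.map (homOfLE (inf_le_right : U ⊓ V ≤ V)).op g, rfl⟩)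
        rwa [add_zero] at this
      · rw [map_mul, ← FilteredRing.ιStalk_germ]
        congr 1
        · exact TopCat.Presheaf.germ_res_apply 𝒜.A.presheaf (homOfLE (inf_le_left : U ⊓ V ≤ U)) _ hW b
        · congr 1
          exact TopCat.Presheaf.germ_res_apply X.presheaf (homOfLE (inf_le_right : U ⊓ V ≤ V)) _ hW g
    | zero => simp
    | add a b _ _ ha hb => rw [add_mul]; exact add_mem ha hb
    | smul c a _ ha =>
      rw [FilteredRing.smul_def, mul_assoc, ← FilteredRing.smul_def]
      exact Submodule.smul_mem _ _ ha
  induction hm using Submodule.span_induction with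
  | mem m hm =>
    obtain ⟨a, ha, rfl⟩ := hm
    exact Submodule.subset_span ⟨_, hF a ha, rfl⟩
  | zero => simp
  | add a b _ _ ha hb => rw [smul_add]; exact add_mem ha hb
  | smul c a _ ha =>
    have : f • c • a = c • f • a := TransferStalk.op_smul_smul 𝒜 i _ c a
    rw [this]
    exact Submodule.smul_mem _ _ ha

/-- `G_p A_{Y→X}` is stable under the right action of `i⁻¹𝒪_X`. -/
lemma smul_mem_GTransferStalk (p : ℤ) {y : Y} (f : X.presheaf.stalk (i y))
    {m : TransferStalk 𝒜 i y} (hm : m ∈ GTransferStalk 𝒜 i p y) :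
    f • m ∈ GTransferStalk 𝒜 i p y := by
  induction hm using Submodule.span_induction with
  | mem m hm => exact Submodule.subset_span (smul_mem_FTransferStalk 𝒜 i p f hm)
  | zero => simp
  | add a b _ _ ha hb => rw [smul_add]; exact add_mem ha hb
  | smul b a _ ha =>
    have : f • b • a = b • f • a := ((pullbackAct 𝒜 i y b).map_smul _ a).symm
    rw [this]
    exact Submodule.smul_mem _ _ ha

instance (p : ℤ) (y : Y) : SMul (X.presheaf.stalk (i y)) (GTransferStalk 𝒜 i p y) where
  smul f m := ⟨f • m.1, smul_mem_GTransferStalk 𝒜 i p f m.2⟩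

lemma coe_smul_GTransferStalk (p : ℤ) {y : Y} (f : X.presheaf.stalk (i y))
    (m : GTransferStalk 𝒜 i p y) : (f • m).1 = f • m.1 := rfl

/-- The right `i⁻¹𝒪_X`-module structure of `G_p A_{Y→X}`. -/
instance (p : ℤ) (y : Y) : Module (X.presheaf.stalk (i y)) (GTransferStalk 𝒜 i p y) where
  one_smul m := Subtype.ext (one_smul _ m.1)
  mul_smul f g m := Subtype.ext (mul_smul f g m.1)
  smul_zero f := Subtype.ext (smul_zero f)
  smul_add f m n := Subtype.ext (smul_add f m.1 n.1)
  add_smul f g m := Subtype.ext (add_smul f g m.1)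
  zero_smul m := Subtype.ext (zero_smul _ m.1)

/-- Multiplication by a function `c ∈ 𝒪_{Y,y}` as an endomorphism of `A_{Y→X}`. -/
def scalarEnd {y : Y} (c : Y.presheaf.stalk y) : EndStalk 𝒜 i y where
  toFun m := c • m
  map_add' := smul_add c
  map_smul' q m := (TransferStalk.op_smul_smul 𝒜 i q c m).symm

lemma isPicardSection_scalarEnd {W : Y.Opens} (c : Γ(Y, W)) :
    IsPicardSection 𝒜 i W (fun y => scalarEnd 𝒜 i (Y.presheaf.germ W y.1 y.2 c)) := by
  refine ⟨fun _ => 0, fun y => TransferStalk.mk 𝒜 i (Y.presheaf.germ W y.1 y.2 c) 1, ?_, ?_, ?_⟩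
  · intro V hV f
    exact ⟨0, fun z hz => by simp⟩
  · refine ⟨⊤, le_top, 1, fun _ => c, fun _ => ⟨1, ?_⟩, fun y => ?_⟩
    · exact 𝒜.F_mono zero_le_one _ ((𝒜.F_zero ⊤ 1).mpr ⟨1, map_one (𝒜.ι.app (op ⊤)).hom⟩)
    · simp
  · intro y d q
    change Y.presheaf.germ W y.1 y.2 c • TransferStalk.mk 𝒜 i d q = _
    rw [TransferStalk.op_smul_mk, TransferStalk.smul_mk, TransferStalk.smul_mk, one_mul, mul_comm]
    simp [TransferStalk.mk_zero_left]

/-- The functions as sections of `i^·A`. -/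
def scalarSection {W : Y.Opens} (c : Γ(Y, W)) : (pullback 𝒜 i).sections W :=
  ⟨fun y => picardι 𝒜 i ⟨scalarEnd 𝒜 i (Y.presheaf.germ W y.1 y.2 c), W, y.2, _,
      isPicardSection_scalarEnd 𝒜 i c, rfl⟩,
    (pullback 𝒜 i).gens_subset_sections ⟨_, isPicardSection_scalarEnd 𝒜 i c, fun _ => rfl⟩⟩

end Transfer

/-! ### Tensor products and the normal sheaf -/

section Tensor

/-- The tensor product of `E` and `V` over a noncommutative ring, where the balancing relations are
`φ e ⊗ v = e ⊗ v'` whenever `rel v v' φ` (so that `φ` is the left action of a scalar `b` on `E` and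
`v' = v b`). The left `K`-module structure of `E` is assumed to commute with the scalars; the
relations are closed up under it. -/
def BalancedTensor (K E V : Type u) [CommRing K] [AddCommGroup E] [Module K E] [AddCommGroup V]
    (rel : V → V → (E → E) → Prop) : Type u :=
  (E ⊗[ℤ] V) ⧸ Submodule.span K
    {t : E ⊗[ℤ] V | ∃ v v' φ e, rel v v' φ ∧ t = φ e ⊗ₜ v - e ⊗ₜ v'}

namespace BalancedTensor

variable {K E E' V : Type u} [CommRing K] [AddCommGroup E] [Module K E] [AddCommGroup E']
  [Module K E'] [AddCommGroup V] {rel : V → V → (E → E) → Prop} {rel' : V → V → (E' → E') → Prop}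

instance : AddCommGroup (BalancedTensor K E V rel) := inferInstanceAs (AddCommGroup (_ ⧸ _))

instance : Module K (BalancedTensor K E V rel) :=
  inferInstanceAs (Module K ((E ⊗[ℤ] V) ⧸ Submodule.span K
    {t : E ⊗[ℤ] V | ∃ v v' φ e, rel v v' φ ∧ t = φ e ⊗ₜ v - e ⊗ₜ v'}))

variable (K rel) in
/-- The class of `v ⊗ e`. -/
def mk (v : V) (e : E) : BalancedTensor K E V rel :=
  Submodule.Quotient.mk (p := Submodule.span K
    {t : E ⊗[ℤ] V | ∃ v v' φ e, rel v v' φ ∧ t = φ e ⊗ₜ v - e ⊗ₜ v'}) (e ⊗ₜ v)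

lemma mk_eq_mk {v v' : V} {φ : E → E} (h : rel v v' φ) (e : E) :
    mk K rel v (φ e) = mk K rel v' e :=
  (Submodule.Quotient.eq _).mpr (Submodule.subset_span ⟨v, v', φ, e, h, rfl⟩)

/-- Functoriality in the second factor for maps compatible with the scalars. -/
def map (g : E →ₗ[K] E')
    (hg : ∀ v v' φ, rel v v' φ → ∃ φ', rel' v v' φ' ∧ ∀ e, g (φ e) = φ' (g e)) :
    BalancedTensor K E V rel →ₗ[K] BalancedTensor K E' V rel' :=
  Submodule.mapQ _ _ (TensorProduct.AlgebraTensorModule.map g (LinearMap.id : V →ₗ[ℤ] V)) (by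
    rw [Submodule.span_le]
    rintro _ ⟨v, v', φ, e, h, rfl⟩
    obtain ⟨φ', h', hφ⟩ := hg v v' φ h
    refine Submodule.subset_span ⟨v, v', φ', g e, h', ?_⟩
    simp [hφ])

lemma map_mk (g : E →ₗ[K] E')
    (hg : ∀ v v' φ, rel v v' φ → ∃ φ', rel' v v' φ' ∧ ∀ e, g (φ e) = φ' (g e)) (v : V) (e : E) :
    map g hg (mk K rel v e) = mk K rel' v (g e) := rfl

end BalancedTensor

variable {X Y S : Scheme.{u}} {x : X ⟶ S}

/-- The sheaf of rings `i⁻¹𝒪_X`. -/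
def pullbackStructureSheaf (i : Y ⟶ X) : GermRing Y.carrier where
  stalk y := X.presheaf.stalk (i y)
  gens W := {s | ∃ (U : X.Opens) (h : W ≤ i ⁻¹ᵁ U) (f : Γ(X, U)),
    ∀ y : W, s y = X.presheaf.germ U (i y.1) (h y.2) f}

instance (i : Y ⟶ X) (y : Y) : CommRing ((pullbackStructureSheaf i).stalk y) :=
  inferInstanceAs (CommRing (X.presheaf.stalk (i y)))

/-- Right modules over the pullback tdo `i^·A`, as sheaves of modules over the opposite rings. -/
abbrev RightModule (𝒜 : TDO x) (i : Y ⟶ X) : Type (u + 1) :=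
  SheafOfModules.{u} (pullback 𝒜 i).op.sheaf

variable {𝒜 : TDO x} {i : Y ⟶ X} (V : RightModule 𝒜 i)

/-- The underlying presheaf of abelian groups of a right `i^·A`-module. -/
abbrev vPresheaf : TopCat.Presheaf Ab.{u} Y.carrier := V.val.presheaf

/-- The stalk of a right `i^·A`-module. -/
abbrev VStalk (y : Y) : Type u := (vPresheaf V).stalk y

/-- The germ of a section. -/
abbrev vGerm {U : Y.Opens} {y : Y} (hy : y ∈ U) (v : V.val.obj (op U)) : VStalk V y :=
  (vPresheaf V).germ U y hy v

/-- The right action of a section of `i^·A`. -/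
def rightSMul {U : Y.Opens} (v : V.val.obj (op U)) (b : (pullback 𝒜 i).sections U) :
    V.val.obj (op U) :=
  HSMul.hSMul (α := (pullback 𝒜 i).op.sheaf.obj.obj (op U)) ((pullback 𝒜 i).opSection b) v

/-- The germ of a section of `i^·A`. -/
def bGerm {U : Y.Opens} {y : Y} (hy : y ∈ U) (b : (pullback 𝒜 i).sections U) :
    PullbackStalk 𝒜 i y := b.1 ⟨y, hy⟩

/-- The balancing relations over `i^·A`: `v b ⊗ e = v ⊗ b e`. -/
def pullbackRel (y : Y) (E : Type u) [AddCommGroup E] [Module (PullbackStalk 𝒜 i y) E] :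
    VStalk V y → VStalk V y → (E → E) → Prop := fun v v' φ =>
  ∃ (U : Y.Opens) (hy : y ∈ U) (w : V.val.obj (op U)) (b : (pullback 𝒜 i).sections U),
    v = vGerm V hy w ∧ v' = vGerm V hy (rightSMul V w b) ∧
    ∀ e, φ e = bGerm hy b • e

/-- The balancing relations over `𝒪_Y`: `v c ⊗ e = v ⊗ c e`. -/
def functionRel (y : Y) (E : Type u) [AddCommGroup E] [Module (Y.presheaf.stalk y) E] :
    VStalk V y → VStalk V y → (E → E) → Prop := fun v v' φ =>
  ∃ (U : Y.Opens) (hy : y ∈ U) (w : V.val.obj (op U)) (c : Γ(Y, U)),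
    v = vGerm V hy w ∧ v' = vGerm V hy (rightSMul V w (scalarSection 𝒜 i c)) ∧
    ∀ e, φ e = Y.presheaf.germ U y hy c • e

/-- The sheaf `V ⊗_{i^·A} A_{Y→X}` of (right) `i⁻¹𝒪_X`-modules. -/
def tensorTransfer : GermModule (pullbackStructureSheaf i) where
  stalk y := BalancedTensor (X.presheaf.stalk (i y)) (TransferStalk 𝒜 i y) (VStalk V y)
    (pullbackRel V y (TransferStalk 𝒜 i y))
  module y := inferInstanceAs (Module (X.presheaf.stalk (i y)) (BalancedTensor _ _ _ _))
  gens W := {s | ∃ (v : V.val.obj (op W)) (c : Γ(Y, W)) (U : X.Opens) (h : W ≤ i ⁻¹ᵁ U)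
      (a : 𝒜.A.presheaf.obj (op U)),
    ∀ y : W, s y = BalancedTensor.mk _ _ (vGerm V y.2 v)
      (TransferStalk.mk 𝒜 i (Y.presheaf.germ W y.1 y.2 c) (𝒜.germ (h y.2) a))}

/-- The sheaf `V ⊗_{i^·A} G_p A_{Y→X}` of (right) `i⁻¹𝒪_X`-modules. The sections of `G_p A_{Y→X}`
are generated by the products of sections of `i^·A`, of `𝒪_Y` and of `F_p A`. -/
def tensorG (p : ℤ) : GermModule (pullbackStructureSheaf i) where
  stalk y := BalancedTensor (X.presheaf.stalk (i y)) (GTransferStalk 𝒜 i p y) (VStalk V y)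
    (pullbackRel V y (GTransferStalk 𝒜 i p y))
  module y := inferInstanceAs (Module (X.presheaf.stalk (i y)) (BalancedTensor _ _ _ _))
  gens W := {s | ∃ (v : V.val.obj (op W)) (b : (pullback 𝒜 i).sections W) (c : Γ(Y, W))
      (U : X.Opens) (h : W ≤ i ⁻¹ᵁ U) (a : 𝒜.F p U) (m : ∀ y : W, GTransferStalk 𝒜 i p y.1),
    (∀ y : W, (m y).1 = bGerm y.2 b •
      TransferStalk.mk 𝒜 i (Y.presheaf.germ W y.1 y.2 c) (𝒜.germ (h y.2) a.1)) ∧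
    ∀ y : W, s y = BalancedTensor.mk _ _ (vGerm V y.2 v) (m y)}

/-- The inclusion `G_p A_{Y→X} → G_q A_{Y→X}` on stalks. -/
def GInclusion {p q : ℤ} (h : p ≤ q) (y : Y) :
    GTransferStalk 𝒜 i p y →ₗ[X.presheaf.stalk (i y)] GTransferStalk 𝒜 i q y where
  toFun m := ⟨m.1, GTransferStalk_mono 𝒜 i h y m.2⟩
  map_add' _ _ := rfl
  map_smul' f m := Subtype.ext (coe_smul_GTransferStalk 𝒜 i p f m)

/-- The inclusion `G_p A_{Y→X} → A_{Y→X}` on stalks. -/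
def GSubtype (p : ℤ) (y : Y) :
    GTransferStalk 𝒜 i p y →ₗ[X.presheaf.stalk (i y)] TransferStalk 𝒜 i y where
  toFun m := m.1
  map_add' _ _ := rfl
  map_smul' f m := coe_smul_GTransferStalk 𝒜 i p f m

lemma GInclusion_coe {p q : ℤ} (h : p ≤ q) (y : Y) (m : GTransferStalk 𝒜 i p y) :
    (GInclusion h y m).1 = m.1 :=
  Subtype.coe_mk (p := fun a => a ∈ GTransferStalk 𝒜 i q y) m.1 (GTransferStalk_mono 𝒜 i h y m.2)

lemma GInclusion_smul {p q : ℤ} (h : p ≤ q) (y : Y) (b : PullbackStalk 𝒜 i y)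
    (m : GTransferStalk 𝒜 i p y) : GInclusion h y (b • m) = b • GInclusion h y m :=
  (Submodule.inclusion (GTransferStalk_mono 𝒜 i h y)).map_smul b m

lemma GSubtype_smul (p : ℤ) (y : Y) (b : PullbackStalk 𝒜 i y) (m : GTransferStalk 𝒜 i p y) :
    GSubtype p y (b • m) = b • GSubtype p y m :=
  (GTransferStalk 𝒜 i p y).subtype.map_smul b m

/-- The canonical map `V ⊗ G_p A_{Y→X} → V ⊗ G_q A_{Y→X}` on stalks. -/
def tensorGMapStalk {p q : ℤ} (h : p ≤ q) (y : Y) :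
    BalancedTensor (X.presheaf.stalk (i y)) (GTransferStalk 𝒜 i p y) (VStalk V y)
        (pullbackRel V y (GTransferStalk 𝒜 i p y)) →ₗ[X.presheaf.stalk (i y)]
      BalancedTensor (X.presheaf.stalk (i y)) (GTransferStalk 𝒜 i q y) (VStalk V y)
        (pullbackRel V y (GTransferStalk 𝒜 i q y)) :=
  BalancedTensor.map (GInclusion h y) (by
    rintro v v' φ ⟨U, hy, w, b, hv, hv', hφ⟩
    exact ⟨fun e => bGerm hy b • e, ⟨U, hy, w, b, hv, hv', fun _ => rfl⟩,
      fun e => by rw [hφ]; exact GInclusion_smul h y _ e⟩)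

lemma tensorGMapStalk_mk {p q : ℤ} (h : p ≤ q) (y : Y) (v : VStalk V y)
    (m : GTransferStalk 𝒜 i p y) :
    tensorGMapStalk V h y (BalancedTensor.mk _ _ v m) =
      BalancedTensor.mk _ _ v (GInclusion h y m) :=
  BalancedTensor.map_mk _ _ _ _

/-- The canonical map `V ⊗ G_p A_{Y→X} → V ⊗ A_{Y→X}` on stalks. -/
def tensorGιStalk (p : ℤ) (y : Y) :
    BalancedTensor (X.presheaf.stalk (i y)) (GTransferStalk 𝒜 i p y) (VStalk V y)
        (pullbackRel V y (GTransferStalk 𝒜 i p y)) →ₗ[X.presheaf.stalk (i y)]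
      BalancedTensor (X.presheaf.stalk (i y)) (TransferStalk 𝒜 i y) (VStalk V y)
        (pullbackRel V y (TransferStalk 𝒜 i y)) :=
  BalancedTensor.map (GSubtype p y) (by
    rintro v v' φ ⟨U, hy, w, b, hv, hv', hφ⟩
    exact ⟨fun e => bGerm hy b • e, ⟨U, hy, w, b, hv, hv', fun _ => rfl⟩,
      fun e => by rw [hφ]; exact GSubtype_smul p y _ e⟩)

/-- The canonical map `V ⊗ G_p A_{Y→X} → V ⊗ G_q A_{Y→X}` for `p ≤ q`. -/
def tensorGMap {p q : ℤ} (h : p ≤ q) : (tensorG V p).sheaf ⟶ (tensorG V q).sheaf :=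
  GermModule.homMk (M := tensorG V p) (N := tensorG V q) (fun y => tensorGMapStalk V h y) (by
    rintro W s ⟨v, b, c, U, hW, a, m, hm, hs⟩
    refine GermModule.gens_subset_sections ⟨v, b, c, U, hW, ⟨a.1, 𝒜.F_mono h U a.2⟩,
      fun y => GInclusion h y.1 (m y),
      fun y => (GInclusion_coe h y.1 (m y)).trans (hm y), fun y => ?_⟩
    exact (congrArg (tensorGMapStalk V h y.1) (hs y)).trans (tensorGMapStalk_mk V h y.1 _ _))

/-- The canonical map `V ⊗ G_p A_{Y→X} → V ⊗ A_{Y→X}`. -/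
def tensorGι (p : ℤ) : (tensorG V p).sheaf ⟶ (tensorTransfer V).sheaf :=
  GermModule.homMk (M := tensorG V p) (N := tensorTransfer V) (fun y => tensorGιStalk V p y) (by
    rintro W s ⟨v, b, c, U, hW, a, m, hm, hs⟩
    refine GermModule.gens_subset_sections ⟨rightSMul V v b, c, U, hW, a.1, fun y => ?_⟩
    refine (congrArg (tensorGιStalk V p y.1) (hs y)).trans ?_
    refine (BalancedTensor.map_mk _ _ _ _).trans ?_
    have h2 : GSubtype p y.1 (m y) = bGerm y.2 b •
      TransferStalk.mk 𝒜 i (Y.presheaf.germ W y.1 y.2 c) (𝒜.germ (hW y.2) a.1) := hm y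
    rw [h2]
    exact BalancedTensor.mk_eq_mk (rel := pullbackRel V y.1 (TransferStalk 𝒜 i y.1))
      ⟨W, y.2, v, b, rfl, rfl, fun _ => rfl⟩ _)

/-- The image in `Der(i⁻¹𝒪_X, 𝒪_Y)` of an element of `i^*Θ_X`, evaluated at the function `f`. -/
def vectorEval (x : X ⟶ S) (i : Y ⟶ X) (y : Y) (f : X.presheaf.stalk (i y)) :
    Y.presheaf.stalk y ⊗[X.presheaf.stalk (i y)] TangentStalk x (i y)
      →ₗ[Y.presheaf.stalk y] Y.presheaf.stalk y :=
  LinearMap.liftBaseChange (Y.presheaf.stalk y)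
    { toFun := fun θ => algebraMap (X.presheaf.stalk (i y)) (Y.presheaf.stalk y) (θ f)
      map_add' := fun _ _ => by simp
      map_smul' := fun _ _ => by simp [Algebra.smul_def] }

/-- The stalk of `Θ_Y` as a submodule of the stalk of `i^*Θ_X`: the elements whose associated
derivation `i⁻¹𝒪_X → 𝒪_Y` is induced by a derivation of `𝒪_Y`. -/
def tangentSubmodule (x : X ⟶ S) (i : Y ⟶ X) (y : Y) :
    Submodule (Y.presheaf.stalk y)
      (Y.presheaf.stalk y ⊗[X.presheaf.stalk (i y)] TangentStalk x (i y)) where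
  carrier := {t | ∃ D : TangentStalk (i ≫ x) y, ∀ f : X.presheaf.stalk (i y),
    vectorEval x i y f t = D (algebraMap (X.presheaf.stalk (i y)) (Y.presheaf.stalk y) f)}
  zero_mem' := ⟨0, fun f => by simp⟩
  add_mem' := by
    rintro s t ⟨D, hD⟩ ⟨E, hE⟩
    exact ⟨D + E, fun f => by rw [map_add, hD, hE]; rfl⟩
  smul_mem' := by
    rintro c t ⟨D, hD⟩
    exact ⟨c • D, fun f => by rw [map_smul, hD]; rfl⟩

/-- The stalk of the normal sheaf `N_{X/Y} = i^*Θ_X / Θ_Y`. -/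
abbrev NormalStalk (x : X ⟶ S) (i : Y ⟶ X) (y : Y) : Type u :=
  (Y.presheaf.stalk y ⊗[X.presheaf.stalk (i y)] TangentStalk x (i y)) ⧸ tangentSubmodule x i y

/-- The class in the normal sheaf of a vector field on `X`. -/
def normalMk (x : X ⟶ S) (i : Y ⟶ X) (y : Y) (θ : TangentStalk x (i y)) : NormalStalk x i y :=
  Submodule.Quotient.mk (1 ⊗ₜ θ)

/-- The embedding of the normal sheaf into its symmetric algebra. -/
abbrev symι (x : X ⟶ S) (i : Y ⟶ X) (y : Y) :
    NormalStalk x i y →ₗ[Y.presheaf.stalk y]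
      SymmetricAlgebra (Y.presheaf.stalk y) (NormalStalk x i y) :=
  SymmetricAlgebra.ι (Y.presheaf.stalk y) (NormalStalk x i y)

/-- The stalk of `Sym^p N_{X/Y}`: the degree `p` part of the symmetric algebra. -/
def SymNormalStalk (x : X ⟶ S) (i : Y ⟶ X) (p : ℕ) (y : Y) : Type u :=
  ↥((LinearMap.range (symι x i y)) ^ p)

instance (p : ℕ) (y : Y) : AddCommGroup (SymNormalStalk x i p y) :=
  inferInstanceAs (AddCommGroup ↥((LinearMap.range (symι x i y)) ^ p))

instance (p : ℕ) (y : Y) : Module (Y.presheaf.stalk y) (SymNormalStalk x i p y) :=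
  inferInstanceAs (Module (Y.presheaf.stalk y) ↥((LinearMap.range (symι x i y)) ^ p))

/-- The `i⁻¹𝒪_X`-module structure through `i⁻¹𝒪_X → 𝒪_Y`. -/
instance (p : ℕ) (y : Y) : Module (X.presheaf.stalk (i y)) (SymNormalStalk x i p y) :=
  Module.compHom _ (algebraMap (X.presheaf.stalk (i y)) (Y.presheaf.stalk y))

/-- The sheaf `V ⊗_{𝒪_Y} Sym^p N_{X/Y}` of `i⁻¹𝒪_X`-modules. The sections of `Sym^p N_{X/Y}` are
generated by products of classes of vector fields on open subsets of `X`. -/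
def tensorSym (p : ℕ) : GermModule (pullbackStructureSheaf i) where
  stalk y := BalancedTensor (X.presheaf.stalk (i y)) (SymNormalStalk x i p y) (VStalk V y)
    (functionRel V y (SymNormalStalk x i p y))
  module y := inferInstanceAs (Module (X.presheaf.stalk (i y)) (BalancedTensor _ _ _ _))
  gens W := {s | ∃ (v : V.val.obj (op W)) (U : X.Opens) (h : W ≤ i ⁻¹ᵁ U)
      (θ : Fin p → ∀ z : U, TangentStalk x z.1) (n : ∀ y : W, SymNormalStalk x i p y.1),
    (∀ k, IsVectorField x U (θ k)) ∧
    (∀ y : W, (n y).1 = ∏ k, symι x i y.1 (normalMk x i y.1 (θ k ⟨i y.1, h y.2⟩))) ∧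
    ∀ y : W, s y = BalancedTensor.mk _ _ (vGerm V y.2 v) (n y)}

/-- The homomorphism `𝒪_X → i_* i⁻¹𝒪_X`. -/
def toPushforward (i : Y ⟶ X) :
    X.ringCatSheaf ⟶ ((Opens.map i.base).sheafPushforwardContinuous RingCat.{u} _ _).obj
      (pullbackStructureSheaf i).sheaf where
  hom :=
    { app := fun U => RingCat.ofHom
        { toFun := fun (f : Γ(X, U.unop)) =>
            (⟨fun y => X.presheaf.germ U.unop (i y.1) y.2 f,
              (pullbackStructureSheaf i).gens_subset_sections ⟨U.unop, le_rfl, f, fun _ => rfl⟩⟩ :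
              (pullbackStructureSheaf i).sections (i ⁻¹ᵁ U.unop))
          map_one' := Subtype.ext (funext fun y => map_one (X.presheaf.germ U.unop (i y.1) y.2).hom)
          map_mul' := fun f g => Subtype.ext (funext fun y =>
            map_mul (X.presheaf.germ U.unop (i y.1) y.2).hom f g)
          map_zero' := Subtype.ext (funext fun y =>
            map_zero (X.presheaf.germ U.unop (i y.1) y.2).hom)
          map_add' := fun f g => Subtype.ext (funext fun y =>
            map_add (X.presheaf.germ U.unop (i y.1) y.2).hom f g) }
      naturality := fun U U' r => by
        ext f
        exact Subtype.ext (funext fun y => X.presheaf.germ_res_apply r.unop (i y.1) y.2 f) }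

/-- The direct image `i_*` from sheaves of `i⁻¹𝒪_X`-modules to sheaves of `𝒪_X`-modules. -/
def directImage (i : Y ⟶ X) :
    SheafOfModules.{u} (pullbackStructureSheaf i).sheaf ⥤ X.Modules :=
  SheafOfModules.pushforward (toPushforward i)

end Tensor

/-! ### Filtrations -/

section Filtrations

/-- The objects `F p` with the transition maps `F (p - 1) ⟶ F p` and the maps to `M` form an
increasing positive filtration of `M`. -/
structure IsFiltration {C : Type*} [Category C] {M : C} (F : ℤ → C) (step : ∀ p, F (p - 1) ⟶ F p)
    (ι : ∀ p, F p ⟶ M) : Prop where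
  mono : ∀ p, Mono (ι p)
  comm : ∀ p, step p ≫ ι p = ι (p - 1)
  zero : Limits.IsZero (F (-1))

/-- The filtration of `M` by the subobjects `F p` is exhaustive: every subobject of `M` that contains
all `F p` is equal to `M`. -/
def IsExhaustive {C : Type*} [Category C] {M : C} {F : ℤ → C} (ι : ∀ p, F p ⟶ M) : Prop :=
  ∀ ⦃N : C⦄ (j : N ⟶ M) [Mono j], (∀ p, ∃ k : F p ⟶ N, k ≫ j = ι p) → IsIso j

end Filtrations

end TwistedD

end

open TwistedD

/-! The whole theorem rests on one local fact: near a point of `Y` the transfer module `A_{Y→X}` is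
free as a left `i^·A`-module on the monomials in operators normal to `Y`, and `G_p A_{Y→X}` is the
span of the monomials of degree at most `p` (`Frame.exists_basis_normalMonomial`,
`Frame.GTransferStalk_eq_span`). No flatness of `V` is then needed. The stalk of `V ⊗ A_{Y→X}` is a
direct sum of copies of the stalk of `V` indexed by multisets of normal directions, `V ⊗ G_p` is the
summand of cardinality at most `p`, and the `p`th graded piece is the summand of cardinality `p`.
The last one is `V ⊗ Sym^p N`, because the symbols of the normal operators form a basis of the
normal sheaf.

The basis is found as follows. Smoothness gives coordinates on `X` and on `Y`. At a point of `Y`,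
linear algebra over the residue field (`exists_adapted_independent`) completes lifts of the
coordinates of `Y` by functions that vanish on `Y`. A `Frame` spreads such adapted coordinates to a
neighbourhood, together with operators of order one whose symbols are the dual vector fields; the
tangential ones restrict to vector fields on `Y`. From `gr A ≅ Sym Θ` one obtains a
Poincaré–Birkhoff–Witt basis of `A` over `𝒪_X`, with the tangential factors on the left
(`TDO.exists_pairMonomial_basis`), hence a basis of `A_{Y→X}` over `𝒪_Y`. The tangential operators
also define sections of the Picard algebroid. Its relations alone show that sorted monomials in
these sections span `i^·A` over `𝒪_Y`. Such a monomial sends `1 ⊗ (normal monomial)` to a member of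
the `𝒪_Y`-basis of `A_{Y→X}`, so the spanning monomials are independent and the normal monomials are
a basis over `i^·A`, without a separate structure theorem for `i^·A`.

The sheaves here are families of germs, so the expansions must hold for sections near a point and
not only for germs (`Frame.exists_pullback_expansion`, `Frame.exists_normalFamily_eq`). One
consequence is that a section of `i^·A` with vanishing germ vanishes nearby, which makes the stalk
of `i^·A` act on the stalk of `V`.

The symbol `v ⊗ a ↦ v ⊗ (symbol of a modulo Θ_Y)` does not mention a frame; a frame serves only to
prove that it is well defined. It is locally surjective with kernel `V ⊗ G_{p-1}`, which identifies
the graded pieces. Direct images keep injectivity, since their sections are sections over preimages.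
They keep exhaustiveness when the preimages of affine open sets are quasi-compact: finitely many
local orders then have a maximum. -/

namespace TwistedD

/-! ### Coordinates and dual derivations on smooth schemes -/

section Coordinates

/-- An additive derivation that vanishes on the image of `K` is `K`-linear. -/
def derivationOfAlgebraMapEqZero {K R M : Type*} [CommRing K] [CommRing R] [Algebra K R]
    [AddCommGroup M] [Module R M] [Module K M] [IsScalarTower K R M] (D : Derivation ℤ R M)
    (h : ∀ s : K, D (algebraMap K R s) = 0) : Derivation K R M where
  toFun := D
  map_add' := D.map_add
  map_smul' s a := by
    rw [Algebra.smul_def, D.leibniz, h, smul_zero, add_zero, algebraMap_smul, RingHom.id_apply]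
  map_one_eq_zero' := D.map_one_eq_zero
  leibniz' := D.leibniz

/-- The Jacobian of a submersive presentation is invertible in the variables selected by `P.map`, so
the differentials of the other variables form a basis. -/
lemma exists_basis_kaehler (k A : Type u) [CommRing k] [CommRing A] [Algebra k A]
    [Algebra.IsStandardSmooth k A] :
    ∃ (n : ℕ) (f : Fin n → A) (b : Module.Basis (Fin n) A Ω[A⁄k]),
      ∀ j, b j = KaehlerDifferential.D k A (f j) := by
  obtain ⟨ι, σ, _, _, ⟨P⟩⟩ := Algebra.IsStandardSmooth.out (R := k) (S := A)
  let e := Finite.equivFin ((Set.range P.map)ᶜ : Set _)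
  refine ⟨_, fun j => P.val (e.symm j).1, P.basisKaehler.reindex e, fun j => ?_⟩
  rw [Module.Basis.reindex_apply, Algebra.SubmersivePresentation.basisKaehler_apply]

/-- The functions `f` are coordinates on `R` over `K`, with dual derivations `∂`: every derivation
over `K` is determined by its values on `f`. -/
structure IsCoordinates (K : Type u) {R : Type u} [CommRing K] [CommRing R] [Algebra K R]
    {J : Type} [Fintype J] [DecidableEq J] (f : J → R) (d : J → Derivation K R R) : Prop where
  dual : ∀ j l, d j (f l) = if j = l then 1 else 0
  expand : ∀ {M : Type u} [AddCommGroup M] [Module R M] (D : Derivation ℤ R M),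
    (∀ s : K, D (algebraMap K R s) = 0) → ∀ a, D a = ∑ j, d j a • D (f j)

/-- Kähler differentials commute with formally étale base change, so a basis of exact differentials
passes from `A` to `R`, and its dual basis gives the derivations. In the application `R` and `K` are
local rings and `hK` holds because `K` is a localization of `k`. -/
lemma exists_isCoordinates (k A R K : Type u) [CommRing k] [CommRing A] [CommRing R] [CommRing K]
    [Algebra k A] [Algebra A R] [Algebra k R] [IsScalarTower k A R] [Algebra k K] [Algebra K R]
    [IsScalarTower k K R]
    [Algebra.FormallyEtale A R] (hK : ∀ s : K, ∃ a b : k, s * algebraMap k K b = algebraMap k K a ∧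
      IsUnit (algebraMap k K b)) {n : ℕ} (f : Fin n → A) (b : Module.Basis (Fin n) A Ω[A⁄k])
    (hb : ∀ j, b j = KaehlerDifferential.D k A (f j)) :
    ∃ d : Fin n → Derivation K R R, IsCoordinates K (fun j => algebraMap A R (f j)) d := by
  let e := KaehlerDifferential.tensorKaehlerEquivOfFormallyEtale k A R
  let c : Module.Basis (Fin n) R Ω[R⁄k] := (b.baseChange R).map e
  have hc : ∀ j, c j = KaehlerDifferential.D k R (algebraMap A R (f j)) := fun j => by
    simp only [c, Module.Basis.map_apply, Module.Basis.baseChange_apply, hb]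
    rw [← KaehlerDifferential.tensorKaehlerEquivOfFormallyEtale_symm_D_algebraMap,
      LinearEquiv.apply_symm_apply]
  let d₀ : Fin n → Derivation k R R := fun j => (c.coord j).compDer (KaehlerDifferential.D k R)
  -- Clearing denominators: if `s * b = a` and `D` kills `a` and `b`, then `b • D s = 0` with `b` a
  -- unit. Thus derivations over `k` and over `K` are the same.
  have hkill : ∀ {M : Type u} [AddCommGroup M] [Module R M] (D : Derivation ℤ R M),
      (∀ s : k, D (algebraMap k R s) = 0) → ∀ s : K, D (algebraMap K R s) = 0 := by
    intro M _ _ D hD s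
    obtain ⟨a, b, hab, hu⟩ := hK s
    have h := congrArg (fun t => D (algebraMap K R t)) hab
    simp only [map_mul, D.leibniz, ← IsScalarTower.algebraMap_apply, hD, smul_zero, zero_add] at h
    have hu' : IsUnit (algebraMap k R b) := by
      rw [IsScalarTower.algebraMap_apply k K R]
      exact hu.map _
    exact (hu'.smul_eq_zero).mp h
  refine ⟨fun j => derivationOfAlgebraMapEqZero ((d₀ j).restrictScalars ℤ) (hkill _ fun s =>
    (d₀ j).map_algebraMap s), ⟨fun j l => ?_, fun {M} _ _ D hD a => ?_⟩⟩
  · change c.coord j (KaehlerDifferential.D k R _) = _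
    rw [← hc, Module.Basis.coord_apply, Module.Basis.repr_self, Finsupp.single_apply]
    simp only [eq_comm]
  · let : Module k M := Module.compHom M (algebraMap k R)
    have : IsScalarTower k R M := ⟨fun s r m => by
      rw [Algebra.smul_def, mul_smul]; rfl⟩
    let D' : Derivation k R M := derivationOfAlgebraMapEqZero D (fun s => by
      rw [IsScalarTower.algebraMap_apply k K R]; exact hD _)
    -- The expansion of the universal differential of `a` in the basis `c` is pushed forward along
    -- the linear map representing `D`.
    have h := congrArg D'.liftKaehlerDifferential (c.sum_repr (KaehlerDifferential.D k R a))
    rw [map_sum] at h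
    simp only [map_smul, hc, Derivation.liftKaehlerDifferential_comp_D] at h
    exact h.symm

end Coordinates

section SchemeCoordinates

variable {X S : Scheme.{u}} (x : X ⟶ S)

/-- A standard smooth affine chart provides functions that serve at all of its points at once,
because both local rings are localizations of the rings of the chart. -/
lemma exists_coordinates [Smooth x] (z : X) :
    ∃ (U : X.Opens) (_ : z ∈ U) (n : ℕ) (f : Fin n → Γ(X, U)), ∀ (z' : X) (hz' : z' ∈ U),
      ∃ d : Fin n → TangentStalk x z',
        IsCoordinates (S.presheaf.stalk (x z')) (fun j => X.presheaf.germ U z' hz' (f j)) d := by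
  obtain ⟨V, hV, U, hU, hz, e, hst⟩ := Smooth.exists_isStandardSmooth x z
  let : Algebra Γ(S, V) Γ(X, U) := (x.appLE V U e).hom.toAlgebra
  have : Algebra.IsStandardSmooth Γ(S, V) Γ(X, U) := hst
  obtain ⟨n, f, b, hb⟩ := exists_basis_kaehler Γ(S, V) Γ(X, U)
  refine ⟨U, hz, n, f, fun z' hz' => ?_⟩
  let : Algebra Γ(X, U) (X.presheaf.stalk z') := (X.presheaf.germ U z' hz').hom.toAlgebra
  let : Algebra Γ(S, V) (S.presheaf.stalk (x z')) :=
    (S.presheaf.germ V (x z') (e hz')).hom.toAlgebra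
  let : Algebra Γ(S, V) (X.presheaf.stalk z') :=
    ((x.appLE V U e) ≫ X.presheaf.germ U z' hz').hom.toAlgebra
  have : IsScalarTower Γ(S, V) Γ(X, U) (X.presheaf.stalk z') := .of_algebraMap_eq fun _ => rfl
  have : IsScalarTower Γ(S, V) (S.presheaf.stalk (x z')) (X.presheaf.stalk z') :=
    .of_algebraMap_eq fun s => by
      simp only [RingHom.algebraMap_toAlgebra, Scheme.Hom.appLE,
        CommRingCat.hom_comp, RingHom.comp_apply]
      exact (TopCat.Presheaf.germ_res_apply X.presheaf (homOfLE e) z' hz' _).trans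
        (Scheme.Hom.germ_stalkMap_apply x V z' (e hz') s).symm
  have := hU.isLocalization_stalk ⟨z', hz'⟩
  have := hV.isLocalization_stalk ⟨x z', e hz'⟩
  have : Algebra.FormallyEtale Γ(X, U) (X.presheaf.stalk z') :=
    .of_isLocalization (hU.primeIdealOf ⟨z', hz'⟩).asIdeal.primeCompl
  refine exists_isCoordinates Γ(S, V) Γ(X, U) _ _ (fun s => ?_) f b hb
  obtain ⟨⟨a, b⟩, h⟩ :=
    IsLocalization.surj (hV.primeIdealOf ⟨x z', e hz'⟩).asIdeal.primeCompl s
  exact ⟨a, b, h, IsLocalization.map_units _ b⟩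

end SchemeCoordinates

end TwistedD

namespace TwistedD

/-! ### Coordinates adapted to an immersion -/

section AdaptedCoordinates

/-- Expanding `d'` along `f` gives `A * P = 1` for the two Jacobian matrices. They are square up to
the bijection `e`, so `P * A = 1`, which converts expansions along `f` into expansions along `f'`.
This matters because duality is an equality of functions and spreads to a neighbourhood, while the
expansion property does not visibly do so. -/
lemma IsCoordinates.of_dual {K R : Type u} [CommRing K] [CommRing R] [Algebra K R]
    {J J' : Type} [Fintype J] [DecidableEq J] [Fintype J'] [DecidableEq J'] {f : J → R}
    {d : J → Derivation K R R} (h : IsCoordinates K f d) (e : J ≃ J') {f' : J' → R}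
    {d' : J' → Derivation K R R} (hd : ∀ j l, d' j (f' l) = if j = l then 1 else 0) :
    IsCoordinates K f' d' := by
  refine ⟨hd, fun {M} _ _ D hD a => ?_⟩
  let A : Matrix J' J R := Matrix.of fun l k => d k (f' l)
  let P : Matrix J J' R := Matrix.of fun k j => d' j (f k)
  have hAP : A * P = 1 := by
    ext l j
    have := h.expand ((d' j).restrictScalars ℤ) (fun s => (d' j).map_algebraMap s) (f' l)
    simp only [Derivation.restrictScalars_apply, smul_eq_mul, hd] at this
    simp only [Matrix.mul_apply, A, P, Matrix.of_apply, Matrix.one_apply, ← this, eq_comm]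
  have hPA : P * A = 1 := (Matrix.mul_eq_one_comm_of_equiv e.symm).mp hAP
  have hd' : ∀ j, d' j a = ∑ k, d k a * P k j := fun j => by
    simpa [P] using h.expand ((d' j).restrictScalars ℤ) (fun s => (d' j).map_algebraMap s) a
  calc D a = ∑ k, d k a • D (f k) := h.expand D hD a
    _ = ∑ k, ∑ l, (d k a * (P * A) k l) • D (f l) := by
      simp [hPA, Matrix.one_apply]
    _ = ∑ j, d' j a • D (f' j) := by
      simp only [hd', h.expand D hD (f' _), Finset.sum_smul, Finset.smul_sum, smul_smul,
        Matrix.mul_apply, Finset.mul_sum]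
      rw [Finset.sum_comm' (t' := Finset.univ) (s' := fun _ => Finset.univ) (by simp)]
      refine (Finset.sum_congr rfl fun l _ => Finset.sum_comm).trans ?_
      rw [Finset.sum_comm]
      refine Finset.sum_congr rfl fun j _ => ?_
      rw [Finset.sum_comm]
      simp only [A, Matrix.of_apply, Finset.sum_mul, Finset.sum_smul, mul_assoc]
      exact Finset.sum_comm

variable {K R K' B : Type u} [CommRing K] [CommRing R] [Algebra K R] [CommRing K'] [CommRing B]
  [Algebra K' B] [Algebra R B]

/-- This is the exactness of the conormal sequence over the residue field, in coordinates. The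
gradients of the lifts `f` are independent since derivations of `B` detect them. Together with the
gradients of the kernel of `R → B` they span, since a derivation of `R` killing the kernel and `f`
descends to `B` and vanishes there. The basis exchange lemma then picks the `g` in the kernel. -/
lemma exists_adapted_independent (κ : Type u) [Field κ] [Algebra R κ] [Algebra B κ]
    [IsScalarTower R B κ]
    (hπ : Function.Surjective (algebraMap R B))
    (hK : ∀ s : K, ∃ s' : K', algebraMap R B (algebraMap K R s) = algebraMap K' B s')
    (hK' : ∀ s' : K', ∃ s : K, algebraMap R B (algebraMap K R s) = algebraMap K' B s')
    {N m : ℕ} {f₀ : Fin N → R} {d₀ : Fin N → Derivation K R R} (h₀ : IsCoordinates K f₀ d₀)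
    {h : Fin m → B} {δ : Fin m → Derivation K' B B} (hh : IsCoordinates K' h δ)
    (f : Fin m → R) (hf : ∀ j, algebraMap R B (f j) = h j) :
    ∃ (r : ℕ) (g : Fin r → R) (_ : Fin N ≃ Fin m ⊕ Fin r), (∀ l, algebraMap R B (g l) = 0) ∧
      LinearIndependent κ fun j k => algebraMap R κ (d₀ k (Sum.elim f g j)) := by
  have hR : ∀ a : R, algebraMap R κ a = algebraMap B κ (algebraMap R B a) :=
    IsScalarTower.algebraMap_apply R B κ
  let I := RingHom.ker (algebraMap R B)
  let L : R → Fin N → κ := fun a k => algebraMap R κ (d₀ k a)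
  have hLf : LinearIndependent κ fun j => L (f j) := by
    rw [Fintype.linearIndependent_iff]
    intro c hc l
    -- The derivation `δ l` of `B` viewed on `R`: it takes the value 1 or 0 on the `f j`, and
    -- expanding it along `f₀` expresses these values through the gradients `L (f j)`.
    let E : Derivation ℤ R B := ((δ l).restrictScalars ℤ).compAlgebraMap R
    have hE : ∀ a, E a = δ l (algebraMap R B a) := fun a => rfl
    have key : ∀ j, (if l = j then 1 else 0 : κ) =
        ∑ k, L (f j) k * algebraMap B κ (E (f₀ k)) := fun j => by
      have := h₀.expand E (fun s => by
        obtain ⟨s', hs⟩ := hK s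
        rw [hE, hs, Derivation.map_algebraMap]) (f j)
      rw [hE, hf, hh.dual] at this
      have := congrArg (algebraMap B κ) this
      simp only [map_sum, Algebra.smul_def, map_mul, ← hR] at this
      rw [← this]
      split <;> simp
    calc c l = ∑ j, c j * (if l = j then 1 else 0) := by simp
      _ = ∑ k, (∑ j, c j • L (f j)) k * algebraMap B κ (E (f₀ k)) := by
        simp only [key, Finset.mul_sum, Finset.sum_apply, Pi.smul_apply, smul_eq_mul,
          Finset.sum_mul]
        rw [Finset.sum_comm]
        simp only [mul_assoc]
      _ = 0 := by
        refine Finset.sum_eq_zero fun k _ => ?_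
        rw [hc, Pi.zero_apply, zero_mul]
  let v : Fin m ⊕ I → Fin N → κ := Sum.elim (fun j => L (f j)) (fun a => L a.1)
  have hspan : Submodule.span κ (Set.range v) = ⊤ := by
    by_contra hne
    obtain ⟨φ, hφ, hle⟩ := Submodule.exists_le_ker_of_lt_top _ (lt_top_iff_ne_top.mpr hne)
    have hv : ∀ t, φ (v t) = 0 := fun t => hle (Submodule.subset_span ⟨t, rfl⟩)
    -- A functional `φ` vanishing on all gradients in question turns the gradient into a derivation
    -- that kills the kernel and the `f j`.
    let D : Derivation ℤ R κ :=
      { toFun := fun a => φ (L a)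
        map_add' := fun a b => by
          rw [← map_add]; congr 1; funext k; simp [L]
        map_smul' := fun n a => by
          rw [RingHom.id_apply, ← map_zsmul]; congr 1; funext k; simp [L]
        map_one_eq_zero' := by
          change φ (L 1) = 0
          have : L 1 = 0 := by funext k; simp [L]
          rw [this, map_zero]
        leibniz' := fun a b => by
          change φ (L (a * b)) = a • φ (L b) + b • φ (L a)
          have : L (a * b) = algebraMap R κ a • L b + algebraMap R κ b • L a := by
            funext k; simp [L, Algebra.smul_def]
          rw [this, map_add, map_smul, map_smul, algebraMap_smul, algebraMap_smul] }
    have hD : ∀ a, D a = φ (L a) := fun _ => rfl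
    have hDI : ∀ a b, algebraMap R B a = algebraMap R B b → D a = D b := fun a b hab => by
      have : a - b ∈ I := by rw [RingHom.mem_ker, map_sub, hab, sub_self]
      rw [← sub_eq_zero, ← map_sub]
      exact hv (Sum.inr ⟨_, this⟩)
    -- An arbitrary set-theoretic section suffices to descend `D` to `B`, since `D` is constant on
    -- the fibres of `R → B`.
    let σ := Function.surjInv hπ
    have hσ : ∀ b, algebraMap R B (σ b) = b := Function.surjInv_eq hπ
    let D' : Derivation ℤ B κ :=
      { toFun := fun b => D (σ b)
        map_add' := fun a b => by rw [← map_add]; exact hDI _ _ (by simp [hσ])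
        map_smul' := fun n a => by
          rw [RingHom.id_apply, ← map_zsmul]
          refine hDI _ _ ?_
          rw [hσ, zsmul_eq_mul, zsmul_eq_mul, map_mul, hσ, map_intCast]
        map_one_eq_zero' := by
          change D (σ 1) = 0
          rw [hDI _ 1 (by simp [hσ]), Derivation.map_one_eq_zero]
        leibniz' := fun a b => by
          change D (σ (a * b)) = a • D (σ b) + b • D (σ a)
          rw [hDI (σ (a * b)) (σ a * σ b) (by simp [hσ]), D.leibniz,
            ← algebraMap_smul B (σ a), ← algebraMap_smul B (σ b), hσ, hσ] }
    have hD' : ∀ a, D' (algebraMap R B a) = D a := fun a => hDI _ _ (hσ _)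
    have hzero : ∀ b, D' b = 0 := fun b => by
      rw [hh.expand D' (fun s' => ?_) b]
      · refine Finset.sum_eq_zero fun j _ => ?_
        rw [← hf, hD', hD, show φ (L (f j)) = 0 from hv (Sum.inl j), smul_zero]
      · obtain ⟨s, hs⟩ := hK' s'
        rw [← hs, hD', hD]
        have : L (algebraMap K R s) = 0 := by funext k; simp [L]
        rw [this, map_zero]
    -- The gradient of `f₀ k` is the `k`th standard vector, so a vanishing `D` forces `φ = 0`.
    refine hφ (LinearMap.pi_ext' fun k => LinearMap.ext_ring ?_)
    have h1 : D (f₀ k) = 0 := by rw [← hD', hzero]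
    have h2 : L (f₀ k) = Pi.single k 1 := by
      funext l
      simp only [L, h₀.dual, Pi.single_apply]
      split <;> simp
    rw [hD, h2] at h1
    simpa using h1
  have hind : LinearIndepOn κ v (Set.range Sum.inl) := by
    rw [linearIndepOn_range_iff Sum.inl_injective]
    exact hLf
  obtain ⟨b, -, hsb, htb, hb⟩ := exists_linearIndepOn_extension hind (Set.subset_univ _)
  have hbfin : Finite b := hb.finite
  let J := {a : I // Sum.inr a ∈ b}
  have hJ : Finite J := Finite.of_injective (fun a : J => (⟨Sum.inr a.1, a.2⟩ : b))
    fun a a' haa => Subtype.ext (Sum.inr_injective (congrArg Subtype.val haa))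
  obtain ⟨r, ⟨e⟩⟩ := Finite.exists_equiv_fin J
  let g : Fin r → R := fun l => (e.symm l).1.1
  let w : Fin m ⊕ Fin r → b := Sum.elim (fun j => ⟨Sum.inl j, hsb ⟨j, rfl⟩⟩)
    (fun l => ⟨Sum.inr (e.symm l).1, (e.symm l).2⟩)
  have hw : Function.Bijective w := by
    constructor
    · rintro (j | l) (j' | l') h
      · simpa [w] using h
      · simp [w] at h
      · simp [w] at h
      · have := Subtype.ext (Sum.inr_injective (congrArg Subtype.val h))
        rw [e.symm.injective this]
    · rintro ⟨j | a, hj⟩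
      · exact ⟨Sum.inl j, rfl⟩
      · exact ⟨Sum.inr (e ⟨a, hj⟩), by simp [w]⟩
  have hlin : LinearIndependent κ fun j => L (Sum.elim f g j) := by
    have := hb.linearIndependent.comp w hw.1
    have hw' : (fun j => L (Sum.elim f g j)) = (fun t : b => v t) ∘ w :=
      funext fun j => by rcases j with j | l <;> rfl
    rw [hw']
    exact this
  have htop : ⊤ ≤ Submodule.span κ (Set.range fun j => L (Sum.elim f g j)) := by
    rw [← hspan, Submodule.span_le]
    rintro _ ⟨t, rfl⟩
    refine Submodule.span_mono ?_ (htb ⟨t, trivial, rfl⟩)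
    rintro _ ⟨t, ht, rfl⟩
    obtain ⟨j, hj⟩ := hw.2 ⟨t, ht⟩
    refine ⟨j, ?_⟩
    have : (w j).1 = t := congrArg Subtype.val hj
    rw [← this]
    rcases j with j | l <;> rfl
  have hcard := Module.finrank_eq_card_basis (Module.Basis.mk hlin htop)
  rw [Module.finrank_fintype_fun_eq_card] at hcard
  exact ⟨r, g, Fintype.equivOfCardEq hcard, fun l => (e.symm l).1.2, hlin⟩

/-- The Jacobian of the adapted functions is invertible over the residue field, hence over the local
ring, and the columns of its inverse are the coefficients of the dual derivations. -/
lemma exists_adapted_coordinates [IsLocalRing R] [IsLocalRing B] [IsLocalHom (algebraMap R B)]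
    (hπ : Function.Surjective (algebraMap R B))
    (hK : ∀ s : K, ∃ s' : K', algebraMap R B (algebraMap K R s) = algebraMap K' B s')
    (hK' : ∀ s' : K', ∃ s : K, algebraMap R B (algebraMap K R s) = algebraMap K' B s')
    {N m : ℕ} {f₀ : Fin N → R} {d₀ : Fin N → Derivation K R R} (h₀ : IsCoordinates K f₀ d₀)
    {h : Fin m → B} {δ : Fin m → Derivation K' B B} (hh : IsCoordinates K' h δ) :
    ∃ (r : ℕ) (f : Fin m → R) (g : Fin r → R) (_ : Fin N ≃ Fin m ⊕ Fin r)
      (d : Fin m ⊕ Fin r → Derivation K R R), (∀ j, algebraMap R B (f j) = h j) ∧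
        (∀ l, algebraMap R B (g l) = 0) ∧
        ∀ j l, d j (Sum.elim f g l) = if j = l then 1 else 0 := by
  obtain ⟨f, hf⟩ := Classical.axiomOfChoice fun j => hπ (h j)
  obtain ⟨r, g, e, hg, hlin⟩ := 
    exists_adapted_independent (IsLocalRing.ResidueField B) hπ hK hK' h₀ hh f hf
  let A : Matrix (Fin N) (Fin N) R := Matrix.of fun j k => d₀ k (Sum.elim f g (e j))
  have hA : IsUnit A.det := by
    have h1 : IsUnit (A.map (algebraMap R (IsLocalRing.ResidueField B))) :=
      Matrix.linearIndependent_rows_iff_isUnit.mp (hlin.comp e e.injective)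
    rw [Matrix.isUnit_iff_isUnit_det] at h1
    have h2 : algebraMap R (IsLocalRing.ResidueField B) A.det =
      (A.map (algebraMap R (IsLocalRing.ResidueField B))).det := RingHom.map_det _ _
    rw [← h2, IsScalarTower.algebraMap_apply R B (IsLocalRing.ResidueField B)] at h1
    exact (isUnit_map_iff (algebraMap R B) _).mp
      ((isUnit_map_iff (IsLocalRing.residue B) _).mp h1)
  refine ⟨r, f, g, e, fun j => ∑ k, A⁻¹ k (e.symm j) • d₀ k, hf, hg, fun j l => ?_⟩
  have := congrFun (congrFun (Matrix.mul_nonsing_inv A hA) (e.symm l)) (e.symm j)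
  rw [Matrix.mul_apply, Matrix.one_apply] at this
  simp only [A, Matrix.of_apply, Equiv.apply_symm_apply, EmbeddingLike.apply_eq_iff_eq] at this
  have hsum : (∑ k, A⁻¹ k (e.symm j) • d₀ k) (Sum.elim f g l) =
      ∑ k, A⁻¹ k (e.symm j) * d₀ k (Sum.elim f g l) := by
    have := congrFun (map_sum Derivation.coeFnAddMonoidHom (fun k => A⁻¹ k (e.symm j) • d₀ k)
      Finset.univ) (Sum.elim f g l)
    rw [Finset.sum_apply] at this
    exact this
  simp only [mul_comm (A⁻¹ _ _)] at hsum
  rw [hsum]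
  refine this.trans ?_
  simp only [eq_comm]

end AdaptedCoordinates

end TwistedD

namespace TwistedD

/-! ### Straightening words over scalars that do not commute with the generators -/

section SortedMonomials

/-- The product of the elements `d j`, for `j` in the multiset `s`, in increasing order. -/
def sortedMonomial {A : Type*} [Monoid A] {n : ℕ} (d : Fin n → A) (s : Multiset (Fin n)) : A :=
  ((s.sort (· ≤ ·)).map d).prod

@[simp]
lemma sortedMonomial_zero {A : Type*} [Monoid A] {n : ℕ} (d : Fin n → A) :
    sortedMonomial d 0 = 1 := by
  simp [sortedMonomial]

lemma map_sortedMonomial {A A' F : Type*} [Monoid A] [Monoid A'] [FunLike F A A']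
    [MonoidHomClass F A A'] (φ : F) {n : ℕ} (d : Fin n → A) (s : Multiset (Fin n)) :
    φ (sortedMonomial d s) = sortedMonomial (fun j => φ (d j)) s := by
  simp [sortedMonomial, map_list_prod, Function.comp_def]

variable {B P : Type*} [CommRing B] [Ring P] (β : B →+* P) {n : ℕ} (p : Fin n → P)

/-- The left `B`-span of the words of length at most `k` in the `p j`. -/
def wordSpan (k : ℕ) : AddSubgroup P :=
  AddSubgroup.closure {a | ∃ (c : B) (l : List (Fin n)), l.length ≤ k ∧ a = β c * (l.map p).prod}

variable {β p}

lemma wordSpan_mono {k l : ℕ} (h : k ≤ l) : wordSpan β p k ≤ wordSpan β p l :=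
  AddSubgroup.closure_mono fun _ ⟨c, w, hw, ha⟩ => ⟨c, w, hw.trans h, ha⟩

lemma word_mem_wordSpan (c : B) (l : List (Fin n)) {k : ℕ} (h : l.length ≤ k) :
    β c * (l.map p).prod ∈ wordSpan β p k :=
  AddSubgroup.subset_closure ⟨c, l, h, rfl⟩

lemma scalar_mul_mem_wordSpan (c : B) {k : ℕ} {a : P} (ha : a ∈ wordSpan β p k) :
    β c * a ∈ wordSpan β p k := by
  induction ha using AddSubgroup.closure_induction with
  | mem a ha =>
    obtain ⟨c', l, hl, rfl⟩ := ha
    rw [← mul_assoc, ← map_mul]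
    exact word_mem_wordSpan _ _ hl
  | zero => rw [mul_zero]; exact zero_mem _
  | add a b _ _ ha hb => rw [mul_add]; exact add_mem ha hb
  | neg a _ ha => rw [mul_neg]; exact neg_mem ha

/-- Moving `p j` to the right of a scalar costs only another scalar, so the length grows by at most
one. -/
lemma generator_mul_mem_wordSpan (hβ : ∀ j c, ∃ c', p j * β c = β c * p j + β c') (j : Fin n)
    {k : ℕ} {a : P} (ha : a ∈ wordSpan β p k) : p j * a ∈ wordSpan β p (k + 1) := by
  induction ha using AddSubgroup.closure_induction with
  | mem a ha =>
    obtain ⟨c, l, hl, rfl⟩ := ha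
    obtain ⟨c', hc'⟩ := hβ j c
    rw [← mul_assoc, hc', add_mul, mul_assoc]
    refine add_mem ?_ (word_mem_wordSpan _ _ (by lia))
    have := word_mem_wordSpan (β := β) (p := p) c (j :: l) (k := k + 1) (by simpa using hl)
    rwa [List.map_cons, List.prod_cons] at this
  | zero => rw [mul_zero]; exact zero_mem _
  | add a b _ _ ha hb => rw [mul_add]; exact add_mem ha hb
  | neg a _ ha => rw [mul_neg]; exact neg_mem ha

lemma word_mul_mem_wordSpan (hβ : ∀ j c, ∃ c', p j * β c = β c * p j + β c') (l : List (Fin n))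
    {k : ℕ} {a : P} (ha : a ∈ wordSpan β p k) :
    (l.map p).prod * a ∈ wordSpan β p (l.length + k) := by
  induction l with
  | nil => simpa using ha
  | cons j l ih =>
    rw [List.map_cons, List.prod_cons, mul_assoc, List.length_cons]
    exact wordSpan_mono (by lia) (generator_mul_mem_wordSpan hβ j ih)

lemma mul_mem_wordSpan (hβ : ∀ j c, ∃ c', p j * β c = β c * p j + β c') {k l : ℕ} {a b : P}
    (ha : a ∈ wordSpan β p k) (hb : b ∈ wordSpan β p l) : a * b ∈ wordSpan β p (k + l) := by
  induction ha using AddSubgroup.closure_induction with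
  | mem a ha =>
    obtain ⟨c, w, hw, rfl⟩ := ha
    rw [mul_assoc]
    exact scalar_mul_mem_wordSpan _ (wordSpan_mono (by lia) (word_mul_mem_wordSpan hβ w hb))
  | zero => rw [zero_mul]; exact zero_mem _
  | add a b _ _ ha hb => rw [add_mul]; exact add_mem ha hb
  | neg a _ ha => rw [neg_mul]; exact neg_mem ha

/-- Exchanging two adjacent letters replaces a factor of length two by a commutator of length at
most one. For the empty word the truncated subtraction is harmless, as the difference is zero. -/
lemma word_sub_word_mem_wordSpan (hβ : ∀ j c, ∃ c', p j * β c = β c * p j + β c')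
    (hp : ∀ j l, p j * p l - p l * p j ∈ wordSpan β p 1) {w w' : List (Fin n)} (h : w.Perm w') :
    (w.map p).prod - (w'.map p).prod ∈ wordSpan β p (w.length - 1) := by
  induction h with
  | nil => simp
  | @cons j l l' hll ih =>
    simp only [List.map_cons, List.prod_cons, ← mul_sub, List.length_cons]
    rcases l with _ | ⟨i, l⟩
    · rw [List.nil_perm.mp hll]; simp
    · exact wordSpan_mono (by simp) (generator_mul_mem_wordSpan hβ j ih)
  | swap i j l =>
    simp only [List.map_cons, List.prod_cons, ← mul_assoc, ← sub_mul, List.length_cons]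
    have := mul_mem_wordSpan hβ (hp j i) (word_mem_wordSpan (p := p) (1 : B) l le_rfl)
    rw [map_one, one_mul] at this
    exact wordSpan_mono (by lia) this
  | trans h₁ _ ih₁ ih₂ =>
    rw [← h₁.length_eq] at ih₂
    simpa using add_mem ih₁ ih₂

variable (β p) in
/-- The left `B`-span of the sorted monomials in the `p j`. -/
def monomialSpan : AddSubgroup P :=
  AddSubgroup.closure {a | ∃ (c : B) (s : Multiset (Fin n)), a = β c * sortedMonomial p s}

lemma scalar_mul_mem_monomialSpan (c : B) {a : P} (ha : a ∈ monomialSpan β p) :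
    β c * a ∈ monomialSpan β p := by
  induction ha using AddSubgroup.closure_induction with
  | mem a ha =>
    obtain ⟨c', s, rfl⟩ := ha
    rw [← mul_assoc, ← map_mul]
    exact AddSubgroup.subset_closure ⟨_, _, rfl⟩
  | zero => rw [mul_zero]; exact zero_mem _
  | add a b _ _ ha hb => rw [mul_add]; exact add_mem ha hb
  | neg a _ ha => rw [mul_neg]; exact neg_mem ha

/-- Straightening by induction on the length: sorting a word leaves an error made of shorter words.
-/
lemma wordSpan_le_monomialSpan (hβ : ∀ j c, ∃ c', p j * β c = β c * p j + β c')
    (hp : ∀ j l, p j * p l - p l * p j ∈ wordSpan β p 1) (k : ℕ) :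
    wordSpan β p k ≤ monomialSpan β p := by
  induction k with
  | zero =>
    rw [wordSpan, AddSubgroup.closure_le]
    rintro _ ⟨c, l, hl, rfl⟩
    rw [List.length_eq_zero_iff.mp (Nat.le_zero.mp hl)]
    exact AddSubgroup.subset_closure ⟨c, 0, by simp⟩
  | succ k ih =>
    rw [wordSpan, AddSubgroup.closure_le]
    rintro _ ⟨c, l, hl, rfl⟩
    refine scalar_mul_mem_monomialSpan c ?_
    have h1 := word_sub_word_mem_wordSpan (β := β) hβ hp
      (Multiset.coe_eq_coe.mp (Multiset.sort_eq (l : Multiset (Fin n)) (· ≤ ·))).symm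
    have h2 := ih (wordSpan_mono (by lia) h1)
    have h3 : ((((l : Multiset (Fin n)).sort (· ≤ ·)).map p).prod) ∈ monomialSpan β p :=
      AddSubgroup.subset_closure ⟨1, l, by rw [map_one, one_mul]; rfl⟩
    simpa using add_mem h2 h3

/-- Products of sorted monomials are not sorted, whereas word spans multiply well. Comparing the two
makes the span of the sorted monomials a ring. -/
lemma monomialSpan_eq_iSup (hβ : ∀ j c, ∃ c', p j * β c = β c * p j + β c')
    (hp : ∀ j l, p j * p l - p l * p j ∈ wordSpan β p 1) {a : P} :
    a ∈ monomialSpan β p ↔ ∃ k, a ∈ wordSpan β p k := by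
  refine ⟨fun ha => ?_, fun ⟨k, hk⟩ => wordSpan_le_monomialSpan hβ hp k hk⟩
  induction ha using AddSubgroup.closure_induction with
  | mem a ha =>
    obtain ⟨c, s, rfl⟩ := ha
    exact ⟨_, word_mem_wordSpan c _ le_rfl⟩
  | zero => exact ⟨0, zero_mem _⟩
  | add a b _ _ ha hb =>
    obtain ⟨k, hk⟩ := ha
    obtain ⟨l, hl⟩ := hb
    exact ⟨max k l, add_mem (wordSpan_mono (le_max_left _ _) hk)
      (wordSpan_mono (le_max_right _ _) hl)⟩
  | neg a _ ha =>
    obtain ⟨k, hk⟩ := ha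
    exact ⟨k, neg_mem hk⟩

variable (β p) in
/-- The left `B`-span of the sorted monomials is a subring. -/
def monomialSubring (hβ : ∀ j c, ∃ c', p j * β c = β c * p j + β c')
    (hp : ∀ j l, p j * p l - p l * p j ∈ wordSpan β p 1) : Subring P where
  carrier := monomialSpan β p
  zero_mem' := zero_mem _
  one_mem' := AddSubgroup.subset_closure ⟨1, 0, by simp⟩
  add_mem' := add_mem
  neg_mem' := neg_mem
  mul_mem' {a b} ha hb := by
    obtain ⟨k, hk⟩ := (monomialSpan_eq_iSup hβ hp).mp ha
    obtain ⟨l, hl⟩ := (monomialSpan_eq_iSup hβ hp).mp hb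
    exact (monomialSpan_eq_iSup hβ hp).mpr ⟨_, mul_mem_wordSpan hβ hk hl⟩

lemma exists_eq_sum_of_mem_monomialSpan {a : P} (ha : a ∈ monomialSpan β p) :
    ∃ c : Multiset (Fin n) →₀ B, a = c.sum fun s b => β b * sortedMonomial p s := by
  induction ha using AddSubgroup.closure_induction with
  | mem a ha =>
    obtain ⟨c, s, rfl⟩ := ha
    exact ⟨Finsupp.single s c, by simp⟩
  | zero => exact ⟨0, by simp⟩
  | add a b _ _ ha hb =>
    obtain ⟨c, rfl⟩ := ha
    obtain ⟨d, rfl⟩ := hb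
    exact ⟨c + d, by rw [Finsupp.sum_add_index'] <;> simp [add_mul]⟩
  | neg a _ ha =>
    obtain ⟨c, rfl⟩ := ha
    exact ⟨-c, by rw [Finsupp.sum_neg_index] <;> simp [Finsupp.sum]⟩

end SortedMonomials

/-! ### Monomial bases of symmetric algebras -/

section SymmetricPowers

variable {R M : Type*} [CommRing R] [AddCommGroup M] [Module R M] {J : Type*}

lemma symmetricAlgebra_equiv_prod [DecidableEq J] (b : Module.Basis J R M) (s : Multiset J) :
    SymmetricAlgebra.equivMvPolynomial b (s.map fun j => SymmetricAlgebra.ι R M (b j)).prod =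
      MvPolynomial.monomial (Multiset.toFinsupp s) 1 := by
  rw [map_multiset_prod, Multiset.map_map]
  simp only [Function.comp_def, SymmetricAlgebra.equivMvPolynomial_ι_apply]
  induction s using Multiset.induction_on with
  | empty => simp
  | cons j s ih =>
    rw [Multiset.map_cons, Multiset.prod_cons, ih, ← Multiset.singleton_add, map_add,
      Multiset.toFinsupp_singleton, MvPolynomial.X, MvPolynomial.monomial_mul, one_mul]

/-- The monomials in a basis form a basis of the symmetric algebra. -/
lemma exists_symmetricAlgebra_basis [DecidableEq J] (b : Module.Basis J R M) :
    ∃ e : Module.Basis (Multiset J) R (SymmetricAlgebra R M),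
      ∀ s, e s = (s.map fun j => SymmetricAlgebra.ι R M (b j)).prod := by
  refine ⟨((MvPolynomial.basisMonomials J R).reindex Multiset.toFinsupp.symm.toEquiv).map
    (SymmetricAlgebra.equivMvPolynomial b).symm.toLinearEquiv, fun s => ?_⟩
  rw [Module.Basis.map_apply, Module.Basis.reindex_apply]
  change (SymmetricAlgebra.equivMvPolynomial b).symm _ = _
  rw [AlgEquiv.symm_apply_eq, symmetricAlgebra_equiv_prod]
  simp

lemma range_symι_pow_eq_span (b : Module.Basis J R M) (p : ℕ) :
    (LinearMap.range (SymmetricAlgebra.ι R M)) ^ p =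
      Submodule.span R {a | ∃ s : Multiset J, s.card = p ∧
        a = (s.map fun j => SymmetricAlgebra.ι R M (b j)).prod} := by
  have h1 : LinearMap.range (SymmetricAlgebra.ι R M) =
      Submodule.span R (Set.range fun j => SymmetricAlgebra.ι R M (b j)) := by
    rw [LinearMap.range_eq_map, ← b.span_eq, Submodule.map_span, ← Set.range_comp]
    rfl
  rw [h1, Submodule.span_pow]
  congr 1
  ext a
  rw [Set.mem_pow]
  constructor
  · rintro ⟨f, rfl⟩
    choose g hg using fun k => (f k).2
    refine ⟨Multiset.ofList (List.ofFn g), by simp, ?_⟩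
    rw [Multiset.map_coe, Multiset.prod_coe, List.map_ofFn]
    congr 2
    funext k
    exact (hg k).symm
  · rintro ⟨s, hs, rfl⟩
    obtain ⟨l, rfl⟩ := Quot.exists_rep s
    have hl : l.length = p := hs
    subst hl
    refine ⟨fun k => ⟨_, ⟨l.get k, rfl⟩⟩, ?_⟩
    change _ = ((l : Multiset J).map _).prod
    rw [Multiset.map_coe, Multiset.prod_coe, ← List.ofFn_get (l.map _)]
    congr 1
    refine List.ext_get (by simp) fun k h1 h2 => by simp

end SymmetricPowers

/-! ### The universal property of the balanced tensor product -/

section BalancedTensorCoordinates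

namespace BalancedTensor

variable {K E V : Type u} [CommRing K] [AddCommGroup E] [Module K E] [AddCommGroup V]
  {rel : V → V → (E → E) → Prop}

variable (K rel) in
/-- The biadditive map `(v, e) ↦ v ⊗ e`. -/
def mkHom : V →+ E →+ BalancedTensor K E V rel :=
  AddMonoidHom.mk' (fun v => AddMonoidHom.mk' (fun e => mk K rel v e) fun e e' => by
      simp only [mk, TensorProduct.add_tmul]; rfl)
    fun v v' => AddMonoidHom.ext fun e => by
      change mk K rel (v + v') e = mk K rel v e + mk K rel v' e
      simp only [mk, TensorProduct.tmul_add]; rfl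

lemma mkHom_apply (v : V) (e : E) : mkHom K rel v e = mk K rel v e := rfl

lemma mk_add_left (v v' : V) (e : E) : mk K rel (v + v') e = mk K rel v e + mk K rel v' e := by
  simp only [← mkHom_apply, map_add, AddMonoidHom.add_apply]

lemma mk_add_right (v : V) (e e' : E) : mk K rel v (e + e') = mk K rel v e + mk K rel v e' := by
  simp only [← mkHom_apply, map_add]

lemma mk_zero_left (e : E) : mk K rel 0 e = 0 := by
  simp only [← mkHom_apply, map_zero, AddMonoidHom.zero_apply]

lemma mk_zero_right (v : V) : mk K rel v 0 = 0 := by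
  simp only [← mkHom_apply, map_zero]

lemma mk_sum_right {ι : Type*} (t : Finset ι) (v : V) (e : ι → E) :
    mk K rel v (∑ k ∈ t, e k) = ∑ k ∈ t, mk K rel v (e k) := by
  simp only [← mkHom_apply, map_sum]

lemma smul_mk (f : K) (v : V) (e : E) : f • mk K rel v e = mk K rel v (f • e) := rfl

@[elab_as_elim]
lemma induction_on {motive : BalancedTensor K E V rel → Prop} (t : BalancedTensor K E V rel)
    (mk : ∀ v e, motive (mk K rel v e)) (add : ∀ s t, motive s → motive t → motive (s + t)) :
    motive t := by
  obtain ⟨t, rfl⟩ := Submodule.Quotient.mk_surjective _ t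
  induction t using TensorProduct.induction_on with
  | zero =>
    have h := mk 0 0
    rwa [mk_zero_left] at h
  | tmul e v => exact mk v e
  | add s t hs ht => exact add _ _ hs ht

/-- A biadditive map that is balanced on all relations induces a map on the tensor product. -/
lemma exists_lift {W : Type*} [AddCommGroup W] (φ : V →+ E →+ W)
    (hrel : ∀ v v' ψ, rel v v' ψ → (∀ (f : K) e, f • ψ e = ψ (f • e)) ∧
      ∀ e, φ v (ψ e) = φ v' e) :
    ∃ Φ : BalancedTensor K E V rel →+ W, ∀ v e, Φ (mk K rel v e) = φ v e := by
  let L : E ⊗[ℤ] V →+ W := TensorProduct.liftAddHom φ.flip (fun n e v => by simp)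
  have hL : ∀ e v, L (e ⊗ₜ v) = φ v e := fun e v => rfl
  let S := Submodule.span K {t : E ⊗[ℤ] V | ∃ v v' φ e, rel v v' φ ∧ t = φ e ⊗ₜ v - e ⊗ₜ v'}
  have hS : S.toAddSubgroup ≤ L.ker := by
    intro t ht
    change t ∈ S at ht
    -- The relations are closed under `K` but `L` is only additive, so the induction needs the
    -- vanishing on all multiples.
    suffices h : ∀ f : K, L (f • t) = 0 by simpa using h 1
    induction ht using Submodule.span_induction with
    | mem t ht =>
      obtain ⟨v, v', ψ, e, h, rfl⟩ := ht
      intro f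
      obtain ⟨h1, h2⟩ := hrel v v' ψ h
      rw [smul_sub, TensorProduct.smul_tmul', TensorProduct.smul_tmul', map_sub, hL, hL, h1, h2,
        sub_self]
    | zero => simp
    | add s t _ _ hs ht => intro f; rw [smul_add, map_add, hs, ht, add_zero]
    | smul g t _ ht => intro f; rw [smul_smul]; exact ht _
  exact ⟨QuotientAddGroup.lift S.toAddSubgroup L hS, fun v e => rfl⟩

end BalancedTensor

end BalancedTensorCoordinates

end TwistedD

namespace TwistedD

/-! ### Stalks of a filtered ring and symbols in a tdo -/

namespace FilteredRing

variable {X : Scheme.{u}} (𝒜 : FilteredRing X)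

/-- Restriction of sections of `A`. -/
abbrev resA {U V : X.Opens} (h : V ≤ U) :
    𝒜.A.presheaf.obj (op U) →+* 𝒜.A.presheaf.obj (op V) :=
  (𝒜.A.presheaf.map (homOfLE h).op).hom

lemma germ_resA {U V : X.Opens} (h : V ≤ U) {z : X} (hz : z ∈ V) (a : 𝒜.A.presheaf.obj (op U)) :
    𝒜.germ hz (𝒜.resA h a) = 𝒜.germ (h hz) a :=
  TopCat.Presheaf.germ_res_apply 𝒜.A.presheaf (homOfLE h) z hz a

lemma exists_germ {z : X} (a : 𝒜.Stalk z) :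
    ∃ (U : X.Opens) (hz : z ∈ U) (b : 𝒜.A.presheaf.obj (op U)), 𝒜.germ hz b = a :=
  𝒜.A.presheaf.exists_germ_eq a

lemma exists_resA_eq {U U' : X.Opens} {z : X} (hz : z ∈ U) (hz' : z ∈ U')
    {a : 𝒜.A.presheaf.obj (op U)} {b : 𝒜.A.presheaf.obj (op U')}
    (h : 𝒜.germ hz a = 𝒜.germ hz' b) :
    ∃ (V : X.Opens) (hU : V ≤ U) (hU' : V ≤ U'), z ∈ V ∧ 𝒜.resA hU a = 𝒜.resA hU' b := by
  obtain ⟨V, hV, i, j, hij⟩ := 𝒜.A.presheaf.germ_eq z hz hz' a b h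
  exact ⟨V, i.le, j.le, hV, hij⟩

lemma germ_mem_FStalk {p : ℤ} {U : X.Opens} {z : X} (hz : z ∈ U) {b : 𝒜.A.presheaf.obj (op U)}
    (hb : b ∈ 𝒜.F p U) : 𝒜.germ hz b ∈ 𝒜.FStalk p z :=
  Submodule.subset_span ⟨U, hz, b, hb, rfl⟩

lemma FStalk_mono {p q : ℤ} (h : p ≤ q) (z : X) : 𝒜.FStalk p z ≤ 𝒜.FStalk q z :=
  Submodule.span_mono fun _ ⟨U, hz, b, hb, hab⟩ => ⟨U, hz, b, 𝒜.F_mono h U hb, hab⟩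

lemma exists_mem_FStalk {z : X} (a : 𝒜.Stalk z) : ∃ p : ℕ, a ∈ 𝒜.FStalk p z := by
  obtain ⟨U, hz, b, rfl⟩ := 𝒜.exists_germ a
  obtain ⟨V, hV, p, hzV, hb⟩ := 𝒜.F_exhaustive U b z hz
  refine ⟨p.toNat, ?_⟩
  rw [← 𝒜.germ_resA hV hzV]
  exact 𝒜.FStalk_mono (Int.self_le_toNat p) z (𝒜.germ_mem_FStalk hzV hb)

lemma FStalk_eq_bot {p : ℤ} (hp : p < 0) (z : X) : 𝒜.FStalk p z = ⊥ := by
  rw [FStalk, Submodule.span_eq_bot]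
  rintro _ ⟨U, hz, b, hb, rfl⟩
  have := 𝒜.F_mono (show p ≤ -1 by lia) U hb
  rw [𝒜.F_neg, AddSubgroup.mem_bot] at this
  rw [this, map_zero]

end FilteredRing

namespace TDO

variable {X S : Scheme.{u}} {x : X ⟶ S} (𝒜 : TDO x)

/-- The span in `FStalk` adds nothing: germs of sections of `F_p` are closed under sums after
shrinking, and under functions because `F_0 · F_p ⊆ F_p`. -/
lemma mem_FStalk_iff {p : ℤ} {z : X} {a : 𝒜.Stalk z} :
    a ∈ 𝒜.FStalk p z ↔ ∃ (U : X.Opens) (hz : z ∈ U), ∃ b ∈ 𝒜.F p U, 𝒜.germ hz b = a := by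
  refine ⟨fun ha => ?_, fun ⟨U, hz, b, hb, h⟩ => h ▸ 𝒜.germ_mem_FStalk hz hb⟩
  induction ha using Submodule.span_induction with
  | mem a ha => exact ha
  | zero => exact ⟨⊤, trivial, 0, zero_mem _, map_zero _⟩
  | add a b _ _ ha hb =>
    obtain ⟨U, hz, a, ha, rfl⟩ := ha
    obtain ⟨V, hz', b, hb, rfl⟩ := hb
    have hW : z ∈ U ⊓ V := ⟨hz, hz'⟩
    refine ⟨U ⊓ V, hW, 𝒜.resA inf_le_left a + 𝒜.resA inf_le_right b,
      add_mem (𝒜.F_res p inf_le_left a ha) (𝒜.F_res p inf_le_right b hb), ?_⟩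
    rw [map_add, 𝒜.germ_resA, 𝒜.germ_resA]
  | smul f a _ ha =>
    obtain ⟨U, hz, a, ha, rfl⟩ := ha
    obtain ⟨V, hz', f, rfl⟩ := X.presheaf.exists_germ_eq f
    have hW : z ∈ V ⊓ U := ⟨hz', hz⟩
    refine ⟨V ⊓ U, hW, 𝒜.resA inf_le_left (𝒜.ι.app (op V) f) * 𝒜.resA inf_le_right a, ?_, ?_⟩
    · have := 𝒜.F_mul 0 p (V ⊓ U) _
        (𝒜.F_res 0 (inf_le_left : V ⊓ U ≤ V) _ ((𝒜.F_zero V _).mpr ⟨f, rfl⟩)) _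
        (𝒜.F_res p (inf_le_right : V ⊓ U ≤ U) a ha)
      rwa [zero_add] at this
    · rw [map_mul, 𝒜.germ_resA, 𝒜.germ_resA, FilteredRing.smul_def, FilteredRing.ιStalk_germ]

/-- Two germs of bounded order are germs of sections over the same open set. -/
lemma exists_pair {p q : ℤ} {z : X} {a b : 𝒜.Stalk z} (ha : a ∈ 𝒜.FStalk p z)
    (hb : b ∈ 𝒜.FStalk q z) : ∃ (U : X.Opens) (hz : z ∈ U), ∃ a' ∈ 𝒜.F p U, ∃ b' ∈ 𝒜.F q U,
      𝒜.germ hz a' = a ∧ 𝒜.germ hz b' = b := by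
  obtain ⟨U, hz, a, ha', rfl⟩ := 𝒜.mem_FStalk_iff.mp ha
  obtain ⟨V, hz', b, hb', rfl⟩ := 𝒜.mem_FStalk_iff.mp hb
  exact ⟨U ⊓ V, ⟨hz, hz'⟩, _, 𝒜.F_res p inf_le_left a ha', _, 𝒜.F_res q inf_le_right b hb',
    𝒜.germ_resA _ _ _, 𝒜.germ_resA _ _ _⟩

lemma mul_mem_FStalk {p q : ℤ} {z : X} {a b : 𝒜.Stalk z} (ha : a ∈ 𝒜.FStalk p z)
    (hb : b ∈ 𝒜.FStalk q z) : a * b ∈ 𝒜.FStalk (p + q) z := by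
  obtain ⟨U, hz, a, ha', b, hb', rfl, rfl⟩ := 𝒜.exists_pair ha hb
  rw [← map_mul]
  exact 𝒜.germ_mem_FStalk hz (𝒜.F_mul p q U a ha' b hb')

lemma commutator_mem_FStalk {p q : ℤ} {z : X} {a b : 𝒜.Stalk z} (ha : a ∈ 𝒜.FStalk p z)
    (hb : b ∈ 𝒜.FStalk q z) : a * b - b * a ∈ 𝒜.FStalk (p + q - 1) z := by
  obtain ⟨U, hz, a, ha', b, hb', rfl, rfl⟩ := 𝒜.exists_pair ha hb
  rw [← map_mul, ← map_mul, ← map_sub]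
  exact 𝒜.germ_mem_FStalk hz (𝒜.commutator p q U a ha' b hb')

lemma mem_FStalk_zero_iff {z : X} {a : 𝒜.Stalk z} :
    a ∈ 𝒜.FStalk 0 z ↔ ∃ f, 𝒜.ιStalk z f = a := by
  rw [𝒜.mem_FStalk_iff]
  constructor
  · rintro ⟨U, hz, b, hb, rfl⟩
    obtain ⟨f, rfl⟩ := (𝒜.F_zero U b).mp hb
    exact ⟨_, 𝒜.ιStalk_germ hz f⟩
  · rintro ⟨f, rfl⟩
    obtain ⟨U, hz, f, rfl⟩ := X.presheaf.exists_germ_eq f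
    exact ⟨U, hz, _, (𝒜.F_zero U _).mpr ⟨f, rfl⟩, (𝒜.ιStalk_germ hz f).symm⟩

lemma one_mem_FStalk (z : X) : 1 ∈ 𝒜.FStalk 0 z := 𝒜.mem_FStalk_zero_iff.mpr ⟨1, map_one _⟩

lemma ιStalk_injective (z : X) : Function.Injective (𝒜.ιStalk z) := by
  rw [injective_iff_map_eq_zero]
  intro f hf
  obtain ⟨U, hz, f, rfl⟩ := X.presheaf.exists_germ_eq f
  rw [FilteredRing.ιStalk_germ, ← map_zero (𝒜.germ hz)] at hf
  obtain ⟨V, hU, hU', hzV, h⟩ := 𝒜.exists_resA_eq hz hz hf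
  have h1 : 𝒜.ι.app (op V) (X.presheaf.map (homOfLE hU).op f) = 0 := by
    rw [map_zero] at h
    rw [← h]
    exact ConcreteCategory.congr_hom (𝒜.ι.naturality (homOfLE hU).op) f
  have h2 := 𝒜.ι_injective V (h1.trans (map_zero (𝒜.ι.app (op V)).hom).symm)
  rw [← TopCat.Presheaf.germ_res_apply X.presheaf (homOfLE hU) z hzV f]
  exact (congrArg (X.presheaf.germ V z hzV) h2).trans (map_zero (X.presheaf.germ V z hzV).hom)

/-- The symbol of an operator of order at most one. -/
lemma exists_hasSymbol {z : X} {a : 𝒜.Stalk z} (ha : a ∈ 𝒜.FStalk 1 z) :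
    ∃ θ : TangentStalk x z, 𝒜.HasSymbol x a θ := by
  -- A commutator with a function has order `1 + 0 - 1 = 0`, so it is a function again; it is unique
  -- since `𝒪_X → A` is injective on stalks, which yields the Leibniz rule.
  have h : ∀ f, ∃ g, 𝒜.ιStalk z g = a * 𝒜.ιStalk z f - 𝒜.ιStalk z f * a := fun f =>
    𝒜.mem_FStalk_zero_iff.mp (by
      simpa using 𝒜.commutator_mem_FStalk ha (𝒜.mem_FStalk_zero_iff.mpr ⟨f, rfl⟩))
  choose θ hθ using h
  have hinj := 𝒜.ιStalk_injective z
  let D : Derivation ℤ (X.presheaf.stalk z) (X.presheaf.stalk z) :=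
    { toFun := θ
      map_add' := fun f g => hinj (by
        simp only [hθ, map_add, mul_add, add_mul]; abel)
      map_smul' := fun n f => hinj (by
        rw [RingHom.id_apply, map_zsmul, hθ, hθ, map_zsmul, mul_smul_comm, smul_mul_assoc,
          smul_sub])
      map_one_eq_zero' := hinj (by
        change 𝒜.ιStalk z (θ 1) = _
        rw [hθ, map_one, map_zero, mul_one, one_mul, sub_self])
      leibniz' := fun f g => hinj (by
        change 𝒜.ιStalk z (θ (f * g)) = 𝒜.ιStalk z (f * θ g + g * θ f)
        rw [mul_comm g (θ f)]
        simp only [hθ, map_add, map_mul]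
        noncomm_ring) }
  refine ⟨derivationOfAlgebraMapEqZero D fun s => hinj ?_, fun f => (hθ f).symm⟩
  change 𝒜.ιStalk z (θ _) = _
  rw [hθ, map_zero, 𝒜.central, sub_self]

lemma hasSymbol_unique {z : X} {a : 𝒜.Stalk z} {θ θ' : TangentStalk x z}
    (h : 𝒜.HasSymbol x a θ) (h' : 𝒜.HasSymbol x a θ') : θ = θ' :=
  Derivation.ext fun f => 𝒜.ιStalk_injective z ((h f).symm.trans (h' f))

lemma HasSymbol.add {z : X} {a b : 𝒜.Stalk z} {θ θ' : TangentStalk x z}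
    (h : 𝒜.HasSymbol x a θ) (h' : 𝒜.HasSymbol x b θ') : 𝒜.HasSymbol x (a + b) (θ + θ') :=
  fun f => by
    rw [Derivation.add_apply, map_add, ← h f, ← h' f]
    noncomm_ring

lemma HasSymbol.smul {z : X} {a : 𝒜.Stalk z} {θ : TangentStalk x z} (h : 𝒜.HasSymbol x a θ)
    (f : X.presheaf.stalk z) : 𝒜.HasSymbol x (f • a) (f • θ) := fun g => by
  rw [Derivation.smul_apply, smul_eq_mul, map_mul, ← h g, FilteredRing.smul_def, mul_sub,
    mul_assoc, ← mul_assoc (𝒜.ιStalk z g), ← map_mul, mul_comm g f, map_mul, mul_assoc]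

lemma HasSymbol.sum {z : X} {ι : Type*} (t : Finset ι) {a : ι → 𝒜.Stalk z}
    {θ : ι → TangentStalk x z} (h : ∀ k, 𝒜.HasSymbol x (a k) (θ k)) :
    𝒜.HasSymbol x (∑ k ∈ t, a k) (∑ k ∈ t, θ k) := by
  classical
  induction t using Finset.induction_on with
  | empty => intro f; simp
  | insert k t hk ih =>
    rw [Finset.sum_insert hk, Finset.sum_insert hk]
    exact HasSymbol.add 𝒜 (h k) ih

lemma list_prod_mem_FStalk {z : X} (l : List (𝒜.Stalk z)) (h : ∀ a ∈ l, a ∈ 𝒜.FStalk 1 z) :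
    l.prod ∈ 𝒜.FStalk l.length z := by
  induction l with
  | nil => exact 𝒜.one_mem_FStalk z
  | cons a l ih =>
    rw [List.prod_cons, List.length_cons, Nat.cast_succ, add_comm]
    exact 𝒜.mul_mem_FStalk (h a (by simp)) (ih fun b hb => h b (by simp [hb]))

/-- The principal symbol on products of operators of order at most one, in terms of lists. -/
lemma exists_symbolMap (z : X) (p : ℕ) :
    ∃ σ : 𝒜.FStalk p z →ₗ[X.presheaf.stalk z]
        SymmetricAlgebra (X.presheaf.stalk z) (TangentStalk x z),
      LinearMap.range σ =
        (LinearMap.range (SymmetricAlgebra.ι (X.presheaf.stalk z) (TangentStalk x z))) ^ p ∧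
      (∀ a, σ a = 0 ↔ a.1 ∈ 𝒜.FStalk (p - 1) z) ∧
      ∀ (ι : Type) (a : ι → 𝒜.Stalk z) (θ : ι → TangentStalk x z) (l : List ι)
        (h : (l.map a).prod ∈ 𝒜.FStalk p z), l.length = p →
        (∀ k, a k ∈ 𝒜.FStalk 1 z) → (∀ k, 𝒜.HasSymbol x (a k) (θ k)) →
        σ ⟨(l.map a).prod, h⟩ =
          (l.map fun k => SymmetricAlgebra.ι (X.presheaf.stalk z) _ (θ k)).prod := by
  obtain ⟨σ, h1, h2, h3⟩ := 𝒜.exists_principalSymbol z p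
  refine ⟨σ, h1, fun a => by rw [← LinearMap.mem_ker, h2]; rfl, ?_⟩
  rintro ι a θ l h rfl ha hθ
  have h4 : (l.map a) = List.ofFn fun k => a (l.get k) := by
    rw [← List.ofFn_get l, List.map_ofFn, List.ofFn_get]; rfl
  have h5 : (l.map fun k => SymmetricAlgebra.ι (X.presheaf.stalk z) _ (θ k)) =
      List.ofFn fun k => SymmetricAlgebra.ι (X.presheaf.stalk z) _ (θ (l.get k)) := by
    rw [← List.ofFn_get l, List.map_ofFn, List.ofFn_get]; rfl
  have h6 := h3 (fun k => a (l.get k)) (fun k => θ (l.get k)) (h4 ▸ h) (fun k => ha _)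
    (fun k => hθ _)
  rw [h5, List.prod_ofFn, ← h6]
  congr 2
  rw [h4]

end TDO

end TwistedD

/-! ### Poincaré–Birkhoff–Witt bases of the stalks of a tdo -/

namespace TwistedD

lemma IsCoordinates.exists_basis {K R : Type u} [CommRing K] [CommRing R] [Algebra K R]
    {J : Type} [Fintype J] [DecidableEq J] {f : J → R} {d : J → Derivation K R R}
    (h : IsCoordinates K f d) :
    ∃ b : Module.Basis J R (Derivation K R R), ∀ j, b j = d j := by
  have happ : ∀ (c : J → R) (a : R), (∑ j, c j • d j) a = ∑ j, c j * d j a := fun c a => by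
    have := congrFun (map_sum Derivation.coeFnAddMonoidHom (fun j => c j • d j) Finset.univ) a
    rw [Finset.sum_apply] at this
    exact this
  have hli : LinearIndependent R d := by
    rw [Fintype.linearIndependent_iff]
    intro c hc l
    have := happ c (f l)
    simpa [hc, h.dual] using this.symm
  refine ⟨Module.Basis.mk hli fun D _ => ?_, fun j => by rw [Module.Basis.mk_apply]⟩
  have : D = ∑ j, D (f j) • d j := Derivation.ext fun a => by
    have := h.expand (D.restrictScalars ℤ) (fun s => D.map_algebraMap s) a
    rw [happ]
    simpa [mul_comm] using this
  rw [this]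
  exact Submodule.sum_mem _ fun j _ => Submodule.smul_mem _ _ (Submodule.subset_span ⟨j, rfl⟩)

section Pairs

variable {α β : Type*}

/-- A pair of multisets as a multiset on the disjoint union. -/
def sumMultiset (i : Multiset α × Multiset β) : Multiset (α ⊕ β) :=
  i.1.map Sum.inl + i.2.map Sum.inr

lemma sumMultiset_injective : Function.Injective (sumMultiset (α := α) (β := β)) := by
  have h1 : ∀ i : Multiset α × Multiset β, (sumMultiset i).filterMap Sum.getLeft? = i.1 := by
    rintro ⟨s, t⟩
    rw [sumMultiset, Multiset.filterMap_add, Multiset.filterMap_map, Multiset.filterMap_map]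
    have h1 : (Sum.getLeft? ∘ (Sum.inl : α → α ⊕ β) : α → Option α) = some := rfl
    have h2 : t.filterMap (Sum.getLeft? ∘ Sum.inr : β → Option α) = 0 := by
      induction t using Multiset.induction_on with
      | empty => rfl
      | cons a t ih => rw [Multiset.filterMap_cons_none _ _ rfl, ih]
    rw [h1, h2, Multiset.filterMap_some, add_zero]
  have h2 : ∀ i : Multiset α × Multiset β, (sumMultiset i).filterMap Sum.getRight? = i.2 := by
    rintro ⟨s, t⟩
    rw [sumMultiset, Multiset.filterMap_add, Multiset.filterMap_map, Multiset.filterMap_map]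
    have h1 : (Sum.getRight? ∘ (Sum.inr : β → α ⊕ β) : β → Option β) = some := rfl
    have h2 : s.filterMap (Sum.getRight? ∘ Sum.inl : α → Option β) = 0 := by
      induction s using Multiset.induction_on with
      | empty => rfl
      | cons a t ih => rw [Multiset.filterMap_cons_none _ _ rfl, ih]
    rw [h1, h2, Multiset.filterMap_some, zero_add]
  intro i j hij
  exact Prod.ext (by rw [← h1 i, hij, h1]) (by rw [← h2 i, hij, h2])

lemma sumMultiset_surjective : Function.Surjective (sumMultiset (α := α) (β := β)) := by
  intro u
  induction u using Multiset.induction_on with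
  | empty => exact ⟨(0, 0), rfl⟩
  | cons a u ih =>
    obtain ⟨i, rfl⟩ := ih
    rcases a with a | a
    · exact ⟨(a ::ₘ i.1, i.2), by simp [sumMultiset]⟩
    · exact ⟨(i.1, a ::ₘ i.2), by simp [sumMultiset]⟩

lemma card_sumMultiset (i : Multiset α × Multiset β) :
    (sumMultiset i).card = i.1.card + i.2.card := by
  simp [sumMultiset]

end Pairs

/-- The product of a sorted monomial in the `d j` and one in the `d' j`. -/
def pairMonomial {A : Type*} [Monoid A] {m r : ℕ} (d : Fin m ⊕ Fin r → A)
    (i : Multiset (Fin m) × Multiset (Fin r)) : A :=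
  sortedMonomial (fun j => d (Sum.inl j)) i.1 * sortedMonomial (fun j => d (Sum.inr j)) i.2

/-- The factors of `pairMonomial`. -/
def pairList {m r : ℕ} (i : Multiset (Fin m) × Multiset (Fin r)) : List (Fin m ⊕ Fin r) :=
  (i.1.sort (· ≤ ·)).map Sum.inl ++ (i.2.sort (· ≤ ·)).map Sum.inr

lemma pairMonomial_eq {A : Type*} [Monoid A] {m r : ℕ} (d : Fin m ⊕ Fin r → A)
    (i : Multiset (Fin m) × Multiset (Fin r)) : ((pairList i).map d).prod = pairMonomial d i := by
  simp [pairMonomial, pairList, sortedMonomial, Function.comp_def]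

lemma length_pairList {m r : ℕ} (i : Multiset (Fin m) × Multiset (Fin r)) :
    (pairList i).length = i.1.card + i.2.card := by
  simp [pairList]

lemma pairMonomial_eq_prod {A : Type*} [CommMonoid A] {m r : ℕ} (d : Fin m ⊕ Fin r → A)
    (i : Multiset (Fin m) × Multiset (Fin r)) :
    pairMonomial d i = ((sumMultiset i).map d).prod := by
  rw [← pairMonomial_eq, ← Multiset.prod_coe, ← Multiset.map_coe]
  congr 2
  rw [pairList, sumMultiset, ← Multiset.coe_add, ← Multiset.map_coe, ← Multiset.map_coe,
    Multiset.sort_eq, Multiset.sort_eq]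

namespace TDO

variable {X S : Scheme.{u}} {x : X ⟶ S} (𝒜 : TDO x) {z : X} {m r : ℕ}
  {d : Fin m ⊕ Fin r → 𝒜.Stalk z}

lemma pairMonomial_mem_FStalk (hd : ∀ j, d j ∈ 𝒜.FStalk 1 z)
    (i : Multiset (Fin m) × Multiset (Fin r)) {p : ℤ} (hp : (i.1.card + i.2.card : ℕ) ≤ p) :
    pairMonomial d i ∈ 𝒜.FStalk p z := by
  refine 𝒜.FStalk_mono hp z ?_
  have := 𝒜.list_prod_mem_FStalk ((pairList i).map d) (by
    intro a ha
    obtain ⟨j, -, rfl⟩ := List.mem_map.mp ha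
    exact hd j)
  rwa [pairMonomial_eq, List.length_map, length_pairList] at this

variable {θ : Fin m ⊕ Fin r → TangentStalk x z}

/-- Induction on the order: the symbol of `a` is a combination of monomials in the basis of symbols,
the same combination of operators has this symbol, and the difference has smaller order. -/
lemma mem_span_pairMonomial (b : Module.Basis (Fin m ⊕ Fin r) (X.presheaf.stalk z)
      (TangentStalk x z)) (hb : ∀ j, b j = θ j) (hd : ∀ j, d j ∈ 𝒜.FStalk 1 z)
    (hθ : ∀ j, 𝒜.HasSymbol x (d j) (θ j)) {p : ℤ} {a : 𝒜.Stalk z} (ha : a ∈ 𝒜.FStalk p z) :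
    a ∈ Submodule.span (X.presheaf.stalk z)
      {c | ∃ i : Multiset (Fin m) × Multiset (Fin r), (i.1.card + i.2.card : ℕ) ≤ p ∧
        c = pairMonomial d i} := by
  rcases lt_or_ge p 0 with hp | hp
  · rw [𝒜.FStalk_eq_bot hp, Submodule.mem_bot] at ha
    rw [ha]
    exact zero_mem _
  lift p to ℕ using hp
  induction p generalizing a with
  -- In order zero the symbol is a scalar and its kernel is `F_{-1} = 0`, so `a` is a multiple of
  -- the empty monomial.
  | zero =>
    obtain ⟨σ, h1, h2, h3⟩ := 𝒜.exists_symbolMap z 0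
    obtain ⟨c, hc⟩ : ∃ c : X.presheaf.stalk z, σ ⟨a, ha⟩ = c • 1 := by
      have : σ ⟨a, ha⟩ ∈ LinearMap.range σ := ⟨_, rfl⟩
      rw [h1, pow_zero, Submodule.mem_one] at this
      obtain ⟨c, hc⟩ := this
      exact ⟨c, by rw [← hc, Algebra.algebraMap_eq_smul_one]⟩
    have h4 := h3 Empty Empty.elim Empty.elim [] (𝒜.one_mem_FStalk z) rfl (by simp) (by simp)
    simp only [List.map_nil, List.prod_nil] at h4
    have h5 : σ (⟨a, ha⟩ - c • ⟨1, 𝒜.one_mem_FStalk z⟩) = 0 := by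
      rw [map_sub, map_smul, h4, hc, sub_self]
    have h6 := (h2 _).mp h5
    rw [𝒜.FStalk_eq_bot (by simp), Submodule.mem_bot] at h6
    rw [show a = c • (1 : 𝒜.Stalk z) from sub_eq_zero.mp h6]
    exact Submodule.smul_mem _ _ (Submodule.subset_span ⟨(0, 0), by simp, by simp [pairMonomial]⟩)
  | succ p ih =>
    obtain ⟨σ, h1, h2, h3⟩ := 𝒜.exists_symbolMap z (p + 1)
    have key : ∀ t ∈ LinearMap.range σ, ∃ a' : 𝒜.FStalk (p + 1 : ℕ) z, σ a' = t ∧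
        a'.1 ∈ Submodule.span (X.presheaf.stalk z)
          {c | ∃ i : Multiset (Fin m) × Multiset (Fin r),
            ((i.1.card + i.2.card : ℕ) : ℤ) ≤ (p + 1 : ℕ) ∧ c = pairMonomial d i} := by
      intro t ht
      rw [h1, range_symι_pow_eq_span b] at ht
      induction ht using Submodule.span_induction with
      | mem t ht =>
        obtain ⟨u, hu, rfl⟩ := ht
        obtain ⟨i, rfl⟩ := sumMultiset_surjective u
        rw [card_sumMultiset] at hu
        have hm := 𝒜.pairMonomial_mem_FStalk hd i (p := (p + 1 : ℕ)) (by rw [hu])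
        refine ⟨⟨pairMonomial d i, hm⟩, ?_, Submodule.subset_span ⟨i, by rw [hu], rfl⟩⟩
        have h4 := h3 _ d θ (pairList i) (by rwa [pairMonomial_eq]) (by rw [length_pairList, hu])
          hd hθ
        simp only [pairMonomial_eq] at h4
        rw [h4, pairMonomial_eq_prod]
        simp only [hb]
      | zero => exact ⟨0, map_zero σ, zero_mem _⟩
      | add s t _ _ hs ht =>
        obtain ⟨a, rfl, ha⟩ := hs
        obtain ⟨b, rfl, hb⟩ := ht
        exact ⟨a + b, map_add σ a b, add_mem ha hb⟩
      | smul c t _ ht =>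
        obtain ⟨a, rfl, ha⟩ := ht
        exact ⟨c • a, map_smul σ c a, Submodule.smul_mem _ _ ha⟩
    obtain ⟨a', h4, h5⟩ := key _ ⟨⟨a, ha⟩, rfl⟩
    have h6 := (h2 (⟨a, ha⟩ - a')).mp (by rw [map_sub, h4, sub_self])
    have h7 := ih (a := a - a'.1) (by simpa using h6)
    have h8 : a = (a - a'.1) + a'.1 := by abel
    rw [h8]
    refine add_mem (Submodule.span_mono ?_ h7) h5
    rintro _ ⟨i, hi, rfl⟩
    exact ⟨i, by push_cast at hi ⊢; lia, rfl⟩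

/-- In a linear relation only the terms of top degree survive the symbol map, and their symbols are
distinct basis monomials of the symmetric algebra. Hence the top coefficients vanish and the degree
drops. -/
lemma linearIndependent_pairMonomial (b : Module.Basis (Fin m ⊕ Fin r) (X.presheaf.stalk z)
      (TangentStalk x z)) (hb : ∀ j, b j = θ j) (hd : ∀ j, d j ∈ 𝒜.FStalk 1 z)
    (hθ : ∀ j, 𝒜.HasSymbol x (d j) (θ j)) :
    LinearIndependent (X.presheaf.stalk z) (pairMonomial d) := by
  classical
  obtain ⟨e, he⟩ := exists_symmetricAlgebra_basis b
  rw [linearIndependent_iff']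
  intro T c hc i hi
  -- Here `p` is a strict bound for the degrees that occur with a nonzero coefficient. It is lowered
  -- until no term is left.
  suffices h : ∀ p : ℕ, (∀ i ∈ T, c i ≠ 0 → i.1.card + i.2.card < p) → ∀ i ∈ T, c i = 0 by
    refine h ((T.sup fun i => i.1.card + i.2.card) + 1) (fun i hi _ => ?_) i hi
    exact Nat.lt_succ_of_le (Finset.le_sup (f := fun i => i.1.card + i.2.card) hi)
  intro p
  induction p with
  | zero => exact fun h i hi => by_contra fun hne => absurd (h i hi hne) (by lia)
  | succ p ih =>
    intro h
    refine ih fun i hi hne => lt_of_le_of_ne (Nat.lt_succ_iff.mp (h i hi hne)) fun hip => hne ?_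
    obtain ⟨σ, -, h2, h3⟩ := 𝒜.exists_symbolMap z p
    -- Monomials of too large a degree are replaced by zero so that `σ` can be applied; their
    -- coefficients vanish anyway.
    let M : Multiset (Fin m) × Multiset (Fin r) → 𝒜.FStalk p z := fun i =>
      if h : ((i.1.card + i.2.card : ℕ) : ℤ) ≤ p then ⟨_, 𝒜.pairMonomial_mem_FStalk hd i h⟩ else 0
    have hM : ∀ i ∈ T, c i • (M i).1 = c i • pairMonomial d i := fun i hi => by
      by_cases hne : c i = 0
      · rw [hne, zero_smul, zero_smul]
      · have : ((i.1.card + i.2.card : ℕ) : ℤ) ≤ p := by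
          exact_mod_cast Nat.lt_succ_iff.mp (h i hi hne)
        simp only [M, dif_pos this]
    have hsum : ∑ i ∈ T, c i • M i = 0 := Subtype.ext (by
      rw [AddSubmonoidClass.coe_finsetSum, ZeroMemClass.coe_zero, ← hc]
      exact Finset.sum_congr rfl hM)
    have hσM : ∀ i, σ (M i) = if i.1.card + i.2.card = p then e (sumMultiset i) else 0 := fun i => by
      simp only [M]
      split_ifs with h4 h5 h5
      · have h6 := h3 _ d θ (pairList i) (by
          rw [pairMonomial_eq]
          exact 𝒜.pairMonomial_mem_FStalk hd i h4) (by rw [length_pairList, h5]) hd hθ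
        simp only [pairMonomial_eq] at h6
        rw [h6, pairMonomial_eq_prod, he]
        simp only [hb]
      · exact (h2 _).mpr (𝒜.pairMonomial_mem_FStalk hd i (by lia))
      · exact absurd (le_of_eq (by exact_mod_cast h5)) h4
      · exact map_zero σ
    have h4 := congrArg σ hsum
    simp only [map_sum, map_smul, hσM, smul_ite, smul_zero, map_zero, ← Finset.sum_filter] at h4
    have h5 := (linearIndependent_iff'.mp (e.linearIndependent.comp _ sumMultiset_injective)) _ c h4
    exact h5 i (Finset.mem_filter.mpr ⟨hi, hip⟩)

/-- The monomials in lifts of a basis of the derivations form a basis of the stalk of a tdo. -/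
lemma exists_pairMonomial_basis (b : Module.Basis (Fin m ⊕ Fin r) (X.presheaf.stalk z)
      (TangentStalk x z)) (hb : ∀ j, b j = θ j) (hd : ∀ j, d j ∈ 𝒜.FStalk 1 z)
    (hθ : ∀ j, 𝒜.HasSymbol x (d j) (θ j)) :
    ∃ e : Module.Basis (Multiset (Fin m) × Multiset (Fin r)) (X.presheaf.stalk z) (𝒜.Stalk z),
      ∀ i, e i = pairMonomial d i := by
  refine ⟨Module.Basis.mk (𝒜.linearIndependent_pairMonomial b hb hd hθ) fun a _ => ?_,
    fun i => by rw [Module.Basis.mk_apply]⟩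
  obtain ⟨p, hp⟩ := 𝒜.exists_mem_FStalk a
  refine Submodule.span_mono ?_ (𝒜.mem_span_pairMonomial b hb hd hθ hp)
  rintro _ ⟨i, -, rfl⟩
  exact ⟨i, rfl⟩

end TDO

end TwistedD

namespace TwistedD

/-! ### Frames: operators of order one adapted to the immersion -/

section Local

lemma exists_open_forall {T : Type*} [TopologicalSpace T] {z : T} {J : Type*} [Finite J]
    {p : J → Opens T → Prop} (hp : ∀ j {U V : Opens T}, V ≤ U → p j U → p j V)
    (h : ∀ j, ∃ U : Opens T, z ∈ U ∧ p j U) : ∃ U : Opens T, z ∈ U ∧ ∀ j, p j U := by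
  choose U hz hU using h
  refine ⟨⟨⋂ j, (U j : Set T), isOpen_iInter_of_finite fun j => (U j).2⟩, ?_, fun j => ?_⟩
  · exact Set.mem_iInter.mpr hz
  · exact hp j (Set.iInter_subset _ j) (hU j)

variable {X Y S : Scheme.{u}}

/-- Two sections with the same germ at a point agree in a neighbourhood. -/
lemma exists_forall_germ_eq {U V : X.Opens} {z : X} (hz : z ∈ U) (hz' : z ∈ V) {f : Γ(X, U)}
    {g : Γ(X, V)} (h : X.presheaf.germ U z hz f = X.presheaf.germ V z hz' g) :
    ∃ (W : X.Opens) (_ : z ∈ W) (hU : W ≤ U) (hV : W ≤ V), ∀ z' (hz' : z' ∈ W),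
      X.presheaf.germ U z' (hU hz') f = X.presheaf.germ V z' (hV hz') g := by
  obtain ⟨W, hW, i, j, hij⟩ := X.presheaf.germ_eq z hz hz' f g h
  refine ⟨W, hW, i.le, j.le, fun z' hz' => ?_⟩
  rw [← TopCat.Presheaf.germ_res_apply X.presheaf i z' hz',
    ← TopCat.Presheaf.germ_res_apply X.presheaf j z' hz']
  exact congrArg _ hij

/-- A family of germs that is locally given by sections is given by a section. -/
lemma exists_section_of_local (V : Y.Opens) (s : ∀ y : V, Y.presheaf.stalk y.1)
    (h : ∀ y : V, ∃ (W : Y.Opens) (_ : y.1 ∈ W) (hV : W ≤ V) (g : Γ(Y, W)),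
      ∀ y' (hy' : y' ∈ W), s ⟨y', hV hy'⟩ = Y.presheaf.germ W y' hy' g) :
    ∃ g : Γ(Y, V), ∀ (y : Y) (hy : y ∈ V), s ⟨y, hy⟩ = Y.presheaf.germ V y hy g := by
  choose W hy hV g hg using h
  obtain ⟨t, ht, -⟩ := Y.sheaf.existsUnique_gluing' (fun y : V => W y) V (fun y => homOfLE (hV y))
    (fun y hyV => Opens.mem_iSup.mpr ⟨⟨y, hyV⟩, hy ⟨y, hyV⟩⟩) g (fun y y' => by
      refine TopCat.Presheaf.section_ext Y.sheaf _ _ _ fun z hz => ?_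
      refine (TopCat.Presheaf.germ_res_apply Y.presheaf (Opens.infLELeft _ _) z hz _).trans
        (.trans ?_ (TopCat.Presheaf.germ_res_apply Y.presheaf (Opens.infLERight _ _) z hz _).symm)
      exact (hg y z hz.1).symm.trans (hg y' z hz.2))
  refine ⟨t, fun y hyV => ?_⟩
  rw [hg ⟨y, hyV⟩ y (hy ⟨y, hyV⟩), ← ht ⟨y, hyV⟩]
  exact TopCat.Presheaf.germ_res_apply Y.presheaf (homOfLE (hV ⟨y, hyV⟩)) y _ t

lemma algebraMap_germ (i : Y ⟶ X) {U : X.Opens} {y : Y} (hy : i y ∈ U) (f : Γ(X, U)) :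
    algebraMap (X.presheaf.stalk (i y)) (Y.presheaf.stalk y) (X.presheaf.germ U (i y) hy f) =
      Y.presheaf.germ (i ⁻¹ᵁ U) y hy (i.app U f) :=
  Scheme.Hom.germ_stalkMap_apply i U y hy f

lemma algebraMap_comp (x : X ⟶ S) (i : Y ⟶ X) (y : Y) (s : S.presheaf.stalk (x (i y))) :
    algebraMap (S.presheaf.stalk ((i ≫ x) y)) (Y.presheaf.stalk y) s =
      algebraMap (X.presheaf.stalk (i y)) (Y.presheaf.stalk y)
        (algebraMap (S.presheaf.stalk (x (i y))) (X.presheaf.stalk (i y)) s) := by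
  have := Scheme.Hom.stalkMap_comp i x y
  exact ConcreteCategory.congr_hom this s

end Local

variable {X Y S : Scheme.{u}} {x : X ⟶ S}

lemma TDO.isVectorField_of_hasSymbol (𝒜 : TDO x) {U : X.Opens} {d : 𝒜.A.presheaf.obj (op U)}
    (hd : d ∈ 𝒜.F 1 U) {θ : ∀ z : U, TangentStalk x z.1}
    (h : ∀ z : U, 𝒜.HasSymbol x (𝒜.germ z.2 d) (θ z)) : IsVectorField x U θ := by
  intro V hV f
  have h1 : 𝒜.ι.app (op V) f ∈ 𝒜.F 0 V := (𝒜.F_zero V _).mpr ⟨f, rfl⟩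
  have h2 := 𝒜.commutator 1 0 V _ (𝒜.F_res 1 hV d hd) _ h1
  obtain ⟨g, hg⟩ := (𝒜.F_zero V _).mp (by simpa using h2)
  refine ⟨g, fun z hz => 𝒜.ιStalk_injective z ?_⟩
  rw [← h ⟨z, hV hz⟩, FilteredRing.ιStalk_germ, FilteredRing.ιStalk_germ, hg, map_sub, map_mul,
    map_mul, 𝒜.germ_resA hV hz]

/-- Operators of order one near a point of `Y`, with symbols dual to functions adapted to `Y`. -/
structure Frame (𝒜 : TDO x) (i : Y ⟶ X) where
  U : X.Opens
  W : Y.Opens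
  le : W ≤ i ⁻¹ᵁ U
  m : ℕ
  r : ℕ
  d : Fin m ⊕ Fin r → 𝒜.A.presheaf.obj (op U)
  d_mem : ∀ j, d j ∈ 𝒜.F 1 U
  θ : Fin m ⊕ Fin r → ∀ z : U, TangentStalk x z.1
  symbol : ∀ j (z : U), 𝒜.HasSymbol x (𝒜.germ z.2 (d j)) (θ j z)
  f : Fin m ⊕ Fin r → Γ(X, U)
  coord : ∀ y : W, IsCoordinates (S.presheaf.stalk (x (i y.1)))
    (fun j => X.presheaf.germ U (i y.1) (le y.2) (f j)) (fun j => θ j ⟨i y.1, le y.2⟩)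
  f_inr : ∀ (y : W) l, algebraMap (X.presheaf.stalk (i y.1)) (Y.presheaf.stalk y.1)
    (X.presheaf.germ U (i y.1) (le y.2) (f (Sum.inr l))) = 0
  δ : Fin m → ∀ y : W, TangentStalk (i ≫ x) y.1
  δ_field : ∀ j, IsVectorField (i ≫ x) W (δ j)
  compat : ∀ j (y : W) (a : X.presheaf.stalk (i y.1)),
    δ j y (algebraMap (X.presheaf.stalk (i y.1)) (Y.presheaf.stalk y.1) a) =
      algebraMap _ _ (θ (Sum.inl j) ⟨i y.1, le y.2⟩ a)

/-- An immersion is surjective on stalks, so a function on `Y` is locally the restriction of a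
function on `X`. Applying `θ` upstairs produces a section, and restricting it computes `δ`. -/
lemma isVectorField_of_compat {i : Y ⟶ X} [IsImmersion i] {U : X.Opens} {W : Y.Opens}
    (le : W ≤ i ⁻¹ᵁ U) {θ : ∀ z : U, TangentStalk x z.1} (hθ : IsVectorField x U θ)
    {δ : ∀ y : W, TangentStalk (i ≫ x) y.1}
    (h : ∀ (y : W) (a : X.presheaf.stalk (i y.1)),
      δ y (algebraMap (X.presheaf.stalk (i y.1)) (Y.presheaf.stalk y.1) a) =
        algebraMap _ _ (θ ⟨i y.1, le y.2⟩ a)) : IsVectorField (i ≫ x) W δ := by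
  intro V hV g
  obtain ⟨t, ht⟩ := exists_section_of_local V
    (fun y => δ ⟨y.1, hV y.2⟩ (Y.presheaf.germ V y.1 y.2 g)) (fun y => by
      obtain ⟨a, ha⟩ := i.stalkMap_surjective y.1 (Y.presheaf.germ V y.1 y.2 g)
      obtain ⟨U', hU', a, rfl⟩ := X.presheaf.exists_germ_eq a
      obtain ⟨b, hb⟩ := hθ (U ⊓ U') inf_le_left (X.presheaf.map (homOfLE inf_le_right).op a)
      have ha' := (algebraMap_germ i hU' a).symm.trans ha
      obtain ⟨W', hW', h1, h2, h3⟩ := exists_forall_germ_eq (X := Y) (z := y.1) _ _ ha'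
      refine ⟨W', hW', h2, Y.presheaf.map (homOfLE (fun y' hy' =>
        ⟨le (hV (h2 hy')), h1 hy'⟩ : W' ≤ i ⁻¹ᵁ (U ⊓ U'))).op (i.app (U ⊓ U') b), fun y' hy' => ?_⟩
      have hy'' : i y' ∈ U ⊓ U' := ⟨le (hV (h2 hy')), h1 hy'⟩
      have h4 := hb (i y') hy''
      refine Eq.trans ?_ ((TopCat.Presheaf.germ_res_apply Y.presheaf (homOfLE (fun y' hy' =>
        ⟨le (hV (h2 hy')), h1 hy'⟩ : W' ≤ i ⁻¹ᵁ (U ⊓ U'))) y' hy' (i.app (U ⊓ U') b))).symm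
      refine Eq.trans ?_ (algebraMap_germ i hy'' b)
      rw [← h4, ← h ⟨y', hV (h2 hy')⟩]
      refine congrArg _ ((h3 y' hy').symm.trans ?_)
      refine (algebraMap_germ i (h1 hy') a).symm.trans ?_
      exact congrArg _ (TopCat.Presheaf.germ_res_apply X.presheaf (homOfLE inf_le_right) _ hy'' a).symm)
  exact ⟨t, ht⟩

/-- Adapted coordinates exist at the point itself. Every property of a frame is then reduced to
finitely many equalities of germs of functions at that point, and these persist on a neighbourhood.
-/
lemma exists_frame [Smooth x] (i : Y ⟶ X) [Smooth (i ≫ x)] [IsImmersion i] (𝒜 : TDO x) (y : Y) :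
    ∃ F : Frame 𝒜 i, y ∈ F.W := by
  obtain ⟨U₀, hU₀, N, f₀, hf₀⟩ := exists_coordinates x (i y)
  obtain ⟨W₀, hW₀, m, h, hh⟩ := exists_coordinates (i ≫ x) y
  obtain ⟨d₀, hd₀⟩ := hf₀ (i y) hU₀
  obtain ⟨δ₀, hδ₀⟩ := hh y hW₀
  have : IsLocalHom (algebraMap (X.presheaf.stalk (i y)) (Y.presheaf.stalk y)) :=
    inferInstanceAs (IsLocalHom (i.stalkMap y).hom)
  obtain ⟨r, f, g, e, d, hf, hg, hd⟩ := exists_adapted_coordinates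
    (K := S.presheaf.stalk (x (i y))) (R := X.presheaf.stalk (i y))
    (K' := S.presheaf.stalk ((i ≫ x) y)) (B := Y.presheaf.stalk y) (i.stalkMap_surjective y)
    (fun s => ⟨s, (algebraMap_comp x i y s).symm⟩) (fun s => ⟨s, (algebraMap_comp x i y s).symm⟩)
    hd₀ hδ₀
  -- Operators of order one are chosen with the dual derivations as symbols, and `U₁` is a
  -- neighbourhood on which these operators and the coordinates are all defined.
  choose a ha hda using fun j => 𝒜.symbol_surjective (i y) (d j)
  obtain ⟨U₁, hU₁, hsec⟩ := exists_open_forall (z := i y) (p := fun j U =>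
      ∃ (s : 𝒜.A.presheaf.obj (op U)) (t : Γ(X, U)), s ∈ 𝒜.F 1 U ∧
        ∀ hy : i y ∈ U, 𝒜.germ hy s = a j ∧
          X.presheaf.germ U (i y) hy t = Sum.elim f g j)
    (fun j U V hVU ⟨s, t, hs, hst⟩ => ⟨𝒜.resA hVU s,
      X.presheaf.map (homOfLE hVU).op t, 𝒜.F_res 1 hVU s hs, fun hy =>
        ⟨(𝒜.germ_resA hVU hy s).trans (hst (hVU hy)).1,
          (TopCat.Presheaf.germ_res_apply X.presheaf (homOfLE hVU) _ hy t).trans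
            (hst (hVU hy)).2⟩⟩) (fun j => by
      obtain ⟨U, hU, b, hb, hba⟩ := 𝒜.mem_FStalk_iff.mp (ha j)
      obtain ⟨U', hU', t, ht⟩ := X.presheaf.exists_germ_eq (Sum.elim f g j)
      refine ⟨U ⊓ U', ⟨hU, hU'⟩, 𝒜.resA inf_le_left b,
        X.presheaf.map (homOfLE inf_le_right).op t, 𝒜.F_res 1 _ b hb, fun hy => ⟨?_, ?_⟩⟩
      · rw [𝒜.germ_resA, hba]
      · exact (TopCat.Presheaf.germ_res_apply X.presheaf
          (homOfLE (inf_le_right : U ⊓ U' ≤ U')) _ hy t).trans ht)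
  choose D t hD hDt using hsec
  choose θ hθ using fun j (z : U₁) => 𝒜.exists_hasSymbol (𝒜.germ_mem_FStalk z.2 (hD j))
  have hθf : ∀ j, IsVectorField x U₁ (θ j) := fun j => 𝒜.isVectorField_of_hasSymbol (hD j) (hθ j)
  -- The values of the symbols on the functions are sections. They equal 0 or 1 at the given point,
  -- hence on `U₂`, which is duality at all points of `U₂`.
  choose G hG using fun j l => hθf j U₁ le_rfl (t l)
  have hθd : ∀ j, θ j ⟨i y, hU₁⟩ = d j := fun j => by
    have h1 := hθ j ⟨i y, hU₁⟩
    rw [(hDt j hU₁).1] at h1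
    exact 𝒜.hasSymbol_unique h1 (hda j)
  obtain ⟨U₂, hU₂, hdual⟩ := exists_open_forall (z := i y) (J := (Fin m ⊕ Fin r) × (Fin m ⊕ Fin r))
    (p := fun j U => ∀ z ∈ U, ∀ hz : z ∈ U₁,
      X.presheaf.germ U₁ z hz (G j.1 j.2) = if j.1 = j.2 then 1 else 0)
    (fun j U V hVU h z hz => h z (hVU hz)) (fun j => by
      have h1 : X.presheaf.germ U₁ (i y) hU₁ (G j.1 j.2) =
          X.presheaf.germ U₁ (i y) hU₁ (if j.1 = j.2 then 1 else 0) := by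
        rw [← hG, hθd, (hDt _ hU₁).2, hd]
        split_ifs <;> simp
      obtain ⟨W, hW, h2, h3, h4⟩ := exists_forall_germ_eq hU₁ hU₁ h1
      refine ⟨W, hW, fun z hz _ => (h4 z hz).trans ?_⟩
      split_ifs <;> simp)
  obtain ⟨W₁, hW₁, hfh⟩ := exists_open_forall (z := y) (J := Fin m)
    (p := fun j W => ∀ y' ∈ W, ∀ (h1 : i y' ∈ U₁) (h2 : y' ∈ W₀),
      algebraMap (X.presheaf.stalk (i y')) (Y.presheaf.stalk y')
        (X.presheaf.germ U₁ (i y') h1 (t (Sum.inl j))) = Y.presheaf.germ W₀ y' h2 (h j))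
    (fun j U V hVU h z hz => h z (hVU hz)) (fun j => by
      have h1 := (algebraMap_germ i hU₁ (t (Sum.inl j))).symm.trans
        ((congrArg _ (hDt (Sum.inl j) hU₁).2).trans (hf j))
      obtain ⟨W, hW, h2, h3, h4⟩ := exists_forall_germ_eq (X := Y) hU₁ hW₀ h1
      exact ⟨W, hW, fun y' hy' h5 h6 => (algebraMap_germ i h5 _).trans (h4 y' hy')⟩)
  obtain ⟨W₂, hW₂, hg0⟩ := exists_open_forall (z := y) (J := Fin r)
    (p := fun l W => ∀ y' ∈ W, ∀ (h1 : i y' ∈ U₁),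
      algebraMap (X.presheaf.stalk (i y')) (Y.presheaf.stalk y')
        (X.presheaf.germ U₁ (i y') h1 (t (Sum.inr l))) = 0)
    (fun j U V hVU h z hz => h z (hVU hz)) (fun l => by
      have h1 := (algebraMap_germ i hU₁ (t (Sum.inr l))).symm.trans
        ((congrArg _ (hDt (Sum.inr l) hU₁).2).trans ((hg l).trans
          (map_zero (Y.presheaf.germ ⊤ y (show y ∈ (⊤ : Y.Opens) from trivial)).hom).symm))
      obtain ⟨W, hW, h2, h3, h4⟩ := exists_forall_germ_eq (X := Y) (z := y) (V := ⊤) hU₁ (show y ∈ (⊤ : Y.Opens) from trivial) h1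
      exact ⟨W, hW, fun y' hy' h5 => (algebraMap_germ i h5 _).trans
        ((h4 y' hy').trans (map_zero (Y.presheaf.germ ⊤ y' (show y' ∈ (⊤ : Y.Opens) from trivial)).hom))⟩)
  -- The derivations on `Y` are chosen at each point separately. That they form vector fields
  -- follows later from their compatibility with the fields on `X`.
  choose δ hδ using fun y' : W₀ => hh y'.1 y'.2
  have hUle : U₀ ⊓ U₁ ⊓ U₂ ≤ U₁ := inf_le_left.trans inf_le_right
  have hres : ∀ l z (hz : z ∈ U₀ ⊓ U₁ ⊓ U₂), X.presheaf.germ (U₀ ⊓ U₁ ⊓ U₂) z hz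
      (X.presheaf.map (homOfLE hUle).op (t l)) = X.presheaf.germ U₁ z (hUle hz) (t l) :=
    fun l z hz => TopCat.Presheaf.germ_res_apply X.presheaf (homOfLE hUle) z hz (t l)
  have hle : i ⁻¹ᵁ (U₀ ⊓ U₁ ⊓ U₂) ⊓ (W₀ ⊓ W₁ ⊓ W₂) ≤ i ⁻¹ᵁ (U₀ ⊓ U₁ ⊓ U₂) := inf_le_left
  have hcoord : ∀ y' (hy' : y' ∈ i ⁻¹ᵁ (U₀ ⊓ U₁ ⊓ U₂) ⊓ (W₀ ⊓ W₁ ⊓ W₂)),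
      IsCoordinates (S.presheaf.stalk (x (i y')))
        (fun j => X.presheaf.germ (U₀ ⊓ U₁ ⊓ U₂) (i y') (hle hy')
          (X.presheaf.map (homOfLE hUle).op (t j)))
        (fun j => θ j ⟨i y', hUle (hle hy')⟩) := fun y' hy' => by
    obtain ⟨d', hd'⟩ := hf₀ (i y') (hle hy').1.1
    refine hd'.of_dual e fun j l => ?_
    have hz : i y' ∈ U₀ ⊓ U₁ ⊓ U₂ := hle hy'
    exact ((congrArg (θ j ⟨i y', hUle hz⟩) (hres l _ hz)).trans (hG j l _ (hUle hz))).trans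
      (hdual (j, l) _ hz.2 _)
  have hδc : ∀ y' (hy' : y' ∈ i ⁻¹ᵁ (U₀ ⊓ U₁ ⊓ U₂) ⊓ (W₀ ⊓ W₁ ⊓ W₂)),
      IsCoordinates (S.presheaf.stalk ((i ≫ x) y'))
        (fun j => algebraMap (X.presheaf.stalk (i y')) (Y.presheaf.stalk y')
          (X.presheaf.germ (U₀ ⊓ U₁ ⊓ U₂) (i y') (hle hy')
            (X.presheaf.map (homOfLE hUle).op (t (Sum.inl j)))))
        (δ ⟨y', hy'.2.1.1⟩) := fun y' hy' => by
    have h1 := hδ ⟨y', hy'.2.1.1⟩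
    convert h1 using 2 with j
    have hz : i y' ∈ U₀ ⊓ U₁ ⊓ U₂ := hle hy'
    exact (congrArg (algebraMap _ _) (hres _ _ hz)).trans (hfh j y' hy'.2.1.2 _ _)
  have hcompat : ∀ j y' (hy' : y' ∈ i ⁻¹ᵁ (U₀ ⊓ U₁ ⊓ U₂) ⊓ (W₀ ⊓ W₁ ⊓ W₂))
      (a : X.presheaf.stalk (i y')), δ ⟨y', hy'.2.1.1⟩ j (algebraMap _ _ a) =
        algebraMap _ _ (θ (Sum.inl j) ⟨i y', hUle (hle hy')⟩ a) := fun j y' hy' a => by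
    -- The difference of the two derivations to be compared kills the base. It is zero because it
    -- vanishes on the coordinates: on the tangential ones both sides are dual to them, and on the
    -- normal ones both terms are zero.
    let E : Derivation ℤ (X.presheaf.stalk (i y')) (Y.presheaf.stalk y') :=
      ((δ ⟨y', hy'.2.1.1⟩ j).restrictScalars ℤ).compAlgebraMap (X.presheaf.stalk (i y')) -
        (Algebra.linearMap (X.presheaf.stalk (i y')) (Y.presheaf.stalk y')).compDer
          ((θ (Sum.inl j) ⟨i y', hUle (hle hy')⟩).restrictScalars ℤ)
    have hE : ∀ a, E a = δ ⟨y', hy'.2.1.1⟩ j (algebraMap _ _ a) -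
        algebraMap _ _ (θ (Sum.inl j) ⟨i y', hUle (hle hy')⟩ a) := fun a => rfl
    rw [← sub_eq_zero, ← hE, (hcoord y' hy').expand E (fun s => by
      have h1 : δ ⟨y', hy'.2.1.1⟩ j (algebraMap (S.presheaf.stalk ((i ≫ x) y'))
          (Y.presheaf.stalk y') s) = 0 := (δ ⟨y', hy'.2.1.1⟩ j).map_algebraMap s
      have h2 : θ (Sum.inl j) ⟨i y', hUle (hle hy')⟩ (algebraMap (S.presheaf.stalk (x (i y')))
          (X.presheaf.stalk (i y')) s) = 0 :=
        Derivation.map_algebraMap _ s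
      rw [hE, h2, map_zero, sub_zero, ← h1]
      exact congrArg _ (algebraMap_comp x i y' s).symm) a]
    refine Finset.sum_eq_zero fun l _ => ?_
    have h3 := (hcoord y' hy').dual (Sum.inl j) l
    rcases l with l | l
    · have h4 := (hδc y' hy').dual j l
      refine (congrArg _ ((hE _).trans ((congrArg₂ _ h4 (congrArg _ h3))))).trans ?_
      simp only [Sum.inl.injEq]
      split_ifs <;> simp
    · have hz : i y' ∈ U₀ ⊓ U₁ ⊓ U₂ := hle hy'
      have h4 := (congrArg (algebraMap _ _) (hres (Sum.inr l) _ hz)).trans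
        (hg0 l y' hy'.2.2 hz.1.2)
      refine (congrArg _ ((hE _).trans ((congrArg₂ _ (congrArg _ h4) (congrArg _ h3))))).trans ?_
      simp
  let F : Frame 𝒜 i :=
    { U := U₀ ⊓ U₁ ⊓ U₂
      W := i ⁻¹ᵁ (U₀ ⊓ U₁ ⊓ U₂) ⊓ (W₀ ⊓ W₁ ⊓ W₂)
      le := hle
      m := m
      r := r
      d := fun j => 𝒜.resA hUle (D j)
      d_mem := fun j => 𝒜.F_res 1 hUle _ (hD j)
      θ := fun j z => θ j ⟨z.1, hUle z.2⟩
      symbol := fun j z => by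
        rw [𝒜.germ_resA]
        exact hθ j ⟨z.1, hUle z.2⟩
      f := fun j => X.presheaf.map (homOfLE hUle).op (t j)
      coord := fun y' => hcoord y'.1 y'.2
      f_inr := fun y' l => by
        have hz : i y'.1 ∈ U₀ ⊓ U₁ ⊓ U₂ := hle y'.2
        exact (congrArg (algebraMap _ _) (hres (Sum.inr l) _ hz)).trans
          (hg0 l y'.1 y'.2.2.2 hz.1.2)
      δ := fun j y' => δ ⟨y'.1, y'.2.2.1.1⟩ j
      δ_field := fun j => isVectorField_of_compat (θ := fun z => θ (Sum.inl j) ⟨z.1, hUle z.2⟩) hle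
        (fun V hV f => hθf (Sum.inl j) V (hV.trans hUle) f) fun y' a => hcompat j y'.1 y'.2 a
      compat := fun j y' a => hcompat j y'.1 y'.2 a }
  exact ⟨F, ⟨⟨hU₀, hU₁⟩, hU₂⟩, ⟨hW₀, hW₁⟩, hW₂⟩

end TwistedD

namespace TwistedD

variable {X Y S : Scheme.{u}} {x : X ⟶ S} {𝒜 : TDO x} {i : Y ⟶ X}

/-! ### The transfer module -/

namespace TransferStalk

variable {y : Y}

lemma mk_add_left (c c' : Y.presheaf.stalk y) (a : 𝒜.Stalk (i y)) :
    mk 𝒜 i (c + c') a = mk 𝒜 i c a + mk 𝒜 i c' a := TensorProduct.add_tmul _ _ _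

lemma mk_add_right (c : Y.presheaf.stalk y) (a a' : 𝒜.Stalk (i y)) :
    mk 𝒜 i c (a + a') = mk 𝒜 i c a + mk 𝒜 i c a' := TensorProduct.tmul_add _ _ _

lemma mk_zero_right (c : Y.presheaf.stalk y) : mk 𝒜 i c 0 = 0 := TensorProduct.tmul_zero _ _

lemma mk_sum_right {ι : Type*} (t : Finset ι) (c : Y.presheaf.stalk y) (a : ι → 𝒜.Stalk (i y)) :
    mk 𝒜 i c (∑ k ∈ t, a k) = ∑ k ∈ t, mk 𝒜 i c (a k) := TensorProduct.tmul_sum _ _ _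

lemma mk_sub_right (c : Y.presheaf.stalk y) (a a' : 𝒜.Stalk (i y)) :
    mk 𝒜 i c (a - a') = mk 𝒜 i c a - mk 𝒜 i c a' := TensorProduct.tmul_sub _ _ _

lemma mk_smul_right (f : X.presheaf.stalk (i y)) (c : Y.presheaf.stalk y) (a : 𝒜.Stalk (i y)) :
    mk 𝒜 i c (f • a) =
      mk 𝒜 i (algebraMap (X.presheaf.stalk (i y)) (Y.presheaf.stalk y) f * c) a :=
  (TensorProduct.tmul_smul f c a).trans (by
    rw [TensorProduct.smul_tmul', Algebra.smul_def]; rfl)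

lemma mk_sub_left (c c' : Y.presheaf.stalk y) (a : 𝒜.Stalk (i y)) :
    mk 𝒜 i (c - c') a = mk 𝒜 i c a - mk 𝒜 i c' a := TensorProduct.sub_tmul _ _ _

lemma mk_eq_smul (c : Y.presheaf.stalk y) (a : 𝒜.Stalk (i y)) : mk 𝒜 i c a = c • mk 𝒜 i 1 a := by
  rw [smul_mk, mul_one]

@[elab_as_elim]
lemma induction_on {motive : TransferStalk 𝒜 i y → Prop} (m : TransferStalk 𝒜 i y)
    (mk : ∀ c a, motive (mk 𝒜 i c a)) (add : ∀ s t, motive s → motive t → motive (s + t)) :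
    motive m :=
  TensorProduct.induction_on (motive := fun m : TransferStalk 𝒜 i y => motive m) m
    (by have h := mk 0 0; rwa [mk_zero_left] at h) mk add

lemma end_ext {φ ψ : EndStalk 𝒜 i y} (h : ∀ c a, φ (mk 𝒜 i c a) = ψ (mk 𝒜 i c a)) : φ = ψ :=
  LinearMap.ext fun m => induction_on m h fun s t hs ht => by rw [map_add, map_add, hs, ht]

/-- A basis of `A` gives a basis of the transfer module. -/
lemma exists_basis {J : Type*} (e : Module.Basis J (X.presheaf.stalk (i y)) (𝒜.Stalk (i y))) :
    ∃ b : Module.Basis J (Y.presheaf.stalk y) (TransferStalk 𝒜 i y), ∀ j, b j = mk 𝒜 i 1 (e j) :=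
  ⟨e.baseChange (Y.presheaf.stalk y), fun j => Module.Basis.baseChange_apply _ _ j⟩

/-- The endomorphism given by a derivation and a compatible operator of order one. -/
lemma exists_end (D : TangentStalk (i ≫ x) y) {d : 𝒜.Stalk (i y)} {θ : TangentStalk x (i y)}
    (hd : 𝒜.HasSymbol x d θ) (h : ∀ a : X.presheaf.stalk (i y),
      D (algebraMap (X.presheaf.stalk (i y)) (Y.presheaf.stalk y) a) = algebraMap _ _ (θ a)) :
    ∃ φ : EndStalk 𝒜 i y, ∀ c q, φ (mk 𝒜 i c q) = mk 𝒜 i (D c) q + mk 𝒜 i c (d * q) := by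
  let b : Y.presheaf.stalk y →+ 𝒜.Stalk (i y) →+ TransferStalk 𝒜 i y :=
    AddMonoidHom.mk' (fun c => AddMonoidHom.mk' (fun q => mk 𝒜 i (D c) q + mk 𝒜 i c (d * q))
      fun q q' => by rw [mk_add_right, mul_add, mk_add_right]; abel)
      fun c c' => AddMonoidHom.ext fun q => by
        change mk 𝒜 i (D (c + c')) q + mk 𝒜 i (c + c') (d * q) =
          (mk 𝒜 i (D c) q + mk 𝒜 i c (d * q)) + (mk 𝒜 i (D c') q + mk 𝒜 i c' (d * q))
        rw [map_add, mk_add_left, mk_add_left]; abel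
  -- Balancing over `𝒪_X`: moving `f` across the tensor sign produces `D f` on the left and the
  -- commutator `[d, f] = θ f` on the right, which agree by hypothesis.
  have hb : ∀ (f : X.presheaf.stalk (i y)) c q, b (f • c) q = b c (f • q) := fun f c q => by
    change mk 𝒜 i (D (f • c)) q + mk 𝒜 i (f • c) (d * q) =
      mk 𝒜 i (D c) (f • q) + mk 𝒜 i c (d * f • q)
    have h1 : d * f • q = f • (d * q) + θ f • q := by
      rw [FilteredRing.smul_def, FilteredRing.smul_def, FilteredRing.smul_def, ← hd f]
      noncomm_ring
    rw [h1, mk_add_right, mk_smul_right, mk_smul_right, mk_smul_right, ← h, Algebra.smul_def,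
      Derivation.leibniz, mk_add_left, smul_eq_mul, smul_eq_mul, mul_comm c]
    abel
  let L : TransferStalk 𝒜 i y →+ TransferStalk 𝒜 i y := TensorProduct.liftAddHom b hb
  have hL : ∀ c q, L (mk 𝒜 i c q) = mk 𝒜 i (D c) q + mk 𝒜 i c (d * q) := fun c q => rfl
  refine ⟨{ toFun := L, map_add' := L.map_add, map_smul' := fun q m => ?_ }, hL⟩
  induction m using induction_on with
  | mk c a =>
    obtain ⟨q, rfl⟩ := MulOpposite.op_surjective q
    rw [op_smul_mk, hL, RingHom.id_apply, hL, smul_add, op_smul_mk, op_smul_mk, mul_assoc]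
  | add s t hs ht => rw [smul_add, map_add, hs, ht, map_add, smul_add]

end TransferStalk

/-! ### The Picard algebroid on stalks and its image in the enveloping algebra -/

section Picard

lemma IsVectorField.res {z : X ⟶ S} {U V : X.Opens} {θ : ∀ z' : U, TangentStalk z z'.1}
    (h : IsVectorField z U θ) (hV : V ≤ U) :
    IsVectorField z V (fun z' => θ ⟨z'.1, hV z'.2⟩) :=
  fun V' hV' f => h V' (hV'.trans hV) f

lemma IsVectorField.add {z : X ⟶ S} {U : X.Opens} {θ θ' : ∀ z' : U, TangentStalk z z'.1}
    (h : IsVectorField z U θ) (h' : IsVectorField z U θ') : IsVectorField z U (θ + θ') := by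
  intro V hV f
  obtain ⟨g, hg⟩ := h V hV f
  obtain ⟨g', hg'⟩ := h' V hV f
  exact ⟨g + g', fun z' hz' => (congrArg₂ _ (hg z' hz') (hg' z' hz')).trans (map_add _ _ _).symm⟩

lemma IsVectorField.smul {z : X ⟶ S} {U : X.Opens} {θ : ∀ z' : U, TangentStalk z z'.1}
    (h : IsVectorField z U θ) (c : Γ(X, U)) :
    IsVectorField z U (fun z' => X.presheaf.germ U z'.1 z'.2 c • θ z') := by
  intro V hV f
  obtain ⟨g, hg⟩ := h V hV f
  refine ⟨X.presheaf.map (homOfLE hV).op c * g, fun z' hz' => ?_⟩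
  rw [map_mul, ← hg z' hz', TopCat.Presheaf.germ_res_apply X.presheaf (homOfLE hV) z' hz' c]
  rfl

lemma IsVectorField.commutator {z : X ⟶ S} {U : X.Opens} {θ θ' : ∀ z' : U, TangentStalk z z'.1}
    (h : IsVectorField z U θ) (h' : IsVectorField z U θ') :
    IsVectorField z U (fun z' => ⁅θ z', θ' z'⁆) := by
  intro V hV f
  obtain ⟨g, hg⟩ := h V hV f
  obtain ⟨g', hg'⟩ := h' V hV f
  obtain ⟨k, hk⟩ := h V hV g'
  obtain ⟨k', hk'⟩ := h' V hV g
  refine ⟨k - k', fun z' hz' => ?_⟩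
  rw [Derivation.commutator_apply, hg, hg', hk, hk', map_sub]

lemma IsTransferSection.res {p : ℤ} {W W' : Y.Opens} {t : ∀ y : W, TransferStalk 𝒜 i y.1}
    (h : IsTransferSection 𝒜 i p W t) (hW : W' ≤ W) :
    IsTransferSection 𝒜 i p W' (fun y => t ⟨y.1, hW y.2⟩) := by
  obtain ⟨U, hU, n, c, a, h⟩ := h
  refine ⟨U, hW.trans hU, n, fun k => Y.presheaf.map (homOfLE hW).op (c k), a, fun y => ?_⟩
  refine (h ⟨y.1, hW y.2⟩).trans (Finset.sum_congr rfl fun k _ => ?_)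
  exact congrArg (TransferStalk.mk 𝒜 i · _)
    (TopCat.Presheaf.germ_res_apply Y.presheaf (homOfLE hW) y.1 y.2 (c k)).symm

lemma IsTransferSection.add {p : ℤ} {W : Y.Opens} {t t' : ∀ y : W, TransferStalk 𝒜 i y.1}
    (h : IsTransferSection 𝒜 i p W t) (h' : IsTransferSection 𝒜 i p W t') :
    IsTransferSection 𝒜 i p W (t + t') := by
  obtain ⟨U, hU, n, c, a, h⟩ := h
  obtain ⟨U', hU', n', c', a', h'⟩ := h'
  refine ⟨U ⊓ U', fun y hy => ⟨hU hy, hU' hy⟩, n + n', Fin.append c c',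
    Fin.append (fun k => ⟨𝒜.resA inf_le_left (a k).1, 𝒜.F_res p inf_le_left _ (a k).2⟩)
      (fun k => ⟨𝒜.resA inf_le_right (a' k).1, 𝒜.F_res p inf_le_right _ (a' k).2⟩), fun y => ?_⟩
  rw [Pi.add_apply, h, h', Fin.sum_univ_add]
  have hz : i y.1 ∈ U ⊓ U' := ⟨hU y.2, hU' y.2⟩
  congr 1 <;> refine Finset.sum_congr rfl fun k _ => ?_
  · rw [Fin.append_left, Fin.append_left]
    exact congrArg _ (𝒜.germ_resA inf_le_left hz (a k).1).symm
  · rw [Fin.append_right, Fin.append_right]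
    exact congrArg _ (𝒜.germ_resA inf_le_right hz (a' k).1).symm

lemma IsTransferSection.smul {p : ℤ} {W : Y.Opens} {t : ∀ y : W, TransferStalk 𝒜 i y.1}
    (h : IsTransferSection 𝒜 i p W t) (c : Γ(Y, W)) :
    IsTransferSection 𝒜 i p W (fun y => Y.presheaf.germ W y.1 y.2 c • t y) := by
  obtain ⟨U, hU, n, b, a, h⟩ := h
  refine ⟨U, hU, n, fun k => c * b k, a, fun y => ?_⟩
  refine (congrArg _ (h y)).trans (Finset.smul_sum.trans (Finset.sum_congr rfl fun k _ => ?_))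
  exact congrArg (TransferStalk.mk 𝒜 i · _) (map_mul (Y.presheaf.germ W y.1 y.2).hom c (b k)).symm

lemma IsPicardSection.res {W W' : Y.Opens} {φ : ∀ y : W, EndStalk 𝒜 i y.1}
    (h : IsPicardSection 𝒜 i W φ) (hW : W' ≤ W) :
    IsPicardSection 𝒜 i W' (fun y => φ ⟨y.1, hW y.2⟩) := by
  obtain ⟨D, t, hD, ht, h⟩ := h
  exact ⟨_, _, hD.res hW, ht.res hW, fun y c q => h ⟨y.1, hW y.2⟩ c q⟩

lemma IsPicardSection.add {W : Y.Opens} {φ φ' : ∀ y : W, EndStalk 𝒜 i y.1}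
    (h : IsPicardSection 𝒜 i W φ) (h' : IsPicardSection 𝒜 i W φ') :
    IsPicardSection 𝒜 i W (φ + φ') := by
  obtain ⟨D, t, hD, ht, h⟩ := h
  obtain ⟨D', t', hD', ht', h'⟩ := h'
  refine ⟨_, _, hD.add hD', ht.add ht', fun y c q => ?_⟩
  rw [Pi.add_apply, LinearMap.add_apply, h, h', Pi.add_apply, Pi.add_apply, Derivation.add_apply,
    TransferStalk.mk_add_left, smul_add, smul_add]
  abel

lemma IsPicardSection.smul {W : Y.Opens} {φ : ∀ y : W, EndStalk 𝒜 i y.1}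
    (h : IsPicardSection 𝒜 i W φ) (c : Γ(Y, W)) :
    IsPicardSection 𝒜 i W
      (fun y => scalarEnd 𝒜 i (Y.presheaf.germ W y.1 y.2 c) * φ y) := by
  obtain ⟨D, t, hD, ht, h⟩ := h
  refine ⟨_, _, hD.smul c, ht.smul c, fun y b q => ?_⟩
  change Y.presheaf.germ W y.1 y.2 c • φ y (TransferStalk.mk 𝒜 i b q) = _
  rw [h, smul_add, TransferStalk.smul_mk, TransferStalk.op_smul_smul, smul_smul, smul_smul,
    mul_comm b]
  rfl

variable (𝒜 i) in
/-- The endomorphisms of the stalk of the transfer module that belong to the Picard algebroid. -/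
def IsPicard {y : Y} (φ : EndStalk 𝒜 i y) : Prop :=
  ∃ (W : Y.Opens) (hy : y ∈ W) (Φ : ∀ y : W, EndStalk 𝒜 i y.1),
    IsPicardSection 𝒜 i W Φ ∧ Φ ⟨y, hy⟩ = φ

variable {y : Y}

lemma IsPicard.add {φ ψ : EndStalk 𝒜 i y} (h : IsPicard 𝒜 i φ) (h' : IsPicard 𝒜 i ψ) :
    IsPicard 𝒜 i (φ + ψ) := by
  obtain ⟨W, hy, Φ, hΦ, rfl⟩ := h
  obtain ⟨W', hy', Φ', hΦ', rfl⟩ := h'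
  exact ⟨W ⊓ W', ⟨hy, hy'⟩, _, (hΦ.res inf_le_left).add (hΦ'.res inf_le_right), rfl⟩

lemma isPicard_scalarEnd (c : Y.presheaf.stalk y) : IsPicard 𝒜 i (scalarEnd 𝒜 i c) := by
  obtain ⟨W, hy, c, rfl⟩ := Y.presheaf.exists_germ_eq c
  exact ⟨W, hy, _, isPicardSection_scalarEnd 𝒜 i c, rfl⟩

lemma IsPicard.smul {φ : EndStalk 𝒜 i y} (h : IsPicard 𝒜 i φ) (c : Y.presheaf.stalk y) :
    IsPicard 𝒜 i (scalarEnd 𝒜 i c * φ) := by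
  obtain ⟨W', hy', c, rfl⟩ := Y.presheaf.exists_germ_eq c
  obtain ⟨W, hy, Φ, hΦ, rfl⟩ := h
  refine ⟨W ⊓ W', ⟨hy, hy'⟩, _, (hΦ.res inf_le_left).smul
    (Y.presheaf.map (homOfLE inf_le_right).op c), ?_⟩
  exact congrArg (fun c => scalarEnd 𝒜 i c * Φ ⟨y, hy⟩)
    (TopCat.Presheaf.germ_res_apply Y.presheaf (homOfLE (inf_le_right : W ⊓ W' ≤ W')) y
      (show y ∈ W ⊓ W' from ⟨hy, hy'⟩) c)

variable (𝒜 i) in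
/-- The element of `i^·A` given by an element of the Picard algebroid. -/
abbrev IsPicard.ι {φ : EndStalk 𝒜 i y} (h : IsPicard 𝒜 i φ) : PullbackStalk 𝒜 i y :=
  picardι 𝒜 i ⟨φ, h⟩

lemma IsPicard.ι_add {φ ψ χ : EndStalk 𝒜 i y} (h : IsPicard 𝒜 i φ) (h' : IsPicard 𝒜 i ψ)
    (h'' : IsPicard 𝒜 i χ) (hχ : χ = φ + ψ) : h''.ι = h.ι + h'.ι :=
  (RingQuot.mkRingHom_rel (EnvRel.add ⟨φ, h⟩ ⟨ψ, h'⟩ ⟨χ, h''⟩ hχ)).trans (map_add _ _ _)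

lemma IsPicard.ι_smul {φ χ : EndStalk 𝒜 i y} (h : IsPicard 𝒜 i φ) (h'' : IsPicard 𝒜 i χ)
    (c : Y.presheaf.stalk y) (hχ : χ = scalarEnd 𝒜 i c * φ) :
    h''.ι = (isPicard_scalarEnd c).ι * h.ι :=
  (RingQuot.mkRingHom_rel (EnvRel.smul c ⟨_, isPicard_scalarEnd c⟩ ⟨φ, h⟩ ⟨χ, h''⟩ (fun _ => rfl)
    (fun m => LinearMap.congr_fun hχ m))).trans (map_mul _ _ _)

lemma IsPicard.ι_bracket {φ ψ χ : EndStalk 𝒜 i y} (h : IsPicard 𝒜 i φ) (h' : IsPicard 𝒜 i ψ)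
    (h'' : IsPicard 𝒜 i χ) (hχ : χ = φ * ψ - ψ * φ) : h''.ι = h.ι * h'.ι - h'.ι * h.ι := by
  refine (RingQuot.mkRingHom_rel (EnvRel.bracket ⟨φ, h⟩ ⟨ψ, h'⟩ ⟨χ, h''⟩ hχ)).trans ?_
  rw [map_sub, map_mul, map_mul]
  rfl

variable (𝒜 i y) in
/-- The functions in `i^·A`. -/
noncomputable def pullbackScalar : Y.presheaf.stalk y →+* PullbackStalk 𝒜 i y where
  toFun c := (isPicard_scalarEnd c).ι
  map_one' := (RingQuot.mkRingHom_rel (EnvRel.one ⟨_, isPicard_scalarEnd 1⟩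
    (LinearMap.ext fun m => one_smul _ m))).trans (map_one _)
  map_mul' c d := (isPicard_scalarEnd d).ι_smul _ c (LinearMap.ext fun m => mul_smul c d m)
  map_zero' := by
    have h := (isPicard_scalarEnd 0).ι_add (isPicard_scalarEnd 0)
      (isPicard_scalarEnd (0 : Y.presheaf.stalk y)) (𝒜 := 𝒜) (i := i) (LinearMap.ext fun m => by
        change (0 : Y.presheaf.stalk y) • m =
          (0 : Y.presheaf.stalk y) • m + (0 : Y.presheaf.stalk y) • m
        rw [zero_smul, zero_add])
    exact left_eq_add.mp h
  map_add' c d := (isPicard_scalarEnd c).ι_add (isPicard_scalarEnd d) _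
    (LinearMap.ext fun m => add_smul c d m)

lemma IsPicard.ι_smul_transfer {φ : EndStalk 𝒜 i y} (h : IsPicard 𝒜 i φ)
    (m : TransferStalk 𝒜 i y) : h.ι • m = φ m :=
  LinearMap.congr_fun (pullbackAct_picardι 𝒜 i ⟨φ, h⟩) m

lemma pullbackScalar_smul (c : Y.presheaf.stalk y) (m : TransferStalk 𝒜 i y) :
    pullbackScalar 𝒜 i y c • m = c • m :=
  (isPicard_scalarEnd c).ι_smul_transfer m

/-- The defining relations treat only binary sums and single scalar multiples, so finite
combinations need an induction. Membership of the partial sums in the algebroid is carried along,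
since `IsPicard.ι` depends on a proof of it. -/
lemma IsPicard.ι_eq_sum {J : Type*} (s : Finset J) {φ : J → EndStalk 𝒜 i y}
    (h : ∀ j, IsPicard 𝒜 i (φ j)) (c₀ : Y.presheaf.stalk y) (c : J → Y.presheaf.stalk y) :
    ∀ {χ : EndStalk 𝒜 i y} (h' : IsPicard 𝒜 i χ),
    χ = scalarEnd 𝒜 i c₀ + ∑ j ∈ s, scalarEnd 𝒜 i (c j) * φ j →
    h'.ι = pullbackScalar 𝒜 i y c₀ + ∑ j ∈ s, pullbackScalar 𝒜 i y (c j) * (h j).ι := by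
  classical
  suffices ∃ h₁ : IsPicard 𝒜 i (scalarEnd 𝒜 i c₀ + ∑ j ∈ s, scalarEnd 𝒜 i (c j) * φ j),
      h₁.ι = pullbackScalar 𝒜 i y c₀ + ∑ j ∈ s, pullbackScalar 𝒜 i y (c j) * (h j).ι by
    rintro _ h' rfl
    exact this.2
  induction s using Finset.induction_on with
  | empty =>
    simp only [Finset.sum_empty, add_zero]
    exact ⟨isPicard_scalarEnd c₀, rfl⟩
  | insert j s hj ih =>
    obtain ⟨h₁, h₂⟩ := ih
    have h₃ := (h j).smul (c j)
    refine ⟨?_, ?_⟩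
    · rw [Finset.sum_insert hj, add_left_comm]
      exact h₃.add h₁
    · refine Eq.trans ?_ ((congrArg _ (Finset.sum_insert hj)).trans (add_left_comm _ _ _)).symm
      rw [← h₂]
      refine (h₃.ι_add h₁ _ ?_).trans (congrArg (· + _) ((h j).ι_smul h₃ (c j) rfl))
      rw [Finset.sum_insert hj, add_left_comm]

end Picard

end TwistedD

/-! ### Expansions of operators in a frame -/

namespace TwistedD

lemma map_pairMonomial {A A' F : Type*} [Monoid A] [Monoid A'] [FunLike F A A']
    [MonoidHomClass F A A'] (φ : F) {m r : ℕ} (d : Fin m ⊕ Fin r → A)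
    (k : Multiset (Fin m) × Multiset (Fin r)) :
    φ (pairMonomial d k) = pairMonomial (fun j => φ (d j)) k := by
  simp [pairMonomial, map_sortedMonomial]

variable {X Y S : Scheme.{u}} {x : X ⟶ S} {𝒜 : TDO x} {i : Y ⟶ X}

namespace Frame

variable (F : Frame 𝒜 i) {y : Y} (hy : y ∈ F.W)

/-- The germ of an operator of the frame. -/
noncomputable def opGerm (j : Fin F.m ⊕ Fin F.r) : 𝒜.Stalk (i y) := 𝒜.germ (F.le hy) (F.d j)

/-- The germ of the symbol of an operator of the frame. -/
def symbolGerm (j : Fin F.m ⊕ Fin F.r) : TangentStalk x (i y) := F.θ j ⟨i y, F.le hy⟩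

lemma opGerm_mem (j : Fin F.m ⊕ Fin F.r) : F.opGerm hy j ∈ 𝒜.FStalk 1 (i y) :=
  𝒜.germ_mem_FStalk _ (F.d_mem j)

lemma hasSymbol (j : Fin F.m ⊕ Fin F.r) : 𝒜.HasSymbol x (F.opGerm hy j) (F.symbolGerm hy j) :=
  F.symbol j ⟨i y, F.le hy⟩

/-- The germ of a coordinate function of the frame. -/
noncomputable def coordGerm (j : Fin F.m ⊕ Fin F.r) : X.presheaf.stalk (i y) :=
  X.presheaf.germ F.U (i y) (F.le hy) (F.f j)

lemma isCoordinates : IsCoordinates (S.presheaf.stalk (x (i y))) (F.coordGerm hy)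
    (F.symbolGerm hy) := F.coord ⟨y, hy⟩

lemma eq_sum_smul_symbolGerm (θ : TangentStalk x (i y)) :
    θ = ∑ j, θ (F.coordGerm hy j) • F.symbolGerm hy j := by
  refine Derivation.ext fun b => ?_
  have h1 := (F.isCoordinates hy).expand (θ.restrictScalars ℤ) (fun s => θ.map_algebraMap s) b
  have h2 := congrFun (map_sum Derivation.coeFnAddMonoidHom
    (fun j => θ (F.coordGerm hy j) • F.symbolGerm hy j) Finset.univ) b
  rw [Finset.sum_apply] at h2
  exact (h1.trans (Finset.sum_congr rfl fun j _ => mul_comm _ _)).trans h2.symm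

lemma coordGerm_inr (l : Fin F.r) : algebraMap (X.presheaf.stalk (i y)) (Y.presheaf.stalk y)
    (F.coordGerm hy (Sum.inr l)) = 0 := F.f_inr ⟨y, hy⟩ l

lemma exists_operator_basis : ∃ e : Module.Basis (Multiset (Fin F.m) × Multiset (Fin F.r))
    (X.presheaf.stalk (i y)) (𝒜.Stalk (i y)), ∀ k, e k = pairMonomial (F.opGerm hy) k := by
  obtain ⟨b, hb⟩ := (F.isCoordinates hy).exists_basis
  exact 𝒜.exists_pairMonomial_basis b hb (F.opGerm_mem hy) (F.hasSymbol hy)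

lemma exists_transfer_basis : ∃ e : Module.Basis (Multiset (Fin F.m) × Multiset (Fin F.r))
    (Y.presheaf.stalk y) (TransferStalk 𝒜 i y),
    ∀ k, e k = TransferStalk.mk 𝒜 i 1 (pairMonomial (F.opGerm hy) k) := by
  obtain ⟨e, he⟩ := F.exists_operator_basis hy
  obtain ⟨b, hb⟩ := TransferStalk.exists_basis e
  exact ⟨b, fun k => by rw [hb, he]⟩

/-- The empty monomial belongs to the `𝒪_Y`-basis of the transfer module, so `𝒪_Y` embeds through `c
↦ c ⊗ 1`. -/
lemma mk_one_injective (F : Frame 𝒜 i) (hy : y ∈ F.W) {c c' : Y.presheaf.stalk y}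
    (h : TransferStalk.mk 𝒜 i c 1 = TransferStalk.mk 𝒜 i c' 1) : c = c' := by
  obtain ⟨e, he⟩ := F.exists_transfer_basis hy
  have h0 : e (0, 0) = TransferStalk.mk 𝒜 i 1 1 := by simp [he, pairMonomial]
  rw [TransferStalk.mk_eq_smul, TransferStalk.mk_eq_smul c', ← h0] at h
  simpa using congrArg (fun m => e.repr m (0, 0)) h

/-- Operators of bounded order near a point are combinations of the monomials of the frame. -/
lemma exists_expansion (hy : y ∈ F.W) {p : ℤ} {U : X.Opens} {a : 𝒜.A.presheaf.obj (op U)} (ha : a ∈ 𝒜.F p U)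
    (hU : i y ∈ U) : ∃ (V : X.Opens) (_ : i y ∈ V) (h : V ≤ U) (h' : V ≤ F.U)
      (s : Finset (Multiset (Fin F.m) × Multiset (Fin F.r)))
      (c : Multiset (Fin F.m) × Multiset (Fin F.r) → Γ(X, V)),
      (∀ k ∈ s, (k.1.card + k.2.card : ℕ) ≤ p) ∧ ∀ z (hz : z ∈ V),
        𝒜.germ (h hz) a = ∑ k ∈ s, X.presheaf.germ V z hz (c k) •
          pairMonomial (fun j => 𝒜.germ (h' hz) (F.d j)) k := by
  classical
  obtain ⟨b, hb⟩ := (F.isCoordinates hy).exists_basis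
  have h1 := 𝒜.mem_span_pairMonomial b hb (F.opGerm_mem hy) (F.hasSymbol hy)
    (𝒜.germ_mem_FStalk hU ha)
  have h2 : {c | ∃ k : Multiset (Fin F.m) × Multiset (Fin F.r), (k.1.card + k.2.card : ℕ) ≤ p ∧
      c = pairMonomial (F.opGerm hy) k} = pairMonomial (F.opGerm hy) ''
        {k | (k.1.card + k.2.card : ℕ) ≤ p} := by
    ext c
    simp [eq_comm]
  rw [h2, Finsupp.mem_span_image_iff_linearCombination] at h1
  obtain ⟨l, hl, hla⟩ := h1
  obtain ⟨V, hV, hsec⟩ := exists_open_forall (z := i y) (J := l.support)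
    (p := fun k (V : X.Opens) => ∃ g : Γ(X, V), ∀ h : i y ∈ V, X.presheaf.germ V (i y) h g = l k.1)
    (fun k U V hVU ⟨g, hg⟩ => ⟨X.presheaf.map (homOfLE hVU).op g, fun h =>
      (TopCat.Presheaf.germ_res_apply X.presheaf (homOfLE hVU) _ h g).trans (hg _)⟩)
    (fun k => by
      obtain ⟨U, hU, g, hg⟩ := X.presheaf.exists_germ_eq (l k.1)
      exact ⟨U, hU, g, fun _ => hg⟩)
  choose g hg using hsec
  let c : Multiset (Fin F.m) × Multiset (Fin F.r) → Γ(X, V) := fun k =>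
    if hk : k ∈ l.support then g ⟨k, hk⟩ else 0
  have hc : ∀ k ∈ l.support, X.presheaf.germ V (i y) hV (c k) = l k := fun k hk => by
    simp only [c, dif_pos hk]
    exact hg ⟨k, hk⟩ hV
  have hVU : i y ∈ V ⊓ F.U := ⟨hV, F.le hy⟩
  let a' : 𝒜.A.presheaf.obj (op (V ⊓ F.U)) := ∑ k ∈ l.support,
    𝒜.ι.app (op (V ⊓ F.U)) (X.presheaf.map (homOfLE inf_le_left).op (c k)) *
      pairMonomial (fun j => 𝒜.resA inf_le_right (F.d j)) k
  have ha' : ∀ z (hz : z ∈ V ⊓ F.U), 𝒜.germ hz a' = ∑ k ∈ l.support,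
      X.presheaf.germ V z hz.1 (c k) • pairMonomial (fun j => 𝒜.germ hz.2 (F.d j)) k :=
    fun z hz => by
      rw [map_sum]
      refine Finset.sum_congr rfl fun k _ => ?_
      rw [map_mul, map_pairMonomial, ← FilteredRing.ιStalk_germ, FilteredRing.smul_def,
        TopCat.Presheaf.germ_res_apply X.presheaf (homOfLE inf_le_left) z hz (c k)]
      simp only [𝒜.germ_resA]
  have h3 : 𝒜.germ hU a = 𝒜.germ hVU a' := by
    rw [ha', ← hla, Finsupp.linearCombination_apply, Finsupp.sum]
    exact Finset.sum_congr rfl fun k hk => by rw [hc k hk]; rfl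
  obtain ⟨V', hV'U, hV'V, hyV', h4⟩ := 𝒜.exists_resA_eq hU hVU h3
  refine ⟨V', hyV', hV'U, hV'V.trans inf_le_right, l.support, fun k =>
    X.presheaf.map (homOfLE (hV'V.trans inf_le_left)).op (c k), fun k hk => hl hk,
    fun z hz => ?_⟩
  rw [← 𝒜.germ_resA hV'U hz, h4, 𝒜.germ_resA hV'V hz, ha' z (hV'V hz)]
  refine Finset.sum_congr rfl fun k _ => ?_
  rw [TopCat.Presheaf.germ_res_apply X.presheaf (homOfLE (hV'V.trans inf_le_left)) z hz (c k)]

/-- Operators of order at most one near a point are combinations of the operators of the frame. -/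
lemma exists_expansion_one (hy : y ∈ F.W) {U : X.Opens} {a : 𝒜.A.presheaf.obj (op U)} (ha : a ∈ 𝒜.F 1 U)
    (hU : i y ∈ U) : ∃ (V : X.Opens) (_ : i y ∈ V) (h : V ≤ U) (h' : V ≤ F.U)
      (c₀ : Γ(X, V)) (c : Fin F.m ⊕ Fin F.r → Γ(X, V)), ∀ z (hz : z ∈ V),
        𝒜.germ (h hz) a = X.presheaf.germ V z hz c₀ • 1 +
          ∑ j, X.presheaf.germ V z hz (c j) • 𝒜.germ (h' hz) (F.d j) := by
  have hUF : i y ∈ U ⊓ F.U := ⟨hU, F.le hy⟩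
  choose θ hθ using fun z : U => 𝒜.exists_hasSymbol (𝒜.germ_mem_FStalk z.2 ha)
  choose g hg using fun j => 𝒜.isVectorField_of_hasSymbol ha hθ (U ⊓ F.U) inf_le_left
    (X.presheaf.map (homOfLE inf_le_right).op (F.f j))
  have hg' : ∀ j, θ ⟨i y, hU⟩ (F.coordGerm hy j) = X.presheaf.germ (U ⊓ F.U) (i y) hUF (g j) :=
    fun j => by
      rw [← hg j (i y) hUF,
        TopCat.Presheaf.germ_res_apply X.presheaf (homOfLE inf_le_right) (i y) hUF]
      rfl
  -- Subtracting the operators of the frame with coefficients `θ (f_j)` kills the symbol, so the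
  -- remainder is a function.
  have h1 : 𝒜.germ hU a - ∑ j, X.presheaf.germ (U ⊓ F.U) (i y) hUF (g j) • F.opGerm hy j ∈
      𝒜.FStalk 0 (i y) := by
    refine 𝒜.symbol_injective _ _ (sub_mem (𝒜.germ_mem_FStalk hU ha) (Submodule.sum_mem _
      fun j _ => Submodule.smul_mem _ _ (F.opGerm_mem hy j))) fun f => ?_
    have h2 := TDO.HasSymbol.sum 𝒜 Finset.univ fun j =>
      TDO.HasSymbol.smul 𝒜 (F.hasSymbol hy j) (X.presheaf.germ (U ⊓ F.U) (i y) hUF (g j))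
    have h3 : θ ⟨i y, hU⟩ =
        ∑ j, X.presheaf.germ (U ⊓ F.U) (i y) hUF (g j) • F.symbolGerm hy j := by
      refine (F.eq_sum_smul_symbolGerm hy _).trans (Finset.sum_congr rfl fun j _ => ?_)
      rw [hg']
    rw [← h3] at h2
    rw [sub_mul, mul_sub, sub_sub_sub_comm, h2 f, hθ ⟨i y, hU⟩ f, sub_self]
    simp
  obtain ⟨f, hf⟩ := 𝒜.mem_FStalk_zero_iff.mp h1
  obtain ⟨U', hU', c₀, rfl⟩ := X.presheaf.exists_germ_eq f
  have hU'' : i y ∈ U' ⊓ (U ⊓ F.U) := ⟨hU', hUF⟩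
  let a' : 𝒜.A.presheaf.obj (op (U' ⊓ (U ⊓ F.U))) :=
    𝒜.ι.app _ (X.presheaf.map (homOfLE inf_le_left).op c₀) +
      ∑ j, 𝒜.ι.app _ (X.presheaf.map (homOfLE inf_le_right).op (g j)) *
        𝒜.resA (inf_le_right.trans inf_le_right) (F.d j)
  have ha' : ∀ z (hz : z ∈ U' ⊓ (U ⊓ F.U)), 𝒜.germ hz a' = X.presheaf.germ U' z hz.1 c₀ • 1 +
      ∑ j, X.presheaf.germ (U ⊓ F.U) z hz.2 (g j) • 𝒜.germ hz.2.2 (F.d j) := fun z hz => by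
    rw [map_add, map_sum, ← FilteredRing.ιStalk_germ, FilteredRing.smul_def, mul_one,
      TopCat.Presheaf.germ_res_apply X.presheaf (homOfLE inf_le_left) z hz c₀]
    refine congrArg _ (Finset.sum_congr rfl fun j _ => ?_)
    rw [map_mul, ← FilteredRing.ιStalk_germ, FilteredRing.smul_def, 𝒜.germ_resA,
      TopCat.Presheaf.germ_res_apply X.presheaf (homOfLE inf_le_right) z hz (g j)]
  have h6 : 𝒜.germ hU a = 𝒜.germ hU'' a' := by
    rw [ha', FilteredRing.smul_def, mul_one]
    exact sub_eq_iff_eq_add.mp hf.symm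
  obtain ⟨V, hVU, hV, hyV, h7⟩ := 𝒜.exists_resA_eq hU hU'' h6
  refine ⟨V, hyV, hVU, hV.trans (inf_le_right.trans inf_le_right),
    X.presheaf.map (homOfLE (hV.trans inf_le_left)).op c₀,
    fun j => X.presheaf.map (homOfLE (hV.trans inf_le_right)).op (g j), fun z hz => ?_⟩
  rw [← 𝒜.germ_resA hVU hz, h7, 𝒜.germ_resA hV hz, ha' z (hV hz),
    TopCat.Presheaf.germ_res_apply X.presheaf (homOfLE (hV.trans inf_le_left)) z hz c₀]
  refine congrArg _ (Finset.sum_congr rfl fun j _ => ?_)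
  rw [TopCat.Presheaf.germ_res_apply X.presheaf (homOfLE (hV.trans inf_le_right)) z hz (g j)]

lemma exists_picard (j : Fin F.m) (y : F.W) : ∃ φ : EndStalk 𝒜 i y.1, ∀ c q,
    φ (TransferStalk.mk 𝒜 i c q) = TransferStalk.mk 𝒜 i (F.δ j y c) q +
      TransferStalk.mk 𝒜 i c (F.opGerm y.2 (Sum.inl j) * q) :=
  TransferStalk.exists_end (F.δ j y) (F.hasSymbol y.2 (Sum.inl j)) (F.compat j y)

/-- The sections of the Picard algebroid given by the operators of the frame along `Y`. -/
noncomputable def picard (j : Fin F.m) (y : F.W) : EndStalk 𝒜 i y.1 :=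
  (F.exists_picard j y).choose

lemma picard_mk (j : Fin F.m) (y : F.W) (c : Y.presheaf.stalk y.1) (q : 𝒜.Stalk (i y.1)) :
    F.picard j y (TransferStalk.mk 𝒜 i c q) = TransferStalk.mk 𝒜 i (F.δ j y c) q +
      TransferStalk.mk 𝒜 i c (F.opGerm y.2 (Sum.inl j) * q) :=
  (F.exists_picard j y).choose_spec c q

lemma isPicardSection_picard (j : Fin F.m) : IsPicardSection 𝒜 i F.W (F.picard j) := by
  refine ⟨F.δ j, fun y => TransferStalk.mk 𝒜 i 1 (F.opGerm y.2 (Sum.inl j)), F.δ_field j,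
    ⟨F.U, F.le, 1, fun _ => 1, fun _ => ⟨F.d (Sum.inl j), F.d_mem _⟩, fun y => ?_⟩, fun y c q => ?_⟩
  · simp only [Fin.sum_univ_one]
    exact congrArg (TransferStalk.mk 𝒜 i · _) (map_one (Y.presheaf.germ F.W y.1 y.2).hom).symm
  · rw [picard_mk, TransferStalk.op_smul_mk, TransferStalk.smul_mk, mul_one]

/-- The derivation part is the Lie bracket of the two fields on `Y`; the operator part is the
commutator in `A`, which has order at most `1 + 1 - 1`. The mixed terms cancel. -/
lemma isPicardSection_commutator (j l : Fin F.m) : IsPicardSection 𝒜 i F.W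
    (fun y => F.picard j y * F.picard l y - F.picard l y * F.picard j y) := by
  refine ⟨_, fun y => TransferStalk.mk 𝒜 i 1 (F.opGerm y.2 (Sum.inl j) * F.opGerm y.2 (Sum.inl l) -
    F.opGerm y.2 (Sum.inl l) * F.opGerm y.2 (Sum.inl j)), (F.δ_field j).commutator (F.δ_field l),
    ⟨F.U, F.le, 1, fun _ => 1, fun _ => ⟨F.d (Sum.inl j) * F.d (Sum.inl l) -
      F.d (Sum.inl l) * F.d (Sum.inl j), 𝒜.commutator 1 1 _ _ (F.d_mem _) _ (F.d_mem _)⟩,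
      fun y => ?_⟩, fun y c q => ?_⟩
  · simp only [Fin.sum_univ_one]
    refine congrArg₂ _ (map_one (Y.presheaf.germ F.W y.1 y.2).hom).symm ?_
    exact ((map_sub _ _ _).trans (congrArg₂ _ (map_mul _ _ _) (map_mul _ _ _))).symm
  · rw [TransferStalk.op_smul_mk, TransferStalk.smul_mk, mul_one, LinearMap.sub_apply,
      Module.End.mul_apply, Module.End.mul_apply, picard_mk, picard_mk, map_add, map_add,
      picard_mk, picard_mk, picard_mk, picard_mk, Derivation.commutator_apply, sub_mul,
      TransferStalk.mk_sub_right, TransferStalk.mk_sub_left, mul_assoc, mul_assoc]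
    abel

end Frame

end TwistedD

namespace TwistedD

variable {X Y S : Scheme.{u}} {x : X ⟶ S} {𝒜 : TDO x} {i : Y ⟶ X}

/-! ### Picard sections in a frame and the generators of the pullback tdo -/

namespace Frame

variable (F : Frame 𝒜 i) {y : Y}

/-- Being well defined on the tensor product forces `D` and the operator to have the same image in
`i^*Θ_X`. The normal components of that image are therefore zero, and `D` is the corresponding
combination of the `δ j`. -/
lemma eq_of_compat [IsImmersion i] (hy : y ∈ F.W) {D : TangentStalk (i ≫ x) y}
    {φ : EndStalk 𝒜 i y} (C₀ : Y.presheaf.stalk y) (C : Fin F.m ⊕ Fin F.r → Y.presheaf.stalk y)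
    (hφ : ∀ c q, φ (TransferStalk.mk 𝒜 i c q) = TransferStalk.mk 𝒜 i (D c) q +
      (TransferStalk.mk 𝒜 i (c * C₀) q +
        ∑ j, TransferStalk.mk 𝒜 i (c * C j) (F.opGerm hy j * q))) :
    φ = scalarEnd 𝒜 i C₀ + ∑ j, scalarEnd 𝒜 i (C (Sum.inl j)) * F.picard j ⟨y, hy⟩ := by
  let ρ := algebraMap (X.presheaf.stalk (i y)) (Y.presheaf.stalk y)
  have h1 : ∀ f : X.presheaf.stalk (i y), D (ρ f) = ∑ j, C j * ρ (F.symbolGerm hy j f) := by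
    intro f
    -- Both arguments are the same tensor. Computing `φ` on each of them and cancelling common terms
    -- leaves an identity in `𝒪_Y ⊗ 1`.
    have h2 : φ (TransferStalk.mk 𝒜 i (ρ f) 1) = φ (TransferStalk.mk 𝒜 i 1 (𝒜.ιStalk (i y) f)) := by
      have := TransferStalk.mk_smul_right (𝒜 := 𝒜) f (1 : Y.presheaf.stalk y) 1
      rw [FilteredRing.smul_def, mul_one, mul_one] at this
      rw [this]
    have h3 : ∀ j, TransferStalk.mk 𝒜 i (C j) (F.opGerm hy j * 𝒜.ιStalk (i y) f) =
        TransferStalk.mk 𝒜 i (ρ f * C j) (F.opGerm hy j) +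
          TransferStalk.mk 𝒜 i (C j * ρ (F.symbolGerm hy j f)) 1 := fun j => by
      rw [← sub_add_cancel (F.opGerm hy j * 𝒜.ιStalk (i y) f)
        (𝒜.ιStalk (i y) f * F.opGerm hy j), F.hasSymbol hy j f, TransferStalk.mk_add_right,
        ← mul_one (𝒜.ιStalk (i y) (F.symbolGerm hy j f)), ← FilteredRing.smul_def,
        ← FilteredRing.smul_def, TransferStalk.mk_smul_right, TransferStalk.mk_smul_right,
        add_comm, mul_comm (algebraMap _ _ (F.symbolGerm hy j f))]
    have h4 : ∀ (s : Finset (Fin F.m ⊕ Fin F.r)) (c : Fin F.m ⊕ Fin F.r → Y.presheaf.stalk y),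
        TransferStalk.mk 𝒜 i (∑ j ∈ s, c j) 1 = ∑ j ∈ s, TransferStalk.mk 𝒜 i (c j) 1 :=
      fun s c => TensorProduct.sum_tmul _ _ _
    refine F.mk_one_injective hy ?_
    rw [hφ, hφ, Derivation.map_one_eq_zero, TransferStalk.mk_zero_left, zero_add] at h2
    simp only [one_mul, mul_one, h3, Finset.sum_add_distrib] at h2
    have h5 : TransferStalk.mk 𝒜 i C₀ (𝒜.ιStalk (i y) f) = TransferStalk.mk 𝒜 i (ρ f * C₀) 1 := by
      rw [← TransferStalk.mk_smul_right, FilteredRing.smul_def, mul_one]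
    rw [h5] at h2
    rw [h4]
    exact add_right_cancel (h2.trans ((add_assoc _ _ _).symm.trans (add_comm _ _)))
  -- A normal coordinate restricts to zero on `Y`, while duality makes the right side of `h1` equal
  -- to the coefficient of the matching operator.
  have h2 : ∀ l, C (Sum.inr l) = 0 := fun l => by
    have h3 := h1 (F.coordGerm hy (Sum.inr l))
    have h4 : ∀ j, F.symbolGerm hy j (F.coordGerm hy (Sum.inr l)) = if j = Sum.inr l then 1 else 0 :=
      fun j => (F.isCoordinates hy).dual j _
    simp only [h4] at h3
    rw [show ρ (F.coordGerm hy (Sum.inr l)) = 0 from F.coordGerm_inr hy l, map_zero] at h3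
    rw [h3]
    simp only [apply_ite ρ, map_one, map_zero, mul_ite, mul_one, mul_zero, Finset.sum_ite_eq',
      Finset.mem_univ, if_true]
  have h3 : ∀ c, D c = ∑ j, C (Sum.inl j) * F.δ j ⟨y, hy⟩ c := fun c => by
    obtain ⟨f, rfl⟩ := i.stalkMap_surjective y c
    refine (h1 f).trans ?_
    rw [Fintype.sum_sum_type]
    simp only [h2, zero_mul, Finset.sum_const_zero, add_zero]
    exact Finset.sum_congr rfl fun j _ => congrArg _ (F.compat j ⟨y, hy⟩ f).symm
  refine TransferStalk.end_ext fun c q => ?_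
  have h4 : ∀ (s : Finset (Fin F.m)) (c : Fin F.m → Y.presheaf.stalk y),
      TransferStalk.mk 𝒜 i (∑ j ∈ s, c j) q = ∑ j ∈ s, TransferStalk.mk 𝒜 i (c j) q :=
    fun s c => TensorProduct.sum_tmul _ _ _
  rw [hφ, h3, h4, LinearMap.add_apply, LinearMap.sum_apply, Fintype.sum_sum_type]
  simp only [h2, mul_zero, TransferStalk.mk_zero_left, Finset.sum_const_zero, add_zero]
  have h5 : ∀ j, (scalarEnd 𝒜 i (C (Sum.inl j)) * F.picard j ⟨y, hy⟩) (TransferStalk.mk 𝒜 i c q) =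
      TransferStalk.mk 𝒜 i (C (Sum.inl j) * F.δ j ⟨y, hy⟩ c) q +
        TransferStalk.mk 𝒜 i (c * C (Sum.inl j)) (F.opGerm hy (Sum.inl j) * q) := fun j => by
    change C (Sum.inl j) • F.picard j ⟨y, hy⟩ (TransferStalk.mk 𝒜 i c q) = _
    rw [F.picard_mk, smul_add, TransferStalk.smul_mk, TransferStalk.smul_mk, mul_comm c]
  simp only [h5, Finset.sum_add_distrib]
  have h6 : scalarEnd 𝒜 i C₀ (TransferStalk.mk 𝒜 i c q) = TransferStalk.mk 𝒜 i (c * C₀) q := by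
    rw [mul_comm]; rfl
  rw [h6]
  abel

/-- Sections of the Picard algebroid near a point are combinations of the sections of the frame. -/
lemma exists_picard_expansion [IsImmersion i] (hy : y ∈ F.W) {W : Y.Opens} (hyW : y ∈ W)
    {Φ : ∀ y : W, EndStalk 𝒜 i y.1} (hΦ : IsPicardSection 𝒜 i W Φ) :
    ∃ (V : Y.Opens) (_ : y ∈ V) (h : V ≤ W) (h' : V ≤ F.W) (c₀ : Γ(Y, V))
      (c : Fin F.m → Γ(Y, V)), ∀ y' (hy' : y' ∈ V), Φ ⟨y', h hy'⟩ =
        scalarEnd 𝒜 i (Y.presheaf.germ V y' hy' c₀) +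
          ∑ j, scalarEnd 𝒜 i (Y.presheaf.germ V y' hy' (c j)) * F.picard j ⟨y', h' hy'⟩ := by
  obtain ⟨D, t, -, ⟨U, hU, n, b, a, ht⟩, hΦ⟩ := hΦ
  -- The operator part is a finite sum of terms `b ⊗ a`. Each `a` is expanded in the operators of
  -- the frame, on a neighbourhood common to all terms.
  obtain ⟨V, hyV, hexp⟩ := exists_open_forall (z := i y) (J := Fin n)
    (p := fun k (V : X.Opens) => ∃ (h : V ≤ U) (h' : V ≤ F.U) (g₀ : Γ(X, V))
      (g : Fin F.m ⊕ Fin F.r → Γ(X, V)), ∀ z (hz : z ∈ V),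
        𝒜.germ (h hz) (a k).1 = X.presheaf.germ V z hz g₀ • 1 +
          ∑ j, X.presheaf.germ V z hz (g j) • 𝒜.germ (h' hz) (F.d j))
    (fun k V V' hV ⟨h, h', g₀, g, hg⟩ => ⟨hV.trans h, hV.trans h',
      X.presheaf.map (homOfLE hV).op g₀, fun j => X.presheaf.map (homOfLE hV).op (g j),
      fun z hz => by
        simp only [TopCat.Presheaf.germ_res_apply X.presheaf (homOfLE hV) z hz]
        exact hg z (hV hz)⟩) (fun k => by
      obtain ⟨V, hyV, h, h', g₀, g, hg⟩ := F.exists_expansion_one hy (a k).2 (hU hyW)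
      exact ⟨V, hyV, h, h', g₀, g, hg⟩)
  choose h h' g₀ g hg using hexp
  have hW' : i ⁻¹ᵁ V ⊓ (W ⊓ F.W) ≤ W := inf_le_right.trans inf_le_left
  have hF' : i ⁻¹ᵁ V ⊓ (W ⊓ F.W) ≤ F.W := inf_le_right.trans inf_le_right
  have hV' : i ⁻¹ᵁ V ⊓ (W ⊓ F.W) ≤ i ⁻¹ᵁ V := inf_le_left
  let s : Γ(X, V) → Γ(Y, i ⁻¹ᵁ V ⊓ (W ⊓ F.W)) := fun g =>
    Y.presheaf.map (homOfLE hV').op (i.app V g)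
  let bb : Fin n → Γ(Y, i ⁻¹ᵁ V ⊓ (W ⊓ F.W)) := fun k => Y.presheaf.map (homOfLE hW').op (b k)
  refine ⟨i ⁻¹ᵁ V ⊓ (W ⊓ F.W), ⟨hyV, hyW, hy⟩, hW', hF', ∑ k, bb k * s (g₀ k),
    fun j => ∑ k, bb k * s (g k (Sum.inl j)), fun y' hy' => ?_⟩
  have hs : ∀ f : Γ(X, V), Y.presheaf.germ _ y' hy' (s f) =
      algebraMap (X.presheaf.stalk (i y')) _ (X.presheaf.germ V (i y') (hV' hy') f) := fun f =>
    (TopCat.Presheaf.germ_res_apply Y.presheaf (homOfLE hV') y' hy' _).trans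
      (algebraMap_germ i (hV' hy') f).symm
  have hb : ∀ k, Y.presheaf.germ _ y' hy' (bb k) = Y.presheaf.germ W y' (hW' hy') (b k) := fun k =>
    TopCat.Presheaf.germ_res_apply Y.presheaf (homOfLE hW') y' hy' _
  refine F.eq_of_compat (hF' hy') (D := D ⟨y', hW' hy'⟩) _
    (fun j => Y.presheaf.germ _ y' hy' (∑ k, bb k * s (g k j))) fun c q => ?_
  refine (hΦ ⟨y', hW' hy'⟩ c q).trans (congrArg _ ?_)
  rw [ht, Finset.smul_sum, Finset.smul_sum]
  have h4 : ∀ (c : Fin n → Y.presheaf.stalk y') (a : 𝒜.Stalk (i y')),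
      TransferStalk.mk 𝒜 i (∑ j, c j) a = ∑ j, TransferStalk.mk 𝒜 i (c j) a :=
    fun c a => TensorProduct.sum_tmul _ _ _
  simp only [map_sum, map_mul, hs, hb, Finset.mul_sum, h4]
  rw [Finset.sum_comm, ← Finset.sum_add_distrib]
  refine Finset.sum_congr rfl fun k _ => ?_
  refine (congrArg (fun a => c • MulOpposite.op q • TransferStalk.mk 𝒜 i _ a)
    (hg k (i y') (hV' hy'))).trans ?_
  rw [TransferStalk.op_smul_mk, add_mul, TransferStalk.mk_add_right, smul_add, Finset.sum_mul,
    TransferStalk.mk_sum_right, Finset.smul_sum]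
  refine congrArg₂ _ ?_ (Finset.sum_congr rfl fun j _ => ?_)
  · rw [FilteredRing.smul_def, mul_one, ← FilteredRing.smul_def, TransferStalk.mk_smul_right,
      TransferStalk.smul_mk]
    exact congrArg (fun c => TransferStalk.mk 𝒜 i c q) (congrArg _ (mul_comm _ _))
  · rw [FilteredRing.smul_def, mul_assoc, ← FilteredRing.smul_def, TransferStalk.mk_smul_right,
      TransferStalk.smul_mk]
    exact congrArg (fun c => TransferStalk.mk 𝒜 i c _) (congrArg _ (mul_comm _ _))

lemma isPicard_picard (j : Fin F.m) (y : F.W) : IsPicard 𝒜 i (F.picard j y) :=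
  ⟨F.W, y.2, _, F.isPicardSection_picard j, rfl⟩

/-- The elements of the pullback tdo given by the operators of the frame along `Y`. -/
noncomputable def gen (j : Fin F.m) (y : F.W) : PullbackStalk 𝒜 i y.1 := (F.isPicard_picard j y).ι

/-- The derivation part acts on `1` and vanishes, so on `1 ⊗ q` only left multiplication by the
operator is left. This links monomials in `i^·A` to monomials in `A`. -/
lemma gen_smul_mk_one (j : Fin F.m) (y : F.W) (q : 𝒜.Stalk (i y.1)) :
    F.gen j y • TransferStalk.mk 𝒜 i 1 q =
      TransferStalk.mk 𝒜 i 1 (F.opGerm y.2 (Sum.inl j) * q) := by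
  rw [gen, IsPicard.ι_smul_transfer, F.picard_mk, Derivation.map_one_eq_zero,
    TransferStalk.mk_zero_left, zero_add]

lemma sortedMonomial_gen_smul (s : Multiset (Fin F.m)) (y : F.W) (q : 𝒜.Stalk (i y.1)) :
    sortedMonomial (F.gen · y) s • TransferStalk.mk 𝒜 i 1 q =
      TransferStalk.mk 𝒜 i 1 (sortedMonomial (fun j => F.opGerm y.2 (Sum.inl j)) s * q) := by
  unfold sortedMonomial
  induction s.sort (· ≤ ·) with
  | nil => simp
  | cons j l ih =>
    rw [List.map_cons, List.prod_cons, mul_smul, ih, F.gen_smul_mk_one, List.map_cons,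
      List.prod_cons, mul_assoc]

/-- The bracket of the Picard section with a function is the derivative of that function, and the
enveloping algebra turns brackets into commutators. -/
lemma gen_mul_scalar (j : Fin F.m) (y : F.W) (c : Y.presheaf.stalk y.1) :
    F.gen j y * pullbackScalar 𝒜 i y.1 c =
      pullbackScalar 𝒜 i y.1 c * F.gen j y + pullbackScalar 𝒜 i y.1 (F.δ j y c) := by
  have := (F.isPicard_picard j y).ι_bracket (isPicard_scalarEnd c)
    (isPicard_scalarEnd (F.δ j y c)) (TransferStalk.end_ext fun b q => by
      change F.δ j y c • TransferStalk.mk 𝒜 i b q =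
        F.picard j y (c • TransferStalk.mk 𝒜 i b q) - c • F.picard j y (TransferStalk.mk 𝒜 i b q)
      rw [TransferStalk.smul_mk, TransferStalk.smul_mk, F.picard_mk, F.picard_mk, smul_add,
        TransferStalk.smul_mk, TransferStalk.smul_mk, Derivation.leibniz,
        TransferStalk.mk_add_left, smul_eq_mul, smul_eq_mul, mul_comm b]
      abel)
  exact sub_eq_iff_eq_add'.mp this.symm

end Frame

end TwistedD

namespace TwistedD

/-! ### Local expansions of sections of the pullback tdo -/

section Monomials

variable {B P B' P' : Type*} [CommRing B] [Ring P] {β : B →+* P} [CommRing B'] [Ring P']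
  {β' : B' →+* P'} {n : ℕ} {p : Fin n → P} {p' : Fin n → P'}

lemma map_mem_wordSpan (ψ : P →+* P') (γ : B →+* B') (hβ : ∀ c, ψ (β c) = β' (γ c))
    (hp : ∀ j, ψ (p j) = p' j) {k : ℕ} {a : P} (ha : a ∈ wordSpan β p k) :
    ψ a ∈ wordSpan β' p' k := by
  induction ha using AddSubgroup.closure_induction with
  | mem a ha =>
    obtain ⟨c, l, hl, rfl⟩ := ha
    rw [map_mul, hβ, map_list_prod, List.map_map]
    simp only [Function.comp_def, hp]
    exact word_mem_wordSpan _ _ hl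
  | zero => rw [map_zero]; exact zero_mem _
  | add a b _ _ ha hb => rw [map_add]; exact add_mem ha hb
  | neg a _ ha => rw [map_neg]; exact neg_mem ha

lemma map_mem_monomialSpan (ψ : P →+* P') (γ : B →+* B') (hβ : ∀ c, ψ (β c) = β' (γ c))
    (hp : ∀ j, ψ (p j) = p' j) {a : P} (ha : a ∈ monomialSpan β p) :
    ψ a ∈ monomialSpan β' p' := by
  induction ha using AddSubgroup.closure_induction with
  | mem a ha =>
    obtain ⟨c, s, rfl⟩ := ha
    rw [map_mul, hβ, map_sortedMonomial]
    simp only [hp]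
    exact AddSubgroup.subset_closure ⟨_, _, rfl⟩
  | zero => rw [map_zero]; exact zero_mem _
  | add a b _ _ ha hb => rw [map_add]; exact add_mem ha hb
  | neg a _ ha => rw [map_neg]; exact neg_mem ha

end Monomials

variable {X Y S : Scheme.{u}} {x : X ⟶ S} {𝒜 : TDO x} {i : Y ⟶ X}

variable (𝒜 i) in
/-- The functions on `V` as families of germs of `i^·A`. -/
noncomputable def scalarFamily (V : Y.Opens) :
    Γ(Y, V) →+* ∀ y : V, (pullback 𝒜 i).stalk y.1 :=
  RingHom.pi fun y => (pullbackScalar 𝒜 i y.1).comp (Y.presheaf.germ V y.1 y.2).hom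

lemma res_scalarFamily {U V : Y.Opens} (h : V ≤ U) (c : Γ(Y, U)) :
    (pullback 𝒜 i).resHom h (scalarFamily 𝒜 i U c) =
      scalarFamily 𝒜 i V ((Y.presheaf.map (homOfLE h).op).hom c) :=
  funext fun y => congrArg (pullbackScalar 𝒜 i y.1)
    (TopCat.Presheaf.germ_res_apply Y.presheaf (homOfLE h) y.1 y.2 c).symm

namespace Frame

variable (F : Frame 𝒜 i) {y : Y}

/-- The generators of the pullback tdo as families of germs over `V`. -/
noncomputable def genFamily {V : Y.Opens} (h : V ≤ F.W) (j : Fin F.m) (y : V) :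
    (pullback 𝒜 i).stalk y.1 :=
  F.gen j ⟨y.1, h y.2⟩

lemma exists_genFamily_mul {V : Y.Opens} (h : V ≤ F.W) (j : Fin F.m) (c : Γ(Y, V)) :
    ∃ c' : Γ(Y, V), F.genFamily h j * scalarFamily 𝒜 i V c =
      scalarFamily 𝒜 i V c * F.genFamily h j + scalarFamily 𝒜 i V c' := by
  obtain ⟨c', hc'⟩ := F.δ_field j V h c
  refine ⟨c', funext fun y => (F.gen_mul_scalar j ⟨y.1, h y.2⟩ _).trans ?_⟩
  exact congrArg (fun b => _ + pullbackScalar 𝒜 i y.1 b) (hc' y.1 y.2)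

/-- The expansion of a Picard section as an endomorphism is transported into the enveloping algebra
by its additivity and scalar relations. It involves only words of length zero and one. -/
lemma mem_wordSpan_of_picard [IsImmersion i] (hy : y ∈ F.W) {W : Y.Opens} (hyW : y ∈ W)
    {Φ : ∀ y : W, EndStalk 𝒜 i y.1} (hΦ : IsPicardSection 𝒜 i W Φ) :
    ∃ (V : Y.Opens) (_ : y ∈ V) (h : V ≤ W) (h' : V ≤ F.W),
      (fun y' : V => (IsPicard.ι 𝒜 i (φ := Φ ⟨y'.1, h y'.2⟩) ⟨W, h y'.2, Φ, hΦ, rfl⟩ :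
          (pullback 𝒜 i).stalk y'.1)) ∈
        wordSpan (scalarFamily 𝒜 i V) (F.genFamily h') 1 := by
  obtain ⟨V, hyV, h, h', c₀, c, hc⟩ := F.exists_picard_expansion hy hyW hΦ
  refine ⟨V, hyV, h, h', ?_⟩
  have h1 : (fun y' : V => (IsPicard.ι 𝒜 i (φ := Φ ⟨y'.1, h y'.2⟩) ⟨W, h y'.2, Φ, hΦ, rfl⟩ :
          (pullback 𝒜 i).stalk y'.1)) = scalarFamily 𝒜 i V c₀ * (([] : List _).map (F.genFamily h')).prod +
        ∑ j, scalarFamily 𝒜 i V (c j) * ([j].map (F.genFamily h')).prod := by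
    funext y'
    refine (IsPicard.ι_eq_sum Finset.univ (fun j => F.isPicard_picard j ⟨y'.1, h' y'.2⟩) _
      (fun j => Y.presheaf.germ V y'.1 y'.2 (c j)) _ (hc y'.1 y'.2)).trans ?_
    simp only [List.map_nil, List.prod_nil, mul_one, List.map_cons, List.prod_cons]
    rw [Pi.add_apply, Finset.sum_apply]
    rfl
  rw [h1]
  exact add_mem (word_mem_wordSpan _ _ (by simp))
    (sum_mem fun j _ => word_mem_wordSpan _ _ (by simp))

/-- Expansions restrict, so one neighbourhood controls the commutators on all smaller open sets.
Straightening can then be done on any of them. -/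
lemma exists_commutator_mem_wordSpan [IsImmersion i] (hy : y ∈ F.W) :
    ∃ (V₀ : Y.Opens) (_ : y ∈ V₀), ∀ (V : Y.Opens) (h : V ≤ F.W), V ≤ V₀ →
      ∀ j l, F.genFamily h j * F.genFamily h l - F.genFamily h l * F.genFamily h j ∈
        wordSpan (scalarFamily 𝒜 i V) (F.genFamily h) 1 := by
  obtain ⟨V₀, hyV, hV⟩ := exists_open_forall (z := y) (J := Fin F.m × Fin F.m)
    (p := fun k (V₀ : Y.Opens) => ∀ (V : Y.Opens) (h : V ≤ F.W), V ≤ V₀ →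
      F.genFamily h k.1 * F.genFamily h k.2 - F.genFamily h k.2 * F.genFamily h k.1 ∈
        wordSpan (scalarFamily 𝒜 i V) (F.genFamily h) 1)
    (fun k U U' hU' hU V h hV => hU V h (hV.trans hU')) (fun k => by
      obtain ⟨V₀, hyV, h, h', hmem⟩ :=
        F.mem_wordSpan_of_picard hy hy (F.isPicardSection_commutator k.1 k.2)
      refine ⟨V₀, hyV, fun V hVF hV => ?_⟩
      have h1 := map_mem_wordSpan (β' := scalarFamily 𝒜 i V) (p' := F.genFamily hVF)
        ((pullback 𝒜 i).resHom hV) (Y.presheaf.map (homOfLE hV).op).hom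
        (res_scalarFamily hV) (fun j => rfl) hmem
      convert h1 using 1
      funext y'
      exact ((F.isPicard_picard k.1 ⟨y'.1, hVF y'.2⟩).ι_bracket (F.isPicard_picard k.2 _)
        _ rfl).symm)
  exact ⟨V₀, hyV, fun V h hVV j l => hV (j, l) V h hVV⟩

lemma res_mem_monomialSpan {V₁ U U' : Y.Opens} {b : ∀ y : V₁, (pullback 𝒜 i).stalk y.1}
    (hU : U ≤ V₁) (hU' : U ≤ F.W) (h : U' ≤ U)
    (hmem : (pullback 𝒜 i).resHom hU b ∈
      monomialSpan (scalarFamily 𝒜 i U) (F.genFamily hU')) :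
    (pullback 𝒜 i).resHom (h.trans hU) b ∈
      monomialSpan (scalarFamily 𝒜 i U') (F.genFamily (h.trans hU')) :=
  map_mem_monomialSpan (β := scalarFamily 𝒜 i U) (p := F.genFamily hU')
    (β' := scalarFamily 𝒜 i U') (p' := F.genFamily (h.trans hU')) ((pullback 𝒜 i).resHom h)
    (Y.presheaf.map (homOfLE h).op).hom (res_scalarFamily h) (fun _ => rfl) hmem

lemma one_mem_monomialSpan {V : Y.Opens} (h : V ≤ F.W) :
    1 ∈ monomialSpan (scalarFamily 𝒜 i V) (F.genFamily h) :=
  AddSubgroup.subset_closure ⟨1, 0, by rw [map_one, sortedMonomial_zero, one_mul]⟩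

lemma mem_monomialSpan_of_gens [IsImmersion i] (hy : y ∈ F.W) {V₀ : Y.Opens} (hyV₀ : y ∈ V₀)
    (hcomm : ∀ (V : Y.Opens) (h : V ≤ F.W), V ≤ V₀ →
      ∀ j l, F.genFamily h j * F.genFamily h l - F.genFamily h l * F.genFamily h j ∈
        wordSpan (scalarFamily 𝒜 i V) (F.genFamily h) 1) {V₁ : Y.Opens} (hyV₁ : y ∈ V₁)
    {b : ∀ y : V₁, (pullback 𝒜 i).stalk y.1} (hb : b ∈ resGens (pullback 𝒜 i).gens V₁) :
    ∃ (V : Y.Opens) (_ : y ∈ V) (h : V ≤ V₁) (h' : V ≤ F.W), V ≤ V₀ ∧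
      (pullback 𝒜 i).resHom h b ∈ monomialSpan (scalarFamily 𝒜 i V) (F.genFamily h') := by
  obtain ⟨U, hU, t, ⟨Φ, hΦ, ht⟩, rfl⟩ := hb
  obtain ⟨V, hyV, h, h', hmem⟩ := F.mem_wordSpan_of_picard hy (hU hyV₁) hΦ
  have hV : V ⊓ (V₁ ⊓ V₀) ≤ V₁ := inf_le_right.trans inf_le_left
  refine ⟨V ⊓ (V₁ ⊓ V₀), ⟨hyV, hyV₁, hyV₀⟩, hV, inf_le_left.trans h',
    inf_le_right.trans inf_le_right, ?_⟩
  refine wordSpan_le_monomialSpan (F.exists_genFamily_mul _)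
    (hcomm _ _ (inf_le_right.trans inf_le_right)) 1 ?_
  have h1 := map_mem_wordSpan (β' := scalarFamily 𝒜 i (V ⊓ (V₁ ⊓ V₀)))
    (p' := F.genFamily (inf_le_left.trans h'))
    ((pullback 𝒜 i).resHom inf_le_left) (Y.presheaf.map (homOfLE inf_le_left).op).hom
    (res_scalarFamily inf_le_left) (fun j => rfl) hmem
  convert h1 using 1
  funext y'
  exact ht ⟨y'.1, hU (hV y'.2)⟩

/-- Sections of the pullback tdo are locally combinations of sorted monomials of the frame. -/
lemma exists_mem_monomialSpan [IsImmersion i] (hy : y ∈ F.W) {V₁ : Y.Opens} (hyV₁ : y ∈ V₁)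
    {b : ∀ y : V₁, (pullback 𝒜 i).stalk y.1} (hb : b ∈ (pullback 𝒜 i).pre V₁) :
    ∃ (V : Y.Opens) (_ : y ∈ V) (h : V ≤ V₁) (h' : V ≤ F.W),
      (pullback 𝒜 i).resHom h b ∈ monomialSpan (scalarFamily 𝒜 i V) (F.genFamily h') := by
  obtain ⟨V₀, hyV₀, hcomm⟩ := F.exists_commutator_mem_wordSpan hy
  -- The bound `V ≤ V₀` is carried through the induction because, in the product case, the sorted
  -- monomials span a ring only where commutators are under control.
  suffices key : ∃ (V : Y.Opens) (_ : y ∈ V) (h : V ≤ V₁) (h' : V ≤ F.W), V ≤ V₀ ∧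
      (pullback 𝒜 i).resHom h b ∈ monomialSpan (scalarFamily 𝒜 i V) (F.genFamily h') by
    obtain ⟨V, hyV, h, h', -, hV⟩ := key
    exact ⟨V, hyV, h, h', hV⟩
  induction hb using Subring.closure_induction with
  | mem b hb => exact F.mem_monomialSpan_of_gens hy hyV₀ hcomm hyV₁ hb
  | zero =>
    refine ⟨V₁ ⊓ V₀ ⊓ F.W, ⟨⟨hyV₁, hyV₀⟩, hy⟩, inf_le_left.trans inf_le_left, inf_le_right,
      inf_le_left.trans inf_le_right, zero_mem (monomialSpan _ _)⟩
  | one =>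
    refine ⟨V₁ ⊓ V₀ ⊓ F.W, ⟨⟨hyV₁, hyV₀⟩, hy⟩, inf_le_left.trans inf_le_left, inf_le_right,
      inf_le_left.trans inf_le_right, F.one_mem_monomialSpan _⟩
  | neg b _ hb =>
    obtain ⟨V, hyV, h, h', hV, hb⟩ := hb
    exact ⟨V, hyV, h, h', hV, neg_mem hb⟩
  | add b b' _ _ hb hb' =>
    obtain ⟨V, hyV, h, h', hV, hb⟩ := hb
    obtain ⟨V', hyV', k, k', hV', hb'⟩ := hb'
    exact ⟨V ⊓ V', ⟨hyV, hyV'⟩, inf_le_left.trans h, inf_le_left.trans h', inf_le_left.trans hV,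
      add_mem (F.res_mem_monomialSpan h h' inf_le_left hb)
        (F.res_mem_monomialSpan k k' inf_le_right hb')⟩
  | mul b b' _ _ hb hb' =>
    obtain ⟨V, hyV, h, h', hV, hb⟩ := hb
    obtain ⟨V', hyV', k, k', hV', hb'⟩ := hb'
    exact ⟨V ⊓ V', ⟨hyV, hyV'⟩, inf_le_left.trans h, inf_le_left.trans h', inf_le_left.trans hV,
      (monomialSubring _ _ (F.exists_genFamily_mul _) (hcomm _ _ (inf_le_left.trans hV))).mul_mem
        (F.res_mem_monomialSpan h h' inf_le_left hb)
        (F.res_mem_monomialSpan k k' inf_le_right hb')⟩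

/-- Sections of the pullback tdo are locally combinations of sorted monomials of the frame. -/
lemma exists_pullback_expansion [IsImmersion i] (hy : y ∈ F.W) {W : Y.Opens} (hyW : y ∈ W)
    (b : (pullback 𝒜 i).sections W) :
    ∃ (V : Y.Opens) (_ : y ∈ V) (h : V ≤ W) (h' : V ≤ F.W) (s : Finset (Multiset (Fin F.m)))
      (c : Multiset (Fin F.m) → Γ(Y, V)), ∀ y' (hy' : y' ∈ V), bGerm (h hy') b =
        ∑ k ∈ s, pullbackScalar 𝒜 i y' (Y.presheaf.germ V y' hy' (c k)) *
          sortedMonomial (F.gen · ⟨y', h' hy'⟩) k := by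
  obtain ⟨V₁, hyV₁, h₁, hpre⟩ := b.2 ⟨y, hyW⟩
  obtain ⟨V, hyV, h, h', hmem⟩ := F.exists_mem_monomialSpan hy hyV₁ hpre
  obtain ⟨c, hc⟩ := exists_eq_sum_of_mem_monomialSpan hmem
  refine ⟨V, hyV, h.trans h₁.le, h', c.support, c, fun y' hy' => ?_⟩
  refine (congrFun hc ⟨y', hy'⟩).trans ?_
  rw [Finsupp.sum, Finset.sum_apply]
  refine Finset.sum_congr rfl fun k _ => congrArg
    (fun q => pullbackScalar 𝒜 i y' (Y.presheaf.germ V y' hy' (c k)) * q) ?_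
  exact map_sortedMonomial (Pi.evalRingHom (fun y : V => (pullback 𝒜 i).stalk y.1) ⟨y', hy'⟩) _ k

end Frame

end TwistedD

namespace TwistedD

variable {X Y S : Scheme.{u}} {x : X ⟶ S} {𝒜 : TDO x} {i : Y ⟶ X}

/-! ### Freeness of the transfer module over the pullback tdo -/

section PullbackStalks

lemma bGerm_res {U V : Y.Opens} (h : V ≤ U) {y : Y} (hy : y ∈ V) (b : (pullback 𝒜 i).sections U) :
    bGerm hy ((pullback 𝒜 i).sectionsRes h b) = bGerm (h hy) b := rfl

/-- Every element of a stalk of the pullback tdo is the germ of a section. -/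
lemma exists_bGerm_eq {y : Y} (b : PullbackStalk 𝒜 i y) :
    ∃ (U : Y.Opens) (hy : y ∈ U) (b' : (pullback 𝒜 i).sections U), bGerm hy b' = b := by
  obtain ⟨a, rfl⟩ := RingQuot.mkRingHom_surjective (EnvRel 𝒜 i y) b
  induction a using FreeAlgebra.induction with
  | grade0 n =>
    refine ⟨⊤, trivial, (n : (pullback 𝒜 i).sections ⊤), ?_⟩
    simp only [eq_intCast, map_intCast]
    rfl
  | grade1 φ =>
    obtain ⟨φ, W, hy, Φ, hΦ, rfl⟩ := φ
    exact ⟨W, hy, ⟨fun y' => picardι 𝒜 i ⟨Φ y', W, y'.2, Φ, hΦ, rfl⟩,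
      (pullback 𝒜 i).gens_subset_sections ⟨Φ, hΦ, fun _ => rfl⟩⟩, rfl⟩
  | mul a b ha hb =>
    obtain ⟨U, hy, a', ha⟩ := ha
    obtain ⟨U', hy', b', hb⟩ := hb
    refine ⟨U ⊓ U', ⟨hy, hy'⟩, (pullback 𝒜 i).sectionsRes inf_le_left a' *
      (pullback 𝒜 i).sectionsRes inf_le_right b', ?_⟩
    rw [map_mul, ← ha, ← hb]
    rfl
  | add a b ha hb =>
    obtain ⟨U, hy, a', ha⟩ := ha
    obtain ⟨U', hy', b', hb⟩ := hb
    refine ⟨U ⊓ U', ⟨hy, hy'⟩, (pullback 𝒜 i).sectionsRes inf_le_left a' +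
      (pullback 𝒜 i).sectionsRes inf_le_right b', ?_⟩
    rw [map_add, ← ha, ← hb]
    rfl

end PullbackStalks

namespace Frame

variable (F : Frame 𝒜 i) {y : Y} (hy : y ∈ F.W)

/-- The monomials of the frame normal to `Y`. -/
noncomputable def normalMonomial (t : Multiset (Fin F.r)) : 𝒜.Stalk (i y) :=
  sortedMonomial (fun l => F.opGerm hy (Sum.inr l)) t

lemma scalar_mul_sortedMonomial_smul (c : Y.presheaf.stalk y) (s : Multiset (Fin F.m))
    (t : Multiset (Fin F.r)) :
    (pullbackScalar 𝒜 i y c * sortedMonomial (F.gen · ⟨y, hy⟩) s) •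
      TransferStalk.mk 𝒜 i 1 (F.normalMonomial hy t) =
        c • TransferStalk.mk 𝒜 i 1 (pairMonomial (F.opGerm hy) (s, t)) := by
  rw [mul_smul, F.sortedMonomial_gen_smul, pullbackScalar_smul]
  rfl

lemma exists_eq_finsupp_sum [IsImmersion i] (b : PullbackStalk 𝒜 i y) :
    ∃ c : Multiset (Fin F.m) →₀ Y.presheaf.stalk y, b = c.sum fun s c =>
      pullbackScalar 𝒜 i y c * sortedMonomial (F.gen · ⟨y, hy⟩) s := by
  obtain ⟨U, hyU, b, rfl⟩ := exists_bGerm_eq b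
  obtain ⟨V, hyV, h, h', s, c, hc⟩ := F.exists_pullback_expansion hy hyU b
  refine ⟨∑ k ∈ s, Finsupp.single k (Y.presheaf.germ V y hyV (c k)), ?_⟩
  rw [hc y hyV, ← Finsupp.sum_finsetSum_index]
  · refine Finset.sum_congr rfl fun k _ => ?_
    rw [Finsupp.sum_single_index]
    rw [map_zero, zero_mul]
  · intro k
    rw [map_zero, zero_mul]
  · intro k a b
    rw [map_add, add_mul]

lemma smul_mk_normalMonomial_eq (c : Multiset (Fin F.m) →₀ Y.presheaf.stalk y)
    (e : Module.Basis (Multiset (Fin F.m) × Multiset (Fin F.r)) (Y.presheaf.stalk y)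
      (TransferStalk 𝒜 i y))
    (he : ∀ k, e k = TransferStalk.mk 𝒜 i 1 (pairMonomial (F.opGerm hy) k))
    (t : Multiset (Fin F.r)) :
    (c.sum fun s c => pullbackScalar 𝒜 i y c * sortedMonomial (F.gen · ⟨y, hy⟩) s) •
      TransferStalk.mk 𝒜 i 1 (F.normalMonomial hy t) = c.sum fun s c => c • e (s, t) := by
  rw [Finsupp.sum, Finset.sum_smul]
  refine Finset.sum_congr rfl fun k _ => ?_
  exact (F.scalar_mul_sortedMonomial_smul hy _ _ _).trans (congrArg (c k • ·) (he _).symm)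

/-- The transfer module is free over the pullback tdo on the monomials normal to `Y`. -/
lemma exists_basis_normalMonomial [IsImmersion i] :
    ∃ e : Module.Basis (Multiset (Fin F.r)) (PullbackStalk 𝒜 i y) (TransferStalk 𝒜 i y),
      ∀ t, e t = TransferStalk.mk 𝒜 i 1 (F.normalMonomial hy t) := by
  obtain ⟨e, he⟩ := F.exists_transfer_basis hy
  -- Only existence of these coefficients is known so far; comparison with the `𝒪_Y`-basis `e` of
  -- the transfer module supplies the missing independence.
  choose c hc using F.exists_eq_finsupp_sum hy
  have hli : LinearIndependent (PullbackStalk 𝒜 i y)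
      fun t => TransferStalk.mk 𝒜 i 1 (F.normalMonomial hy t) := by
    rw [linearIndependent_iff]
    intro l hl
    -- The pair `(s, t)` of a tangential and a normal monomial names exactly one vector of `e`, so
    -- each coefficient in a relation over `i^·A` appears as one coordinate.
    have h1 : ∀ t ∈ l.support, ∀ s, c (l t) s = 0 := by
      have h2 : (l.sum fun t b => (c b).sum fun s a => a • e (s, t)) = 0 := by
        rw [← hl, Finsupp.linearCombination_apply]
        refine Finsupp.sum_congr fun t _ => ?_
        conv_rhs => rw [hc (l t)]
        rw [F.smul_mk_normalMonomial_eq hy _ e he]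
      intro t ht s
      have h3 := congrArg (fun m => e.repr m (s, t)) h2
      simp only [Finsupp.sum, map_sum, map_smul, Module.Basis.repr_self, map_zero,
        Finsupp.finsetSum_apply, Finsupp.smul_apply, Finsupp.zero_apply] at h3
      rw [Finset.sum_eq_single t, Finset.sum_eq_single s] at h3
      · simpa using h3
      · intro s' _ hs'
        rw [Finsupp.single_eq_of_ne (by simpa using Ne.symm hs'), smul_zero]
      · intro hs
        rw [Finsupp.notMem_support_iff.mp hs, zero_smul]
      · intro t' _ ht'
        refine Finset.sum_eq_zero fun s' _ => ?_
        rw [Finsupp.single_eq_of_ne (by simp [Ne.symm ht']), smul_zero]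
      · exact fun h => absurd ht h
    ext t
    by_cases ht : t ∈ l.support
    · rw [hc (l t), show c (l t) = 0 from Finsupp.ext (h1 t ht)]
      rfl
    · exact Finsupp.notMem_support_iff.mp ht
  refine ⟨Module.Basis.mk hli fun m _ => ?_, fun t => by rw [Module.Basis.mk_apply]⟩
  rw [← e.linearCombination_repr m, Finsupp.linearCombination_apply]
  refine Submodule.sum_mem _ fun k _ => ?_
  -- Each vector of the `𝒪_Y`-basis is an element of `i^·A` applied to a normal monomial, which
  -- gives spanning.
  have h1 : (e.repr m k) • e k = (pullbackScalar 𝒜 i y (e.repr m k) *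
      sortedMonomial (F.gen · ⟨y, hy⟩) k.1) • TransferStalk.mk 𝒜 i 1 (F.normalMonomial hy k.2) := by
    rw [F.scalar_mul_sortedMonomial_smul hy, he]
  change (e.repr m k) • e k ∈ _
  rw [h1]
  exact Submodule.smul_mem _ _ (Submodule.subset_span ⟨k.2, rfl⟩)

/-- Sections of the pullback tdo with vanishing germ vanish near the point. -/
lemma exists_bGerm_eq_zero [IsImmersion i] (hy : y ∈ F.W) {W : Y.Opens} (hyW : y ∈ W)
    {b : (pullback 𝒜 i).sections W} (hb : bGerm hyW b = 0) :
    ∃ (V : Y.Opens) (_ : y ∈ V) (h : V ≤ W), (pullback 𝒜 i).sectionsRes h b = 0 := by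
  classical
  obtain ⟨e, he⟩ := F.exists_transfer_basis hy
  obtain ⟨V, hyV, h, h', s, c, hc⟩ := F.exists_pullback_expansion hy hyW b
  have h1 : ∀ k ∈ s, Y.presheaf.germ V y hyV (c k) = 0 := by
    -- Applying `b` to `1 ⊗ 1`, the empty normal monomial, displays the coefficients of `b` as
    -- coordinates. They vanish at `y`, hence in a neighbourhood, as there are finitely many.
    have h2 : ∑ k ∈ s, Y.presheaf.germ V y hyV (c k) • e (k, 0) = 0 := by
      rw [← zero_smul (PullbackStalk 𝒜 i y) (TransferStalk.mk 𝒜 i 1 (F.normalMonomial hy 0)), ← hb,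
        hc y hyV, Finset.sum_smul]
      refine Finset.sum_congr rfl fun k _ => ?_
      rw [he, F.scalar_mul_sortedMonomial_smul hy]
    intro k hk
    have h3 := congrArg (fun m => e.repr m (k, 0)) h2
    simp only [map_sum, map_smul, Module.Basis.repr_self, map_zero,
      Finsupp.finsetSum_apply, Finsupp.smul_apply, Finsupp.zero_apply] at h3
    rw [Finset.sum_eq_single k] at h3
    · simpa using h3
    · intro s' _ hs'
      rw [Finsupp.single_eq_of_ne (by simpa using Ne.symm hs'), smul_zero]
    · exact fun h => absurd hk h
  obtain ⟨V', hyV', hV'⟩ := exists_open_forall (z := y) (J := s)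
    (p := fun k (V' : Y.Opens) => ∀ y' (_ : y' ∈ V') (hy' : y' ∈ V),
      Y.presheaf.germ V y' hy' (c k.1) = 0)
    (fun k U U' hU hU' y' hy' => hU' y' (hU hy')) (fun k => by
      obtain ⟨W', hyW', hU, hV, hW'⟩ := exists_forall_germ_eq hyV hyV
        ((h1 k.1 k.2).trans (map_zero (Y.presheaf.germ V y hyV).hom).symm)
      exact ⟨W', hyW', fun y' hy' hy'' => (hW' y' hy').trans
        (map_zero (Y.presheaf.germ V y' hy'').hom)⟩)
  refine ⟨V' ⊓ V, ⟨hyV', hyV⟩, inf_le_right.trans h, Subtype.ext (funext fun y' => ?_)⟩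
  refine (hc y'.1 y'.2.2).trans (Finset.sum_eq_zero fun k hk => ?_)
  rw [hV' ⟨k, hk⟩ y'.1 y'.2.1 y'.2.2, map_zero, zero_mul]

end Frame

end TwistedD

namespace TwistedD

/-! ### Tensoring with a free module -/

section BalancedTensorBasis

namespace BalancedTensor

variable {K E V P : Type u} [CommRing K] [AddCommGroup E] [Module K E] [AddCommGroup V] [Ring P]
  [Module P E] {rel : V → V → (E → E) → Prop} (act : V →+ P →+ V)

/-- The tensor product with a free module. -/
lemma exists_repr {J : Type*} (act_mul : ∀ v b b', act v (b * b') = act (act v b) b')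
    (act_one : ∀ v, act v 1 = v)
    (hrel : ∀ v v' φ, rel v v' φ ↔ ∃ b, v' = act v b ∧ ∀ e, φ e = b • e)
    (hK : ∀ (f : K) (b : P) (e : E), f • b • e = b • f • e) (e : Module.Basis J P E) :
    ∃ Φ : BalancedTensor K E V rel ≃+ (J →₀ V),
      (∀ v m, Φ (mk K rel v m) = (e.repr m).mapRange (act v) (map_zero _)) ∧
      ∀ j v, Φ (mk K rel v (e j)) = Finsupp.single j v := by
  -- The candidate isomorphism lets the coordinates of `m` act on `v`; its inverse sends a family
  -- `(v_j)` to the sum of the `v_j ⊗ e_j`.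
  let φ : V →+ E →+ (J →₀ V) := AddMonoidHom.mk' (fun v => AddMonoidHom.mk'
      (fun m => (e.repr m).mapRange (act v) (map_zero _)) fun m m' => by
        rw [map_add, Finsupp.mapRange_add (fun b b' => map_add (act v) b b')])
    fun v v' => AddMonoidHom.ext fun m => Finsupp.ext fun j => by
      change act (v + v') _ = act v _ + act v' _
      rw [map_add]
      rfl
  have hφ : ∀ v m j, φ v m j = act v (e.repr m j) := fun v m j => rfl
  obtain ⟨Φ, hΦ⟩ := exists_lift (K := K) (rel := rel) φ (fun v v' ψ h => by
    obtain ⟨b, rfl, hψ⟩ := (hrel _ _ _).mp h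
    refine ⟨fun f m => by rw [hψ, hψ, hK], fun m => Finsupp.ext fun j => ?_⟩
    rw [hφ, hφ, hψ, map_smul, Finsupp.smul_apply, smul_eq_mul, act_mul])
  have hsingle : ∀ j v, Φ (mk K rel v (e j)) = Finsupp.single j v := fun j v => by
    rw [hΦ]
    refine Finsupp.ext fun l => ?_
    classical
    rw [hφ, e.repr_self, Finsupp.single_apply, Finsupp.single_apply]
    split_ifs
    · exact act_one v
    · exact map_zero _
  let Ψ : (J →₀ V) →+ BalancedTensor K E V rel :=
    Finsupp.liftAddHom fun j => (mkHom K rel).flip (e j)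
  have hΨ : ∀ j v, Ψ (Finsupp.single j v) = mk K rel v (e j) := fun j v =>
    Finsupp.liftAddHom_apply_single _ _ _
  have h1 : ∀ a, Φ (Ψ a) = a := fun a => by
    have : Φ.comp Ψ = AddMonoidHom.id _ := Finsupp.addHom_ext fun j v => by
      rw [AddMonoidHom.comp_apply, hΨ, hsingle]
      rfl
    exact DFunLike.congr_fun this a
  have h2 : ∀ a, Ψ (Φ a) = a := fun a => by
    induction a using induction_on with
    | mk v m =>
      rw [hΦ]
      have h3 : φ v m = (e.repr m).sum fun j b => Finsupp.single j (act v b) := by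
        refine Finsupp.ext fun l => ?_
        classical
        rw [hφ, Finsupp.sum, Finsupp.finsetSum_apply]
        simp only [Finsupp.single_apply]
        rw [Finset.sum_ite_eq']
        split_ifs with h
        · rfl
        · rw [Finsupp.notMem_support_iff.mp h, map_zero]
      rw [h3, Finsupp.sum, map_sum]
      conv_rhs => rw [← e.linearCombination_repr m, Finsupp.linearCombination_apply, Finsupp.sum,
        mk_sum_right]
      refine Finset.sum_congr rfl fun j _ => ?_
      rw [hΨ]
      have hr : rel v (act v (e.repr m j)) (fun m' => e.repr m j • m') :=
        (hrel _ _ _).mpr ⟨_, rfl, fun _ => rfl⟩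
      exact (mk_eq_mk hr (e j)).symm
    | add s t hs ht => rw [map_add, map_add, hs, ht]
  exact ⟨{ toFun := Φ, invFun := Ψ, left_inv := h2, right_inv := h1, map_add' := map_add Φ },
    hΦ, hsingle⟩

end BalancedTensor

end BalancedTensorBasis

variable {X Y S : Scheme.{u}} {x : X ⟶ S} {𝒜 : TDO x} {i : Y ⟶ X} (V : RightModule 𝒜 i)

/-- Restriction of sections of a right module. -/
noncomputable abbrev vRes {U W : Y.Opens} (h : W ≤ U) (v : V.val.obj (op U)) : V.val.obj (op W) :=
  V.val.map (homOfLE h).op v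

lemma vGerm_vRes {U W : Y.Opens} (h : W ≤ U) {y : Y} (hy : y ∈ W) (v : V.val.obj (op U)) :
    vGerm V hy (vRes V h v) = vGerm V (h hy) v :=
  TopCat.Presheaf.germ_res_apply (vPresheaf V) (homOfLE h) y hy v

lemma exists_vGerm_eq {y : Y} (v : VStalk V y) :
    ∃ (U : Y.Opens) (hy : y ∈ U) (w : V.val.obj (op U)), vGerm V hy w = v :=
  (vPresheaf V).exists_germ_eq v

lemma exists_vRes_eq {U W : Y.Opens} {y : Y} (hU : y ∈ U) (hW : y ∈ W) {v : V.val.obj (op U)}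
    {w : V.val.obj (op W)} (h : vGerm V hU v = vGerm V hW w) :
    ∃ (W' : Y.Opens) (_ : y ∈ W') (h : W' ≤ U) (h' : W' ≤ W), vRes V h v = vRes V h' w := by
  obtain ⟨W', hy, j, k, h⟩ := (vPresheaf V).germ_eq y hU hW v w h
  exact ⟨W', hy, j.le, k.le, h⟩

lemma vGerm_add {U : Y.Opens} {y : Y} (hy : y ∈ U) (v w : V.val.obj (op U)) :
    vGerm V hy (v + w) = vGerm V hy v + vGerm V hy w :=
  map_add ((vPresheaf V).germ U y hy).hom v w

lemma rightSMul_add_left {U : Y.Opens} (v w : V.val.obj (op U)) (b : (pullback 𝒜 i).sections U) :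
    rightSMul V (v + w) b = rightSMul V v b + rightSMul V w b := smul_add _ _ _

lemma rightSMul_add_right {U : Y.Opens} (v : V.val.obj (op U))
    (b b' : (pullback 𝒜 i).sections U) :
    rightSMul V v (b + b') = rightSMul V v b + rightSMul V v b' :=
  add_smul (R := (pullback 𝒜 i).op.sheaf.obj.obj (op U)) ((pullback 𝒜 i).opSection b)
    ((pullback 𝒜 i).opSection b') v

lemma rightSMul_mul {U : Y.Opens} (v : V.val.obj (op U)) (b b' : (pullback 𝒜 i).sections U) :
    rightSMul V v (b * b') = rightSMul V (rightSMul V v b) b' :=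
  mul_smul (α := (pullback 𝒜 i).op.sheaf.obj.obj (op U)) ((pullback 𝒜 i).opSection b')
    ((pullback 𝒜 i).opSection b) v

lemma rightSMul_one {U : Y.Opens} (v : V.val.obj (op U)) : rightSMul V v 1 = v :=
  one_smul ((pullback 𝒜 i).op.sheaf.obj.obj (op U)) v

lemma vRes_rightSMul {U W : Y.Opens} (h : W ≤ U) (v : V.val.obj (op U))
    (b : (pullback 𝒜 i).sections U) : vRes V h (rightSMul V v b) =
      rightSMul V (vRes V h v) ((pullback 𝒜 i).sectionsRes h b) :=
  V.val.map_smul (homOfLE h).op ((pullback 𝒜 i).opSection b) v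

/-! ### The right action on stalks of `V` -/

section Action

lemma exists_bGerm_pair {y : Y} (v : VStalk V y) (b : PullbackStalk 𝒜 i y) :
    ∃ (U : Y.Opens) (hy : y ∈ U) (w : V.val.obj (op U)) (b' : (pullback 𝒜 i).sections U),
      vGerm V hy w = v ∧ bGerm hy b' = b := by
  obtain ⟨U, hU, w, rfl⟩ := exists_vGerm_eq V v
  obtain ⟨W, hW, b, rfl⟩ := exists_bGerm_eq b
  exact ⟨U ⊓ W, ⟨hU, hW⟩, vRes V inf_le_left w, (pullback 𝒜 i).sectionsRes inf_le_right b,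
    vGerm_vRes V _ _ _, rfl⟩

variable [Smooth x] [Smooth (i ≫ x)] [IsImmersion i]

/-- The germ of a section of `i^·A` is here its value in an algebraic stalk, so equality of germs
does not by definition give equality nearby. `Frame.exists_bGerm_eq_zero` supplies this, and the
action on germs becomes well defined. -/
lemma vGerm_rightSMul_congr {U U' : Y.Opens} {y : Y} (hU : y ∈ U) (hU' : y ∈ U')
    {v : V.val.obj (op U)} {v' : V.val.obj (op U')} {b : (pullback 𝒜 i).sections U}
    {b' : (pullback 𝒜 i).sections U'} (hv : vGerm V hU v = vGerm V hU' v')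
    (hb : bGerm hU b = bGerm hU' b') :
    vGerm V hU (rightSMul V v b) = vGerm V hU' (rightSMul V v' b') := by
  obtain ⟨W, hW, h, h', hv⟩ := exists_vRes_eq V hU hU' hv
  obtain ⟨F, hF⟩ := exists_frame i 𝒜 y
  obtain ⟨W', hW', h'', hb⟩ := F.exists_bGerm_eq_zero hF hW
    (b := (pullback 𝒜 i).sectionsRes h b - (pullback 𝒜 i).sectionsRes h' b')
    (sub_eq_zero.mpr hb)
  rw [map_sub, sub_eq_zero] at hb
  rw [← vGerm_vRes V (h''.trans h) hW', ← vGerm_vRes V (h''.trans h') hW', vRes_rightSMul,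
    vRes_rightSMul]
  have h1 : vRes V (h''.trans h) v = vRes V (h''.trans h') v' := by
    have h2 : ∀ {U : Y.Opens} (h : W ≤ U) (v : V.val.obj (op U)),
        vRes V (h''.trans h) v = vRes V h'' (vRes V h v) := fun h v =>
      ConcreteCategory.congr_hom ((vPresheaf V).map_comp (homOfLE h).op (homOfLE h'').op) v
    exact (h2 h v).trans ((congrArg (vRes V h'') hv).trans (h2 h' v').symm)
  rw [h1]
  exact congrArg (fun b => vGerm V hW' (rightSMul V _ b)) hb

lemma exists_action (y : Y) : ∃ act : VStalk V y →+ PullbackStalk 𝒜 i y →+ VStalk V y,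
    (∀ (U : Y.Opens) (hy : y ∈ U) (v : V.val.obj (op U)) (b : (pullback 𝒜 i).sections U),
      act (vGerm V hy v) (bGerm hy b) = vGerm V hy (rightSMul V v b)) := by
  choose U hU w b hw hb using fun v : VStalk V y => fun b : PullbackStalk 𝒜 i y =>
    exists_bGerm_pair V v b
  let f : VStalk V y → PullbackStalk 𝒜 i y → VStalk V y := fun v b' =>
    vGerm V (hU v b') (rightSMul V (w v b') (b v b'))
  have hf : ∀ (U : Y.Opens) (hy : y ∈ U) (v : V.val.obj (op U)) (b : (pullback 𝒜 i).sections U),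
      f (vGerm V hy v) (bGerm hy b) = vGerm V hy (rightSMul V v b) := fun U hy v b =>
    vGerm_rightSMul_congr V _ _ (hw _ _) (hb _ _)
  refine ⟨AddMonoidHom.mk' (fun v => AddMonoidHom.mk' (f v) fun b₁ b₂ => ?_)
    fun v₁ v₂ => AddMonoidHom.ext fun b => ?_, hf⟩
  · obtain ⟨U₁, hU₁, w, b₁, rfl, rfl⟩ := exists_bGerm_pair V v b₁
    obtain ⟨U₂, hU₂, b₂, rfl⟩ := exists_bGerm_eq b₂
    have hy : y ∈ U₁ ⊓ U₂ := ⟨hU₁, hU₂⟩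
    rw [← vGerm_vRes V inf_le_left hy, ← bGerm_res (inf_le_left : U₁ ⊓ U₂ ≤ U₁) hy,
      ← bGerm_res (inf_le_right : U₁ ⊓ U₂ ≤ U₂) hy]
    refine (hf _ hy _ ((pullback 𝒜 i).sectionsRes inf_le_left b₁ +
      (pullback 𝒜 i).sectionsRes inf_le_right b₂)).trans ?_
    rw [rightSMul_add_right, vGerm_add, hf, hf]
  · change f (v₁ + v₂) b = f v₁ b + f v₂ b
    obtain ⟨U₁, hU₁, v₁, b, rfl, rfl⟩ := exists_bGerm_pair V v₁ b
    obtain ⟨U₂, hU₂, v₂, rfl⟩ := exists_vGerm_eq V v₂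
    have hy : y ∈ U₁ ⊓ U₂ := ⟨hU₁, hU₂⟩
    rw [← vGerm_vRes V inf_le_left hy, ← bGerm_res (inf_le_left : U₁ ⊓ U₂ ≤ U₁) hy,
      ← vGerm_vRes V inf_le_right hy, ← vGerm_add, hf, hf, hf, rightSMul_add_left, vGerm_add]

/-- The right action of the stalk of the pullback tdo on the stalk of a right module. -/
noncomputable def act (y : Y) : VStalk V y →+ PullbackStalk 𝒜 i y →+ VStalk V y :=
  (exists_action V y).choose

variable {y : Y}

lemma act_germ {U : Y.Opens} (hy : y ∈ U) (v : V.val.obj (op U)) (b : (pullback 𝒜 i).sections U) :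
    act V y (vGerm V hy v) (bGerm hy b) = vGerm V hy (rightSMul V v b) :=
  (exists_action V y).choose_spec U hy v b

lemma act_mul (v : VStalk V y) (b b' : PullbackStalk 𝒜 i y) :
    act V y v (b * b') = act V y (act V y v b) b' := by
  obtain ⟨U, hU, v, b, rfl, rfl⟩ := exists_bGerm_pair V v b
  obtain ⟨W, hW, b', rfl⟩ := exists_bGerm_eq b'
  have hy : y ∈ U ⊓ W := ⟨hU, hW⟩
  rw [← vGerm_vRes V inf_le_left hy, ← bGerm_res (inf_le_left : U ⊓ W ≤ U) hy,
    ← bGerm_res (inf_le_right : U ⊓ W ≤ W) hy, act_germ, act_germ, ← rightSMul_mul]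
  exact act_germ V hy _ ((pullback 𝒜 i).sectionsRes inf_le_left b *
      (pullback 𝒜 i).sectionsRes inf_le_right b')

lemma act_one (v : VStalk V y) : act V y v 1 = v := by
  obtain ⟨U, hU, v, rfl⟩ := exists_vGerm_eq V v
  refine (act_germ V hU v 1).trans ?_
  rw [rightSMul_one]

/-- Every pair of germs of `V` and of `i^·A` comes from sections over one open set, so the relations
stated with sections are those of the action on stalks. -/
lemma pullbackRel_iff {E : Type u} [AddCommGroup E] [Module (PullbackStalk 𝒜 i y) E]
    {v v' : VStalk V y} {φ : E → E} :
    pullbackRel V y E v v' φ ↔ ∃ b, v' = act V y v b ∧ ∀ e, φ e = b • e := by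
  constructor
  · rintro ⟨U, hy, w, b, rfl, rfl, h⟩
    exact ⟨bGerm hy b, (act_germ V hy w b).symm, h⟩
  · rintro ⟨b, rfl, h⟩
    obtain ⟨U, hy, v, b, rfl, rfl⟩ := exists_bGerm_pair V v b
    exact ⟨U, hy, v, b, rfl, act_germ V hy v b, h⟩

lemma functionRel_iff {E : Type u} [AddCommGroup E] [Module (Y.presheaf.stalk y) E]
    {v v' : VStalk V y} {φ : E → E} :
    functionRel V y E v v' φ ↔
      ∃ c, v' = act V y v (pullbackScalar 𝒜 i y c) ∧ ∀ e, φ e = c • e := by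
  constructor
  · rintro ⟨U, hy, w, c, rfl, rfl, h⟩
    exact ⟨Y.presheaf.germ U y hy c, (act_germ V hy w (scalarSection 𝒜 i c)).symm, h⟩
  · rintro ⟨c, rfl, h⟩
    obtain ⟨U, hU, v, rfl⟩ := exists_vGerm_eq V v
    obtain ⟨W, hW, c, rfl⟩ := Y.presheaf.exists_germ_eq c
    have hy : y ∈ U ⊓ W := ⟨hU, hW⟩
    have hc : Y.presheaf.germ (U ⊓ W) y hy (Y.presheaf.map (homOfLE inf_le_right).op c) =
        Y.presheaf.germ W y hW c :=
      TopCat.Presheaf.germ_res_apply Y.presheaf (homOfLE inf_le_right) y hy c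
    refine ⟨U ⊓ W, hy, vRes V inf_le_left v, Y.presheaf.map (homOfLE inf_le_right).op c,
      (vGerm_vRes V inf_le_left hy v).symm, ?_, fun e => ?_⟩
    · rw [← act_germ, vGerm_vRes V inf_le_left hy, ← hc]
      rfl
    · rw [h, hc]

end Action

end TwistedD

namespace TwistedD

/-! ### Symmetric powers under base change and the symbol along `Y` -/

section Algebra

/-- Part of a basis is a basis of its span. -/
lemma exists_basis_of_eq_span {R M J : Type*} [Ring R] [AddCommGroup M] [Module R M]
    (e : Module.Basis J R M) (s : Set J) {N : Submodule R M} (hN : N = Submodule.span R (e '' s)) :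
    ∃ b : Module.Basis s R N, ∀ j, (b j : M) = e j := by
  subst hN
  have h : Submodule.span R (Set.range fun j : s => e j) = Submodule.span R (e '' s) := by
    rw [Set.image_eq_range]
  refine ⟨(Module.Basis.span (e.linearIndependent.comp (fun j : s => j.1)
    Subtype.val_injective)).map (LinearEquiv.ofEq _ _ h), fun j => ?_⟩
  rw [Module.Basis.map_apply, LinearEquiv.coe_ofEq_apply, Module.Basis.span_apply]
  rfl

variable {R B M N : Type*} [CommRing R] [CommRing B] [Algebra R B] [AddCommGroup M] [Module R M]
  [AddCommGroup N] [Module B N]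

/-- Functoriality of the symmetric algebra for semilinear maps. -/
lemma exists_symmetricAlgebra_map (g : M →+ N) (hg : ∀ (r : R) m, g (r • m) = algebraMap R B r • g m) :
    ∃ φ : SymmetricAlgebra R M →+* SymmetricAlgebra B N,
      (∀ m, φ (SymmetricAlgebra.ι R M m) = SymmetricAlgebra.ι B N (g m)) ∧
      ∀ r, φ (algebraMap R _ r) = algebraMap B _ (algebraMap R B r) := by
  let _ : Algebra R (SymmetricAlgebra B N) :=
    ((algebraMap B (SymmetricAlgebra B N)).comp (algebraMap R B)).toAlgebra
  let l : M →ₗ[R] SymmetricAlgebra B N :=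
    { toFun := fun m => SymmetricAlgebra.ι B N (g m)
      map_add' := fun m m' => by rw [map_add, map_add]
      map_smul' := fun r m => by
        rw [hg, map_smul, RingHom.id_apply, Algebra.smul_def, Algebra.smul_def]
        rfl }
  refine ⟨(SymmetricAlgebra.lift l).toRingHom, fun m => ?_, fun r => ?_⟩
  · exact SymmetricAlgebra.lift_ι_apply (f := l) (a := m)
  · exact (SymmetricAlgebra.lift l).commutes r

lemma map_mem_range_ι_pow {φ : SymmetricAlgebra R M →+* SymmetricAlgebra B N} {g : M → N}
    (h : ∀ m, φ (SymmetricAlgebra.ι R M m) = SymmetricAlgebra.ι B N (g m))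
    (h' : ∀ r, φ (algebraMap R _ r) = algebraMap B _ (algebraMap R B r)) (p : ℕ) :
    ∀ {a : SymmetricAlgebra R M}, a ∈ (LinearMap.range (SymmetricAlgebra.ι R M)) ^ p →
      φ a ∈ (LinearMap.range (SymmetricAlgebra.ι B N)) ^ p := by
  induction p with
  | zero =>
    intro a ha
    rw [pow_zero] at ha ⊢
    obtain ⟨r, rfl⟩ := Submodule.mem_one.mp ha
    rw [h']
    exact Submodule.mem_one.mpr ⟨_, rfl⟩
  | succ p ih =>
    intro a ha
    rw [pow_succ] at ha ⊢
    induction ha using Submodule.mul_induction_on' with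
    | mem_mul_mem a ha b hb =>
      obtain ⟨m, rfl⟩ := hb
      rw [map_mul, h]
      exact Submodule.mul_mem_mul (ih ha) ⟨_, rfl⟩
    | add a _ b _ ha hb => rw [map_add]; exact add_mem ha hb

/-- The symbol is composed with the ring map of symmetric algebras induced by `g`, which preserves
degrees. It is phrased for an additive `g` that is semilinear along `R → B`, as `Θ_X → N` is. -/
lemma exists_symmetricPower_map (g : M → N) (hadd : ∀ m m', g (m + m') = g m + g m')
    (hg : ∀ (r : R) m, g (r • m) = algebraMap R B r • g m) (p : ℕ) {F : Type*} [AddCommGroup F]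
    [Module R F] (σ : F →ₗ[R] SymmetricAlgebra R M)
    (hσ : LinearMap.range σ = (LinearMap.range (SymmetricAlgebra.ι R M)) ^ p) :
    ∃ τ : F →+ ↥((LinearMap.range (SymmetricAlgebra.ι B N)) ^ p),
      (∀ (r : R) a, τ (r • a) = algebraMap R B r • τ a) ∧ (∀ a, σ a = 0 → τ a = 0) ∧
      ∀ (J : Type) (θ : J → M) (l : List J) (a : F),
        σ a = (l.map fun k => SymmetricAlgebra.ι R M (θ k)).prod →
        (τ a).1 = (l.map fun k => SymmetricAlgebra.ι B N (g (θ k))).prod := by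
  obtain ⟨φ, h4, h5⟩ := exists_symmetricAlgebra_map (AddMonoidHom.mk' g hadd) hg
  have h6 : ∀ a, φ (σ a) ∈ (LinearMap.range (SymmetricAlgebra.ι B N)) ^ p := fun a =>
    map_mem_range_ι_pow h4 h5 p (hσ ▸ LinearMap.mem_range_self σ a)
  refine ⟨AddMonoidHom.mk' (fun a => ⟨φ (σ a), h6 a⟩) fun a b => Subtype.ext ?_,
    fun r a => Subtype.ext ?_, fun a ha => Subtype.ext ?_, fun J θ l a h => ?_⟩
  · change φ (σ (a + b)) = φ (σ a) + φ (σ b)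
    rw [map_add, map_add]
  · change φ (σ (r • a)) = algebraMap R B r • φ (σ a)
    rw [map_smul, Algebra.smul_def, map_mul, h5, Algebra.smul_def]
  · change φ (σ a) = 0
    rw [ha, map_zero]
  · change φ (σ a) = _
    rw [h, map_list_prod, List.map_map]
    congr 2
    funext k
    exact h4 (θ k)

end Algebra

variable {X Y S : Scheme.{u}} {x : X ⟶ S} {𝒜 : TDO x} {i : Y ⟶ X} {y : Y}

section NormalSymbol

lemma normalMk_smul (f : X.presheaf.stalk (i y)) (θ : TangentStalk x (i y)) :
    normalMk x i y (f • θ) =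
      algebraMap (X.presheaf.stalk (i y)) (Y.presheaf.stalk y) f • normalMk x i y θ := by
  unfold normalMk
  rw [← Submodule.Quotient.mk_smul, TensorProduct.tmul_smul, TensorProduct.smul_tmul',
    TensorProduct.smul_tmul', Algebra.smul_def, smul_eq_mul]

lemma normalMk_add (θ θ' : TangentStalk x (i y)) :
    normalMk x i y (θ + θ') = normalMk x i y θ + normalMk x i y θ' := by
  unfold normalMk
  rw [TensorProduct.tmul_add, Submodule.Quotient.mk_add]

/-- The principal symbol along `Y`, with values in the symmetric powers of the normal sheaf. -/
lemma exists_normalSymbol (𝒜 : TDO x) (i : Y ⟶ X) (p : ℕ) (y : Y) :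
    ∃ τ : 𝒜.FStalk p (i y) →+ SymNormalStalk x i p y,
      (∀ (f : X.presheaf.stalk (i y)) a, τ (f • a) =
        algebraMap (X.presheaf.stalk (i y)) (Y.presheaf.stalk y) f • τ a) ∧
      (∀ a, a.1 ∈ 𝒜.FStalk (p - 1) (i y) → τ a = 0) ∧
      ∀ (J : Type) (a : J → 𝒜.Stalk (i y)) (θ : J → TangentStalk x (i y)) (l : List J)
        (h : (l.map a).prod ∈ 𝒜.FStalk p (i y)), l.length = p →
        (∀ k, a k ∈ 𝒜.FStalk 1 (i y)) → (∀ k, 𝒜.HasSymbol x (a k) (θ k)) →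
        (τ ⟨(l.map a).prod, h⟩).1 = (l.map fun k => symι x i y (normalMk x i y (θ k))).prod := by
  obtain ⟨σ, h1, h2, h3⟩ := 𝒜.exists_symbolMap (i y) p
  obtain ⟨τ, h4, h5, h6⟩ := exists_symmetricPower_map (R := X.presheaf.stalk (i y))
    (B := Y.presheaf.stalk y) (M := TangentStalk x (i y)) (N := NormalStalk x i y)
    (normalMk x i y) normalMk_add normalMk_smul p σ h1
  exact ⟨τ, h4, fun a ha => h5 a ((h2 a).mpr ha), fun J a θ l h hl ha hθ =>
    h6 J θ l _ (h3 J a θ l h hl ha hθ)⟩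

variable (𝒜 i) in
/-- The principal symbol along `Y`. -/
noncomputable def normalSymbol (p : ℕ) (y : Y) : 𝒜.FStalk p (i y) →+ SymNormalStalk x i p y :=
  (exists_normalSymbol 𝒜 i p y).choose

lemma normalSymbol_smul {p : ℕ} (f : X.presheaf.stalk (i y)) (a : 𝒜.FStalk p (i y)) :
    normalSymbol 𝒜 i p y (f • a) =
      algebraMap (X.presheaf.stalk (i y)) (Y.presheaf.stalk y) f • normalSymbol 𝒜 i p y a :=
  (exists_normalSymbol 𝒜 i p y).choose_spec.1 f a

lemma normalSymbol_eq_zero {p : ℕ} {a : 𝒜.FStalk p (i y)} (h : a.1 ∈ 𝒜.FStalk (p - 1) (i y)) :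
    normalSymbol 𝒜 i p y a = 0 :=
  (exists_normalSymbol 𝒜 i p y).choose_spec.2.1 a h

lemma normalSymbol_list_prod {p : ℕ} {J : Type} (a : J → 𝒜.Stalk (i y))
    (θ : J → TangentStalk x (i y)) (l : List J) (h : (l.map a).prod ∈ 𝒜.FStalk p (i y))
    (hl : l.length = p) (ha : ∀ k, a k ∈ 𝒜.FStalk 1 (i y)) (hθ : ∀ k, 𝒜.HasSymbol x (a k) (θ k)) :
    (normalSymbol 𝒜 i p y ⟨(l.map a).prod, h⟩).1 =
      (l.map fun k => symι x i y (normalMk x i y (θ k))).prod :=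
  (exists_normalSymbol 𝒜 i p y).choose_spec.2.2 J a θ l h hl ha hθ

lemma normalSymbol_congr {p : ℕ} {a b : 𝒜.FStalk p (i y)}
    (h : a.1 - b.1 ∈ 𝒜.FStalk (p - 1) (i y)) :
    normalSymbol 𝒜 i p y a = normalSymbol 𝒜 i p y b := by
  rw [← sub_eq_zero, ← map_sub]
  exact normalSymbol_eq_zero h

end NormalSymbol

section Transfer

/-- The sheaf `i^·A` acts by endomorphisms that commute with right multiplication by `A`, and `𝒪_X`
acts through the latter. -/
lemma smul_pullback_smul (f : X.presheaf.stalk (i y)) (b : PullbackStalk 𝒜 i y)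
    (m : TransferStalk 𝒜 i y) : f • b • m = b • f • m :=
  ((pullbackAct 𝒜 i y b).map_smul _ m).symm

lemma smul_pullback_smul_G {p : ℤ} (f : X.presheaf.stalk (i y)) (b : PullbackStalk 𝒜 i y)
    (m : GTransferStalk 𝒜 i p y) : f • b • m = b • f • m :=
  Subtype.ext (smul_pullback_smul f b m.1)

lemma mk_one_mem_GTransferStalk {p : ℤ} {a : 𝒜.Stalk (i y)} (ha : a ∈ 𝒜.FStalk p (i y)) :
    TransferStalk.mk 𝒜 i 1 a ∈ GTransferStalk 𝒜 i p y :=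
  Submodule.subset_span (Submodule.subset_span ⟨a, ha, rfl⟩)

lemma mk_smul_one_right (f : X.presheaf.stalk (i y)) (a : 𝒜.Stalk (i y)) :
    TransferStalk.mk 𝒜 i 1 (f • a) = pullbackScalar 𝒜 i y
      (algebraMap (X.presheaf.stalk (i y)) (Y.presheaf.stalk y) f) • TransferStalk.mk 𝒜 i 1 a := by
  rw [TransferStalk.mk_smul_right, pullbackScalar_smul, TransferStalk.smul_mk]

end Transfer

namespace Frame

variable (F : Frame 𝒜 i) (hy : y ∈ F.W)

lemma mk_one_pairMonomial (k : Multiset (Fin F.m) × Multiset (Fin F.r)) :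
    TransferStalk.mk 𝒜 i 1 (pairMonomial (F.opGerm hy) k) =
      sortedMonomial (F.gen · ⟨y, hy⟩) k.1 •
        TransferStalk.mk 𝒜 i 1 (F.normalMonomial hy k.2) :=
  (F.sortedMonomial_gen_smul k.1 ⟨y, hy⟩ _).symm

lemma normalMonomial_mem {t : Multiset (Fin F.r)} {p : ℤ} (h : (t.card : ℤ) ≤ p) :
    F.normalMonomial hy t ∈ 𝒜.FStalk p (i y) := by
  have := 𝒜.pairMonomial_mem_FStalk (F.opGerm_mem hy) (0, t) (p := p) (by simpa using h)
  simpa [pairMonomial, normalMonomial] using this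

lemma mem_span_pairMonomial {p : ℤ} {a : 𝒜.Stalk (i y)} (ha : a ∈ 𝒜.FStalk p (i y)) :
    a ∈ Submodule.span (X.presheaf.stalk (i y))
      {c | ∃ k : Multiset (Fin F.m) × Multiset (Fin F.r), (k.1.card + k.2.card : ℕ) ≤ p ∧
        c = pairMonomial (F.opGerm hy) k} := by
  obtain ⟨b, hb⟩ := (F.isCoordinates hy).exists_basis
  exact 𝒜.mem_span_pairMonomial b hb (F.opGerm_mem hy) (F.hasSymbol hy) ha

/-- Operators of order `p` are combinations of monomials of total degree at most `p`. The tangential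
factors stand on the left and are absorbed by `i^·A`, so only normal monomials of degree at most `p`
are left. -/
lemma GTransferStalk_eq_span (p : ℤ) : GTransferStalk 𝒜 i p y =
    Submodule.span (PullbackStalk 𝒜 i y)
      ((fun t => TransferStalk.mk 𝒜 i 1 (F.normalMonomial hy t)) '' {t | (t.card : ℤ) ≤ p}) := by
  refine le_antisymm ?_ ?_
  · refine Submodule.span_le.mpr fun m hm => ?_
    change m ∈ FTransferStalk 𝒜 i p y at hm
    induction hm using Submodule.span_induction with
    | mem m hm =>
      obtain ⟨a, ha, rfl⟩ := hm
      have h := F.mem_span_pairMonomial hy ha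
      clear ha
      induction h using Submodule.span_induction with
      | mem a h =>
        obtain ⟨k, hk, rfl⟩ := h
        rw [F.mk_one_pairMonomial hy]
        exact Submodule.smul_mem _ _ (Submodule.subset_span ⟨k.2, by
          simp only [Set.mem_ofPred_eq]; lia, rfl⟩)
      | zero => rw [TransferStalk.mk_zero_right]; exact zero_mem _
      | add a b _ _ h h' =>
        rw [TransferStalk.mk_add_right]
        exact add_mem h h'
      | smul f a _ h =>
        rw [mk_smul_one_right]
        exact Submodule.smul_mem _ _ h
    | zero => exact zero_mem (Submodule.span _ _)
    | add a b _ _ ha hb => exact add_mem ha hb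
    | smul c a _ ha =>
      rw [← pullbackScalar_smul (𝒜 := 𝒜) (i := i)]
      exact Submodule.smul_mem _ _ ha
  · refine Submodule.span_le.mpr ?_
    rintro _ ⟨t, ht, rfl⟩
    exact mk_one_mem_GTransferStalk (F.normalMonomial_mem hy ht)

end Frame

end TwistedD

/-! ### Bases of the normal sheaf and coordinates on the tensor products -/

namespace TwistedD

/-- The monomials of degree `p` in a basis form a basis of the symmetric power. -/
lemma exists_symmetricPower_basis {R M J : Type*} [CommRing R] [AddCommGroup M] [Module R M]
    [DecidableEq J] (b : Module.Basis J R M) (p : ℕ) :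
    ∃ e : Module.Basis {s : Multiset J // s.card = p} R
        ↥((LinearMap.range (SymmetricAlgebra.ι R M)) ^ p),
      ∀ s, (e s).1 = (s.1.map fun j => SymmetricAlgebra.ι R M (b j)).prod := by
  obtain ⟨e, he⟩ := exists_symmetricAlgebra_basis b
  obtain ⟨b', hb'⟩ := exists_basis_of_eq_span e {s | s.card = p}
    (N := (LinearMap.range (SymmetricAlgebra.ι R M)) ^ p) (by
      rw [range_symι_pow_eq_span b]
      congr 1
      ext a
      simp only [Set.mem_ofPred_eq, Set.mem_image, he, eq_comm])
  exact ⟨b', fun s => (hb' s).trans (he s)⟩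

variable {X Y S : Scheme.{u}} {x : X ⟶ S} {𝒜 : TDO x} {i : Y ⟶ X} {y : Y}

lemma vectorEval_tmul (f : X.presheaf.stalk (i y)) (c : Y.presheaf.stalk y)
    (θ : TangentStalk x (i y)) : vectorEval x i y f (c ⊗ₜ θ) =
      c * algebraMap (X.presheaf.stalk (i y)) (Y.presheaf.stalk y) (θ f) := rfl

lemma normal_mk_tmul (c : Y.presheaf.stalk y) (θ : TangentStalk x (i y)) :
    (Submodule.Quotient.mk (c ⊗ₜ θ) : NormalStalk x i y) = c • normalMk x i y θ := by
  unfold normalMk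
  rw [← Submodule.Quotient.mk_smul, TensorProduct.smul_tmul', smul_eq_mul, mul_one]

namespace Frame

variable (F : Frame 𝒜 i) (hy : y ∈ F.W)

lemma normalMk_inl (j : Fin F.m) : normalMk x i y (F.symbolGerm hy (Sum.inl j)) = 0 := by
  refine (Submodule.Quotient.mk_eq_zero _).mpr ⟨F.δ j ⟨y, hy⟩, fun f => ?_⟩
  rw [vectorEval_tmul, one_mul]
  exact (F.compat j ⟨y, hy⟩ f).symm

/-- The tangential symbols lie in `Θ_Y`, so the normal ones span. For independence, a combination
lying in `Θ_Y` is evaluated on the normal coordinates, which vanish on `Y`: the result is a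
coefficient on one side and zero on the other. -/
lemma exists_normal_basis : ∃ b : Module.Basis (Fin F.r) (Y.presheaf.stalk y) (NormalStalk x i y),
    ∀ l, b l = normalMk x i y (F.symbolGerm hy (Sum.inr l)) := by
  have hli : LinearIndependent (Y.presheaf.stalk y)
      fun l => normalMk x i y (F.symbolGerm hy (Sum.inr l)) := by
    rw [Fintype.linearIndependent_iff]
    intro c hc l
    let t : Y.presheaf.stalk y ⊗[X.presheaf.stalk (i y)] TangentStalk x (i y) :=
      ∑ l, c l ⊗ₜ F.symbolGerm hy (Sum.inr l)
    have h1 : (Submodule.Quotient.mk t : NormalStalk x i y) = 0 := by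
      rw [← hc]
      refine (map_sum (tangentSubmodule x i y).mkQ _ _).trans ?_
      exact Finset.sum_congr rfl fun l _ => normal_mk_tmul _ _
    obtain ⟨D, hD⟩ := (Submodule.Quotient.mk_eq_zero _).mp h1
    have h2 := hD (F.coordGerm hy (Sum.inr l))
    rw [F.coordGerm_inr hy l, map_zero, map_sum] at h2
    rw [← h2, Finset.sum_eq_single l]
    · rw [vectorEval_tmul, (F.isCoordinates hy).dual, if_pos rfl, map_one, mul_one]
    · intro l' _ hl'
      rw [vectorEval_tmul, (F.isCoordinates hy).dual, if_neg (by simpa using hl'), map_zero,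
        mul_zero]
    · simp
  refine ⟨Module.Basis.mk hli (Submodule.eq_top_iff'.mpr fun n => ?_).ge, fun l => by rw [Module.Basis.mk_apply]⟩
  obtain ⟨t, rfl⟩ := Submodule.Quotient.mk_surjective _ n
  induction t using TensorProduct.induction_on with
  | zero => exact zero_mem (Submodule.span _ _)
  | tmul c θ =>
    rw [normal_mk_tmul]
    refine Submodule.smul_mem _ c ?_
    obtain ⟨b, hb⟩ := (F.isCoordinates hy).exists_basis
    have h1 : θ ∈ Submodule.span (X.presheaf.stalk (i y)) (Set.range b) := b.mem_span θ
    induction h1 using Submodule.span_induction with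
    | mem θ h =>
      obtain ⟨j | l, rfl⟩ := h
      · rw [hb, F.normalMk_inl hy]
        exact zero_mem _
      · rw [hb]
        exact Submodule.subset_span ⟨l, rfl⟩
    | zero =>
      have : normalMk x i y 0 = 0 := by
        unfold normalMk
        rw [TensorProduct.tmul_zero, Submodule.Quotient.mk_zero]
      rw [this]
      exact zero_mem _
    | add θ θ' _ _ h h' =>
      rw [normalMk_add]
      exact add_mem h h'
    | smul f θ _ h =>
      rw [normalMk_smul]
      exact Submodule.smul_mem _ _ h
  | add s t hs ht =>
    rw [Submodule.Quotient.mk_add]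
    exact add_mem hs ht

lemma exists_symNormal_basis (p : ℕ) :
    ∃ b : Module.Basis {t : Multiset (Fin F.r) // t.card = p} (Y.presheaf.stalk y)
        (SymNormalStalk x i p y), ∀ t, (b t).1 =
      (t.1.map fun l => symι x i y (normalMk x i y (F.symbolGerm hy (Sum.inr l)))).prod := by
  obtain ⟨b, hb⟩ := F.exists_normal_basis hy
  obtain ⟨e, he⟩ := exists_symmetricPower_basis b p
  refine ⟨e, fun t => (he t).trans ?_⟩
  simp only [hb]

end Frame

variable (V : RightModule 𝒜 i)

/-- The stalk of `V ⊗ A_{Y→X}`. -/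
abbrev TransferTensor (y : Y) : Type u :=
  BalancedTensor (X.presheaf.stalk (i y)) (TransferStalk 𝒜 i y) (VStalk V y)
    (pullbackRel V y (TransferStalk 𝒜 i y))

/-- The stalk of `V ⊗ G_p A_{Y→X}`. -/
abbrev GTensor (p : ℤ) (y : Y) : Type u :=
  BalancedTensor (X.presheaf.stalk (i y)) (GTransferStalk 𝒜 i p y) (VStalk V y)
    (pullbackRel V y (GTransferStalk 𝒜 i p y))

/-- The stalk of `V ⊗ Sym^p N`. -/
abbrev SymTensor (p : ℕ) (y : Y) : Type u :=
  BalancedTensor (X.presheaf.stalk (i y)) (SymNormalStalk x i p y) (VStalk V y)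
    (functionRel V y (SymNormalStalk x i p y))

/-- The element `v ⊗ m` of the stalk of `V ⊗ A_{Y→X}`. -/
noncomputable abbrev transferMk (v : VStalk V y) (m : TransferStalk 𝒜 i y) : TransferTensor V y :=
  BalancedTensor.mk _ _ v m

variable {V} in
/-- The element `v ⊗ m` of the stalk of `V ⊗ G_p A_{Y→X}`. -/
noncomputable abbrev gMk {p : ℤ} (v : VStalk V y) (m : GTransferStalk 𝒜 i p y) : GTensor V p y :=
  BalancedTensor.mk _ _ v m

variable {V} in
/-- The element `v ⊗ n` of the stalk of `V ⊗ Sym^p N`. -/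
noncomputable abbrev symMk {p : ℕ} (v : VStalk V y) (n : SymNormalStalk x i p y) : SymTensor V p y :=
  BalancedTensor.mk _ _ v n

/-- The class of `1 ⊗ a` in `G_p A_{Y→X}`. -/
noncomputable def gOne {p : ℤ} (a : 𝒜.FStalk p (i y)) : GTransferStalk 𝒜 i p y :=
  ⟨TransferStalk.mk 𝒜 i 1 a.1, mk_one_mem_GTransferStalk a.2⟩

lemma gOne_add {p : ℤ} (a b : 𝒜.FStalk p (i y)) : gOne (a + b) = gOne a + gOne b :=
  Subtype.ext (TransferStalk.mk_add_right _ _ _)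

lemma gOne_smul {p : ℤ} (f : X.presheaf.stalk (i y)) (a : 𝒜.FStalk p (i y)) :
    gOne (f • a) = pullbackScalar 𝒜 i y
      (algebraMap (X.presheaf.stalk (i y)) (Y.presheaf.stalk y) f) • gOne a :=
  Subtype.ext (mk_smul_one_right f a.1)

section Repr

variable [Smooth x] [Smooth (i ≫ x)] [IsImmersion i]

lemma gMk_smul {p : ℤ} (v : VStalk V y) (b : PullbackStalk 𝒜 i y) (m : GTransferStalk 𝒜 i p y) :
    gMk v (b • m) = gMk (act V y v b) m :=
  BalancedTensor.mk_eq_mk (rel := pullbackRel V y (GTransferStalk 𝒜 i p y))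
    ((pullbackRel_iff V (φ := fun m => b • m)).mpr ⟨b, rfl, fun _ => rfl⟩) m

lemma symMk_smul {p : ℕ} (v : VStalk V y) (c : Y.presheaf.stalk y) (n : SymNormalStalk x i p y) :
    symMk v (c • n) = symMk (act V y v (pullbackScalar 𝒜 i y c)) n :=
  BalancedTensor.mk_eq_mk (rel := functionRel V y (SymNormalStalk x i p y))
    ((functionRel_iff V (φ := fun m => c • m)).mpr ⟨c, rfl, fun _ => rfl⟩) n

variable (F : Frame 𝒜 i) (hy : y ∈ F.W)

lemma exists_repr_transfer :
    ∃ Φ : TransferTensor V y ≃+ (Multiset (Fin F.r) →₀ VStalk V y), ∀ t v,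
      Φ (transferMk V v (TransferStalk.mk 𝒜 i 1 (F.normalMonomial hy t))) =
        Finsupp.single t v := by
  obtain ⟨e, he⟩ := F.exists_basis_normalMonomial hy
  obtain ⟨Φ, -, hΦ⟩ := BalancedTensor.exists_repr (K := X.presheaf.stalk (i y))
    (rel := pullbackRel V y (TransferStalk 𝒜 i y)) (act V y) (act_mul V) (act_one V)
    (fun _ _ _ => pullbackRel_iff V) smul_pullback_smul e
  exact ⟨Φ, fun t v => by rw [← he, hΦ]⟩

lemma exists_repr_G (p : ℤ) :
    ∃ Φ : GTensor V p y ≃+ ({t : Multiset (Fin F.r) // (t.card : ℤ) ≤ p} →₀ VStalk V y),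
      ∀ t v, Φ (gMk v (gOne ⟨_, F.normalMonomial_mem hy t.2⟩)) = Finsupp.single t v := by
  obtain ⟨e, he⟩ := F.exists_basis_normalMonomial hy
  obtain ⟨e', he'⟩ := exists_basis_of_eq_span e {t | (t.card : ℤ) ≤ p}
    (N := GTransferStalk 𝒜 i p y) (by
      rw [F.GTransferStalk_eq_span hy]
      congr 2
      funext t
      exact (he t).symm)
  obtain ⟨Φ, -, hΦ⟩ := BalancedTensor.exists_repr (K := X.presheaf.stalk (i y))
    (rel := pullbackRel V y (GTransferStalk 𝒜 i p y)) (act V y) (act_mul V) (act_one V)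
    (fun _ _ _ => pullbackRel_iff V) smul_pullback_smul_G e'
  refine ⟨Φ, fun t v => ?_⟩
  have h : gOne ⟨_, F.normalMonomial_mem hy t.2⟩ = e' t :=
    Subtype.ext ((he t.1).symm.trans (he' t).symm)
  rw [h]
  exact hΦ t v

/-- Here the scalars are `𝒪_Y`, acting on `V` through `i^·A`. The same abstract computation applies,
and the index set is the top-degree part of the one for `G_p`. -/
lemma exists_repr_sym (p : ℕ) :
    ∃ Φ : SymTensor V p y ≃+ ({t : Multiset (Fin F.r) // t.card = p} →₀ VStalk V y),
      ∀ t v n, n.1 = (t.1.map fun l =>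
          symι x i y (normalMk x i y (F.symbolGerm hy (Sum.inr l)))).prod →
        Φ (symMk v n) = Finsupp.single t v := by
  obtain ⟨e, he⟩ := F.exists_symNormal_basis hy p
  let act' : VStalk V y →+ Y.presheaf.stalk y →+ VStalk V y :=
    AddMonoidHom.mk' (fun v => (act V y v).comp (pullbackScalar 𝒜 i y).toAddMonoidHom)
      fun v v' => by rw [map_add, AddMonoidHom.add_comp]
  have h1 : ∀ v c, act' v c = act V y v (pullbackScalar 𝒜 i y c) := fun v c => rfl
  obtain ⟨Φ, -, hΦ⟩ := BalancedTensor.exists_repr (K := X.presheaf.stalk (i y))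
    (rel := functionRel V y (SymNormalStalk x i p y)) act'
    (fun v b b' => by rw [h1, h1, h1, map_mul, act_mul])
    (fun v => by rw [h1, map_one, act_one]) (fun _ _ _ => functionRel_iff V)
    (fun f c n => smul_comm (algebraMap (X.presheaf.stalk (i y)) (Y.presheaf.stalk y) f) c n) e
  refine ⟨Φ, fun t v n hn => ?_⟩
  have h : n = e t := Subtype.ext (hn.trans (he t).symm)
  rw [h]
  exact hΦ t v

/-- The tensor product with `G_p A_{Y→X}` injects into the tensor product with `A_{Y→X}`. -/
lemma tensorGιStalk_injective (p : ℤ) (y : Y) : Function.Injective (tensorGιStalk V p y) := by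
  obtain ⟨F, hy⟩ := exists_frame i 𝒜 y
  obtain ⟨Φ, hΦ⟩ := exists_repr_transfer V F hy
  obtain ⟨Ψ, hΨ⟩ := exists_repr_G V F hy p
  -- In coordinates the map extends a finitely supported family by zero from the monomials of degree
  -- at most `p` to all monomials.
  have h : ∀ a, Φ (tensorGιStalk V p y (Ψ.symm a)) = a.mapDomain Subtype.val := fun a => by
    induction a using Finsupp.induction_linear with
    | zero => simp
    | add a b ha hb => rw [map_add, map_add, map_add, ha, hb, Finsupp.mapDomain_add]
    | single t v =>
      rw [← hΨ t v, AddEquiv.symm_apply_apply, hΨ, Finsupp.mapDomain_single, ← hΦ t.1 v]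
      rfl
  intro a b hab
  obtain ⟨a, rfl⟩ := Ψ.symm.surjective a
  obtain ⟨b, rfl⟩ := Ψ.symm.surjective b
  refine congrArg _ (Finsupp.mapDomain_injective Subtype.val_injective ?_)
  rw [← h, ← h, hab]

end Repr

end TwistedD

/-! ### The principal symbol on stalks -/

namespace TwistedD

variable {X Y S : Scheme.{u}} {x : X ⟶ S} {𝒜 : TDO x} {i : Y ⟶ X} {y : Y}

namespace Frame

variable (F : Frame 𝒜 i) (hy : y ∈ F.W)

lemma normalSymbol_pairMonomial {p : ℕ} (k : Multiset (Fin F.m) × Multiset (Fin F.r))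
    (h : pairMonomial (F.opGerm hy) k ∈ 𝒜.FStalk p (i y)) (hk : k.1.card + k.2.card = p) :
    (normalSymbol 𝒜 i p y ⟨_, h⟩).1 =
      ((pairList k).map fun j => symι x i y (normalMk x i y (F.symbolGerm hy j))).prod := by
  have h' : ((pairList k).map (F.opGerm hy)).prod ∈ 𝒜.FStalk p (i y) := by
    rwa [pairMonomial_eq]
  rw [← normalSymbol_list_prod _ _ _ h' ((length_pairList k).trans hk) (F.opGerm_mem hy)
    (F.hasSymbol hy)]
  congr 3
  exact (pairMonomial_eq _ _).symm

/-- Either the total degree is below `p`, or there is a tangential factor, whose class in the normal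
sheaf is zero. -/
lemma normalSymbol_pairMonomial_eq_zero {p : ℕ} (k : Multiset (Fin F.m) × Multiset (Fin F.r))
    (h : pairMonomial (F.opGerm hy) k ∈ 𝒜.FStalk p (i y)) (hk : k.1.card + k.2.card ≤ p)
    (hk' : k.2.card < p) : normalSymbol 𝒜 i p y ⟨_, h⟩ = 0 := by
  rcases hk.lt_or_eq with hlt | heq
  · exact normalSymbol_eq_zero (𝒜.pairMonomial_mem_FStalk (F.opGerm_mem hy) k (by lia))
  · refine Subtype.ext ((F.normalSymbol_pairMonomial hy k h heq).trans ?_)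
    obtain ⟨j, hj⟩ := Multiset.card_pos_iff_exists_mem.mp (show 0 < k.1.card by lia)
    refine List.prod_eq_zero (List.mem_map.mpr ⟨Sum.inl j, ?_, ?_⟩)
    · exact List.mem_append_left _ (List.mem_map.mpr ⟨j, (Multiset.mem_sort _).mpr hj, rfl⟩)
    · rw [F.normalMk_inl hy, map_zero]

lemma normalSymbol_normalMonomial {p : ℕ} (t : Multiset (Fin F.r))
    (h : F.normalMonomial hy t ∈ 𝒜.FStalk p (i y)) (ht : t.card = p) :
    (normalSymbol 𝒜 i p y ⟨_, h⟩).1 =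
      (t.map fun l => symι x i y (normalMk x i y (F.symbolGerm hy (Sum.inr l)))).prod := by
  have h' : ((t.sort (· ≤ ·)).map fun l => F.opGerm hy (Sum.inr l)).prod ∈ 𝒜.FStalk p (i y) := h
  refine (normalSymbol_list_prod (fun l => F.opGerm hy (Sum.inr l))
    (fun l => F.symbolGerm hy (Sum.inr l)) (t.sort (· ≤ ·)) h' (by simpa using ht)
    (fun l => F.opGerm_mem hy _) (fun l => F.hasSymbol hy _)).trans ?_
  rw [← Multiset.prod_coe, ← Multiset.map_coe, Multiset.sort_eq]

lemma normalSymbol_normalMonomial_eq_zero {p : ℕ} (t : Multiset (Fin F.r))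
    (h : F.normalMonomial hy t ∈ 𝒜.FStalk p (i y)) (ht : t.card < p) :
    normalSymbol 𝒜 i p y ⟨_, h⟩ = 0 :=
  normalSymbol_eq_zero (F.normalMonomial_mem hy (by lia))

end Frame

variable (V : RightModule 𝒜 i) [Smooth x] [Smooth (i ≫ x)] [IsImmersion i]

-- Elements `v ⊗ (1 ⊗ a)` generate additively because operators of `i^·A` and functions on `Y` can
-- be moved onto `v`. For this reason the inner induction is over all `v` at once.
@[elab_as_elim]
lemma GTensor.induction_on {p : ℤ} {motive : GTensor V p y → Prop} (z : GTensor V p y)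
    (mk : ∀ v a, motive (gMk v (gOne a))) (add : ∀ s t, motive s → motive t → motive (s + t)) :
    motive z := by
  have zero : motive 0 := by
    have := mk 0 0
    rwa [gMk, BalancedTensor.mk_zero_left] at this
  induction z using BalancedTensor.induction_on with
  | mk v m =>
    obtain ⟨m, hm⟩ := m
    suffices h : ∀ v, ∃ hm, motive (gMk v ⟨m, hm⟩) from (h v).2
    clear v
    induction hm using Submodule.span_induction with
    | mem m hm =>
      change m ∈ FTransferStalk 𝒜 i p y at hm
      induction hm using Submodule.span_induction with
      | mem m hm =>
        obtain ⟨a, ha, rfl⟩ := hm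
        exact fun v => ⟨_, mk v ⟨a, ha⟩⟩
      | zero => exact fun v => ⟨zero_mem _, by
          have h : gMk v (0 : GTransferStalk 𝒜 i p y) = 0 := BalancedTensor.mk_zero_right v
          exact h ▸ zero⟩
      | add m n _ _ hm hn => exact fun v => ⟨add_mem (hm v).1 (hn v).1, by
          have h : gMk v (⟨m, (hm v).1⟩ + ⟨n, (hn v).1⟩ : GTransferStalk 𝒜 i p y) = _ :=
            BalancedTensor.mk_add_right v _ _
          exact h ▸ add _ _ (hm v).2 (hn v).2⟩
      | smul c m _ hm =>
        intro v
        have h := gMk_smul V v (pullbackScalar 𝒜 i y c) ⟨m, (hm v).1⟩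
        have h' := (hm (act V y v (pullbackScalar 𝒜 i y c))).2
        rw [← h] at h'
        rw [← pullbackScalar_smul (𝒜 := 𝒜) (i := i)]
        exact ⟨_, h'⟩
    | zero => exact fun v => ⟨zero_mem _, by
          have h : gMk v (0 : GTransferStalk 𝒜 i p y) = 0 := BalancedTensor.mk_zero_right v
          exact h ▸ zero⟩
    | add m n _ _ hm hn => exact fun v => ⟨add_mem (hm v).1 (hn v).1, by
          have h : gMk v (⟨m, (hm v).1⟩ + ⟨n, (hn v).1⟩ : GTransferStalk 𝒜 i p y) = _ :=
            BalancedTensor.mk_add_right v _ _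
          exact h ▸ add _ _ (hm v).2 (hn v).2⟩
    | smul b m _ hm =>
      intro v
      have h := gMk_smul V v b ⟨m, (hm v).1⟩
      have h' := (hm (act V y v b)).2
      rw [← h] at h'
      exact ⟨_, h'⟩
  | add s t hs ht => exact add s t hs ht

/-- In a frame the map takes the coefficients of the monomials of degree exactly `p`. The stated
formula does not mention the frame and determines the map, so symbols at different points fit
together. -/
lemma exists_symbolStalk_addHom (p : ℕ) (y : Y) : ∃ σ : GTensor V p y →+ SymTensor V p y,
    ∀ v a, σ (gMk v (gOne a)) = symMk v (normalSymbol 𝒜 i p y a) := by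
  obtain ⟨F, hy⟩ := exists_frame i 𝒜 y
  obtain ⟨Φ, hΦ⟩ := exists_repr_G V F hy p
  obtain ⟨Ψ, hΨ⟩ := exists_repr_sym V F hy p
  let ι : {t : Multiset (Fin F.r) // t.card = p} →
      {t : Multiset (Fin F.r) // (t.card : ℤ) ≤ (p : ℤ)} := fun t => ⟨t.1, by rw [t.2]⟩
  have hι : Function.Injective ι := fun s t h =>
    Subtype.ext (congrArg (fun t : {t : Multiset (Fin F.r) // (t.card : ℤ) ≤ (p : ℤ)} => t.1) h)
  let σ : GTensor V p y →+ SymTensor V p y := Ψ.symm.toAddMonoidHom.comp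
    ((Finsupp.comapDomain.addMonoidHom hι).comp Φ.toAddMonoidHom)
  have hσ : ∀ z, σ z = Ψ.symm (Finsupp.comapDomain ι (Φ z) hι.injOn) := fun z => rfl
  have hlt : ∀ (t : {t : Multiset (Fin F.r) // (t.card : ℤ) ≤ (p : ℤ)}) v, t.1.card < p →
      σ (gMk v (gOne ⟨_, F.normalMonomial_mem hy t.2⟩)) = 0 := fun t v ht => by
    rw [hσ, hΦ, AddEquiv.map_eq_zero_iff]
    classical
    refine Finsupp.ext fun s => ?_
    rw [Finsupp.comapDomain_apply, Finsupp.single_apply, if_neg]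
    · rfl
    · rintro rfl
      exact absurd s.2 ht.ne
  have heq : ∀ (t : {t : Multiset (Fin F.r) // t.card = p}) v,
      σ (gMk v (gOne ⟨_, F.normalMonomial_mem hy (ι t).2⟩)) =
        Ψ.symm (Finsupp.single t v) := fun t v => by
    rw [hσ, hΦ, Finsupp.comapDomain_single]
  refine ⟨σ, fun v a => ?_⟩
  obtain ⟨a, ha⟩ := a
  -- The vector `v` is left free since a scalar factor of `a` moves onto it, and the order bound is
  -- reproved along the induction.
  suffices h : ∀ v, ∃ ha, σ (gMk v (gOne ⟨a, ha⟩)) = symMk v (normalSymbol 𝒜 i p y ⟨a, ha⟩) from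
    (h v).2
  have hspan := F.mem_span_pairMonomial hy ha
  clear ha v
  induction hspan using Submodule.span_induction with
  | mem a h =>
    obtain ⟨k, hk, rfl⟩ := h
    have ha := 𝒜.pairMonomial_mem_FStalk (F.opGerm_mem hy) k hk
    refine fun v => ⟨ha, ?_⟩
    have hk' : (k.2.card : ℤ) ≤ p := by lia
    have h1 : (gOne ⟨_, ha⟩ : GTransferStalk 𝒜 i p y) = sortedMonomial (F.gen · ⟨y, hy⟩) k.1 •
        gOne ⟨_, F.normalMonomial_mem hy hk'⟩ := Subtype.ext (F.mk_one_pairMonomial hy k)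
    rw [h1, gMk_smul]
    -- If the normal degree is below `p`, both sides vanish. If it equals `p`, there is no room for
    -- tangential factors and the monomial is purely normal.
    rcases (show k.2.card ≤ p by lia).lt_or_eq with h | h
    · rw [hlt ⟨k.2, hk'⟩ _ h, F.normalSymbol_pairMonomial_eq_zero hy k ha (by lia) h]
      exact (BalancedTensor.mk_zero_right v).symm
    · have h2 : k.1 = 0 := Multiset.card_eq_zero.mp (by lia)
      rw [h2, sortedMonomial_zero, act_one]
      refine (heq ⟨k.2, h⟩ v).trans ?_
      rw [AddEquiv.symm_apply_eq, hΨ ⟨k.2, h⟩ v]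
      have h3 : pairMonomial (F.opGerm hy) k = F.normalMonomial hy k.2 := by
        rw [pairMonomial, h2, sortedMonomial_zero, one_mul]
        rfl
      rw [← F.normalSymbol_normalMonomial hy k.2 (h3 ▸ ha) h]
      congr 3
  | zero =>
    refine fun v => ⟨zero_mem _, ?_⟩
    have h1 : (gOne 0 : GTransferStalk 𝒜 i p y) = 0 :=
      Subtype.ext (TransferStalk.mk_zero_right _)
    have h2 : normalSymbol 𝒜 i p y 0 = 0 := map_zero _
    refine ((congrArg (fun m => σ (gMk v m)) h1).trans ?_).trans
      (congrArg (symMk v) h2).symm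
    rw [gMk, symMk, BalancedTensor.mk_zero_right, BalancedTensor.mk_zero_right, map_zero]
  | add a b _ _ ha hb =>
    refine fun v => ⟨add_mem (ha v).1 (hb v).1, ?_⟩
    have h1 := gOne_add ⟨a, (ha v).1⟩ ⟨b, (hb v).1⟩
    have h2 := map_add (normalSymbol 𝒜 i p y) ⟨a, (ha v).1⟩ ⟨b, (hb v).1⟩
    refine ((congrArg (fun m => σ (gMk v m)) h1).trans ?_).trans
      (congrArg (symMk v) h2).symm
    rw [gMk, symMk, BalancedTensor.mk_add_right, BalancedTensor.mk_add_right, map_add]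
    exact congrArg₂ _ (ha v).2 (hb v).2
  | smul f a _ ha =>
    refine fun v => ⟨Submodule.smul_mem _ _ (ha v).1, ?_⟩
    have h1 := gOne_smul f ⟨a, (ha v).1⟩
    have h2 := normalSymbol_smul f ⟨a, (ha v).1⟩
    refine ((congrArg (fun m => σ (gMk v m)) h1).trans ?_).trans
      (congrArg (symMk v) h2).symm
    rw [gMk_smul, symMk_smul]
    exact (ha _).2

/-- The principal symbol on stalks. -/
lemma exists_symbolStalk (p : ℕ) (y : Y) :
    ∃ σ : GTensor V p y →ₗ[X.presheaf.stalk (i y)] SymTensor V p y,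
      ∀ v a, σ (gMk v (gOne a)) = symMk v (normalSymbol 𝒜 i p y a) := by
  obtain ⟨σ, hσ⟩ := exists_symbolStalk_addHom V p y
  refine ⟨{ toFun := σ, map_add' := map_add σ, map_smul' := fun f z => ?_ }, hσ⟩
  rw [RingHom.id_apply]
  induction z using GTensor.induction_on with
  | mk v a =>
    have ha : a.1 * 𝒜.ιStalk (i y) f ∈ 𝒜.FStalk p (i y) := by
      simpa using 𝒜.mul_mem_FStalk a.2 (𝒜.mem_FStalk_zero_iff.mpr ⟨f, rfl⟩)
    have h1 : f • gMk v (gOne a) = gMk v (gOne ⟨_, ha⟩) := rfl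
    rw [h1, hσ, hσ]
    -- Functions act on the transfer module by right multiplication but on operators by left
    -- multiplication. The two differ by a commutator of order `p - 1`, which the symbol does not
    -- see.
    have h2 : normalSymbol 𝒜 i p y ⟨_, ha⟩ = normalSymbol 𝒜 i p y (f • a) := by
      refine normalSymbol_congr ?_
      have h3 := 𝒜.commutator_mem_FStalk a.2 (𝒜.mem_FStalk_zero_iff.mpr ⟨f, rfl⟩)
      rwa [add_zero] at h3
    rw [h2, normalSymbol_smul]
    rfl
  | add s t hs ht => rw [smul_add, map_add, hs, ht, map_add, smul_add]

/-- The principal symbol on stalks. -/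
noncomputable def symbolStalk (p : ℕ) (y : Y) :
    GTensor V p y →ₗ[X.presheaf.stalk (i y)] SymTensor V p y :=
  (exists_symbolStalk V p y).choose

lemma symbolStalk_mk {p : ℕ} (v : VStalk V y) (a : 𝒜.FStalk p (i y)) :
    symbolStalk V p y (gMk v (gOne a)) = symMk v (normalSymbol 𝒜 i p y a) :=
  (exists_symbolStalk V p y).choose_spec v a

/-- The coefficients of the monomials of top degree are determined by the principal symbol. -/
lemma eq_zero_of_symbolStalk_eq_zero (F : Frame 𝒜 i) (hy : y ∈ F.W) {p : ℕ}
    (w : {t : Multiset (Fin F.r) // (t.card : ℤ) ≤ (p : ℤ)} →₀ VStalk V y)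
    (h : symbolStalk V p y (w.sum fun t v =>
      gMk v (gOne ⟨_, F.normalMonomial_mem hy t.2⟩)) = 0)
    (t : {t : Multiset (Fin F.r) // (t.card : ℤ) ≤ (p : ℤ)}) (ht : t.1.card = p) : w t = 0 := by
  obtain ⟨Ψ, hΨ⟩ := exists_repr_sym V F hy p
  have h1 : ∀ (s : {t : Multiset (Fin F.r) // (t.card : ℤ) ≤ (p : ℤ)}) v,
      Ψ (symbolStalk V p y (gMk v (gOne ⟨_, F.normalMonomial_mem hy s.2⟩))) ⟨t.1, ht⟩ =
        if s = t then v else 0 := fun s v => by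
    rw [symbolStalk_mk]
    rcases (show s.1.card ≤ p by have := s.2; lia).lt_or_eq with hlt | heq
    · rw [F.normalSymbol_normalMonomial_eq_zero hy s.1 _ hlt, symMk, BalancedTensor.mk_zero_right,
        map_zero, if_neg]
      · rfl
      · rintro rfl
        exact absurd ht hlt.ne
    · rw [hΨ ⟨s.1, heq⟩ v _ (F.normalSymbol_normalMonomial hy s.1 _ heq)]
      classical
      rw [Finsupp.single_apply]
      simp only [Subtype.ext_iff]
  have h2 := congrArg (fun z => Ψ z ⟨t.1, ht⟩) h
  simp only [Finsupp.sum, map_sum, Finsupp.finsetSum_apply, h1, map_zero] at h2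
  rw [Finset.sum_ite_eq'] at h2
  split_ifs at h2 with h3
  · exact h2
  · exact Finsupp.notMem_support_iff.mp h3

end TwistedD

/-! ### Sections of `V ⊗ G_p` as combinations of normal monomials -/

namespace TwistedD

/-- Induction on sections of a sheaf of modules given by generators, for local properties. -/
lemma GermModule.exists_of_mem_sections {T : TopCat.{u}} {R : GermRing T} {M : GermModule R}
    (P : ∀ V : Opens T, (∀ y : V, M.stalk y.1) → Prop)
    (res : ∀ {U V : Opens T} (h : V ≤ U) {s}, P U s → P V (res h s))
    {y : T} (zero : ∃ V, y ∈ V ∧ P V 0)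
    (add : ∀ {V s t}, P V s → P V t → P V (s + t))
    (neg : ∀ {V s}, P V s → P V (-s))
    (smul : ∀ {U V : Opens T} (hV : V ≤ U) {r s}, r ∈ R.gens U → P V s → y ∈ V →
      ∃ (W : Opens T) (_ : y ∈ W) (h : W ≤ V),
        P W (TwistedD.res h fun y : V => r ⟨y.1, hV y.2⟩ • s y))
    (gens : ∀ {V s}, s ∈ M.gens V → y ∈ V → ∃ (W : Opens T) (_ : y ∈ W) (h : W ≤ V),
      P W (TwistedD.res h s))
    {U : Opens T} {s : ∀ y : U, M.stalk y.1} (hs : s ∈ M.sections U) (hy : y ∈ U) :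
    ∃ (V : Opens T) (_ : y ∈ V) (h : V ≤ U), P V (TwistedD.res h s) := by
  let L : ∀ V : Opens T, (∀ y : V, M.stalk y.1) → Prop := fun V s =>
    ∃ (W : Opens T) (_ : y ∈ W) (h : W ≤ V), P W (TwistedD.res h s)
  have hzero : ∀ {V : Opens T}, y ∈ V → L V 0 := fun {V} hyV => by
    obtain ⟨W, hW, h⟩ := zero
    exact ⟨W ⊓ V, ⟨hW, hyV⟩, inf_le_right, res (inf_le_left : W ⊓ V ≤ W) h⟩
  have hadd : ∀ {V : Opens T} {s t : ∀ y : V, M.stalk y.1}, L V s → L V t → L V (s + t) := by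
    rintro V s t ⟨W, hW, h, hs⟩ ⟨W', hW', h', ht⟩
    exact ⟨W ⊓ W', ⟨hW, hW'⟩, inf_le_left.trans h,
      add (res (inf_le_left : W ⊓ W' ≤ W) hs) (res (inf_le_right : W ⊓ W' ≤ W') ht)⟩
  have hcongr : ∀ {V : Opens T} {s t : ∀ y : V, M.stalk y.1}, L V s → (∀ y, s y = t y) → L V t :=
    fun h hst => funext hst ▸ h
  -- Scalars are built from generators of `R` by ring operations, so stability is proved by
  -- induction on the scalar. The family `t` stays arbitrary because the product case applies the
  -- hypothesis twice.
  have hsmul : ∀ {V : Opens T}, y ∈ V → ∀ r ∈ R.pre V, ∀ t : ∀ y : V, M.stalk y.1,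
      L V t → L V fun y => r y • t y := by
    intro V hyV r hr
    induction hr using Subring.closure_induction with
    | mem r hr =>
      obtain ⟨U, hU, r, hr, rfl⟩ := hr
      rintro t ⟨W, hW, h, ht⟩
      obtain ⟨W', hW', h', ht'⟩ := smul (h.trans hU) hr ht hW
      exact ⟨W', hW', h'.trans h, ht'⟩
    | zero => exact fun t _ => hcongr (hzero hyV) fun y => (zero_smul _ _).symm
    | one => exact fun t ht => hcongr ht fun y => (one_smul _ _).symm
    | add r r' _ _ h h' =>
      exact fun t ht => hcongr (hadd (h t ht) (h' t ht)) fun y => (add_smul _ _ _).symm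
    | neg r _ h =>
      intro t ht
      obtain ⟨W, hW, h', ht⟩ := h t ht
      exact hcongr (s := -fun y => r y • t y) ⟨W, hW, h', neg ht⟩ fun y => (neg_smul _ _).symm
    | mul r r' _ _ h h' =>
      exact fun t ht => hcongr (h _ (h' t ht)) fun y => (mul_smul _ _ _).symm
  obtain ⟨V, hV, f, h⟩ := hs ⟨y, hy⟩
  suffices key : ∀ t ∈ M.pre V, L V t by
    obtain ⟨W, hW, hWV, hP⟩ := key _ h
    exact ⟨W, hW, hWV.trans f.le, hP⟩
  have hyV : y ∈ V := hV
  intro t ht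
  induction ht using Submodule.span_induction with
  | mem t ht =>
    obtain ⟨U, hU, t, ht, rfl⟩ := ht
    obtain ⟨W, hW, h, hP⟩ := gens ht (hU hyV)
    exact ⟨W ⊓ V, ⟨hW, hyV⟩, inf_le_right, res (inf_le_left : W ⊓ V ≤ W) hP⟩
  | zero => exact hzero hyV
  | add s t _ _ hs ht => exact hadd hs ht
  | smul r t _ ht =>
    obtain ⟨V', hV', g, hr⟩ := r.2 ⟨y, hyV⟩
    obtain ⟨W, hW, h, ht⟩ := ht
    obtain ⟨W', hW', h', hP⟩ := hsmul hV' _ hr (TwistedD.res g.le t)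
      ⟨W ⊓ V', ⟨hW, hV'⟩, inf_le_right, res (inf_le_left : W ⊓ V' ≤ W) ht⟩
    exact ⟨W', hW', h'.trans g.le, hP⟩

variable {X Y S : Scheme.{u}} {x : X ⟶ S} {𝒜 : TDO x} {i : Y ⟶ X} (V : RightModule 𝒜 i)

/-- Restriction of sections as a homomorphism of groups. -/
noncomputable def vResHom {U W : Y.Opens} (h : W ≤ U) : V.val.obj (op U) →+ V.val.obj (op W) :=
  AddMonoidHom.mk' (vRes V h) fun v w => map_add (V.val.map (homOfLE h).op).hom v w

/-- Taking germs as a homomorphism of groups. -/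
noncomputable def vGermHom {U : Y.Opens} {y : Y} (hy : y ∈ U) : V.val.obj (op U) →+ VStalk V y :=
  AddMonoidHom.mk' (vGerm V hy) (vGerm_add V hy)

namespace Frame

variable (F : Frame 𝒜 i)

/-- The finite sums `∑ v_t ⊗ d^t` over the normal monomials of order at most `p`, as families of
germs over `W`. -/
noncomputable def normalFamily (p : ℤ) {W : Y.Opens} (h : W ≤ F.W) :
    ({t : Multiset (Fin F.r) // (t.card : ℤ) ≤ p} →₀ V.val.obj (op W)) →+
      ∀ y : W, GTensor V p y.1 :=
  Finsupp.liftAddHom fun t => AddMonoidHom.mk'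
    (fun v y => gMk (vGerm V y.2 v) (gOne ⟨_, F.normalMonomial_mem (h y.2) t.2⟩))
    fun v w => funext fun y => by
      rw [Pi.add_apply, vGerm_add]
      exact BalancedTensor.mk_add_left _ _ _

lemma normalFamily_single (p : ℤ) {W : Y.Opens} (h : W ≤ F.W)
    (t : {t : Multiset (Fin F.r) // (t.card : ℤ) ≤ p}) (v : V.val.obj (op W)) (y : W) :
    F.normalFamily V p h (Finsupp.single t v) y =
      gMk (vGerm V y.2 v) (gOne ⟨_, F.normalMonomial_mem (h y.2) t.2⟩) := by
  unfold normalFamily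
  rw [Finsupp.liftAddHom_apply_single]
  rfl

lemma normalFamily_apply (p : ℤ) {W : Y.Opens} (h : W ≤ F.W)
    (w : {t : Multiset (Fin F.r) // (t.card : ℤ) ≤ p} →₀ V.val.obj (op W)) (y : W) :
    F.normalFamily V p h w y =
      (Finsupp.mapRange.addMonoidHom (vGermHom V y.2) w).sum fun t v =>
        gMk v (gOne ⟨_, F.normalMonomial_mem (h y.2) t.2⟩) := by
  induction w using Finsupp.induction_linear with
  | zero => rw [map_zero, map_zero, Finsupp.sum_zero_index]; rfl
  | add w w' hw hw' =>
    rw [map_add, map_add, Finsupp.sum_add_index', ← hw, ← hw', Pi.add_apply]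
    · exact fun t => BalancedTensor.mk_zero_left _
    · exact fun t v v' => BalancedTensor.mk_add_left _ _ _
  | single t v =>
    rw [Finsupp.mapRange.addMonoidHom_apply, Finsupp.mapRange_single, normalFamily_single,
      Finsupp.sum_single_index]
    · rfl
    · exact BalancedTensor.mk_zero_left _

lemma res_normalFamily (p : ℤ) {W W' : Y.Opens} (h : W ≤ F.W) (h' : W' ≤ W)
    (w : {t : Multiset (Fin F.r) // (t.card : ℤ) ≤ p} →₀ V.val.obj (op W)) :
    res h' (F.normalFamily V p h w) = F.normalFamily V p (h'.trans h)
      (Finsupp.mapRange.addMonoidHom (vResHom V h') w) := by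
  induction w using Finsupp.induction_linear with
  | zero => rw [map_zero, map_zero, map_zero]; rfl
  | add w w' hw hw' =>
    rw [map_add, map_add, map_add, ← hw, ← hw']
    rfl
  | single t v =>
    rw [Finsupp.mapRange.addMonoidHom_apply, Finsupp.mapRange_single]
    funext y
    rw [normalFamily_single]
    refine (normalFamily_single _ _ _ _ _ _ _).trans ?_
    exact congrArg (fun v => gMk v _) (vGerm_vRes V h' y.2 v).symm

/-- The elements of the pullback tdo given by the operators of the frame, as sections. -/
noncomputable def genSection {W : Y.Opens} (h : W ≤ F.W) (j : Fin F.m) :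
    (pullback 𝒜 i).sections W :=
  ⟨F.genFamily h j, GermRing.res_mem_sections h ((pullback 𝒜 i).gens_subset_sections
    ⟨_, F.isPicardSection_picard j, fun _ => rfl⟩)⟩

lemma bGerm_sortedMonomial_genSection {W : Y.Opens} (h : W ≤ F.W) (s : Multiset (Fin F.m)) {y : Y}
    (hy : y ∈ W) : bGerm hy (sortedMonomial (F.genSection h) s) =
      sortedMonomial (F.gen · ⟨y, h hy⟩) s :=
  map_sortedMonomial ((Pi.evalRingHom _ (⟨y, hy⟩ : W)).comp
    ((pullback 𝒜 i).sections W).subtype) _ _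

variable [Smooth x] [Smooth (i ≫ x)] [IsImmersion i]

/-- A section `w ⊗ a` is locally a combination of normal monomials. -/
lemma exists_normalFamily_eq_gMk {p : ℤ} {y : Y} (hy : y ∈ F.W) {W : Y.Opens} (hyW : y ∈ W)
    (v : V.val.obj (op W)) {U : X.Opens} (hU : W ≤ i ⁻¹ᵁ U) (a : 𝒜.F p U) :
    ∃ (W' : Y.Opens) (_ : y ∈ W') (h : W' ≤ W) (h' : W' ≤ F.W)
      (w : {t : Multiset (Fin F.r) // (t.card : ℤ) ≤ p} →₀ V.val.obj (op W')),
      ∀ y' : W', F.normalFamily V p h' w y' = gMk (vGerm V (h y'.2) v)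
        (gOne ⟨_, 𝒜.germ_mem_FStalk (hU (h y'.2)) a.2⟩) := by
  obtain ⟨U', hyU, h, h', s, c, hs, hc⟩ := F.exists_expansion hy a.2 (hU hyW)
  have hW : W ⊓ F.W ⊓ i ⁻¹ᵁ U' ≤ F.W := inf_le_left.trans inf_le_right
  have hW' : W ⊓ F.W ⊓ i ⁻¹ᵁ U' ≤ W := inf_le_left.trans inf_le_left
  have hWU : W ⊓ F.W ⊓ i ⁻¹ᵁ U' ≤ i ⁻¹ᵁ U' := inf_le_right
  -- In each term of the expansion of `a`, the restricted coefficient and the tangential monomial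
  -- act on `v`, and only the normal monomial remains on the right.
  refine ⟨W ⊓ F.W ⊓ i ⁻¹ᵁ U', ⟨⟨hyW, hy⟩, hyU⟩, hW', hW, ∑ k ∈ s.attach,
    Finsupp.single ⟨k.1.2, by have := hs k.1 k.2; lia⟩ (rightSMul V (vRes V hW' v)
      (scalarSection 𝒜 i ((Y.presheaf.map (homOfLE hWU).op).hom (i.app U' (c k.1))) *
        sortedMonomial (F.genSection hW) k.1.1)), fun y' => ?_⟩
  rw [map_sum, Finset.sum_apply]
  have h1 : gOne ⟨_, 𝒜.germ_mem_FStalk (hU (hW' y'.2)) a.2⟩ = ∑ k ∈ s.attach,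
      (pullbackScalar 𝒜 i y'.1 (algebraMap _ _ (X.presheaf.germ U' (i y'.1) (hWU y'.2) (c k.1))) *
        sortedMonomial (F.gen · ⟨y'.1, hW y'.2⟩) k.1.1) •
        gOne ⟨_, F.normalMonomial_mem (t := k.1.2) (p := p) (hW y'.2)
          (by have := hs k.1 k.2; lia)⟩ := by
    refine Subtype.ext ?_
    rw [AddSubmonoidClass.coe_finsetSum]
    change TransferStalk.mk 𝒜 i 1 (𝒜.germ (h (hWU y'.2)) a.1) = _
    rw [hc _ (hWU y'.2), TransferStalk.mk_sum_right, ← Finset.sum_attach]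
    refine Finset.sum_congr rfl fun k _ => (mk_smul_one_right _ _).trans ?_
    rw [SetLike.val_smul, mul_smul]
    exact congrArg (_ • ·) (F.mk_one_pairMonomial (hW y'.2) k.1)
  rw [h1]
  refine .trans ?_ (BalancedTensor.mk_sum_right _ _ _).symm
  refine Finset.sum_congr rfl fun k _ => ?_
  rw [normalFamily_single]
  refine .trans ?_ (gMk_smul V _ _ _).symm
  refine congrArg (fun v => gMk v _) ?_
  rw [← act_germ, vGerm_vRes]
  congr 1
  refine (map_mul ((Pi.evalRingHom _ y').comp ((pullback 𝒜 i).sections _).subtype) _ _).trans ?_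
  refine congrArg₂ (· * ·) ?_ (F.bGerm_sortedMonomial_genSection hW _ y'.2)
  exact congrArg (pullbackScalar 𝒜 i y'.1)
    ((TopCat.Presheaf.germ_res_apply Y.presheaf (homOfLE hWU) y'.1 y'.2 _).trans
      (algebraMap_germ i (hWU y'.2) _).symm)

end Frame

end TwistedD

namespace TwistedD

lemma TDO.one_mem_F {X S : Scheme.{u}} {x : X ⟶ S} (𝒜 : TDO x) (U : X.Opens) : 1 ∈ 𝒜.F 0 U :=
  (𝒜.F_zero U 1).mpr ⟨1, map_one (𝒜.ι.app (op U)).hom⟩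

lemma TDO.list_prod_mem_F {X S : Scheme.{u}} {x : X ⟶ S} (𝒜 : TDO x) {U : X.Opens}
    (l : List (𝒜.A.presheaf.obj (op U))) (hl : ∀ a ∈ l, a ∈ 𝒜.F 1 U) {p : ℤ}
    (hp : (l.length : ℤ) ≤ p) : l.prod ∈ 𝒜.F p U := by
  refine 𝒜.F_mono hp U ?_
  clear hp
  induction l with
  | nil => exact 𝒜.one_mem_F U
  | cons a l ih =>
    rw [List.prod_cons, List.length_cons, Nat.cast_add, Nat.cast_one, add_comm]
    exact 𝒜.F_mul 1 _ U _ (hl a List.mem_cons_self) _ (ih fun b hb => hl b (List.mem_cons_of_mem _ hb))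

variable {X Y S : Scheme.{u}} {x : X ⟶ S} {𝒜 : TDO x} {i : Y ⟶ X} (V : RightModule 𝒜 i)

/-- The family of germs `v ⊗ a` is a section. -/
lemma gMk_mem_sections {p : ℤ} {W : Y.Opens} (v : V.val.obj (op W)) {U : X.Opens}
    (hU : W ≤ i ⁻¹ᵁ U) (a : 𝒜.F p U) :
    (fun y : W => (gMk (vGerm V y.2 v) (gOne ⟨_, 𝒜.germ_mem_FStalk (hU y.2) a.2⟩) :
      (tensorG V p).stalk y.1)) ∈ (tensorG V p).sections W :=
  GermModule.gens_subset_sections ⟨v, 1, 1, U, hU, a, _, fun y => by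
    have h1 : bGerm y.2 (1 : (pullback 𝒜 i).sections W) = 1 := rfl
    rw [h1, one_smul, map_one]
    rfl, fun y => rfl⟩

lemma smul_gOne {p : ℤ} {y : Y} (f : X.presheaf.stalk (i y)) {a : 𝒜.Stalk (i y)}
    (ha : a ∈ 𝒜.FStalk p (i y)) (ha' : a * 𝒜.ιStalk (i y) f ∈ 𝒜.FStalk p (i y)) :
    f • gOne ⟨a, ha⟩ = gOne ⟨a * 𝒜.ιStalk (i y) f, ha'⟩ :=
  Subtype.ext (coe_smul_GTransferStalk 𝒜 i p f _)

namespace Frame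

variable (F : Frame 𝒜 i)

/-- The normal monomials as sections of `F_p A`. -/
noncomputable def normalSection {p : ℤ} (t : {t : Multiset (Fin F.r) // (t.card : ℤ) ≤ p}) :
    𝒜.F p F.U :=
  ⟨sortedMonomial (fun l => F.d (Sum.inr l)) t.1, by
    refine 𝒜.list_prod_mem_F _ (fun a ha => ?_) (by simpa using t.2)
    obtain ⟨l, -, rfl⟩ := List.mem_map.mp ha
    exact F.d_mem _⟩

lemma germ_normalSection {p : ℤ} (t : {t : Multiset (Fin F.r) // (t.card : ℤ) ≤ p}) {y : Y}
    (hy : y ∈ F.W) : 𝒜.germ (F.le hy) (F.normalSection t).1 = F.normalMonomial hy t.1 :=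
  map_sortedMonomial (𝒜.germ (F.le hy)) _ _

lemma normalFamily_mem_sections (p : ℤ) {W : Y.Opens} (h : W ≤ F.W)
    (w : {t : Multiset (Fin F.r) // (t.card : ℤ) ≤ p} →₀ V.val.obj (op W)) :
    (F.normalFamily V p h w : ∀ y : W, (tensorG V p).stalk y.1) ∈ (tensorG V p).sections W := by
  induction w using Finsupp.induction_linear with
  | zero => rw [map_zero]; exact zero_mem _
  | add w w' hw hw' => rw [map_add]; exact add_mem hw hw'
  | single t v =>
    convert gMk_mem_sections V v (h.trans F.le) (F.normalSection t) using 2 with y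
    rw [normalFamily_single]
    congr 3
    exact (F.germ_normalSection t (h y.2)).symm

variable [Smooth x] [Smooth (i ≫ x)] [IsImmersion i]

lemma exists_normalFamily_eq_smul {p : ℤ} {y : Y} {W : Y.Opens} (hyW : y ∈ W)
    (h : W ≤ F.W) {U : X.Opens} (hU : W ≤ i ⁻¹ᵁ U) (f : Γ(X, U))
    (w : {t : Multiset (Fin F.r) // (t.card : ℤ) ≤ p} →₀ V.val.obj (op W)) :
    ∃ (W' : Y.Opens) (_ : y ∈ W') (h' : W' ≤ W)
      (w' : {t : Multiset (Fin F.r) // (t.card : ℤ) ≤ p} →₀ V.val.obj (op W')),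
      ∀ y' : W', F.normalFamily V p (h'.trans h) w' y' =
        X.presheaf.germ U (i y'.1) (hU (h' y'.2)) f • F.normalFamily V p h w ⟨y'.1, h' y'.2⟩ := by
  induction w using Finsupp.induction_linear with
  | zero =>
    refine ⟨W, hyW, le_rfl, 0, fun y' => ?_⟩
    rw [map_zero]
    exact (smul_zero _).symm
  | add w₁ w₂ h₁ h₂ =>
    obtain ⟨W₁, hy₁, hW₁, w₁', h₁⟩ := h₁
    obtain ⟨W₂, hy₂, hW₂, w₂', h₂⟩ := h₂
    refine ⟨W₁ ⊓ W₂, ⟨hy₁, hy₂⟩, inf_le_left.trans hW₁,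
      Finsupp.mapRange.addMonoidHom (vResHom V inf_le_left) w₁' +
        Finsupp.mapRange.addMonoidHom (vResHom V inf_le_right) w₂', fun y' => ?_⟩
    rw [map_add, map_add, Pi.add_apply, Pi.add_apply, smul_add, ← h₁ ⟨y'.1, y'.2.1⟩,
      ← h₂ ⟨y'.1, y'.2.2⟩]
    exact congrArg₂ (· + ·)
      (congrFun (F.res_normalFamily V p (hW₁.trans h) inf_le_left w₁') y').symm
      (congrFun (F.res_normalFamily V p (hW₂.trans h) inf_le_right w₂') y').symm
  | single t v =>
    have hUF : W ≤ i ⁻¹ᵁ (F.U ⊓ U) := le_inf (h.trans F.le) hU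
    -- Right multiplication by `f` turns the normal monomial into another operator of order at most
    -- `p`, which is expanded anew.
    let a : 𝒜.F p (F.U ⊓ U) := ⟨𝒜.resA inf_le_left (F.normalSection t).1 *
      𝒜.ι.app (op (F.U ⊓ U)) (X.presheaf.map (homOfLE inf_le_right).op f), by
        have := 𝒜.F_mul p 0 (F.U ⊓ U) _ (𝒜.F_res p inf_le_left _ (F.normalSection t).2) _
          ((𝒜.F_zero _ _).mpr ⟨X.presheaf.map (homOfLE inf_le_right).op f, rfl⟩)
        rwa [add_zero] at this⟩
    obtain ⟨W', hyW', h', _, w', hw'⟩ := F.exists_normalFamily_eq_gMk V (h hyW) hyW v hUF a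
    refine ⟨W', hyW', h', w', fun y' => (hw' y').trans ?_⟩
    rw [normalFamily_single]
    have ha : 𝒜.germ (hUF (h' y'.2)) a.1 = F.normalMonomial (h (h' y'.2)) t.1 *
        𝒜.ιStalk (i y'.1) (X.presheaf.germ U (i y'.1) (hU (h' y'.2)) f) := by
      refine (map_mul (𝒜.germ (hUF (h' y'.2))) _ _).trans ?_
      refine congrArg₂ (· * ·) ((𝒜.germ_resA inf_le_left (hUF (h' y'.2)) _).trans
        (F.germ_normalSection t (h (h' y'.2)))) ?_
      refine (𝒜.ιStalk_germ (hUF (h' y'.2)) _).symm.trans (congrArg _ ?_)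
      exact TopCat.Presheaf.germ_res_apply X.presheaf (homOfLE inf_le_right) _ (hUF (h' y'.2)) f
    refine .trans ?_ (BalancedTensor.smul_mk _ _ _).symm
    refine congrArg (gMk _) ?_
    refine Eq.trans ?_ (smul_gOne _ _ (ha ▸ 𝒜.germ_mem_FStalk (hUF (h' y'.2)) a.2)).symm
    congr 2

/-- Every section of `V ⊗ G_p A_{Y→X}` is locally a combination of normal monomials. -/
lemma exists_normalFamily_eq {p : ℤ} {y : Y} (hy : y ∈ F.W) {W : Y.Opens} (hyW : y ∈ W)
    {s : ∀ y : W, (tensorG V p).stalk y.1} (hs : s ∈ (tensorG V p).sections W) :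
    ∃ (W' : Y.Opens) (_ : y ∈ W') (h : W' ≤ W) (h' : W' ≤ F.W)
      (w : {t : Multiset (Fin F.r) // (t.card : ℤ) ≤ p} →₀ V.val.obj (op W')),
      F.normalFamily V p h' w = res h s := by
  suffices hP : ∃ (W' : Y.Opens) (_ : y ∈ W') (h : W' ≤ W), ∃ (h' : W' ≤ F.W) (w : _),
      F.normalFamily V p h' w = res h s by
    obtain ⟨W', hy, h, h', w, hw⟩ := hP
    exact ⟨W', hy, h, h', w, hw⟩
  refine GermModule.exists_of_mem_sections (M := tensorG V p) (P := fun W' s =>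
    ∃ (h' : W' ≤ F.W) (w : _), F.normalFamily V p h' w = s) ?_ ?_ ?_ ?_ ?_ ?_ hs hyW
  · rintro U U' h _ ⟨h', w, rfl⟩
    exact ⟨h.trans h', _, (F.res_normalFamily V p h' h w).symm⟩
  · exact ⟨F.W, hy, le_rfl, 0, map_zero _⟩
  · rintro U _ _ ⟨h, w, rfl⟩ ⟨-, w', rfl⟩
    exact ⟨h, w + w', map_add _ _ _⟩
  · rintro U _ ⟨h, w, rfl⟩
    exact ⟨h, -w, map_neg _ _⟩
  · rintro U U' hU r _ ⟨U₀, h, f, hf⟩ ⟨h', w, rfl⟩ hyU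
    obtain ⟨W', hyW', h₁, w', hw'⟩ :=
      F.exists_normalFamily_eq_smul V hyU h' (hU.trans h) f w
    refine ⟨W', hyW', h₁, h₁.trans h', w', funext fun y' => (hw' y').trans ?_⟩
    exact congrArg (· • F.normalFamily V p h' w ⟨y'.1, h₁ y'.2⟩) (hf ⟨y'.1, hU (h₁ y'.2)⟩).symm
  · rintro U s ⟨v, b, c, U', hU, a, m, hm, hs⟩ hyU
    -- A generator `v ⊗ b (c ⊗ a)` equals `(v b c) ⊗ (1 ⊗ a)`, which reduces it to the case already
    -- treated.
    obtain ⟨W', hyW', h, h', w, hw⟩ := F.exists_normalFamily_eq_gMk V hy hyU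
      (rightSMul V v (b * scalarSection 𝒜 i c)) hU a
    refine ⟨W', hyW', h, h', w, funext fun y' => (hw y').trans ?_⟩
    refine .trans ?_ (hs ⟨y'.1, h y'.2⟩).symm
    rw [← act_germ]
    refine (gMk_smul V _ _ _).symm.trans (congrArg (gMk _) (Subtype.ext ?_))
    refine .trans ?_ (hm ⟨y'.1, h y'.2⟩).symm
    rw [SetLike.val_smul]
    have h1 : bGerm (h y'.2) (b * scalarSection 𝒜 i c) = bGerm (h y'.2) b *
      pullbackScalar 𝒜 i y'.1 (Y.presheaf.germ U y'.1 (h y'.2) c) := rfl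
    rw [h1, mul_smul, pullbackScalar_smul]
    exact congrArg (_ • ·) ((TransferStalk.smul_mk 𝒜 i _ _ _).trans (by rw [mul_one]))

end Frame

end TwistedD

/-! ### The principal symbol as a morphism of sheaves -/

namespace TwistedD

namespace GermModule

variable {T : TopCat.{u}} {R : GermRing T} {M N : GermModule R}

lemma mem_sections_of_eq {W : Opens T} {s t : ∀ y : W, M.stalk y.1} (ht : t ∈ M.sections W)
    (h : ∀ y, s y = t y) : s ∈ M.sections W :=
  (funext h : s = t) ▸ ht

lemma mem_sections_of_local {W : Opens T} {s : ∀ y : W, M.stalk y.1}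
    (h : ∀ y ∈ W, ∃ (W' : Opens T) (_ : y ∈ W') (h : W' ≤ W), res h s ∈ M.sections W') :
    s ∈ M.sections W :=
  M.mem_sections.mpr (M.localPred.locality _ fun y => by
    obtain ⟨W', hy, h, hs⟩ := h y.1 y.2
    exact ⟨W', hy, homOfLE h, hs⟩)

/-- A section of `N` that is locally the image of sections of `M` under an injective map is the
image of a section of `M`. -/
lemma exists_lift (φ : ∀ y, M.stalk y → N.stalk y) (hφ : ∀ y, Function.Injective (φ y))
    {W : Opens T} {s : ∀ y : W, N.stalk y.1}
    (h : ∀ y ∈ W, ∃ (W' : Opens T) (_ : y ∈ W') (h : W' ≤ W), ∃ s' ∈ M.sections W',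
      ∀ y' : W', φ y' (s' y') = s ⟨y'.1, h y'.2⟩) :
    ∃ s' ∈ M.sections W, ∀ y : W, φ y (s' y) = s y := by
  choose V hV hVW t ht hts using h
  exact ⟨fun y => t y.1 y.2 ⟨y.1, hV y.1 y.2⟩, mem_sections_of_local fun y hy =>
    ⟨V y hy, hV y hy, hVW y hy, mem_sections_of_eq (ht y hy) fun y' =>
      hφ _ ((hts y'.1 (hVW y hy y'.2) ⟨y'.1, hV _ _⟩).trans (hts y hy y').symm)⟩, fun y => hts y.1 y.2 ⟨y.1, hV y.1 y.2⟩⟩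

end GermModule

variable {X Y S : Scheme.{u}} {x : X ⟶ S} {𝒜 : TDO x} {i : Y ⟶ X} (V : RightModule 𝒜 i)

/-- The family of germs `v ⊗ θ_1 ⋯ θ_p` is a section. -/
lemma symMk_mem_sections {p : ℕ} {W : Y.Opens} (v : V.val.obj (op W)) {U : X.Opens}
    (hU : W ≤ i ⁻¹ᵁ U) {J : Type} (θ : J → ∀ z : U, TangentStalk x z.1)
    (hθ : ∀ j, IsVectorField x U (θ j)) (t : Multiset J) (ht : t.card = p)
    (n : ∀ y : W, SymNormalStalk x i p y.1) (hn : ∀ y : W, (n y).1 =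
      (t.map fun j => symι x i y.1 (normalMk x i y.1 (θ j ⟨i y.1, hU y.2⟩))).prod) :
    (fun y : W => (symMk (vGerm V y.2 v) (n y) : (tensorSym V p).stalk y.1)) ∈
      (tensorSym V p).sections W := by
  obtain ⟨g, rfl⟩ : ∃ g : Fin p → J, t = Multiset.ofList (List.ofFn g) := by
    induction t using Quotient.inductionOn with
    | h l =>
      obtain rfl : l.length = p := ht
      exact ⟨l.get, by rw [List.ofFn_get]; rfl⟩
  refine GermModule.gens_subset_sections ⟨v, U, hU, fun k => θ (g k), n, fun k => hθ _,
    fun y => (hn y).trans ?_, fun y => rfl⟩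
  rw [Multiset.map_coe, Multiset.prod_coe, List.map_ofFn, List.prod_ofFn]
  rfl

lemma normalSymbol_prod_germ {p : ℕ} {U : X.Opens} (a : Fin p → 𝒜.A.presheaf.obj (op U))
    (ha : ∀ k, a k ∈ 𝒜.F 1 U) {y : Y} (hy : i y ∈ U)
    (hmem : ((List.finRange p).map a).prod ∈ 𝒜.F p U) {θ : Fin p → TangentStalk x (i y)}
    (hθ : ∀ k, 𝒜.HasSymbol x (𝒜.germ hy (a k)) (θ k)) :
    (normalSymbol 𝒜 i p y ⟨_, 𝒜.germ_mem_FStalk hy hmem⟩).1 =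
      ∏ k, symι x i y (normalMk x i y (θ k)) := by
  have h1 : 𝒜.germ hy ((List.finRange p).map a).prod =
      ((List.finRange p).map fun k => 𝒜.germ hy (a k)).prod := by
    rw [map_list_prod, List.map_map]
    rfl
  have h2 := 𝒜.germ_mem_FStalk hy hmem
  rw [h1] at h2
  have h3 := normalSymbol_list_prod (i := i) _ θ (List.finRange p) h2 (by simp)
    (fun k => 𝒜.germ_mem_FStalk hy (ha k)) hθ
  rw [← List.prod_ofFn, List.ofFn_eq_map, ← h3]
  exact congrArg (fun a => (normalSymbol 𝒜 i p y a).1) (Subtype.ext h1)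

namespace Frame

variable (F : Frame 𝒜 i)

variable [Smooth x] [Smooth (i ≫ x)] [IsImmersion i] in
-- Terms of degree below `p` have zero symbol, and those of degree `p` become products of the vector
-- fields of the frame, which are generators of the target.
lemma symbolStalk_normalFamily_mem_sections (p : ℕ) {W : Y.Opens} (h : W ≤ F.W)
    (w : {t : Multiset (Fin F.r) // (t.card : ℤ) ≤ p} →₀ V.val.obj (op W)) :
    (fun y : W => symbolStalk V p y.1 (F.normalFamily V p h w y) :
      ∀ y : W, (tensorSym V p).stalk y.1) ∈ (tensorSym V p).sections W := by
  induction w using Finsupp.induction_linear with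
  | zero =>
    refine GermModule.mem_sections_of_eq (zero_mem _) fun y => ?_
    rw [map_zero]
    exact map_zero (symbolStalk V p y.1)
  | add w w' hw hw' =>
    refine GermModule.mem_sections_of_eq (add_mem hw hw') fun y => ?_
    rw [map_add]
    exact map_add (symbolStalk V p y.1) _ _
  | single t v =>
    have h1 : ∀ y : W, symbolStalk V p y.1 (F.normalFamily V p h (Finsupp.single t v) y) =
        symMk (vGerm V y.2 v) (normalSymbol 𝒜 i p y.1 ⟨_, F.normalMonomial_mem (h y.2) t.2⟩) :=
      fun y => by rw [normalFamily_single, symbolStalk_mk]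
    simp only [h1]
    rcases (Nat.cast_le.mp t.2).lt_or_eq with ht | ht
    · refine GermModule.mem_sections_of_eq (zero_mem _) fun y => ?_
      rw [F.normalSymbol_normalMonomial_eq_zero _ _ _ ht]
      exact BalancedTensor.mk_zero_right _
    · exact symMk_mem_sections V v (h.trans F.le) (fun l => F.θ (Sum.inr l))
        (fun l => 𝒜.isVectorField_of_hasSymbol (F.d_mem _) (F.symbol _)) t.1 ht _
        fun y => F.normalSymbol_normalMonomial (h y.2) t.1 _ ht

/-- A vector field is the symbol of an operator of order one near a point of `Y`. -/
lemma exists_operator {U : X.Opens}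
    {θ : ∀ z : U, TangentStalk x z.1} (hθ : IsVectorField x U θ) :
    ∃ a ∈ 𝒜.F 1 (U ⊓ F.U), ∀ y' (h : i y' ∈ U ⊓ F.U), y' ∈ F.W →
      𝒜.HasSymbol x (𝒜.germ h a) (θ ⟨i y', h.1⟩) := by
  choose g hg using fun j => hθ (U ⊓ F.U) inf_le_left
    (X.presheaf.map (homOfLE inf_le_right).op (F.f j))
  refine ⟨∑ j, 𝒜.ι.app (op (U ⊓ F.U)) (g j) * 𝒜.resA inf_le_right (F.d j),
    sum_mem fun j _ => ?_, fun y' h hy' => ?_⟩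
  · have := 𝒜.F_mul 0 1 (U ⊓ F.U) _ ((𝒜.F_zero _ _).mpr ⟨g j, rfl⟩) _
      (𝒜.F_res 1 inf_le_right _ (F.d_mem j))
    rwa [zero_add] at this
  · have h1 : 𝒜.germ h (∑ j, 𝒜.ι.app (op (U ⊓ F.U)) (g j) * 𝒜.resA inf_le_right (F.d j)) =
        ∑ j, X.presheaf.germ (U ⊓ F.U) (i y') h (g j) • F.opGerm hy' j := by
      rw [map_sum]
      refine Finset.sum_congr rfl fun j _ => (map_mul _ _ _).trans ?_
      rw [𝒜.germ_resA inf_le_right h, ← 𝒜.ιStalk_germ]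
      rfl
    have h2 : θ ⟨i y', h.1⟩ =
        ∑ j, X.presheaf.germ (U ⊓ F.U) (i y') h (g j) • F.symbolGerm hy' j := by
      refine (F.eq_sum_smul_symbolGerm hy' _).trans (Finset.sum_congr rfl fun j _ => ?_)
      rw [← hg j (i y') h, TopCat.Presheaf.germ_res_apply X.presheaf (homOfLE inf_le_right) _ h]
      rfl
    rw [h1, h2]
    exact TDO.HasSymbol.sum 𝒜 _ fun j => TDO.HasSymbol.smul 𝒜 (F.hasSymbol hy' j) _

end Frame

variable [Smooth x] [Smooth (i ≫ x)] [IsImmersion i]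

lemma symbolStalk_mem_sections {p : ℕ} {W : Y.Opens} {s : ∀ y : W, (tensorG V p).stalk y.1}
    (hs : s ∈ (tensorG V p).sections W) :
    (fun y : W => symbolStalk V p y.1 (s y) : ∀ y : W, (tensorSym V p).stalk y.1) ∈
      (tensorSym V p).sections W := by
  refine GermModule.mem_sections_of_local fun y hyW => ?_
  obtain ⟨F, hy⟩ := exists_frame i 𝒜 y
  obtain ⟨W', hyW, h, h', w, hw⟩ := F.exists_normalFamily_eq V hy hyW hs
  refine ⟨W', hyW, h, ?_⟩
  refine GermModule.mem_sections_of_eq (F.symbolStalk_normalFamily_mem_sections V p h' w)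
    fun y' => ?_
  rw [hw]

/-- The principal symbol `V ⊗ G_p A_{Y→X} → V ⊗ Sym^p N`. -/
noncomputable def tensorSymbol (p : ℕ) : (tensorG V p).sheaf ⟶ (tensorSym V p).sheaf :=
  GermModule.homMk (M := tensorG V p) (N := tensorSym V p) (fun y => symbolStalk V p y)
    fun _ _ hs => symbolStalk_mem_sections V (GermModule.gens_subset_sections hs)

/-- The principal symbol is locally surjective. -/
lemma exists_symbolStalk_eq {p : ℕ} {W : Y.Opens} {s : ∀ y : W, (tensorSym V p).stalk y.1}
    (hs : s ∈ (tensorSym V p).sections W) {y : Y} (hy : y ∈ W) :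
    ∃ (W' : Y.Opens) (_ : y ∈ W') (h : W' ≤ W), ∃ s' ∈ (tensorG V p).sections W',
      ∀ y' : W', symbolStalk V p y' (s' y') = s ⟨y'.1, h y'.2⟩ := by
  refine GermModule.exists_of_mem_sections (M := tensorSym V p) (P := fun W s =>
    ∃ s' ∈ (tensorG V p).sections W, ∀ y' : W, symbolStalk V p y' (s' y') = s y')
    ?_ ?_ ?_ ?_ ?_ ?_ hs hy
  · rintro U U' h s ⟨s', hs', hss⟩
    exact ⟨res h s', GermModule.res_mem_sections h hs', fun y' => hss ⟨y'.1, h y'.2⟩⟩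
  · exact ⟨W, hy, 0, zero_mem _, fun y' => map_zero (symbolStalk V p y'.1)⟩
  · rintro U _ _ ⟨s, hs, h⟩ ⟨t, ht, h'⟩
    exact ⟨s + t, add_mem hs ht, fun y' =>
      (map_add (symbolStalk V p y'.1) _ _).trans (congrArg₂ (· + ·) (h y') (h' y'))⟩
  · rintro U _ ⟨s, hs, h⟩
    exact ⟨-s, neg_mem hs, fun y' =>
      (map_neg (symbolStalk V p y'.1) _).trans (congrArg Neg.neg (h y'))⟩
  · rintro U U' hU r _ hr ⟨s, hs, h⟩ hyU
    let r' : (pullbackStructureSheaf i).sections U' :=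
      ⟨res hU r, GermRing.res_mem_sections hU ((pullbackStructureSheaf i).gens_subset_sections hr)⟩
    exact ⟨U', hyU, le_rfl, _, ((tensorG V p).sections U').smul_mem r' hs, fun y' =>
      ((symbolStalk V p y'.1).map_smul _ _).trans (congrArg (fun z : SymTensor V p y'.1 =>
        HSMul.hSMul (α := X.presheaf.stalk (i y'.1)) (r ⟨y'.1, hU y'.2⟩) z) (h y'))⟩
  · rintro U s ⟨v, U', hU, θ, n, hθ, hn, hs⟩ hyU
    obtain ⟨F, hyF⟩ := exists_frame i 𝒜 y
    -- Each vector field is lifted to an operator of order one near the point; the product of these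
    -- operators has the product of their classes as its symbol along `Y`.
    choose a ha haθ using fun k => F.exists_operator (hθ k)
    have hW : U ⊓ F.W ≤ i ⁻¹ᵁ (U' ⊓ F.U) :=
      le_inf (inf_le_left.trans hU) (inf_le_right.trans F.le)
    have hmem : ((List.finRange p).map a).prod ∈ 𝒜.F p (U' ⊓ F.U) := by
      refine 𝒜.list_prod_mem_F _ (fun b hb => ?_) (by simp)
      obtain ⟨k, -, rfl⟩ := List.mem_map.mp hb
      exact ha k
    refine ⟨U ⊓ F.W, ⟨hyU, hyF⟩, inf_le_left, _,
      gMk_mem_sections V (vRes V inf_le_left v) hW ⟨_, hmem⟩, fun y' => ?_⟩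
    refine (symbolStalk_mk V _ _).trans (.trans ?_ (hs ⟨y'.1, y'.2.1⟩).symm)
    rw [vGerm_vRes]
    refine congrArg (symMk _) (Subtype.ext (.trans ?_ (hn ⟨y'.1, y'.2.1⟩).symm))
    exact normalSymbol_prod_germ a ha (hW y'.2) hmem fun k => haθ k y'.1 (hW y'.2) y'.2.2

end TwistedD

/-! ### The kernel of the symbol and local exhaustion -/

namespace TwistedD

variable {X Y S : Scheme.{u}} {x : X ⟶ S} {𝒜 : TDO x} {i : Y ⟶ X} (V : RightModule 𝒜 i)

lemma vRes_vRes {U W W' : Y.Opens} (h : W ≤ U) (h' : W' ≤ W) (v : V.val.obj (op U)) :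
    vRes V h' (vRes V h v) = vRes V (h'.trans h) v :=
  (ConcreteCategory.congr_hom (V.val.presheaf.map_comp (homOfLE h).op (homOfLE h').op) v).symm

lemma tensorGMapStalk_mem_sections {p q : ℤ} (h : p ≤ q) {W : Y.Opens}
    {s : ∀ y : W, (tensorG V p).stalk y.1} (hs : s ∈ (tensorG V p).sections W) :
    (fun y : W => tensorGMapStalk V h y.1 (s y) : ∀ y : W, (tensorG V q).stalk y.1) ∈
      (tensorG V q).sections W :=
  ((tensorGMap V h).val.app (op W) (⟨s, hs⟩ : (tensorG V p).sections W) :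
    (tensorG V q).sections W).2

section

variable [Smooth x] [Smooth (i ≫ x)] [IsImmersion i]

lemma tensorGιStalk_tensorGMapStalk {p q : ℤ} (h : p ≤ q) (y : Y) (z : GTensor V p y) :
    tensorGιStalk V q y (tensorGMapStalk V h y z) = tensorGιStalk V p y z := by
  induction z using GTensor.induction_on with
  | mk v a =>
    have h1 : GSubtype q y (GInclusion h y (gOne a)) = GSubtype p y (gOne a) :=
      GInclusion_coe h y (gOne a)
    refine (congrArg _ (tensorGMapStalk_mk V h y v (gOne a))).trans ?_
    refine (BalancedTensor.map_mk _ _ _ _).trans ?_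
    rw [h1]
    exact (BalancedTensor.map_mk _ _ _ _).symm
  | add z w hz hw => 
    rw [map_add, map_add, map_add, hz, hw]

lemma tensorGMapStalk_injective {p q : ℤ} (h : p ≤ q) (y : Y) :
    Function.Injective (tensorGMapStalk V h y) := fun z w hzw => by
  refine tensorGιStalk_injective V p y ?_
  rw [← tensorGιStalk_tensorGMapStalk V h, ← tensorGιStalk_tensorGMapStalk V h, hzw]

lemma symbolStalk_tensorGMapStalk (p : ℕ) (y : Y) (z : GTensor V (p - 1) y) :
    symbolStalk V p y (tensorGMapStalk V (sub_one_lt (p : ℤ)).le y z) = 0 := by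
  induction z using GTensor.induction_on with
  | mk v a =>
    have h1 : tensorGMapStalk V (sub_one_lt (p : ℤ)).le y (gMk v (gOne a)) =
      gMk v (gOne ⟨a.1, 𝒜.FStalk_mono (sub_one_lt (p : ℤ)).le _ a.2⟩) := rfl
    rw [h1, symbolStalk_mk, normalSymbol_eq_zero a.2]
    exact BalancedTensor.mk_zero_right _
  | add z w hz hw => rw [map_add, map_add, hz, hw, add_zero]

end

namespace Frame

variable (F : Frame 𝒜 i)

lemma normalFamily_mapDomain {p q : ℤ} (hpq : p ≤ q) {W : Y.Opens} (h : W ≤ F.W)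
    (w : {t : Multiset (Fin F.r) // (t.card : ℤ) ≤ p} →₀ V.val.obj (op W)) (y : W) :
    F.normalFamily V q h (w.mapDomain fun t => ⟨t.1, t.2.trans hpq⟩) y =
      tensorGMapStalk V hpq y.1 (F.normalFamily V p h w y) := by
  induction w using Finsupp.induction_linear with
  | zero => rw [Finsupp.mapDomain_zero, map_zero, map_zero]; exact (map_zero _).symm
  | add w w' hw hw' =>
    rw [Finsupp.mapDomain_add, map_add, map_add, Pi.add_apply, Pi.add_apply, map_add, hw, hw']
  | single t v =>
    rw [Finsupp.mapDomain_single, normalFamily_single, normalFamily_single]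
    rfl

end Frame

variable [Smooth x] [Smooth (i ≫ x)] [IsImmersion i]

/-- The sections with vanishing principal symbol are the sections of smaller order. -/
lemma exists_tensorGMapStalk_eq {p : ℕ} {W : Y.Opens} {s : ∀ y : W, (tensorG V p).stalk y.1}
    (hs : s ∈ (tensorG V p).sections W) (h0 : ∀ y : W, symbolStalk V p y.1 (s y) = 0) :
    ∃ s' ∈ (tensorG V (p - 1)).sections W,
      ∀ y : W, tensorGMapStalk V (sub_one_lt (p : ℤ)).le y.1 (s' y) = s y := by
  classical
  refine GermModule.exists_lift (M := tensorG V (p - 1)) (N := tensorG V p)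
    (fun y => tensorGMapStalk V (sub_one_lt (p : ℤ)).le y)
    (tensorGMapStalk_injective V _) fun y hyW => ?_
  obtain ⟨F, hy⟩ := exists_frame i 𝒜 y
  obtain ⟨W₁, hy₁, h, h', w, hw⟩ := F.exists_normalFamily_eq V hy hyW hs
  -- The symbol determines the top coefficients, so their germs at `y` vanish. As the support is
  -- finite, they vanish on a common neighbourhood `W₂`.
  have h1 : ∀ t : {t : Multiset (Fin F.r) // (t.card : ℤ) ≤ (p : ℤ)}, t.1.card = p →
      vGerm V hy₁ (w t) = 0 := fun t ht => by
    have := eq_zero_of_symbolStalk_eq_zero V F hy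
      (Finsupp.mapRange.addMonoidHom (vGermHom V hy₁) w) (by
        rw [← F.normalFamily_apply V p h' w ⟨y, hy₁⟩, hw]
        exact h0 ⟨y, hyW⟩) t ht
    exact this
  obtain ⟨W₂, hy₂, hW₂⟩ := exists_open_forall (z := y) (J := w.support)
    (p := fun t (W₂ : Y.Opens) => ∃ h : W₂ ≤ W₁, t.1.1.card = p → vRes V h (w t.1) = 0)
    (fun t U U' hU' ⟨h, hU⟩ => ⟨hU'.trans h, fun ht => by
      have := congrArg (vRes V hU') (hU ht)
      rw [vRes_vRes] at this
      exact this.trans (map_zero (vResHom V hU'))⟩) (fun t => by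
      by_cases ht : t.1.1.card = p
      · obtain ⟨W', hy', j, k, hjk⟩ := exists_vRes_eq V hy₁ hy₁ ((h1 t.1 ht).trans
          (map_zero (vGermHom V hy₁)).symm)
        exact ⟨W', hy', j, fun _ => hjk.trans (map_zero (vResHom V k))⟩
      · exact ⟨W₁, hy₁, le_rfl, fun h => absurd h ht⟩)
  have hW : W₁ ⊓ W₂ ≤ W₁ := inf_le_left
  let f : {t : Multiset (Fin F.r) // (t.card : ℤ) ≤ p - 1} →
      {t : Multiset (Fin F.r) // (t.card : ℤ) ≤ p} := fun t => ⟨t.1, t.2.trans (sub_one_lt _).le⟩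
  have hf : Function.Injective f := fun t t' h => Subtype.ext (congrArg (fun t => t.1) h)
  let w₂ := Finsupp.mapRange.addMonoidHom (vResHom V hW) w
  -- Over `W₁ ⊓ W₂` only monomials of degree at most `p - 1` occur, so the family of coefficients is
  -- pulled back along the inclusion of index sets.
  have hsupp : (w₂.support : Set _) ⊆ Set.range f := fun t ht => by
    have ht0 : vRes V hW (w t) ≠ 0 := Finsupp.mem_support_iff.mp ht
    have htw : t ∈ w.support := Finsupp.mem_support_iff.mpr fun h => ht0 (by
      rw [h]; exact map_zero (vResHom V hW))
    obtain ⟨h₂, ht₂⟩ := hW₂ ⟨t, htw⟩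
    have htp : t.1.card ≠ p := fun htp => ht0 (by
      have := congrArg (vRes V (inf_le_right : W₁ ⊓ W₂ ≤ W₂)) (ht₂ htp)
      rw [vRes_vRes] at this
      exact this.trans (map_zero (vResHom V _)))
    have := t.2
    exact ⟨⟨t.1, by lia⟩, rfl⟩
  refine ⟨W₁ ⊓ W₂, ⟨hy₁, hy₂⟩, hW.trans h, _, F.normalFamily_mem_sections V (p - 1) (hW.trans h')
    (w₂.comapDomain f hf.injOn), fun y' => ?_⟩
  refine (F.normalFamily_mapDomain V (sub_one_lt (p : ℤ)).le (hW.trans h') _ y').symm.trans ?_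
  refine (congrArg (fun w => F.normalFamily V p (hW.trans h') w y')
    (Finsupp.mapDomain_comapDomain f hf w₂ hsupp)).trans ?_
  refine (congrFun (F.res_normalFamily V p h' hW w) y').symm.trans ?_
  rw [hw]

/-- `V ⊗ A_{Y→X}` is locally the union of the filtration. -/
lemma exists_tensorGιStalk_eq {W : Y.Opens} {s : ∀ y : W, (tensorTransfer V).stalk y.1}
    (hs : s ∈ (tensorTransfer V).sections W) {y : Y} (hy : y ∈ W) :
    ∃ (W' : Y.Opens) (_ : y ∈ W') (h : W' ≤ W), ∃ p : ℕ, ∃ s' ∈ (tensorG V p).sections W',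
      ∀ y' : W', tensorGιStalk V p y' (s' y') = s ⟨y'.1, h y'.2⟩ := by
  have mono : ∀ {W : Y.Opens} {s : ∀ y : W, (tensorTransfer V).stalk y.1} {p q : ℕ} (_ : p ≤ q),
      (∃ s' ∈ (tensorG V p).sections W, ∀ y' : W, tensorGιStalk V p y' (s' y') = s y') →
      ∃ s' ∈ (tensorG V q).sections W, ∀ y' : W, tensorGιStalk V q y' (s' y') = s y' := by
    rintro W s p q hpq ⟨s', hs', h⟩
    exact ⟨_, tensorGMapStalk_mem_sections V (Nat.cast_le.mpr hpq) hs', fun y' =>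
      (tensorGιStalk_tensorGMapStalk V (Nat.cast_le.mpr hpq) _ _).trans (h y')⟩
  refine GermModule.exists_of_mem_sections (M := tensorTransfer V) (P := fun W s =>
    ∃ p : ℕ, ∃ s' ∈ (tensorG V p).sections W, ∀ y' : W, tensorGιStalk V p y' (s' y') = s y')
    ?_ ?_ ?_ ?_ ?_ ?_ hs hy
  · rintro U U' h s ⟨p, s', hs', hss⟩
    exact ⟨p, res h s', GermModule.res_mem_sections h hs', fun y' => hss ⟨y'.1, h y'.2⟩⟩
  · exact ⟨W, hy, 0, 0, zero_mem _, fun y' => map_zero (tensorGιStalk V _ y'.1)⟩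
  · rintro U _ _ ⟨p, h⟩ ⟨q, h'⟩
    obtain ⟨s, hs, h⟩ := mono (le_max_left p q) h
    obtain ⟨t, ht, h'⟩ := mono (le_max_right p q) h'
    exact ⟨max p q, s + t, add_mem hs ht, fun y' =>
      (map_add (tensorGιStalk V _ y'.1) _ _).trans (congrArg₂ (· + ·) (h y') (h' y'))⟩
  · rintro U _ ⟨p, s, hs, h⟩
    exact ⟨p, -s, neg_mem hs, fun y' =>
      (map_neg (tensorGιStalk V _ y'.1) _).trans (congrArg Neg.neg (h y'))⟩
  · rintro U U' hU r _ hr ⟨p, s, hs, h⟩ hyU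
    let r' : (pullbackStructureSheaf i).sections U' :=
      ⟨res hU r, GermRing.res_mem_sections hU ((pullbackStructureSheaf i).gens_subset_sections hr)⟩
    exact ⟨U', hyU, le_rfl, p, _, ((tensorG V p).sections U').smul_mem r' hs, fun y' =>
      ((tensorGιStalk V _ y'.1).map_smul _ _).trans (congrArg (fun z : TransferTensor V y'.1 =>
        HSMul.hSMul (α := X.presheaf.stalk (i y'.1)) (r ⟨y'.1, hU y'.2⟩) z) (h y'))⟩
  · rintro U s ⟨v, c, U', hU, a, hs⟩ hyU
    -- The operator `a` has bounded order only near the point. A negative order is rounded up to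
    -- zero, and the function `c` is moved onto `v`.
    obtain ⟨U'', hU'', p, hz, ha⟩ := 𝒜.F_exhaustive U' a (i y) (hU hyU)
    have ha' := 𝒜.F_mono (Int.self_le_toNat p) U'' ha
    refine ⟨U ⊓ i ⁻¹ᵁ U'', ⟨hyU, hz⟩, inf_le_left, p.toNat, _, gMk_mem_sections V
      (vRes V inf_le_left (rightSMul V v (scalarSection 𝒜 i c))) inf_le_right ⟨_, ha'⟩,
      fun y' => ?_⟩
    refine (BalancedTensor.map_mk _ _ _ _).trans (.trans ?_ (hs ⟨y'.1, y'.2.1⟩).symm)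
    rw [vGerm_vRes]
    refine (BalancedTensor.mk_eq_mk (rel := pullbackRel V y'.1 (TransferStalk 𝒜 i y'.1))
      (φ := fun e => pullbackScalar 𝒜 i y'.1 (Y.presheaf.germ U y'.1 y'.2.1 c) • e)
      ⟨U, y'.2.1, v, scalarSection 𝒜 i c, rfl, rfl, fun _ => rfl⟩ _).symm.trans ?_
    refine congrArg (transferMk V _) ((pullbackScalar_smul _ _).trans ?_)
    refine (TransferStalk.smul_mk 𝒜 i _ _ _).trans ?_
    rw [mul_one]
    exact congrArg _ (𝒜.germ_resA hU'' y'.2.2 a)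

end TwistedD

namespace TwistedD

/-! ### Sheaves of modules: monomorphisms, local surjectivity and cokernels -/

section SheafOfModules

variable {T : TopCat.{u}} {R : Sheaf (Opens.grothendieckTopology T) RingCat.{u}}
  {M N P : SheafOfModules.{u} R}

/-- The map on sections over `U`. -/
noncomputable def appHom (f : M ⟶ N) (U : Opens T) : M.val.obj (op U) →+ N.val.obj (op U) :=
  (f.val.app (op U)).hom.toAddMonoidHom

lemma appHom_res (f : M ⟶ N) {U U' : Opens T} (h : U' ≤ U) (m : M.val.obj (op U)) :
    N.val.presheaf.map (homOfLE h).op (appHom f U m) =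
      appHom f U' (M.val.presheaf.map (homOfLE h).op m) :=
  (PresheafOfModules.naturality_apply f.val (homOfLE h).op m).symm

lemma appHom_comp (f : M ⟶ N) (g : N ⟶ P) (U : Opens T) (m : M.val.obj (op U)) :
    appHom (f ≫ g) U m = appHom g U (appHom f U m) := rfl

lemma hom_ext_appHom {f g : M ⟶ N} (h : ∀ U m, appHom f U m = appHom g U m) : f = g :=
  SheafOfModules.hom_ext (PresheafOfModules.hom_ext fun U => ModuleCat.hom_ext
    (LinearMap.ext (h U.unop)))

lemma mono_of_injective (f : M ⟶ N) (h : ∀ U, Function.Injective (appHom f U)) : Mono f :=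
  ⟨fun g k hgk => hom_ext_appHom fun U m => h U
    ((appHom_comp g f U m).symm.trans ((congrArg (fun l => appHom l U m) hgk).trans
      (appHom_comp k f U m)))⟩

lemma injective_of_mono (f : M ⟶ N) [Mono f] (U : Opens T) : Function.Injective (appHom f U) := by
  have h : Mono ((SheafOfModules.evaluation R (op U)).map f) := inferInstance
  exact (ModuleCat.mono_iff_injective _).mp h

lemma isIso_of_bijective (f : M ⟶ N) (h : ∀ U, Function.Bijective (appHom f U)) : IsIso f := by
  have h1 : IsIso ((PresheafOfModules.toPresheaf R.obj).map f.val) :=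
    (NatTrans.isIso_iff_isIso_app _).mpr fun U =>
      (ConcreteCategory.isIso_iff_bijective _).mpr (h U.unop)
  have h2 : IsIso ((SheafOfModules.forget R).map f) :=
    isIso_of_reflects_iso f.val (PresheafOfModules.toPresheaf R.obj)
  exact isIso_of_reflects_iso f (SheafOfModules.forget R)

lemma isZero_of_subsingleton (h : ∀ U : Opens T, Subsingleton (M.val.obj (op U))) :
    Limits.IsZero M :=
  (Limits.IsZero.iff_id_eq_zero M).mpr (hom_ext_appHom fun U _ => (h U).elim _ _)

/-- The morphism is surjective on sections locally. -/
def IsLocallySurjective (f : M ⟶ N) : Prop :=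
  ∀ (U : Opens T) (n : N.val.obj (op U)), ∀ y ∈ U, ∃ (W : Opens T) (_ : y ∈ W) (h : W ≤ U)
    (m : M.val.obj (op W)), appHom f W m = N.val.presheaf.map (homOfLE h).op n

lemma IsLocallySurjective.of_comp {f : M ⟶ N} {g : N ⟶ P} (h : IsLocallySurjective (f ≫ g)) :
    IsLocallySurjective g := fun U n y hy => by
  obtain ⟨W, hW, hWU, m, hm⟩ := h U n y hy
  exact ⟨W, hW, hWU, appHom f W m, hm⟩

/-- A locally surjective monomorphism of sheaves of modules is an isomorphism. -/
lemma IsLocallySurjective.isIso {f : M ⟶ N} (h : IsLocallySurjective f) [Mono f] : IsIso f := by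
  refine isIso_of_bijective f fun U => ⟨injective_of_mono f U, fun n => ?_⟩
  choose W hW hWU m hm using h U n
  let G : TopCat.Sheaf AddCommGrpCat.{u} T := ⟨M.val.presheaf, M.isSheaf⟩
  let G' : TopCat.Sheaf AddCommGrpCat.{u} T := ⟨N.val.presheaf, N.isSheaf⟩
  obtain ⟨s, hs, -⟩ := G.existsUnique_gluing' (fun y : U => W y.1 y.2) U
    (fun y => homOfLE (hWU y.1 y.2)) (fun y hy => Opens.mem_iSup.mpr ⟨⟨y, hy⟩, hW y hy⟩)
    (fun y => m y.1 y.2) (fun y y' => by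
      -- The local preimages agree on overlaps because their images do and `f` is injective on
      -- sections.
      refine injective_of_mono f _ ?_
      refine (appHom_res f inf_le_left _).symm.trans (.trans ?_ (appHom_res f inf_le_right _))
      rw [hm, hm]
      exact (ConcreteCategory.congr_hom (N.val.presheaf.map_comp (homOfLE (hWU y.1 y.2)).op
        (homOfLE (inf_le_left : W y.1 y.2 ⊓ W y'.1 y'.2 ≤ _)).op) n).symm.trans
        (ConcreteCategory.congr_hom (N.val.presheaf.map_comp (homOfLE (hWU y'.1 y'.2)).op
        (homOfLE (inf_le_right : W y.1 y.2 ⊓ W y'.1 y'.2 ≤ _)).op) n))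
  refine ⟨s, ?_⟩
  refine G'.eq_of_locally_eq' (fun y : U => W y.1 y.2) U (fun y => homOfLE (hWU y.1 y.2))
    (fun y hy => Opens.mem_iSup.mpr ⟨⟨y, hy⟩, hW y hy⟩) _ _ fun y => ?_
  refine (appHom_res f (hWU y.1 y.2) s).trans (.trans ?_ (hm y.1 y.2))
  exact congrArg _ (hs y)

/-- The inclusion of the image of `f` is a locally surjective monomorphism, hence an isomorphism. -/
lemma IsLocallySurjective.epi {f : M ⟶ N} (h : IsLocallySurjective f) : Epi f := by
  rw [← Abelian.image.fac f] at h
  have h1 := h.of_comp.isIso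
  rw [← Abelian.image.fac f]
  exact epi_comp _ _

/-- The cokernel of a monomorphism that is the kernel of a locally surjective morphism, on sections. -/
lemma nonempty_cokernel_iso {f : M ⟶ N} {g : N ⟶ P} [Mono f] (hg : IsLocallySurjective g)
    (hfg : f ≫ g = 0) (h : ∀ U n, appHom g U n = 0 → ∃ m, appHom f U m = n) :
    Nonempty (Limits.cokernel f ≅ P) := by
  have := hg.epi
  have h1 : Mono (Limits.kernel.lift g f hfg) := mono_of_mono_fac (Limits.kernel.lift_ι g f hfg)
  -- By `h` sections of the kernel lift even without shrinking, so `f` is a kernel of `g`; an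
  -- epimorphism in an abelian category is the cokernel of its kernel.
  have h2 : IsLocallySurjective (Limits.kernel.lift g f hfg) := fun U n y hy => by
    obtain ⟨m, hm⟩ := h U (appHom (Limits.kernel.ι g) U n) (by
      rw [← appHom_comp, Limits.kernel.condition]
      rfl)
    refine ⟨U, hy, le_rfl, m, injective_of_mono (Limits.kernel.ι g) U ?_⟩
    rw [← appHom_comp, Limits.kernel.lift_ι, hm]
    exact congrArg _ (ConcreteCategory.congr_hom
      ((Limits.kernel g).val.presheaf.map_id (op U)) n).symm
  have h3 := h2.isIso
  have h4 : Limits.IsLimit (Limits.KernelFork.ofι f hfg) :=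
    (Limits.kernelIsKernel g).ofIsoLimit (Limits.Fork.ext
      (asIso (Limits.kernel.lift g f hfg)).symm (by simp))
  exact ⟨(Limits.cokernelIsCokernel f).coconePointUniqueUpToIso
    (Abelian.epiIsCokernelOfKernel _ h4)⟩

end SheafOfModules

end TwistedD

/-! ### The filtrations, their exhaustiveness and their graded pieces -/

namespace TwistedD

/-- A filtration that locally on sections is exhaustive is exhaustive. -/
lemma isExhaustive_of_local {T : TopCat.{u}} {R : Sheaf (Opens.grothendieckTopology T) RingCat.{u}}
    {M : SheafOfModules.{u} R} {F : ℤ → SheafOfModules.{u} R} (ι : ∀ p, F p ⟶ M)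
    (h : ∀ (U : Opens T) (n : M.val.obj (op U)), ∀ y ∈ U, ∃ (W : Opens T) (_ : y ∈ W) (h : W ≤ U)
      (p : ℤ) (m : (F p).val.obj (op W)),
        appHom (ι p) W m = M.val.presheaf.map (homOfLE h).op n) : IsExhaustive ι := by
  intro N j _ hj
  refine IsLocallySurjective.isIso (f := j) fun U n y hy => ?_
  obtain ⟨W, hW, hWU, p, m, hm⟩ := h U n y hy
  obtain ⟨k, hk⟩ := hj p
  refine ⟨W, hW, hWU, appHom k W m, ?_⟩
  rw [← appHom_comp, hk, hm]

variable {X Y S : Scheme.{u}} {x : X ⟶ S} {𝒜 : TDO x} {i : Y ⟶ X} (V : RightModule 𝒜 i)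
  [Smooth x] [Smooth (i ≫ x)] [IsImmersion i]

/-- There are no normal monomials of negative degree. -/
lemma subsingleton_GTensor (y : Y) : Subsingleton (GTensor V (-1) y) := by
  obtain ⟨F, hy⟩ := exists_frame i 𝒜 y
  obtain ⟨Φ, -⟩ := exists_repr_G V F hy (-1)
  have : IsEmpty {t : Multiset (Fin F.r) // (t.card : ℤ) ≤ -1} := ⟨fun t => by have := t.2; lia⟩
  exact Φ.toEquiv.subsingleton

lemma subsingleton_sections_tensorG (U : Y.Opens) :
    Subsingleton ((tensorG V (-1)).sheaf.val.obj (op U)) :=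
  ⟨fun s t => Subtype.ext (a1 := (s : (tensorG V (-1)).sections U))
    (a2 := (t : (tensorG V (-1)).sections U))
    (funext fun y => (subsingleton_GTensor V y.1).elim _ _)⟩

lemma appHom_tensorGι_injective (p : ℤ) (U : Y.Opens) :
    Function.Injective (appHom (tensorGι V p) U) := fun (_ : (tensorG V p).sections U)
      (_ : (tensorG V p).sections U) h => Subtype.ext (funext fun y =>
  tensorGιStalk_injective V p y.1 (congrFun (congrArg
    (fun s : (tensorTransfer V).sections U => s.1) h) y))

lemma tensorGMap_comp_tensorGι {p q : ℤ} (h : p ≤ q) :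
    tensorGMap V h ≫ tensorGι V q = tensorGι V p :=
  hom_ext_appHom fun U (m : (tensorG V p).sections U) =>
    Subtype.ext (a1 := (appHom (tensorGMap V h ≫ tensorGι V q) U m : (tensorTransfer V).sections U))
      (funext fun y => tensorGιStalk_tensorGMapStalk V h y.1 (m.1 y))

lemma isFiltration_tensorG : IsFiltration (fun p => (tensorG V p).sheaf)
    (fun p => tensorGMap V (sub_one_lt p).le) (fun p => tensorGι V p) where
  mono p := mono_of_injective _ (appHom_tensorGι_injective V p)
  comm _ := tensorGMap_comp_tensorGι V _
  zero := isZero_of_subsingleton (subsingleton_sections_tensorG V)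

/-- Sections of a direct image are sections over the preimage, so injectivity and vanishing on
sections carry over without any finiteness condition. -/
lemma isFiltration_directImage : IsFiltration (fun p => (directImage i).obj (tensorG V p).sheaf)
    (fun p => (directImage i).map (tensorGMap V (sub_one_lt p).le))
    (fun p => (directImage i).map (tensorGι V p)) where
  mono p := mono_of_injective (R := X.ringCatSheaf) _
    fun U => appHom_tensorGι_injective V p (i ⁻¹ᵁ U)
  comm p := by rw [← Functor.map_comp, tensorGMap_comp_tensorGι]
  zero := isZero_of_subsingleton (R := X.ringCatSheaf)
    fun U => subsingleton_sections_tensorG V (i ⁻¹ᵁ U)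

lemma isFiltration_pushforward :
    IsFiltration
        (fun p => (Scheme.Modules.pushforward x).obj ((directImage i).obj (tensorG V p).sheaf))
        (fun p => (Scheme.Modules.pushforward x).map
          ((directImage i).map (tensorGMap V (sub_one_lt p).le)))
        (fun p => (Scheme.Modules.pushforward x).map ((directImage i).map (tensorGι V p))) where
  mono p := mono_of_injective (R := S.ringCatSheaf) _
    fun U => appHom_tensorGι_injective V p (i ⁻¹ᵁ x ⁻¹ᵁ U)
  comm p := by rw [← Functor.map_comp, ← Functor.map_comp, tensorGMap_comp_tensorGι]
  zero := isZero_of_subsingleton (R := S.ringCatSheaf)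
    fun U => subsingleton_sections_tensorG V (i ⁻¹ᵁ x ⁻¹ᵁ U)

lemma isExhaustive_tensorGι : IsExhaustive (fun p => tensorGι V p) :=
  isExhaustive_of_local _ fun U (s : (tensorTransfer V).sections U) y hy => by
    obtain ⟨W, hW, h, p, s', hs', hss⟩ := exists_tensorGιStalk_eq V s.2 hy
    exact ⟨W, hW, h, p, (⟨s', hs'⟩ : (tensorG V p).sections W), Subtype.ext
      (a2 := (⟨_, GermModule.res_mem_sections h s.2⟩ : (tensorTransfer V).sections W))
      (funext hss)⟩

/-- Over a quasi-compact open set every section lies in one step of the filtration. -/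
lemma exists_tensorGι_eq {U : Y.Opens} (hU : IsCompact (U : Set Y))
    (s : (tensorTransfer V).sheaf.val.obj (op U)) :
    ∃ (p : ℤ) (s' : (tensorG V p).sheaf.val.obj (op U)), appHom (tensorGι V p) U s' = s := by
  revert s
  intro (s : (tensorTransfer V).sections U)
  choose W hW h p s' hs' hss using fun (y : Y) (hy : y ∈ U) => exists_tensorGιStalk_eq V s.2 hy
  -- The largest of the finitely many local orders serves everywhere, and the local lifts glue
  -- because the inclusion into `V ⊗ A_{Y→X}` is injective.
  obtain ⟨t, ht⟩ := hU.elim_nhds_subcover' (fun y hy => W y hy)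
    (fun y hy => (W y hy).2.mem_nhds (hW y hy))
  have hp : ∀ k ∈ t, (p k.1 k.2 : ℤ) ≤ (t.sup fun k => p k.1 k.2 : ℕ) := fun k hk =>
    Nat.cast_le.mpr (Finset.le_sup (f := fun k : (U : Set Y) => p k.1 k.2) hk)
  obtain ⟨z, hz, hzs⟩ := GermModule.exists_lift
    (M := tensorG V (t.sup fun k => p k.1 k.2 : ℕ)) (N := tensorTransfer V)
    (fun y => tensorGιStalk V _ y) (tensorGιStalk_injective V _) (s := s.1) fun y hy => by
      obtain ⟨k, hk, hyk⟩ := Set.mem_iUnion₂.mp (ht hy)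
      exact ⟨W k.1 k.2, hyk, h k.1 k.2, _, tensorGMapStalk_mem_sections V (hp k hk)
        (hs' k.1 k.2), fun y' => (tensorGιStalk_tensorGMapStalk V (hp k hk) _ _).trans
          (hss k.1 k.2 y')⟩
  exact ⟨_, (⟨z, hz⟩ : (tensorG V _).sections U), Subtype.ext (a2 := s) (funext hzs)⟩

/-- Affine open sets have quasi-compact preimages, over which a section already has bounded order.
-/
lemma isExhaustive_directImage [QuasiCompact i] :
    IsExhaustive (fun p => (directImage i).map (tensorGι V p)) := by
  refine isExhaustive_of_local (R := X.ringCatSheaf) (M := (directImage i).obj _)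
    (fun p => (directImage i).map (tensorGι V p)) fun U s z hz => ?_
  obtain ⟨W, hW, hzW, hWU⟩ := exists_isAffineOpen_mem_and_subset hz
  obtain ⟨p, s', h⟩ := exists_tensorGι_eq V
    (QuasiCompact.isCompact_preimage (f := i) W W.2 hW.isCompact)
    (((directImage i).obj (tensorTransfer V).sheaf).val.presheaf.map (homOfLE hWU).op s)
  exact ⟨W, hzW, hWU, p, s', h⟩

lemma isExhaustive_pushforward [QuasiCompact (i ≫ x)] :
    IsExhaustive (fun p =>
      (Scheme.Modules.pushforward x).map ((directImage i).map (tensorGι V p))) := by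
  refine isExhaustive_of_local (R := S.ringCatSheaf)
    (M := (Scheme.Modules.pushforward x).obj ((directImage i).obj _))
    (fun p => (Scheme.Modules.pushforward x).map ((directImage i).map (tensorGι V p)))
    fun U s z hz => ?_
  obtain ⟨W, hW, hzW, hWU⟩ := exists_isAffineOpen_mem_and_subset hz
  obtain ⟨p, s', h⟩ := exists_tensorGι_eq V (U := i ⁻¹ᵁ x ⁻¹ᵁ W)
    (QuasiCompact.isCompact_preimage (f := i ≫ x) W W.2 hW.isCompact)
    (((Scheme.Modules.pushforward x).obj
      ((directImage i).obj (tensorTransfer V).sheaf)).val.presheaf.map (homOfLE hWU).op s)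
  exact ⟨W, hzW, hWU, p, s', h⟩

/-- The graded pieces of the filtration. -/
lemma nonempty_cokernel_tensorGMap_iso (p : ℕ) :
    Nonempty (Limits.cokernel (tensorGMap V (sub_one_lt (p : ℤ)).le) ≅ (tensorSym V p).sheaf) := by
  have : Mono (tensorGMap V (sub_one_lt (p : ℤ)).le) := by
    have := (isFiltration_tensorG V).mono (p - 1)
    exact mono_of_mono_fac (tensorGMap_comp_tensorGι V (sub_one_lt (p : ℤ)).le)
  -- The symbol is locally surjective with kernel exactly the sections of order `p - 1`, so it is
  -- the cokernel of the inclusion.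
  refine nonempty_cokernel_iso (g := tensorSymbol V p) ?_ ?_ ?_
  · intro U (s : (tensorSym V p).sections U) y hy
    obtain ⟨W, hW, h, s', hs', hss⟩ := exists_symbolStalk_eq V s.2 hy
    exact ⟨W, hW, h, (⟨s', hs'⟩ : (tensorG V p).sections W), Subtype.ext
      (a2 := (⟨_, GermModule.res_mem_sections h s.2⟩ : (tensorSym V p).sections W))
      (funext hss)⟩
  · exact hom_ext_appHom fun U (s : (tensorG V (p - 1)).sections U) => Subtype.ext
      (a2 := (0 : (tensorSym V p).sections U))
      (funext fun y => symbolStalk_tensorGMapStalk V p y.1 (s.1 y))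
  · intro U (s : (tensorG V p).sections U) hs
    obtain ⟨s', hs', h⟩ := exists_tensorGMapStalk_eq V s.2 fun y => congrFun (congrArg
      (fun s : (tensorSym V p).sections U => s.1) hs) y
    exact ⟨(⟨s', hs'⟩ : (tensorG V (p - 1)).sections U), Subtype.ext (a2 := s) (funext h)⟩

end TwistedD

theorem mainTheorem6 {S X Y : Scheme.{u}} (x : X ⟶ S) (i : Y ⟶ X) [Smooth x] [Smooth (i ≫ x)]
    [IsImmersion i] (𝒜 : TDO x) (V : RightModule 𝒜 i) :
    (IsFiltration (fun p => (tensorG V p).sheaf) (fun p => tensorGMap V (sub_one_lt p).le)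
        (fun p => tensorGι V p) ∧
      IsExhaustive (fun p => tensorGι V p) ∧
      ∀ p : ℕ, Nonempty (Limits.cokernel (tensorGMap V (sub_one_lt (p : ℤ)).le) ≅
        (tensorSym V p).sheaf)) ∧
    (IsFiltration (fun p => (directImage i).obj (tensorG V p).sheaf)
        (fun p => (directImage i).map (tensorGMap V (sub_one_lt p).le))
        (fun p => (directImage i).map (tensorGι V p)) ∧
      (QuasiCompact i → IsExhaustive (fun p => (directImage i).map (tensorGι V p)))) ∧
    (IsFiltration
        (fun p => (Scheme.Modules.pushforward x).obj ((directImage i).obj (tensorG V p).sheaf))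
        (fun p => (Scheme.Modules.pushforward x).map
          ((directImage i).map (tensorGMap V (sub_one_lt p).le)))
        (fun p => (Scheme.Modules.pushforward x).map ((directImage i).map (tensorGι V p))) ∧
      (QuasiCompact (i ≫ x) → IsExhaustive (fun p =>
        (Scheme.Modules.pushforward x).map ((directImage i).map (tensorGι V p))))) := by
  refine ⟨⟨isFiltration_tensorG V, isExhaustive_tensorGι V, nonempty_cokernel_tensorGMap_iso V⟩,
    ⟨isFiltration_directImage V, fun _ => isExhaustive_directImage V⟩,
    isFiltration_pushforward V, fun _ => isExhaustive_pushforward V⟩
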